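/- Let $\Bbbk$ be an algebraically closed field of characteristic $0$, let $g>1$, let $a_1,\dots,a_{2g+2}\in\Bbbk$ be pairwise distinct (the branch points of a hyperelliptic curve of genus $g$), and let $V=\Bbbk^{2g+2}$. For $P=(s:t)\in\mathbb P^1$ put $q_P=s\,q_0+t\,q_\infty$, where $q_0=\sum a_ix_i^2$ and $q_\infty=-\sum x_i^2$. Let $P=(1:a_i)$ be a branching point, so that $q_P$ has a one-dimensional kernel; let $v_P$ generate this kernel, let $\pi_P\colon V\to V_P=V/v_P$ be the projection, and let $q'_P$ be the nondegenerate quadratic form on $V_P$ induced by $q_P$. Let $1\le k\le g$. Let $\mathrm{OGr}_P(k,V)$ be the scheme of $k$-dimensional $q_P$-isotropic subspaces of $V$, let $\mathrm{OGr}(m,V_P)$ be the scheme of $m$-dimensional $q'_P$-isotropic subspaces of $V_P$, and let $\mathrm{OFl}(k-1,k;V_P)$ be the scheme of flags $U'_{k-1}\subset U'_k$ of $q'_P$-isotropic subspaces of $V_P$ of dimensions $k-1$ and $k$. Let $$\widetilde{\mathrm{OGr}}_P(k,V)=\{(U_k,U'_k)\in \mathrm{OGr}_P(k,V)\times\mathrm{OGr}(k,V_P)\mid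 U_k\subset\pi_P^{-1}(U'_k)\},$$ with projections $p_1$ to $\mathrm{OGr}_P(k,V)$ and $p_2$ to $\mathrm{OGr}(k,V_P)$. Let $\mathcal U_k$ and $\mathcal U'_k$ be the pullbacks to $\widetilde{\mathrm{OGr}}_P(k,V)$ of the tautological bundles, and put $H=c_1(\mathcal U_k^\vee)$, $H'=c_1(\mathcal U_k'^\vee)$. Then these schemes and maps exist, that is, the corresponding functors of points on $\Bbbk$-algebras are represented by $\Bbbk$-schemes, and: 1. The map $p_2$ is a $\mathbb P^k$-fibration (Zariski-locally over the base it is the projection from a product with $\mathbb P^k$), and $\widetilde{\mathrm{OGr}}_P(k,V)$ is a smooth projective variety (smooth, projective and integral over $\Bbbk$). 2. The map $p_1$ is birational. Let $E$ be its exceptional divisor, that is, the complement of the largest open subset on which $p_1$ is a local isomorphism, with its reduced scheme structure. The morphism $(U'_{k-1},U'_k)\mapsto(\pi_P^{-1}(U'_{k-1}),U'_k)$ induces an isomorphism $\mathrm{OFl}(k-1,k;V_P)\cong E\subset\widetilde{\mathrm{OGr}}_P(k,V)$. Under this isomorphism, the restriction of $p_1$ to $E$ is the composition $$\mathrm{OFl}(k-1,k;V_P)\to\mathrm{OGr}(k-1,V_P)\hookrightarrow\mathrm{OGr}_P(k,V),$$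 where the first map is the natural projection and the second one, $U'_{k-1}\mapsto\pi_P^{-1}(U'_{k-1})$, is a closed embedding whose image is the subscheme of $\mathrm{OGr}_P(k,V)$ parameterizing the isotropic $U_k\subset V$ that contain $v_P$. 3. The subscheme $E$ is an effective Cartier divisor, and $E=H-H'$ in $\mathrm{Pic}(\widetilde{\mathrm{OGr}}_P(k,V))$, that is, $\mathcal O(E)\cong\mathcal O(H)\otimes\mathcal O(-H')$. -/

import Mathlib

open CategoryTheory AlgebraicGeometry Opposite TensorProduct

universe u

namespace OrthogonalGrassmannian

noncomputable section

section Grassmannians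

variable {K : Type u} [Field K] {V : Type u} [AddCommGroup V] [Module K V]

theorem map_eq_span {m : ℕ} {A B : Type u} [CommRing A] [Algebra K A] [CommRing B] [Algebra K B]
    (f : A →ₐ[K] B) (N : Module.Grassmannian A (A ⊗[K] V) m) :
    (Module.Grassmannian.map f N).toSubmodule =
      Submodule.span B (LinearMap.rTensor V f.toLinearMap '' (N.toSubmodule : Set (A ⊗[K] V))) := by
  rw [Module.Grassmannian.map_toSubmodule]
  let : Algebra A B := f.toAlgebra
  have : IsScalarTower K A B := IsScalarTower.of_algebraMap_eq' <| IsScalarTower.algebraMap_eq K A B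
  have h1 : (Module.Grassmannian.baseChangeMkQ B N.toSubmodule) =
    N.toSubmodule.mkQ.baseChange B ∘ₗ
      (AlgebraTensorModule.cancelBaseChange K A B B V).symm.toLinearMap := rfl
  have h2 : LinearMap.ker (N.toSubmodule.mkQ.baseChange B) = N.toSubmodule.baseChange B := by
    ext x
    have hex : Function.Exact N.toSubmodule.subtype N.toSubmodule.mkQ :=
      LinearMap.exact_subtype_mkQ N.toSubmodule
    have := lTensor_exact (R := A) (M := N.toSubmodule) B hex (Submodule.mkQ_surjective N.toSubmodule) x
    rw [LinearMap.mem_ker]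
    exact this
  have h3 : ∀ z : A ⊗[K] V, AlgebraTensorModule.cancelBaseChange K A B B V ((1 : B) ⊗ₜ[A] z) =
      LinearMap.rTensor V f.toLinearMap z := by
    intro z
    induction z with
    | zero => simp
    | tmul a v =>
      rw [AlgebraTensorModule.cancelBaseChange_tmul]
      simp [Algebra.smul_def, RingHom.algebraMap_toAlgebra]
    | add x y hx hy => rw [TensorProduct.tmul_add, map_add, map_add, hx, hy]
  rw [h1, LinearMap.ker_comp, h2, Submodule.baseChange_eq_span]
  rw [← Submodule.map_equiv_eq_comap_symm, Submodule.map_span]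
  congr 1
  ext y
  simp only [Set.mem_image, SetLike.mem_coe, Submodule.mem_map]
  constructor
  · rintro ⟨_, ⟨z, hz, rfl⟩, rfl⟩
    exact ⟨z, hz, (h3 z).symm⟩
  · rintro ⟨z, hz, rfl⟩
    exact ⟨_, ⟨z, hz, rfl⟩, h3 z⟩

/-- The quadratic form induced by `q` on the quotient of `V` by a subspace `L` such that
`q (x + l) = q x` for all `l` in `L`. -/
def inducedForm (q : QuadraticForm K V) (L : Submodule K V)
    (h : ∀ x, ∀ l ∈ L, q (x + l) = q x) : QuadraticForm K (V ⧸ L) :=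
  QuadraticMap.ofPolar
    (fun y => Quotient.liftOn' y q (by
      intro x x' hx
      have := h x' (x - x') ((Submodule.quotientRel_def L).mp hx)
      rw [← this]
      congr 1
      abel))
    (by
      intro a y
      induction y using Submodule.Quotient.induction_on with
      | H x => exact QuadraticMap.map_smul q a x)
    (by
      intro y y' z
      induction y using Submodule.Quotient.induction_on with
      | H x =>
      induction y' using Submodule.Quotient.induction_on with
      | H x' =>
      induction z using Submodule.Quotient.induction_on with
      | H w => exact QuadraticMap.polar_add_left q x x' w)
    (by
      intro a y z
      induction y using Submodule.Quotient.induction_on with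
      | H x =>
      induction z using Submodule.Quotient.induction_on with
      | H w => exact QuadraticMap.polar_smul_left q a x w)

theorem inducedForm_mk (q : QuadraticForm K V) (L : Submodule K V)
    (h : ∀ x, ∀ l ∈ L, q (x + l) = q x) (x : V) : inducedForm q L h (L.mkQ x) = q x :=
  rfl

variable [CharZero K]

/-- The extension `q_A` of a quadratic form `q` on `V` to the `A`-module `A ⊗ V`. -/
def formBaseChange (q : QuadraticForm K V) (A : Type u) [CommRing A] [Algebra K A] :
    QuadraticForm A (A ⊗[K] V) :=
  letI : Invertible (2 : K) := invertibleOfNonzero two_ne_zero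
  q.baseChange A

/-- An `A`-submodule of `A ⊗ V` is isotropic if the quadratic form vanishes on it. -/
def IsIsotropic (q : QuadraticForm K V) (A : Type u) [CommRing A] [Algebra K A]
    (U : Submodule A (A ⊗[K] V)) : Prop :=
  ∀ u ∈ U, formBaseChange q A u = 0

theorem polar_formBaseChange_tmul (q : QuadraticForm K V) (A : Type u) [CommRing A] [Algebra K A]
    (a b : A) (v w : V) :
    QuadraticMap.polar (formBaseChange q A) (a ⊗ₜ v) (b ⊗ₜ w) =
      algebraMap K A (QuadraticMap.polar q v w) * (a * b) := by
  let : Invertible (2 : K) := invertibleOfNonzero two_ne_zero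
  let : Invertible (2 : A) := (Invertible.map (algebraMap K A) 2).copy 2 (map_ofNat _ 2).symm
  have := QuadraticForm.polarBilin_baseChange (A := A) q
  have := congrArg (fun z => z (a ⊗ₜ v) (b ⊗ₜ w)) this
  simp only [QuadraticMap.polarBilin_apply_apply, LinearMap.BilinForm.baseChange_tmul] at this
  exact this.trans (Algebra.smul_def _ _)

theorem polar_rTensor (q : QuadraticForm K V) {A B : Type u} [CommRing A] [Algebra K A]
    [CommRing B] [Algebra K B] (f : A →ₐ[K] B) (x y : A ⊗[K] V) :
    QuadraticMap.polar (formBaseChange q B) (LinearMap.rTensor V f.toLinearMap x)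
      (LinearMap.rTensor V f.toLinearMap y) =
      f (QuadraticMap.polar (formBaseChange q A) x y) := by
  induction x with
  | zero => simp
  | add x x' hx hx' => simp only [map_add, QuadraticMap.polar_add_left, hx, hx']
  | tmul a v =>
    induction y with
    | zero => simp
    | add x x' hx hx' => simp only [map_add, QuadraticMap.polar_add_right, hx, hx']
    | tmul b w => simp [polar_formBaseChange_tmul]

theorem IsIsotropic.map {q : QuadraticForm K V} {A B : Type u} [CommRing A] [Algebra K A]
    [CommRing B] [Algebra K B] (f : A →ₐ[K] B) {m : ℕ}
    {N : Module.Grassmannian A (A ⊗[K] V) m} (hN : IsIsotropic q A N.toSubmodule) :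
    IsIsotropic q B (Module.Grassmannian.map f N).toSubmodule := by
  have key : ∀ y ∈ (Module.Grassmannian.map f N).toSubmodule,
      ∀ z ∈ (Module.Grassmannian.map f N).toSubmodule,
      QuadraticMap.polar (formBaseChange q B) y z = 0 := by
    rw [map_eq_span]
    intro y hy z hz
    induction hy, hz using Submodule.span_induction₂ with
    | mem_mem x y hx hy =>
      obtain ⟨x, hx, rfl⟩ := hx
      obtain ⟨y, hy, rfl⟩ := hy
      rw [polar_rTensor, QuadraticMap.polar, hN _ hx, hN _ hy, hN _ (add_mem hx hy)]
      simp
    | zero_left => simp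
    | zero_right => simp
    | add_left x y z _ _ _ h1 h2 => rw [QuadraticMap.polar_add_left, h1, h2, add_zero]
    | add_right x y z _ _ _ h1 h2 => rw [QuadraticMap.polar_add_right, h1, h2, add_zero]
    | smul_left r x y _ _ h => rw [QuadraticMap.polar_smul_left, h, smul_zero]
    | smul_right r x y _ _ h => rw [QuadraticMap.polar_smul_right, h, smul_zero]
  intro u hu
  let : Invertible (2 : K) := invertibleOfNonzero two_ne_zero
  let : Invertible (2 : B) := (Invertible.map (algebraMap K B) 2).copy 2 (map_ofNat _ 2).symm
  have h := key u hu u hu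
  rw [QuadraticMap.polar_self, two_smul, ← two_mul] at h
  exact (isUnit_of_invertible (2 : B)).mul_right_eq_zero.mp h


/-- The functor of points of the isotropic Grassmannian `OGr(k, V)` of the quadratic space
`(V, q)`: its `A`-points are the `A`-submodules `U` of `A ⊗ V` which are locally direct summands of
rank `k` (that is, the quotient is locally free of rank `dim V - k`) on which the quadratic form
vanishes. For the form `q_P` of the pencil this is the scheme of `U` in `Gr(k, V)` with `P(U)`
contained in the quadric `Q_P`. -/
def OGr (q : QuadraticForm K V) (k : ℕ) : CommAlgCat.{u} K ⥤ Type u where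
  obj A := {N : Module.Grassmannian A (A ⊗[K] V) (Module.finrank K V - k) //
    IsIsotropic q A N.toSubmodule}
  map f := ↾fun N => ⟨Module.Grassmannian.map f.hom N.1, N.2.map f.hom⟩
  map_id A := by
    apply ConcreteCategory.hom_ext
    intro N
    exact Subtype.ext (Module.Grassmannian.map_id _ A N.1)
  map_comp f g := by
    apply ConcreteCategory.hom_ext
    intro N
    exact Subtype.ext (Module.Grassmannian.map_comp _ f.hom g.hom N.1)

theorem OGr_map_id {q : QuadraticForm K V} {k : ℕ} {A : CommAlgCat.{u} K} (N : (OGr q k).obj A) :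
    (OGr q k).map (𝟙 A) N = N := by
  rw [CategoryTheory.Functor.map_id]
  rfl

theorem OGr_map_comp {q : QuadraticForm K V} {k : ℕ} {A B C : CommAlgCat.{u} K} (f : A ⟶ B)
    (g : B ⟶ C) (N : (OGr q k).obj A) :
    (OGr q k).map (f ≫ g) N = (OGr q k).map g ((OGr q k).map f N) := by
  rw [CategoryTheory.Functor.map_comp]
  rfl

/-- The submodule of `A ⊗ V` given by an `A`-point of `OGr(k, V)`. -/
def subspace {q : QuadraticForm K V} {k : ℕ} {A : CommAlgCat.{u} K} (N : (OGr q k).obj A) :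
    Submodule A (A ⊗[K] V) :=
  N.1.toSubmodule

theorem subspace_map {q : QuadraticForm K V} {k : ℕ} {A B : CommAlgCat.{u} K} (f : A ⟶ B)
    (N : (OGr q k).obj A) :
    subspace ((OGr q k).map f N) =
      Submodule.span B (LinearMap.rTensor V f.hom.toLinearMap '' (subspace N : Set (A ⊗[K] V))) :=
  map_eq_span f.hom N.1

theorem map_mem_subspace {q : QuadraticForm K V} {k : ℕ} {A B : CommAlgCat.{u} K} (f : A ⟶ B)
    (N : (OGr q k).obj A) {u : A ⊗[K] V} (hu : u ∈ subspace N) :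
    LinearMap.rTensor V f.hom.toLinearMap u ∈ subspace ((OGr q k).map f N) := by
  rw [subspace_map]
  exact Submodule.subset_span ⟨u, hu, rfl⟩

/-- The functor of points of the variety of partial isotropic flags `OFl(k₁, k₂; V)`. -/
def OFl (q : QuadraticForm K V) (k₁ k₂ : ℕ) : CommAlgCat.{u} K ⥤ Type u where
  obj A := {p : (OGr q k₁).obj A × (OGr q k₂).obj A // subspace p.1 ≤ subspace p.2}
  map f := ↾fun p => ⟨((OGr q k₁).map f p.1.1, (OGr q k₂).map f p.1.2), by
    rw [subspace_map, subspace_map]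
    exact Submodule.span_mono (Set.image_mono p.2)⟩
  map_id A := by
    apply ConcreteCategory.hom_ext
    intro p
    exact Subtype.ext (Prod.ext (OGr_map_id p.1.1) (OGr_map_id p.1.2))
  map_comp f g := by
    apply ConcreteCategory.hom_ext
    intro p
    exact Subtype.ext (Prod.ext (OGr_map_comp f g p.1.1) (OGr_map_comp f g p.1.2))

/-- A quadratic form is invariant under translation by vectors in its kernel. -/
theorem map_add_of_mem_kernel {q : QuadraticForm K V} {L : Submodule K V}
    (hL : LinearMap.ker (QuadraticMap.polarBilin q) = L) (x : V) (l : V) (hl : l ∈ L) :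
    q (x + l) = q x := by
  rw [← hL, LinearMap.mem_ker] at hl
  have h1 : QuadraticMap.polar q l x = 0 := LinearMap.congr_fun hl x
  have h2 : QuadraticMap.polar q l l = 0 := LinearMap.congr_fun hl l
  rw [QuadraticMap.polar_self, two_smul, ← two_mul] at h2
  have h3 : q l = 0 := (mul_eq_zero.mp h2).resolve_left two_ne_zero
  rw [QuadraticMap.polar_comm, QuadraticMap.polar, h3] at h1
  linear_combination h1

/-- The quadratic form induced by `q` on the quotient of `V` by the kernel of `q`, for a kernel
generated by a vector `v`. -/
def reducedForm {q : QuadraticForm K V} {v : V}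
    (hv : LinearMap.ker (QuadraticMap.polarBilin q) = Submodule.span K {v}) :
    QuadraticForm K (V ⧸ Submodule.span K {v}) :=
  inducedForm q (Submodule.span K {v}) (map_add_of_mem_kernel hv)

/-- The base change `A ⊗ V → A ⊗ (V / L)` of the projection `V → V / L`. -/
def projection (L : Submodule K V) (A : Type u) [CommRing A] [Algebra K A] :
    A ⊗[K] V →ₗ[A] A ⊗[K] (V ⧸ L) :=
  L.mkQ.baseChange A

/-- The functor of points of the subvariety of `OGr(k, V) × OGr(k, V / L)` of all pairs `(U, U')`
such that `U` is contained in the preimage of `U'`. -/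
def TOGr (q : QuadraticForm K V) (L : Submodule K V) (q' : QuadraticForm K (V ⧸ L)) (k : ℕ) :
    CommAlgCat.{u} K ⥤ Type u where
  obj A := {p : (OGr q k).obj A × (OGr q' k).obj A //
    subspace p.1 ≤ (subspace p.2).comap (projection L A)}
  map {A B} f := ↾fun p => ⟨((OGr q k).map f p.1.1, (OGr q' k).map f p.1.2), by
    rw [subspace_map, Submodule.span_le]
    rintro _ ⟨u, hu, rfl⟩
    have h : projection L B (LinearMap.rTensor V f.hom.toLinearMap u) =
        LinearMap.rTensor (V ⧸ L) f.hom.toLinearMap (projection L A u) := by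
      clear hu
      induction u with
      | zero => simp only [map_zero]
      | tmul a v => simp [projection]
      | add x y hx hy => simp only [map_add, hx, hy]
    rw [SetLike.mem_coe, Submodule.mem_comap, h]
    exact map_mem_subspace f p.1.2 (p.2 hu)⟩
  map_id A := by
    apply ConcreteCategory.hom_ext
    intro p
    exact Subtype.ext (Prod.ext (OGr_map_id p.1.1) (OGr_map_id p.1.2))
  map_comp f g := by
    apply ConcreteCategory.hom_ext
    intro p
    exact Subtype.ext (Prod.ext (OGr_map_comp f g p.1.1) (OGr_map_comp f g p.1.2))

end Grassmannians

section Moduli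

variable {K : Type u} [Field K]

/-- A scheme over `K` representing a functor `F` on `K`-algebras: a bijection, natural in the
`K`-algebra `A`, between the morphisms `Spec A ⟶ X` over `K` and `F(A)`. The scheme is determined
by `F` up to a unique isomorphism, because morphisms of schemes are determined by their values on
points with values in affine schemes. -/
structure ModuliScheme (F : CommAlgCat.{u} K ⥤ Type u) where
  /-- the scheme over `K` -/
  scheme : Over (Spec (CommRingCat.of K))
  /-- the identification of its functor of points -/
  points : (algSpec (CommRingCat.of K)).rightOp ⋙ yoneda.obj scheme ≅ F

/-- The spectrum of a `K`-algebra as a scheme over `K`. -/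
abbrev specOver (A : CommAlgCat.{u} K) : Over (Spec (CommRingCat.of K)) :=
  (algSpec (CommRingCat.of K)).obj (op A)

/-- The element of `F(A)` corresponding to an `A`-point of the moduli scheme. -/
def ModuliScheme.pt {F : CommAlgCat.{u} K ⥤ Type u} (X : ModuliScheme F) {A : CommAlgCat.{u} K}
    (x : specOver A ⟶ X.scheme) : F.obj A :=
  X.points.hom.app A x

theorem ModuliScheme.pt_comp {F : CommAlgCat.{u} K ⥤ Type u} (X : ModuliScheme F)
    {A B : CommAlgCat.{u} K} (f : A ⟶ B) (x : specOver A ⟶ X.scheme) :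
    X.pt ((algSpec (CommRingCat.of K)).map f.op ≫ x) = F.map f (X.pt x) :=
  ConcreteCategory.congr_hom (X.points.hom.naturality f) x

/-- The algebra structure on the ring of functions on an affine open subset of a `K`-scheme. -/
abbrev coordAlgebra {T : Over (Spec (CommRingCat.of K))} (W : T.left.affineOpens) :
    Algebra K Γ(T.left, W) :=
  (Spec.preimage (W.2.fromSpec ≫ T.hom)).hom.toAlgebra

/-- The ring of functions on an affine open subset of a `K`-scheme as a `K`-algebra. -/
def coordAlg {T : Over (Spec (CommRingCat.of K))} (W : T.left.affineOpens) : CommAlgCat.{u} K :=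
  letI := coordAlgebra W
  CommAlgCat.of K Γ(T.left, W)

/-- The inclusion of an affine open subset as a point with values in its ring of functions. -/
def chart {T : Over (Spec (CommRingCat.of K))} (W : T.left.affineOpens) :
    specOver (coordAlg W) ⟶ T :=
  Over.homMk W.2.fromSpec (Spec.map_preimage (W.2.fromSpec ≫ T.hom)).symm

/-- The restriction of functions between affine open subsets. -/
def coordRes {T : Over (Spec (CommRingCat.of K))} {W W' : T.left.affineOpens} (h : W' ≤ W) :
    coordAlg W ⟶ coordAlg W' :=
  letI := coordAlgebra W
  letI := coordAlgebra W'
  CommAlgCat.ofHom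
    { (T.left.presheaf.map (homOfLE (X := T.left.Opens) h).op).hom with
      commutes' := fun r => by
        have h1 : Spec.preimage (W.2.fromSpec ≫ T.hom) ≫
            T.left.presheaf.map (homOfLE (X := T.left.Opens) h).op =
            Spec.preimage (W'.2.fromSpec ≫ T.hom) := by
          apply Spec.map_injective
          rw [Spec.map_comp, Spec.map_preimage, Spec.map_preimage, ← Category.assoc,
            W.2.map_fromSpec W'.2]
        exact ConcreteCategory.congr_hom h1 r }

theorem chart_res {T : Over (Spec (CommRingCat.of K))} {W W' : T.left.affineOpens} (h : W' ≤ W) :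
    (algSpec (CommRingCat.of K)).map (coordRes h).op ≫ chart W = chart W' := by
  apply Over.OverMorphism.ext
  exact W.2.map_fromSpec W'.2 (homOfLE (X := T.left.Opens) h).op

end Moduli

section Picard

/-- The structure sheaf of a scheme restricted to the partially ordered set of affine open
subsets. -/
def affineStructure (X : Scheme.{u}) : (X.affineOpens)ᵒᵖ ⥤ CommRingCat.{u} :=
  (Monotone.functor (f := fun U : X.affineOpens => (U : X.Opens)) fun _ _ h => h).op ⋙ X.presheaf

/-- Presheaves of modules over the structure sheaf on the affine open subsets of `X`, with the
tensor product `(M ⊗ N)(U) = M(U) ⊗ N(U)` over `Γ(X, U)`. -/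
abbrev AffineModules (X : Scheme.{u}) : Type (u + 1) :=
  PresheafOfModules.{u} (affineStructure X ⋙ forget₂ CommRingCat RingCat)

/-- The Picard group of `X`: isomorphism classes of invertible objects `M` for the tensor product
on affine open subsets. If `M ⊗ N` is isomorphic to the structure sheaf, then every `M(U)` is an
invertible `Γ(X, U)`-module, and the maps from the base change of `M(U)` to `Γ(X, V)` to `M(V)`
and the one for `N`, being maps of invertible modules with invertible tensor product, are
isomorphisms. So invertible objects are the same as invertible sheaves. -/
abbrev Pic (X : Scheme.{u}) : Type (u + 1) :=
  (Skeleton (AffineModules X))ˣ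

/-- An ideal sheaf as a sheaf of modules (on the affine open subsets). -/
def idealModule {X : Scheme.{u}} (I : X.IdealSheafData) : AffineModules X :=
  PresheafOfModules.Submodule.toPresheafOfModules
    (M := PresheafOfModules.unit (affineStructure X ⋙ forget₂ CommRingCat RingCat))
    { obj := fun U => (show Submodule Γ(X, U.unop.1) Γ(X, U.unop.1) from I.ideal U.unop)
      map := fun {U V} f => by
        intro x hx
        have h := I.map_ideal (leOfHom f.unop)
        change (X.presheaf.map (homOfLE (leOfHom f.unop)).op).hom x ∈ I.ideal V.unop
        rw [← h]
        exact Ideal.mem_map_of_mem _ hx }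

/-- The class in the Picard group of an invertible module. -/
def IsClassOf {X : Scheme.{u}} (L : Pic X) (M : AffineModules X) : Prop :=
  (L : Skeleton (AffineModules X)) = toSkeleton M

section Exterior

variable {A B C : Type u} [CommRing A] [CommRing B] [CommRing C] {f : A →+* B} {g : B →+* C}
  {M N P : Type u} [AddCommGroup M] [Module A M] [AddCommGroup N] [Module B N]
  [AddCommGroup P] [Module C P]

/-- The map induced on exterior powers by a semilinear map. -/
def exteriorMap (k : ℕ) (φ : M →ₛₗ[f] N) : ⋀[A]^k M →ₛₗ[f] ⋀[B]^k N :=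
  letI : Module A (⋀[B]^k N) := Module.compHom _ f
  let ψ : M [⋀^Fin k]→ₗ[A] (⋀[B]^k N) :=
    { toFun := fun m => exteriorPower.ιMulti B k (φ ∘ m)
      map_update_add' := fun m i x y => by
        simp only [Function.comp_update, map_add, AlternatingMap.map_update_add]
      map_update_smul' := fun m i c x => by
        simp only [Function.comp_update, map_smulₛₗ, AlternatingMap.map_update_smul]
        rfl
      map_eq_zero_of_eq' := fun m i j h hij =>
        AlternatingMap.map_eq_zero_of_eq _ _ (by simp [h]) hij }
  { toFun := exteriorPower.alternatingMapLinearEquiv ψ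
    map_add' := map_add _
    map_smul' := fun c x => (exteriorPower.alternatingMapLinearEquiv ψ).map_smul c x }

theorem exteriorMap_ιMulti (k : ℕ) (φ : M →ₛₗ[f] N) (m : Fin k → M) :
    exteriorMap k φ (exteriorPower.ιMulti A k m) = exteriorPower.ιMulti B k (φ ∘ m) := by
  let : Module A (⋀[B]^k N) := Module.compHom _ f
  exact exteriorPower.alternatingMapLinearEquiv_apply_ιMulti _ _

theorem exterior_induction (k : ℕ) {p : ⋀[A]^k M → Prop}
    (h : ∀ m, p (exteriorPower.ιMulti A k m)) (h0 : p 0) (hadd : ∀ x y, p x → p y → p (x + y))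
    (hsmul : ∀ (a : A) x, p x → p (a • x)) (x : ⋀[A]^k M) : p x := by
  have hx : x ∈ Submodule.span A (Set.range (exteriorPower.ιMulti A k (M := M))) := by
    rw [exteriorPower.ιMulti_span]
    trivial
  induction hx using Submodule.span_induction with
  | mem x hx =>
    obtain ⟨m, rfl⟩ := hx
    exact h m
  | zero => exact h0
  | add x y _ _ hx hy => exact hadd x y hx hy
  | smul a x _ hx => exact hsmul a x hx

theorem exteriorMap_id (k : ℕ) {f : A →+* A} (φ : M →ₛₗ[f] M) (hf : ∀ a, f a = a)
    (hφ : ∀ m, φ m = m) (x : ⋀[A]^k M) : exteriorMap k φ x = x := by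
  induction x using exterior_induction with
  | h m =>
    rw [exteriorMap_ιMulti]
    congr 1
    funext i
    exact hφ (m i)
  | h0 => exact map_zero _
  | hadd x y hx hy => rw [map_add, hx, hy]
  | hsmul a x hx => rw [LinearMap.map_smulₛₗ, hx, hf]

theorem exteriorMap_comp (k : ℕ) {h : A →+* C} (φ : M →ₛₗ[f] N) (ψ : N →ₛₗ[g] P) (χ : M →ₛₗ[h] P)
    (hh : ∀ a, h a = g (f a)) (hχ : ∀ m, χ m = ψ (φ m)) (x : ⋀[A]^k M) :
    exteriorMap k χ x = exteriorMap k ψ (exteriorMap k φ x) := by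
  induction x using exterior_induction with
  | h m =>
    rw [exteriorMap_ιMulti, exteriorMap_ιMulti, exteriorMap_ιMulti]
    congr 1
    funext i
    exact hχ (m i)
  | h0 => rw [map_zero, map_zero, map_zero]
  | hadd x y hx hy => rw [map_add, map_add, map_add, hx, hy]
  | hsmul a x hx =>
    rw [LinearMap.map_smulₛₗ, LinearMap.map_smulₛₗ, LinearMap.map_smulₛₗ, hx, hh]

variable {𝒞 : Type*} [Category* 𝒞] {R : 𝒞ᵒᵖ ⥤ CommRingCat.{u}}

/-- The restriction maps of a presheaf of modules over a presheaf of commutative rings. -/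
def moduleRes (M : PresheafOfModules.{u} (R ⋙ forget₂ CommRingCat RingCat)) {U W : 𝒞ᵒᵖ}
    (i : U ⟶ W) : M.obj U →ₛₗ[(R.map i).hom] M.obj W where
  toFun m := M.map i m
  map_add' := map_add (M.map i).hom
  map_smul' r m := M.map_smul i r m

/-- The presheaf of abelian groups underlying the exterior power of a presheaf of modules. -/
def exteriorAb (M : PresheafOfModules.{u} (R ⋙ forget₂ CommRingCat RingCat)) (k : ℕ) :
    𝒞ᵒᵖ ⥤ Ab.{u} where
  obj U := AddCommGrpCat.of (⋀[R.obj U]^k (M.obj U))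
  map i := AddCommGrpCat.ofHom (exteriorMap k (moduleRes M i)).toAddMonoidHom
  map_id U := by
    apply ConcreteCategory.hom_ext
    intro x
    exact exteriorMap_id k (moduleRes M (𝟙 U))
      (fun a => ConcreteCategory.congr_hom (R.map_id U) a)
      (fun m => ConcreteCategory.congr_hom (M.presheaf.map_id U) m) x
  map_comp i j := by
    apply ConcreteCategory.hom_ext
    intro x
    exact exteriorMap_comp k (moduleRes M i) (moduleRes M j) (moduleRes M (i ≫ j))
      (fun a => ConcreteCategory.congr_hom (R.map_comp i j) a)
      (fun m => M.map_comp_apply i j m) x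

/-- The exterior power of a presheaf of modules, computed objectwise. -/
def exteriorPresheaf (M : PresheafOfModules.{u} (R ⋙ forget₂ CommRingCat RingCat)) (k : ℕ) :
    PresheafOfModules.{u} (R ⋙ forget₂ CommRingCat RingCat) :=
  letI (U : 𝒞ᵒᵖ) : Module ((R ⋙ forget₂ CommRingCat RingCat).obj U) ((exteriorAb M k).obj U) :=
    (inferInstance : Module (R.obj U) (⋀[R.obj U]^k (M.obj U)))
  PresheafOfModules.ofPresheaf (exteriorAb M k) fun _ _ i r m =>
    (exteriorMap k (moduleRes M i)).map_smulₛₗ r m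

end Exterior

end Picard

section Tautological

variable {K : Type u} [Field K] [CharZero K] {V : Type u} [AddCommGroup V] [Module K V]
  {q : QuadraticForm K V} {k : ℕ} {T : Over (Spec (CommRingCat.of K))} {X : ModuliScheme (OGr q k)}

/-- The sections over an affine open subset `W` of the pullback along `f` of the tautological
subbundle of the trivial bundle with fibre `V` on the isotropic Grassmannian. -/
def taut (f : T ⟶ X.scheme) (W : T.left.affineOpens) :
    Submodule (coordAlg W) (coordAlg W ⊗[K] V) :=
  subspace (X.pt (chart W ≫ f))

theorem rTensor_mem_taut (f : T ⟶ X.scheme) {W W' : T.left.affineOpens} (h : W' ≤ W)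
    (u : coordAlg W ⊗[K] V) (hu : u ∈ taut f W) :
    LinearMap.rTensor V (coordRes h).hom.toLinearMap u ∈ taut f W' := by
  have := map_mem_subspace (coordRes h) _ hu
  rwa [← ModuliScheme.pt_comp, ← Category.assoc, chart_res] at this

/-- The restriction of sections of the pullback of the tautological subbundle. -/
def tautRes (f : T ⟶ X.scheme) {W W' : T.left.affineOpens} (h : W' ≤ W) :
    taut f W →ₛₗ[((coordRes h).hom : coordAlg W →+* coordAlg W')] taut f W' where
  toFun u := ⟨LinearMap.rTensor V (coordRes h).hom.toLinearMap u,
    rTensor_mem_taut f h u u.2⟩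
  map_add' u u' := Subtype.ext (map_add _ _ _)
  map_smul' a u := by
    apply Subtype.ext
    have key : ∀ x : coordAlg W ⊗[K] V,
        LinearMap.rTensor V (coordRes h).hom.toLinearMap (a • x) =
          (coordRes h).hom a • LinearMap.rTensor V (coordRes h).hom.toLinearMap x := by
      intro x
      induction x with
      | zero => simp
      | tmul b v => simp [TensorProduct.smul_tmul']
      | add x y hx hy => simp only [smul_add, map_add, hx, hy]
    exact key u

theorem tautRes_refl (f : T ⟶ X.scheme) (W : T.left.affineOpens) (u : taut f W) :
    tautRes f (le_refl W) u = u := by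
  apply Subtype.ext
  have h : (coordRes (le_refl W)).hom.toLinearMap = LinearMap.id := by
    ext x
    exact ConcreteCategory.congr_hom (T.left.presheaf.map_id (op W.1)) x
  change LinearMap.rTensor V (coordRes (le_refl W)).hom.toLinearMap u = u
  rw [h, LinearMap.rTensor_id]
  rfl

theorem tautRes_trans (f : T ⟶ X.scheme) {W W' W'' : T.left.affineOpens} (h : W' ≤ W)
    (h' : W'' ≤ W') (u : taut f W) :
    tautRes f (h'.trans h) u = tautRes f h' (tautRes f h u) := by
  apply Subtype.ext
  have e : (coordRes (h'.trans h)).hom.toLinearMap =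
      (coordRes h').hom.toLinearMap ∘ₗ (coordRes h).hom.toLinearMap := by
    ext x
    exact ConcreteCategory.congr_hom (T.left.presheaf.map_comp
      (homOfLE (X := T.left.Opens) h).op (homOfLE (X := T.left.Opens) h').op) x
  change LinearMap.rTensor V (coordRes (h'.trans h)).hom.toLinearMap u = _
  rw [e, LinearMap.rTensor_comp]
  rfl

/-- The presheaf of abelian groups underlying the tautological bundle. -/
def tautPresheaf (f : T ⟶ X.scheme) : (T.left.affineOpens)ᵒᵖ ⥤ Ab.{u} where
  obj W := AddCommGrpCat.of (taut f W.unop)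
  map g := AddCommGrpCat.ofHom (tautRes f (leOfHom g.unop)).toAddMonoidHom
  map_id W := by
    apply ConcreteCategory.hom_ext
    intro x
    exact tautRes_refl f W.unop x
  map_comp g g' := by
    apply ConcreteCategory.hom_ext
    intro x
    exact tautRes_trans f (leOfHom g.unop) (leOfHom g'.unop) x

/-- The pullback along `f` of the tautological bundle on the isotropic Grassmannian. -/
def tautBundle (f : T ⟶ X.scheme) : AffineModules T.left :=
  letI (W : (T.left.affineOpens)ᵒᵖ) :
      Module ((affineStructure T.left ⋙ forget₂ CommRingCat RingCat).obj W)
        ((tautPresheaf f).obj W) :=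
    (inferInstance : Module (coordAlg W.unop) (taut f W.unop))
  PresheafOfModules.ofPresheaf (tautPresheaf f) fun _ _ g r m =>
    (tautRes f (leOfHom g.unop)).map_smulₛₗ r m

/-- The determinant (top exterior power) of the pullback along `f` of the tautological bundle of
rank `k` on the isotropic Grassmannian. Its inverse in the Picard group is the line bundle with
first Chern class `c_1` of the dual of the tautological bundle. -/
def detTaut (f : T ⟶ X.scheme) : AffineModules T.left :=
  exteriorPresheaf (tautBundle f) k

end Tautological

section Geometry

/-- Projective space `P^n` over `K`: the homogeneous spectrum of the polynomial ring in `n + 1`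
variables, as a scheme over `K`. -/
def projectiveSpace (K : Type u) [Field K] (n : ℕ) : Over (Spec (CommRingCat.of K)) :=
  letI := MvPolynomial.gradedAlgebra (σ := Fin (n + 1)) (R := K)
  Over.mk (Proj.toSpecZero (MvPolynomial.homogeneousSubmodule (Fin (n + 1)) K) ≫
    Spec.map (CommRingCat.ofHom
      (algebraMap K (MvPolynomial.homogeneousSubmodule (Fin (n + 1)) K 0))))

variable {K : Type u} [Field K]

/-- A scheme over `K` is projective if it has a closed immersion into some `P^n` over `K`. -/
def IsProjective (X : Over (Spec (CommRingCat.of K))) : Prop :=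
  ∃ (n : ℕ) (i : X ⟶ projectiveSpace K n), IsClosedImmersion i.left

/-- A smooth projective variety over `K`: a smooth, projective, integral scheme over `K`. -/
structure IsSmoothProjectiveVariety (X : Over (Spec (CommRingCat.of K))) : Prop where
  smooth : Smooth X.hom
  projective : IsProjective X
  integral : IsIntegral X.left

/-- A morphism `f : X ⟶ Y` over `K` is a `P^n`-fibration if it is, locally over `Y` in the Zariski
topology, isomorphic to the projection `W × P^n ⟶ W`. -/
def IsProjectiveFibration (n : ℕ) {X Y : Over (Spec (CommRingCat.of K))} (f : X ⟶ Y) : Prop :=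
  ∀ y : Y.left, ∃ (W : Y.left.Opens) (_ : y ∈ W)
    (e : (f.left ⁻¹ᵁ W).toScheme ≅ Limits.pullback (W.ι ≫ Y.hom) (projectiveSpace K n).hom),
    e.hom ≫ Limits.pullback.fst (W.ι ≫ Y.hom) (projectiveSpace K n).hom = f.left ∣_ W

/-- A morphism is birational if it restricts to an isomorphism between dense open subschemes. -/
def IsBirational {X Y : Scheme.{u}} (f : X ⟶ Y) : Prop :=
  ∃ φ : X.PartialIso Y, φ.iso.hom ≫ φ.target.ι = φ.source.ι ≫ f

/-- The exceptional locus of a morphism: the complement of the largest open subset on which the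
morphism is a local isomorphism. -/
def exceptionalLocus {X Y : Scheme.{u}} (f : X ⟶ Y) : TopologicalSpace.Closeds X :=
  (sSup {U : X.Opens | IsOpenImmersion (U.ι ≫ f)}).compl

/-- The ideal sheaf of the exceptional locus with its reduced scheme structure. -/
def exceptionalIdeal {X Y : Scheme.{u}} (f : X ⟶ Y) : X.IdealSheafData :=
  Scheme.IdealSheafData.vanishingIdeal (exceptionalLocus f)

end Geometry

section Pencil

variable {K : Type u} [Field K] {n : ℕ}

/-- The quadratic form `q_P = s q_0 + t q_∞` of the pencil at the point `P = (s : t)`, where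
`q_0 = ∑ a_i x_i ^ 2` and `q_∞ = - ∑ x_i ^ 2`. -/
def pencilForm (a : Fin n → K) (s t : K) : QuadraticForm K (Fin n → K) :=
  s • QuadraticMap.weightedSumSquares K a + t • (-QuadraticMap.weightedSumSquares K (1 : Fin n → K))

/-- The point `(s : t)` of the projective line is one of the branching points `(1 : a_i)`. -/
def IsBranchingPoint (a : Fin n → K) (s t : K) : Prop :=
  s ≠ 0 ∧ ∃ i, t = s * a i

theorem pencilForm_apply (a : Fin n → K) (s t : K) (x : Fin n → K) :
    pencilForm a s t x = s * ∑ i, a i * x i ^ 2 + t * (-∑ i, x i ^ 2) := by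
  simp [pencilForm, QuadraticMap.weightedSumSquares_apply, pow_two]

end Pencil

end

end OrthogonalGrassmannian

open OrthogonalGrassmannian

namespace OrthogonalGrassmannian

noncomputable section

section Points

variable {K : Type u} [Field K]

/-- The functor of points on `K`-algebras of a `K`-scheme. -/
abbrev pointFunctor (X : Over (Spec (CommRingCat.of K))) : CommAlgCat.{u} K ⥤ Type u :=
  (algSpec (CommRingCat.of K)).rightOp ⋙ yoneda.obj X

/-- Restriction of points along a map of algebras. -/
abbrev res {X : Over (Spec (CommRingCat.of K))} {A B : CommAlgCat.{u} K} (f : A ⟶ B)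
    (y : specOver A ⟶ X) : specOver B ⟶ X :=
  (algSpec (CommRingCat.of K)).map f.op ≫ y

theorem res_res {X : Over (Spec (CommRingCat.of K))} {A B C : CommAlgCat.{u} K} (f : A ⟶ B)
    (g : B ⟶ C) (y : specOver A ⟶ X) : res g (res f y) = res (f ≫ g) y := by
  simp [res]

theorem res_id {X : Over (Spec (CommRingCat.of K))} {A : CommAlgCat.{u} K}
    (y : specOver A ⟶ X) : res (𝟙 A) y = y := by
  simp [res]

theorem exists_algSpec_map {A B : CommAlgCat.{u} K} (φ : specOver B ⟶ specOver A) :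
    ∃ f : A ⟶ B, φ = (algSpec (CommRingCat.of K)).map f.op :=
  ⟨((algSpec.fullyFaithful (R := CommRingCat.of K)).preimage φ).unop,
    ((algSpec.fullyFaithful (R := CommRingCat.of K)).map_preimage φ).symm⟩

theorem algSpec_map_injective {A B : CommAlgCat.{u} K} {f g : A ⟶ B}
    (h : (algSpec (CommRingCat.of K)).map f.op = (algSpec (CommRingCat.of K)).map g.op) : f = g :=
  Quiver.Hom.op_inj ((algSpec.fullyFaithful (R := CommRingCat.of K)).map_injective h)

/-- A point landing in an open subscheme `Spec R` factors through it. -/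
theorem exists_factor {X : Over (Spec (CommRingCat.of K))} {A R : CommAlgCat.{u} K}
    (c : specOver R ⟶ X) [IsOpenImmersion c.left] (y : specOver A ⟶ X)
    (h : Set.range y.left ⊆ Set.range c.left) : ∃ f : R ⟶ A, y = res f c := by
  let l : specOver A ⟶ specOver R := Over.homMk (IsOpenImmersion.lift c.left y.left h) (by
    rw [← Over.w c, ← Category.assoc, IsOpenImmersion.lift_fac, Over.w y])
  obtain ⟨f, hf⟩ := exists_algSpec_map l
  refine ⟨f, ?_⟩
  rw [res, ← hf]
  ext1
  exact (IsOpenImmersion.lift_fac _ _ _).symm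

theorem isAffine {X : Scheme.{u}} (W : X.affineOpens) : IsAffineOpen W.1 := W.2

instance {T : Over (Spec (CommRingCat.of K))} (W : T.left.affineOpens) :
    IsOpenImmersion (chart W).left :=
  (isAffine W).isOpenImmersion_fromSpec

/-- The identification of an affine open subscheme with a spectrum. -/
def chartIso {T : Over (Spec (CommRingCat.of K))} (W : T.left.affineOpens) :
    W.1.toScheme ≅ (specOver (coordAlg W)).left :=
  (isAffine W).isoSpec

theorem chartIso_inv_ι {T : Over (Spec (CommRingCat.of K))} (W : T.left.affineOpens) :
    (chartIso W).inv ≫ W.1.ι = (chart W).left :=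
  (isAffine W).isoSpec_inv_ι

theorem chartIso_hom_chart {T : Over (Spec (CommRingCat.of K))} (W : T.left.affineOpens) :
    (chartIso W).hom ≫ (chart W).left = W.1.ι := by
  rw [← chartIso_inv_ι, Iso.hom_inv_id_assoc]

theorem range_chart {T : Over (Spec (CommRingCat.of K))} (W : T.left.affineOpens) :
    Set.range (chart W).left = (W : Set T.left) :=
  (isAffine W).range_fromSpec

theorem exists_affineOpen {X : Scheme.{u}} (x : X) (U : X.Opens) (h : x ∈ U) :
    ∃ W : X.affineOpens, x ∈ W.1 ∧ W.1 ≤ U := by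
  obtain ⟨W, hW, hx, hU⟩ := TopologicalSpace.Opens.isBasis_iff_nbhd.mp X.isBasis_affineOpens h
  exact ⟨⟨W, hW⟩, hx, hU⟩

/-- Morphisms are determined by their values on points with values in algebras. -/
theorem hom_ext_points {X Y : Over (Spec (CommRingCat.of K))} {f g : X ⟶ Y}
    (h : ∀ (A : CommAlgCat.{u} K) (x : specOver A ⟶ X), x ≫ f = x ≫ g) : f = g := by
  ext1
  apply Scheme.hom_ext_of_forall
  intro x
  obtain ⟨W, hx, -⟩ := exists_affineOpen x ⊤ trivial
  refine ⟨W.1, hx, ?_⟩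
  have := congrArg Over.Hom.left (h _ (chart W))
  rw [← cancel_epi (chartIso W).inv, ← Category.assoc, ← Category.assoc, chartIso_inv_ι]
  exact this

theorem hom_ext_points_left {Z : Scheme.{u}} {Y : Over (Spec (CommRingCat.of K))}
    {f g : Z ⟶ Y.left} (hw : f ≫ Y.hom = g ≫ Y.hom)
    (h : ∀ (A : CommAlgCat.{u} K) (x : (specOver A).left ⟶ Z),
      x ≫ f ≫ Y.hom = (specOver A).hom → x ≫ f = x ≫ g) : f = g := by
  let Z' : Over (Spec (CommRingCat.of K)) := Over.mk (f ≫ Y.hom)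
  have : (Over.homMk f : Z' ⟶ Y) = Over.homMk g hw.symm := by
    apply hom_ext_points
    intro A x
    ext1
    exact h A x.left (Over.w x)
  exact congrArg Over.Hom.left this

/-- A natural transformation of functors of points comes from a morphism. -/
theorem exists_hom_of_natural {X Y : Over (Spec (CommRingCat.of K))}
    (η : ∀ A : CommAlgCat.{u} K, (specOver A ⟶ X) → (specOver A ⟶ Y))
    (hη : ∀ (A B : CommAlgCat.{u} K) (f : A ⟶ B) (x : specOver A ⟶ X),
      η B (res f x) = res f (η A x)) :
    ∃ f : X ⟶ Y, ∀ (A : CommAlgCat.{u} K) (x : specOver A ⟶ X), x ≫ f = η A x := by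
  have hU : TopologicalSpace.IsOpenCover (fun W : X.left.affineOpens => W.1) := by
    apply TopologicalSpace.IsOpenCover.mk
    rw [eq_top_iff]
    intro x _
    obtain ⟨W, hx, -⟩ := exists_affineOpen x ⊤ trivial
    exact TopologicalSpace.Opens.mem_iSup.mpr ⟨W, hx⟩
  let 𝒰 := X.left.openCoverOfIsOpenCover _ hU
  obtain ⟨m, hmd⟩ : ∃ m : ∀ W : X.left.affineOpens, W.1.toScheme ⟶ Y.left,
      ∀ W, m W = (chartIso W).hom ≫ (η _ (chart W)).left := ⟨_, fun W => rfl⟩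
  have hm (W : X.left.affineOpens) : m W ≫ Y.hom = W.1.ι ≫ X.hom := by
    simp only [hmd, Category.assoc]
    rw [Over.w (η _ (chart W)), ← Over.w (chart W), ← Category.assoc, chartIso_hom_chart]
  have key (A : CommAlgCat.{u} K) (W : X.left.affineOpens)
      (x : (specOver A).left ⟶ W.1.toScheme)
      (hx : x ≫ W.1.ι ≫ X.hom = (specOver A).hom) :
      x ≫ m W = (η A (Over.homMk (x ≫ W.1.ι) ((Category.assoc _ _ _).trans hx))).left := by
    let y : specOver A ⟶ X := Over.homMk (x ≫ W.1.ι) ((Category.assoc _ _ _).trans hx)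
    have hy : Set.range y.left ⊆ Set.range (chart W).left := by
      rw [range_chart]
      rintro _ ⟨a, rfl⟩
      exact (x a).2
    obtain ⟨f, hf⟩ := exists_factor (chart W) y hy
    change _ = (η A y).left
    rw [hf, hη]
    have h1 : x ≫ (chartIso W).hom = ((algSpec (CommRingCat.of K)).map f.op).left := by
      have h2 : x ≫ W.1.ι = ((algSpec (CommRingCat.of K)).map f.op).left ≫ (chart W).left :=
        congrArg Over.Hom.left hf
      rw [← cancel_mono (chart W).left, ← h2, Category.assoc, chartIso_hom_chart]
    rw [hmd, ← Category.assoc, h1]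
    rfl
  have hglue : ∀ W W' : X.left.affineOpens,
      Limits.pullback.fst W.1.ι W'.1.ι ≫ m W = Limits.pullback.snd W.1.ι W'.1.ι ≫ m W' := by
    intro W W'
    apply hom_ext_points_left
    · rw [Category.assoc, Category.assoc, hm, hm, Limits.pullback.condition_assoc]
    · intro A x hx
      have h1 := key A W (x ≫ Limits.pullback.fst _ _) (by
        rw [Category.assoc, ← hm, ← hx, Category.assoc])
      have h2 := key A W' (x ≫ Limits.pullback.snd _ _) (by
        rw [Category.assoc, ← Limits.pullback.condition_assoc, ← hm, ← hx, Category.assoc])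
      rw [Category.assoc] at h1 h2
      rw [h1, h2]
      congr 2
      ext1
      simp [Limits.pullback.condition]
  let f : X.left ⟶ Y.left := 𝒰.glueMorphisms m hglue
  have hf (W : X.left.affineOpens) : W.1.ι ≫ f = m W := 𝒰.ι_glueMorphisms m hglue W
  have hfY : f ≫ Y.hom = X.hom := by
    apply Scheme.hom_ext_of_forall
    intro x
    obtain ⟨W, hx, -⟩ := exists_affineOpen x ⊤ trivial
    refine ⟨W.1, hx, ?_⟩
    rw [← Category.assoc, hf, hm]
  refine ⟨Over.homMk f hfY, fun A x => ?_⟩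
  have hlocal : ∀ (W : X.left.affineOpens), chart W ≫ (Over.homMk f hfY : X ⟶ Y) = η _ (chart W) := by
    intro W
    ext1
    change (chart W).left ≫ f = _
    rw [← chartIso_inv_ι, Category.assoc, hf]
    simp only [hmd, Iso.inv_hom_id_assoc]
  ext1
  apply Scheme.hom_ext_of_forall
  intro p
  obtain ⟨W, hx, -⟩ := exists_affineOpen (x.left p) ⊤ trivial
  obtain ⟨D, hp, hD⟩ := exists_affineOpen p (x.left ⁻¹ᵁ W.1) hx
  let y : specOver (coordAlg D) ⟶ X := chart (T := specOver A) D ≫ x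
  obtain ⟨g, hg⟩ := exists_factor (chart W) y (by
    rw [range_chart]
    rintro _ ⟨a, rfl⟩
    apply hD
    rw [← SetLike.mem_coe, ← range_chart (T := specOver A) D]
    exact ⟨a, rfl⟩)
  obtain ⟨h, hh⟩ := exists_algSpec_map (chart (T := specOver A) D)
  have e1 : chart (T := specOver A) D ≫ x ≫ (Over.homMk f hfY : X ⟶ Y) =
      chart (T := specOver A) D ≫ η A x := by
    rw [← Category.assoc]
    change y ≫ _ = _
    rw [hg, res, Category.assoc, hlocal]
    change res g _ = _
    rw [← hη, ← hg]
    simp only [y]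
    rw [hh]
    exact hη _ _ h x
  refine ⟨D.1, hp, ?_⟩
  rw [← cancel_epi (chartIso (T := specOver A) D).inv, ← Category.assoc, ← Category.assoc,
    chartIso_inv_ι (T := specOver A)]
  exact congrArg Over.Hom.left e1

end Points

section Localization

variable {K : Type u} [Field K]

/-- The localization of a `K`-algebra at an element. -/
def loc (A : CommAlgCat.{u} K) (r : A) : CommAlgCat.{u} K :=
  CommAlgCat.of K (Localization.Away r)

/-- The localization map. -/
def toLoc (A : CommAlgCat.{u} K) (r : A) : A ⟶ loc A r :=
  CommAlgCat.ofHom (IsScalarTower.toAlgHom K A (Localization.Away r))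

theorem isUnit_toLoc (A : CommAlgCat.{u} K) (r : A) : IsUnit ((toLoc A r).hom r) :=
  IsLocalization.Away.algebraMap_isUnit (S := Localization.Away r) r

theorem exists_of_isUnit {A B : CommAlgCat.{u} K} {r : A} (f : A ⟶ B) (h : IsUnit (f.hom r)) :
    ∃ g : loc A r ⟶ B, toLoc A r ≫ g = f := by
  refine ⟨CommAlgCat.ofHom
    { IsLocalization.Away.lift (S := Localization.Away r) r (g := f.hom.toRingHom) h with
      commutes' := fun a => ?_ }, ?_⟩
  · rw [IsScalarTower.algebraMap_apply K A (Localization.Away r)]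
    exact (IsLocalization.Away.lift_eq (S := Localization.Away r) r h _).trans (f.hom.commutes a)
  · ext a
    exact IsLocalization.Away.lift_eq (S := Localization.Away r) r h a

/-- A `K`-algebra quotient. -/
def quot (A : CommAlgCat.{u} K) (I : Ideal A) : CommAlgCat.{u} K := CommAlgCat.of K (A ⧸ I)

/-- The quotient map. -/
def toQuot (A : CommAlgCat.{u} K) (I : Ideal A) : A ⟶ quot A I :=
  CommAlgCat.ofHom (Ideal.Quotient.mkₐ K I)

theorem toQuot_eq_zero {A : CommAlgCat.{u} K} {I : Ideal A} {a : A} :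
    (toQuot A I).hom a = 0 ↔ a ∈ I :=
  Ideal.Quotient.eq_zero_iff_mem

theorem exists_of_kills {A B : CommAlgCat.{u} K} {I : Ideal A} (f : A ⟶ B)
    (h : ∀ a ∈ I, f.hom a = 0) : ∃ g : quot A I ⟶ B, toQuot A I ≫ g = f :=
  ⟨CommAlgCat.ofHom (Ideal.Quotient.liftₐ I f.hom h), rfl⟩

theorem span_eq_top_of_local {A : CommAlgCat.{u} K} {t : Set A}
    (h : ∀ p : PrimeSpectrum A, ∃ r ∉ p.asIdeal, r ∈ t) : Ideal.span t = ⊤ := by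
  by_contra hne
  obtain ⟨m, hm, hle⟩ := Ideal.exists_le_maximal _ hne
  obtain ⟨r, hr, hrt⟩ := h ⟨m, hm.isPrime⟩
  exact hr (hle (Ideal.subset_span hrt))

theorem exists_notMem_of_span {A : CommAlgCat.{u} K} {t : Set A} (h : Ideal.span t = ⊤)
    (p : PrimeSpectrum A) : ∃ r ∉ p.asIdeal, r ∈ t := by
  by_contra! hne
  apply p.2.ne_top
  rw [← top_le_iff, ← h, Ideal.span_le]
  intro r hr
  by_contra hrp
  exact hne r hrp hr

theorem exists_finset_of_local {A : CommAlgCat.{u} K} {P : A → Prop}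
    (h : ∀ p : PrimeSpectrum A, ∃ r ∉ p.asIdeal, P r) :
    ∃ t : Finset A, Ideal.span (t : Set A) = ⊤ ∧ ∀ r ∈ t, P r := by
  have : Ideal.span {r | P r} = ⊤ := span_eq_top_of_local h
  obtain ⟨t, ht, h1⟩ := (Ideal.span_eq_top_iff_finite _).mp this
  exact ⟨t, h1, fun r hr => ht hr⟩

theorem eq_zero_of_local {A : CommAlgCat.{u} K} {a : A}
    (h : ∀ p : PrimeSpectrum A, ∃ r ∉ p.asIdeal, (toLoc A r).hom a = 0) : a = 0 := by
  by_contra hne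
  have hne' : Ideal.span {b : A | b * a = 0} ≠ ⊤ := by
    intro htop
    have h1 : ∀ b ∈ Ideal.span {b : A | b * a = 0}, b * a = 0 := by
      intro b hb
      induction hb using Submodule.span_induction with
      | mem b hb => exact hb
      | zero => exact zero_mul a
      | add x y _ _ hx hy => rw [add_mul, hx, hy, add_zero]
      | smul c x _ hx => rw [smul_eq_mul, mul_assoc, hx, mul_zero]
    exact hne (by simpa using h1 1 (htop ▸ trivial))
  apply hne'
  apply span_eq_top_of_local
  intro p
  obtain ⟨r, hr, h0⟩ := h p
  obtain ⟨⟨_, n, rfl⟩, hn⟩ := (IsLocalization.map_eq_zero_iff (Submonoid.powers r)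
    (Localization.Away r) a).mp h0
  exact ⟨r ^ n, fun hmem => hr (p.2.mem_of_pow_mem n hmem), hn⟩

/-- A functor on `K`-algebras is a Zariski sheaf. -/
structure IsZariskiSheaf (F : CommAlgCat.{u} K ⥤ Type u) : Prop where
  separated : ∀ (A : CommAlgCat.{u} K) (x x' : F.obj A), (∀ p : PrimeSpectrum A,
    ∃ r ∉ p.asIdeal, F.map (toLoc A r) x = F.map (toLoc A r) x') → x = x'
  glue : ∀ (A : CommAlgCat.{u} K) (t : Finset A), Ideal.span (t : Set A) = ⊤ →
    ∀ x : ∀ r : t, F.obj (loc A r.1), (∀ (r r' : t) (B : CommAlgCat.{u} K) (g : loc A r.1 ⟶ B)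
      (h : loc A r'.1 ⟶ B), toLoc A r.1 ≫ g = toLoc A r'.1 ≫ h →
      F.map g (x r) = F.map h (x r')) → ∃ y, ∀ r : t, F.map (toLoc A r.1) y = x r

theorem map_map {F : CommAlgCat.{u} K ⥤ Type u} {A B C : CommAlgCat.{u} K} (f : A ⟶ B)
    (g : B ⟶ C) (x : F.obj A) : F.map g (F.map f x) = F.map (f ≫ g) x := by
  rw [F.map_comp]
  rfl

theorem map_one {F : CommAlgCat.{u} K ⥤ Type u} {A : CommAlgCat.{u} K} (x : F.obj A) :
    F.map (𝟙 A) x = x := by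
  rw [F.map_id]
  rfl

/-- Elements of a sheaf which exist locally and are unique exist globally. -/
theorem IsZariskiSheaf.exists_of_local {F : CommAlgCat.{u} K ⥤ Type u} (hF : IsZariskiSheaf F)
    {A : CommAlgCat.{u} K} (Q : ∀ B : CommAlgCat.{u} K, (A ⟶ B) → F.obj B → Prop)
    (hres : ∀ (B C : CommAlgCat.{u} K) (f : A ⟶ B) (g : B ⟶ C) (x : F.obj B), Q B f x →
      Q C (f ≫ g) (F.map g x))
    (huniq : ∀ (B : CommAlgCat.{u} K) (f : A ⟶ B) (x x' : F.obj B), Q B f x → Q B f x' → x = x')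
    (hloc : ∀ p : PrimeSpectrum A, ∃ r ∉ p.asIdeal, ∃ x, Q (loc A r) (toLoc A r) x) :
    ∃ x : F.obj A, ∀ p : PrimeSpectrum A, ∃ r ∉ p.asIdeal,
      Q (loc A r) (toLoc A r) (F.map (toLoc A r) x) := by
  obtain ⟨t, ht, hP⟩ := exists_finset_of_local hloc
  choose x hx using fun r : t => hP r.1 r.2
  obtain ⟨y, hy⟩ := hF.glue A t ht x (by
    intro r r' B g h hgh
    apply huniq B (toLoc A r.1 ≫ g)
    · exact hres _ _ _ _ _ (hx r)
    · rw [hgh]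
      exact hres _ _ _ _ _ (hx r'))
  refine ⟨y, fun p => ?_⟩
  obtain ⟨r, hr, hrt⟩ := exists_notMem_of_span ht p
  refine ⟨r, hr, ?_⟩
  rw [hy ⟨r, hrt⟩]
  exact hx ⟨r, hrt⟩

/-- The cover of the spectrum of `A` by the spectra of localizations. -/
abbrev locCover (A : CommAlgCat.{u} K) {ι : Type u} (s : ι → A)
    (hs : Ideal.span (Set.range s) = ⊤) : (specOver A).left.OpenCover where
  I₀ := ι
  X r := (specOver (loc A (s r))).left
  f r := ((algSpec (CommRingCat.of K)).map (toLoc A (s r)).op).left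
  mem₀ := (Scheme.affineOpenCoverOfSpanRangeEqTop (R := CommRingCat.of A) s hs).openCover.mem₀

theorem pointFunctor_isZariskiSheaf (X : Over (Spec (CommRingCat.of K))) :
    IsZariskiSheaf (pointFunctor X) where
  separated := by
    intro A x x' h
    have htop : Ideal.span (Set.range fun r : {r : A |
        res (toLoc A r) x = res (toLoc A r) x'} => r.1) = ⊤ := by
      rw [Subtype.range_coe]
      exact span_eq_top_of_local h
    apply Over.OverMorphism.ext
    apply (locCover A _ htop).hom_ext
    intro r
    exact congrArg Over.Hom.left r.2
  glue := by
    intro A t ht x hx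
    have htop : Ideal.span (Set.range fun r : t => r.1) = ⊤ := by
      rw [← ht]
      congr 1
      exact Subtype.range_coe
    let m (r : t) : specOver (loc A r.1) ⟶ X := x r
    have hglue : ∀ r r' : t,
        Limits.pullback.fst ((locCover A _ htop).f r) ((locCover A _ htop).f r') ≫ (m r).left =
          Limits.pullback.snd ((locCover A _ htop).f r) ((locCover A _ htop).f r') ≫ (m r').left := by
      intro r r'
      have hc (r : t) : (locCover A _ htop).f r ≫ (specOver A).hom = (specOver (loc A r.1)).hom :=
        Over.w ((algSpec (CommRingCat.of K)).map (toLoc A r.1).op)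
      have hw : Limits.pullback.fst ((locCover A _ htop).f r) ((locCover A _ htop).f r') ≫
          (specOver (loc A r.1)).hom =
          Limits.pullback.snd ((locCover A _ htop).f r) ((locCover A _ htop).f r') ≫ (specOver (loc A r'.1)).hom := by
        rw [← hc, ← hc, Limits.pullback.condition_assoc]
      apply hom_ext_points_left
      · rw [Category.assoc, Category.assoc, Over.w, Over.w, hw]
      · intro B z hz
        rw [Category.assoc, Over.w] at hz
        let z1 : specOver B ⟶ specOver (loc A r.1) := Over.homMk (z ≫ Limits.pullback.fst _ _)
          ((Category.assoc _ _ _).trans hz)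
        let z2 : specOver B ⟶ specOver (loc A r'.1) := Over.homMk (z ≫ Limits.pullback.snd _ _)
          (by
            refine (Category.assoc _ _ _).trans ?_
            rw [← hw]
            exact hz)
        obtain ⟨g, hg⟩ := exists_algSpec_map z1
        obtain ⟨h, hh⟩ := exists_algSpec_map z2
        have hgh : toLoc A r.1 ≫ g = toLoc A r'.1 ≫ h := by
          apply algSpec_map_injective
          rw [op_comp, op_comp, Functor.map_comp, Functor.map_comp, ← hg, ← hh]
          ext1
          change (z ≫ Limits.pullback.fst _ _) ≫ (locCover A _ htop).f r =
            (z ≫ Limits.pullback.snd _ _) ≫ (locCover A _ htop).f r'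
          rw [Category.assoc, Category.assoc, Limits.pullback.condition]
        have := hx r r' B g h hgh
        change res g (m r) = res h (m r') at this
        rw [res, res, ← hg, ← hh] at this
        have := congrArg Over.Hom.left this
        exact (Category.assoc _ _ _).symm.trans (this.trans (Category.assoc _ _ _))
    refine ⟨(Over.homMk ((locCover A _ htop).glueMorphisms (fun r => (m r).left) hglue) ?_ : specOver A ⟶ X), ?_⟩
    · apply (locCover A _ htop).hom_ext
      intro r
      rw [← Category.assoc, (locCover A _ htop).ι_glueMorphisms, Over.w]
      exact (Over.w ((algSpec (CommRingCat.of K)).map (toLoc A (Subtype.val r)).op)).symm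
    · intro r
      apply Over.OverMorphism.ext
      exact (locCover A _ htop).ι_glueMorphisms (fun r => (m r).left) hglue r

end Localization

end

end OrthogonalGrassmannian

namespace OrthogonalGrassmannian

noncomputable section

variable {K : Type u} [Field K]

section LocalFactor

theorem exists_prime_toLoc {A : CommAlgCat.{u} K} {r : A} (p : PrimeSpectrum A)
    (hr : r ∉ p.asIdeal) : ∃ q : PrimeSpectrum (loc A r),
      PrimeSpectrum.comap (toLoc A r).hom.toRingHom q = p := by
  have := PrimeSpectrum.localization_away_comap_range (Localization.Away r) r
  have h : p ∈ (PrimeSpectrum.basicOpen r : Set (PrimeSpectrum A)) := hr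
  rw [← this] at h
  exact h

/-- A point factors locally through an open subscheme around every prime mapping into it. -/
theorem exists_local_factor {X : Over (Spec (CommRingCat.of K))} {A R : CommAlgCat.{u} K}
    (c : specOver R ⟶ X) [IsOpenImmersion c.left] (y : specOver A ⟶ X) (p : PrimeSpectrum A)
    (h : y.left p ∈ Set.range c.left) :
    ∃ r ∉ p.asIdeal, ∃ f : R ⟶ loc A r, res (toLoc A r) y = res f c := by
  have ho : IsOpen (y.left ⁻¹' Set.range c.left) :=
    (c.left.isOpenEmbedding.isOpen_range).preimage y.left.continuous
  obtain ⟨r, hr, hsub⟩ : ∃ r : A, r ∉ p.asIdeal ∧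
      ∀ q : PrimeSpectrum A, r ∉ q.asIdeal → y.left q ∈ Set.range c.left := by
    obtain ⟨_, ⟨r, rfl⟩, hr, hsub⟩ :=
      PrimeSpectrum.isTopologicalBasis_basic_opens.exists_subset_of_mem_open h ho
    exact ⟨r, hr, fun q hq => hsub hq⟩
  refine ⟨r, hr, exists_factor c _ ?_⟩
  rintro _ ⟨q, rfl⟩
  refine hsub (PrimeSpectrum.comap (toLoc A r).hom.toRingHom q) fun hmem => q.2.ne_top ?_
  exact Ideal.eq_top_of_isUnit_mem _ hmem (isUnit_toLoc A r)

theorem exists_chart_factor {X : Over (Spec (CommRingCat.of K))} {A : CommAlgCat.{u} K}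
    (y : specOver A ⟶ X) (p : PrimeSpectrum A) (U : X.left.Opens) (hU : y.left p ∈ U) :
    ∃ W : X.left.affineOpens, W.1 ≤ U ∧ y.left p ∈ W.1 ∧
      ∃ r ∉ p.asIdeal, ∃ f : coordAlg W ⟶ loc A r, res (toLoc A r) y = res f (chart W) := by
  obtain ⟨W, hx, hW⟩ := exists_affineOpen (y.left p) U hU
  exact ⟨W, hW, hx, exists_local_factor (chart W) y p (by rw [range_chart]; exact hx)⟩

end LocalFactor

section SamePoints

/-- A morphism which is injective on points with values in algebras. -/
def InjOnPoints {X Y : Over (Spec (CommRingCat.of K))} (h : X ⟶ Y) : Prop :=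
  ∀ (A : CommAlgCat.{u} K) (x x' : specOver A ⟶ X), x ≫ h = x' ≫ h → x = x'

theorem injOnPoints_of_mono {X Y : Over (Spec (CommRingCat.of K))} (h : X ⟶ Y) [Mono h.left] :
    InjOnPoints h := by
  intro A x x' hx
  ext1
  rw [← cancel_mono h.left]
  exact congrArg Over.Hom.left hx

/-- Two morphisms which are injective on points and have the same points in their image differ
by an isomorphism. -/
theorem exists_iso_of_same_points {X Y Z : Over (Spec (CommRingCat.of K))} (h : X ⟶ Y) (i : Z ⟶ Y)
    (hh : InjOnPoints h) (hi : InjOnPoints i)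
    (hs : ∀ (A : CommAlgCat.{u} K) (y : specOver A ⟶ Y),
      (∃ x, x ≫ h = y) ↔ ∃ z, z ≫ i = y) :
    ∃ e : X ≅ Z, e.hom ≫ i = h := by
  have key : ∀ {X Z : Over (Spec (CommRingCat.of K))} (h : X ⟶ Y) (i : Z ⟶ Y),
      InjOnPoints i → (∀ (A : CommAlgCat.{u} K) (y : specOver A ⟶ Y),
      (∃ x, x ≫ h = y) → ∃ z, z ≫ i = y) → ∃ a : X ⟶ Z, a ≫ i = h := by
    intro X Z h i hi hs
    choose η hη using fun (A : CommAlgCat.{u} K) (x : specOver A ⟶ X) => hs A (x ≫ h) ⟨x, rfl⟩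
    obtain ⟨a, ha⟩ := exists_hom_of_natural η (by
      intro A B f x
      apply hi
      rw [hη, res, res, Category.assoc, Category.assoc, hη])
    refine ⟨a, hom_ext_points fun A x => ?_⟩
    rw [← Category.assoc, ha, hη]
  obtain ⟨a, ha⟩ := key h i hi fun A y => (hs A y).1
  obtain ⟨b, hb⟩ := key i h hh fun A y => (hs A y).2
  refine ⟨⟨a, b, hom_ext_points fun A x => hh _ _ _ ?_, hom_ext_points fun A x => hi _ _ _ ?_⟩, ha⟩
  · rw [Category.assoc, Category.assoc, hb, ha, Category.comp_id]
  · rw [Category.assoc, Category.assoc, ha, hb, Category.comp_id]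

end SamePoints

section Conditions

variable (F : CommAlgCat.{u} K ⥤ Type u) (Φ : ∀ A : CommAlgCat.{u} K, F.obj A → Prop)

/-- A condition on the points of a functor which defines a closed subfunctor. -/
def IsClosedCond : Prop :=
  ∀ (A : CommAlgCat.{u} K) (x : F.obj A), ∃ J : Ideal A, ∀ (B : CommAlgCat.{u} K) (f : A ⟶ B),
    Φ B (F.map f x) ↔ ∀ a ∈ J, f.hom a = 0

/-- A condition on the points of a functor which defines an open subfunctor. -/
def IsOpenCond : Prop :=
  ∀ (A : CommAlgCat.{u} K) (x : F.obj A), ∃ J : Ideal A, ∀ (B : CommAlgCat.{u} K) (f : A ⟶ B),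
    Φ B (F.map f x) ↔ J.map f.hom.toRingHom = ⊤

variable {F Φ}

theorem IsClosedCond.map (h : IsClosedCond F Φ) {A B : CommAlgCat.{u} K} (f : A ⟶ B)
    {x : F.obj A} (hx : Φ A x) : Φ B (F.map f x) := by
  obtain ⟨J, hJ⟩ := h A x
  rw [hJ]
  intro a ha
  have h1 := (hJ A (𝟙 A)).1 (by rwa [map_one]) a ha
  have h1 : a = 0 := h1
  rw [h1, map_zero]

theorem IsOpenCond.map (h : IsOpenCond F Φ) {A B : CommAlgCat.{u} K} (f : A ⟶ B)
    {x : F.obj A} (hx : Φ A x) : Φ B (F.map f x) := by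
  obtain ⟨J, hJ⟩ := h A x
  rw [hJ]
  have h1 := (hJ A (𝟙 A)).1 (by rwa [map_one])
  have h1 : J.map (RingHom.id A) = ⊤ := h1
  rw [Ideal.map_id] at h1
  rw [h1, Ideal.map_top]

theorem IsClosedCond.of_local (h : IsClosedCond F Φ) {A : CommAlgCat.{u} K} {x : F.obj A}
    (hx : ∀ p : PrimeSpectrum A, ∃ r ∉ p.asIdeal, Φ _ (F.map (toLoc A r) x)) : Φ A x := by
  obtain ⟨J, hJ⟩ := h A x
  rw [← map_one x, hJ]
  intro a ha
  apply eq_zero_of_local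
  intro p
  obtain ⟨r, hr, h1⟩ := hx p
  exact ⟨r, hr, (hJ _ _).1 h1 a ha⟩

theorem ideal_eq_of_kills {A : CommAlgCat.{u} K} {J J' : Ideal A}
    (h : ∀ (B : CommAlgCat.{u} K) (f : A ⟶ B), (∀ a ∈ J, f.hom a = 0) ↔ ∀ a ∈ J', f.hom a = 0) :
    J = J' := by
  apply le_antisymm
  · intro a ha
    rw [← toQuot_eq_zero]
    exact (h _ (toQuot A J')).2 (fun b hb => toQuot_eq_zero.2 hb) a ha
  · intro a ha
    rw [← toQuot_eq_zero]
    exact (h _ (toQuot A J)).1 (fun b hb => toQuot_eq_zero.2 hb) a ha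

theorem IsClosedCond.of_iso {G : CommAlgCat.{u} K ⥤ Type u} (e : G ⟶ F) (h : IsClosedCond F Φ) :
    IsClosedCond G (fun A x => Φ A (e.app A x)) := by
  intro A x
  obtain ⟨J, hJ⟩ := h A (e.app A x)
  refine ⟨J, fun B f => ?_⟩
  rw [← hJ, ← NatTrans.naturality_apply]

/-- The complement of a closed condition, as an open condition: the equations generate the unit
ideal. -/
def ComplCond (F : CommAlgCat.{u} K ⥤ Type u) (Φ : ∀ A : CommAlgCat.{u} K, F.obj A → Prop)
    (A : CommAlgCat.{u} K) (x : F.obj A) : Prop :=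
  ∀ (B : CommAlgCat.{u} K) (f : A ⟶ B), Φ B (F.map f x) → Subsingleton B

end Conditions

section Subschemes

/-- The ideal of functions on an affine open subset given by an ideal sheaf. -/
def coordIdeal {X : Over (Spec (CommRingCat.of K))} (I : X.left.IdealSheafData)
    (W : X.left.affineOpens) : Ideal (coordAlg W) :=
  I.ideal W

theorem res_left_apply {X : Over (Spec (CommRingCat.of K))} {A B : CommAlgCat.{u} K} (f : A ⟶ B)
    (y : specOver A ⟶ X) (q : PrimeSpectrum B) :
    (res f y).left q = y.left (PrimeSpectrum.comap f.hom.toRingHom q) := rfl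

variable {X : Over (Spec (CommRingCat.of K))}
  {Φ : ∀ A : CommAlgCat.{u} K, (specOver A ⟶ X) → Prop}

theorem exists_idealSheaf (h : IsClosedCond (pointFunctor X) Φ) :
    ∃ I : X.left.IdealSheafData, ∀ (W : X.left.affineOpens) (B : CommAlgCat.{u} K)
      (f : coordAlg W ⟶ B), Φ B (res f (chart W)) ↔ ∀ a ∈ coordIdeal I W, f.hom a = 0 := by
  choose J hJ using fun W : X.left.affineOpens => h _ (chart W)
  refine ⟨⟨J, fun W s => ?_, _, rfl⟩, hJ⟩
  have hle : X.left.affineBasicOpen s ≤ W := X.left.basicOpen_le s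
  change Ideal.map (coordRes hle).hom.toRingHom (J W) = _
  apply ideal_eq_of_kills
  intro B f
  have e : res (coordRes hle ≫ f) (chart W) = res f (chart (X.left.affineBasicOpen s)) := by
    rw [← res_res]
    exact congrArg (res f) (chart_res hle)
  refine Iff.trans ?_ (hJ _ B f)
  refine Iff.trans ?_ (show Φ B (res (coordRes hle ≫ f) (chart W)) ↔ _ by rw [e]; rfl)
  refine Iff.trans ?_ (hJ W B (coordRes hle ≫ f)).symm
  constructor
  · intro h1 a ha
    exact h1 _ (Ideal.mem_map_of_mem (coordRes hle).hom.toRingHom ha)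
  · intro h1 a ha
    have hk : Ideal.map (coordRes hle).hom.toRingHom (J W) ≤ RingHom.ker f.hom.toRingHom := by
      rw [Ideal.map_le_iff_le_comap]
      exact h1
    exact hk ha

/-- The closed subscheme of a `K`-scheme defined by an ideal sheaf. -/
def subOver (I : X.left.IdealSheafData) : Over (Spec (CommRingCat.of K)) :=
  Over.mk (I.subschemeι ≫ X.hom)

/-- The inclusion of the closed subscheme. -/
def subIncl (I : X.left.IdealSheafData) : subOver I ⟶ X := Over.homMk I.subschemeι

instance (I : X.left.IdealSheafData) : IsClosedImmersion (subIncl I).left :=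
  inferInstanceAs (IsClosedImmersion I.subschemeι)

/-- The affine charts of a closed subscheme. -/
theorem exists_subChart (I : X.left.IdealSheafData) (W : X.left.affineOpens) :
    ∃ c : specOver (quot (coordAlg W) (coordIdeal I W)) ⟶ subOver I, IsOpenImmersion c.left ∧
      c ≫ subIncl I = res (toQuot _ _) (chart W) ∧
      Set.range c.left = I.subschemeι ⁻¹' (W.1 : Set X.left) := by
  have h1 : I.subschemeCover.f W ≫ I.subschemeι =
      ((algSpec (CommRingCat.of K)).map (toQuot (coordAlg W) (coordIdeal I W)).op).left ≫
        (chart W).left :=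
    (I.subschemeCover_map_subschemeι W).trans (I.glueDataObjι_ι W)
  refine ⟨Over.homMk (I.subschemeCover.f W) ?_, ?_, ?_, ?_⟩
  · refine (Category.assoc _ _ _).symm.trans ((congrArg (· ≫ X.hom) h1).trans ?_)
    refine (Category.assoc _ _ _).trans ((congrArg (_ ≫ ·) (Over.w (chart W))).trans ?_)
    exact Over.w ((algSpec (CommRingCat.of K)).map (toQuot (coordAlg W) (coordIdeal I W)).op)
  · exact I.subschemeCover.map_prop W
  · apply Over.OverMorphism.ext
    exact h1
  · have := I.opensRange_subschemeCover_map W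
    exact congrArg SetLike.coe this

theorem mem_range_subIncl_iff (h : IsClosedCond (pointFunctor X) Φ) {I : X.left.IdealSheafData}
    (hI : ∀ (W : X.left.affineOpens) (B : CommAlgCat.{u} K)
      (f : coordAlg W ⟶ B), Φ B (res f (chart W)) ↔ ∀ a ∈ coordIdeal I W, f.hom a = 0)
    {A : CommAlgCat.{u} K} (y : specOver A ⟶ X) :
    Φ A y ↔ ∃ z, z ≫ subIncl I = y := by
  constructor
  · intro hy
    obtain ⟨z, hz⟩ := (pointFunctor_isZariskiSheaf (subOver I)).exists_of_local (A := A)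
      (fun B f (z : specOver B ⟶ subOver I) => z ≫ subIncl I = res f y)
      (by
        intro B C f g z hz
        change res g z ≫ subIncl I = _
        rw [res, Category.assoc, hz, ← res_res])
      (by
        intro B f z z' hz hz'
        exact injOnPoints_of_mono (subIncl I) _ _ _ (hz.trans hz'.symm))
      (by
        intro p
        obtain ⟨W, -, -, r, hr, f, hf⟩ := exists_chart_factor y p ⊤ trivial
        refine ⟨r, hr, ?_⟩
        have h1 : Φ _ (res (toLoc A r) y) := h.map (toLoc A r) hy
        rw [hf, hI] at h1
        obtain ⟨g, hg⟩ := exists_of_kills f h1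
        obtain ⟨c, -, hc, -⟩ := exists_subChart I W
        refine ⟨res g c, ?_⟩
        rw [hf, res, Category.assoc, hc, ← hg, ← res_res])
    refine ⟨z, ?_⟩
    apply (pointFunctor_isZariskiSheaf X).separated
    intro p
    obtain ⟨r, hr, h1⟩ := hz p
    refine ⟨r, hr, ?_⟩
    change res _ z ≫ _ = _ at h1
    exact (Category.assoc _ _ _).symm.trans h1
  · rintro ⟨z, rfl⟩
    apply h.of_local
    intro p
    obtain ⟨W, hx, -⟩ := exists_affineOpen (I.subschemeι (z.left p)) ⊤ trivial
    obtain ⟨c, hc1, hc2, hc3⟩ := exists_subChart I W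
    obtain ⟨r, hr, f, hf⟩ := exists_local_factor c z p (by rw [hc3]; exact hx)
    refine ⟨r, hr, ?_⟩
    change Φ _ ((algSpec _).map _ ≫ z ≫ subIncl I)
    rw [← Category.assoc]
    change Φ _ (res _ z ≫ subIncl I)
    rw [hf, res, Category.assoc, hc2]
    change Φ _ (res f (res _ _))
    rw [res_res, hI]
    intro a ha
    change f.hom ((toQuot _ _).hom a) = 0
    rw [toQuot_eq_zero.2 ha, map_zero]

/-- A morphism which is injective on points and whose image is a closed condition is a closed
immersion, and its kernel is given by the ideals of the closed condition. -/
theorem isClosedImmersion_of_points {Z : Over (Spec (CommRingCat.of K))} (i : Z ⟶ X)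
    (hi : InjOnPoints i) (h : IsClosedCond (pointFunctor X) Φ)
    (hΦ : ∀ (A : CommAlgCat.{u} K) (y : specOver A ⟶ X), Φ A y ↔ ∃ z, z ≫ i = y) :
    IsClosedImmersion i.left ∧ ∀ (W : X.left.affineOpens) (B : CommAlgCat.{u} K)
      (f : coordAlg W ⟶ B), Φ B (res f (chart W)) ↔ ∀ a ∈ coordIdeal i.left.ker W, f.hom a = 0 := by
  obtain ⟨I, hI⟩ := exists_idealSheaf h
  obtain ⟨e, he⟩ := exists_iso_of_same_points i (subIncl I) hi (injOnPoints_of_mono _)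
    (fun A y => by rw [← hΦ, mem_range_subIncl_iff h hI])
  have he' : e.hom.left ≫ (subIncl I).left = i.left := congrArg Over.Hom.left he
  have : IsIso e.hom.left := inferInstanceAs (IsIso ((Over.forget _).map e.hom))
  have hk : i.left.ker = I := by
    rw [← he']
    exact (Scheme.Hom.ker_comp_of_isIso _ _).trans I.ker_subschemeι
  refine ⟨?_, ?_⟩
  · rw [← he']
    infer_instance
  · rw [hk]
    exact hI

/-- The open subset defined by an open condition. -/
theorem exists_opens (h : IsOpenCond (pointFunctor X) Φ) :
    ∃ U : X.left.Opens, ∀ (A : CommAlgCat.{u} K) (y : specOver A ⟶ X),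
      Φ A y ↔ Set.range y.left ⊆ (U : Set X.left) := by
  choose J hJ using fun W : X.left.affineOpens => h _ (chart W)
  let V (W : X.left.affineOpens) : Set (PrimeSpectrum (coordAlg W)) :=
    (PrimeSpectrum.zeroLocus (J W : Set (coordAlg W)))ᶜ
  have hV (W : X.left.affineOpens) : IsOpen ((chart W).left '' V W) :=
    (chart W).left.isOpenEmbedding.isOpenMap _ (PrimeSpectrum.isClosed_zeroLocus _).isOpen_compl
  refine ⟨⟨⋃ W, (chart W).left '' V W, isOpen_iUnion hV⟩, fun A y => ⟨?_, ?_⟩⟩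
  · rintro hy _ ⟨p, rfl⟩
    obtain ⟨W, -, -, r, hr, f, hf⟩ := exists_chart_factor y p ⊤ trivial
    obtain ⟨q, hq⟩ := exists_prime_toLoc p hr
    have h1 : Φ _ (res (toLoc A r) y) := h.map (toLoc A r) hy
    rw [hf] at h1
    have h1 := (hJ W _ f).1 h1
    refine Set.mem_iUnion.mpr ⟨W, PrimeSpectrum.comap f.hom.toRingHom q, ?_, ?_⟩
    · intro hmem
      apply q.2.ne_top
      rw [← top_le_iff, ← h1, Ideal.map_le_iff_le_comap]
      exact hmem
    · have h2 := congrArg (fun z : specOver (loc A r) ⟶ X => z.left q) hf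
      refine (res_left_apply f (chart W) q).symm.trans (h2.symm.trans ?_)
      exact (res_left_apply (toLoc A r) y q).trans (congrArg y.left hq)
  · intro hy
    obtain ⟨I, hI⟩ := h A y
    have htop : I = ⊤ := by
      by_contra hne
      obtain ⟨m, hm, hle⟩ := Ideal.exists_le_maximal _ hne
      let p : PrimeSpectrum A := ⟨m, hm.isPrime⟩
      obtain ⟨W, q, hq, hqy⟩ := Set.mem_iUnion.mp (hy ⟨p, rfl⟩)
      obtain ⟨r, hr, f, hf⟩ := exists_local_factor (chart W) y p ⟨q, hqy⟩
      obtain ⟨p', hp'⟩ := exists_prime_toLoc p hr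
      have hpq : PrimeSpectrum.comap f.hom.toRingHom p' = q := by
        apply (chart W).left.isOpenEmbedding.injective
        have h2 := congrArg (fun z : specOver (loc A r) ⟶ X => z.left p') hf
        refine (res_left_apply f (chart W) p').symm.trans (h2.symm.trans ?_)
        exact ((res_left_apply (toLoc A r) y p').trans (congrArg y.left hp')).trans hqy.symm
      obtain ⟨s, hs, hsq⟩ := Set.not_subset.mp hq
      have hsp : f.hom s ∉ p'.asIdeal := by
        intro hmem
        apply hsq
        rw [← hpq]
        exact hmem
      obtain ⟨p'', hp''⟩ := exists_prime_toLoc p' hsp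
      have h1 : Φ _ (res (f ≫ toLoc (loc A r) (f.hom s)) (chart W)) := by
        refine (hJ W _ _).2 ?_
        apply Ideal.eq_top_of_isUnit_mem _ (Ideal.mem_map_of_mem _ hs)
        exact isUnit_toLoc (loc A r) (f.hom s)
      rw [← res_res, ← hf, res_res] at h1
      have h2 := (hI _ _).1 h1
      apply p''.2.ne_top
      rw [← top_le_iff, ← h2, Ideal.map_le_iff_le_comap]
      have h3 : m = Ideal.comap (toLoc A r ≫ toLoc (loc A r) (f.hom s)).hom.toRingHom p''.asIdeal := by
        have := congrArg PrimeSpectrum.asIdeal hp'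
        rw [← hp''] at this
        exact this.symm
      rw [← h3]
      exact hle
    have := (hI A (𝟙 A)).2 (by rw [htop, Ideal.map_top])
    change Φ A (res (𝟙 A) y) at this
    rwa [res_id] at this

/-- An open subscheme of a `K`-scheme. -/
def openOver (U : X.left.Opens) : Over (Spec (CommRingCat.of K)) := Over.mk (U.ι ≫ X.hom)

/-- The inclusion of the open subscheme. -/
def openIncl (U : X.left.Opens) : openOver U ⟶ X := Over.homMk U.ι

instance (U : X.left.Opens) : IsOpenImmersion (openIncl U).left :=
  inferInstanceAs (IsOpenImmersion U.ι)

theorem mem_range_openIncl_iff (U : X.left.Opens) {A : CommAlgCat.{u} K} (y : specOver A ⟶ X) :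
    (∃ z, z ≫ openIncl U = y) ↔ Set.range y.left ⊆ (U : Set X.left) := by
  constructor
  · rintro ⟨z, rfl⟩ _ ⟨p, rfl⟩
    exact (z.left p).2
  · intro h
    have h' : Set.range y.left ⊆ Set.range U.ι := by rwa [Scheme.Opens.range_ι]
    have hl := IsOpenImmersion.lift_fac (openIncl U).left y.left h'
    refine ⟨Over.homMk (IsOpenImmersion.lift (openIncl U).left y.left h') ?_, ?_⟩
    · rw [← Over.w (openIncl U), ← Category.assoc, hl, Over.w y]
    · apply Over.OverMorphism.ext
      exact hl

/-- A morphism which is injective on points and whose image is an open condition is an open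
immersion. -/
theorem isOpenImmersion_of_points {Z : Over (Spec (CommRingCat.of K))} (i : Z ⟶ X)
    (hi : InjOnPoints i) {U : X.left.Opens}
    (hU : ∀ (A : CommAlgCat.{u} K) (y : specOver A ⟶ X),
      (∃ z, z ≫ i = y) ↔ Set.range y.left ⊆ (U : Set X.left)) :
    IsOpenImmersion i.left ∧ Set.range i.left = (U : Set X.left) := by
  obtain ⟨e, he⟩ := exists_iso_of_same_points i (openIncl U) hi (injOnPoints_of_mono _)
    (fun A y => by rw [hU, mem_range_openIncl_iff])
  have he' : e.hom.left ≫ (openIncl U).left = i.left := congrArg Over.Hom.left he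
  have : IsIso e.hom.left := inferInstanceAs (IsIso ((Over.forget _).map e.hom))
  refine ⟨?_, ?_⟩
  · rw [← he']
    infer_instance
  · rw [← he', Scheme.Hom.comp_base, TopCat.coe_comp, Set.range_comp,
      Set.range_eq_univ.mpr e.hom.left.surjective, Set.image_univ]
    exact Scheme.Opens.range_ι U

end Subschemes

end

end OrthogonalGrassmannian

namespace OrthogonalGrassmannian

noncomputable section

variable {K : Type u} [Field K] {N : ℕ}

section ProjectivePoints

attribute [local instance] MvPolynomial.gradedAlgebra

open MvPolynomial HomogeneousLocalization

theorem aeval_mul_of_isHomogeneous {A : Type u} [CommRing A] [Algebra K A]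
    {p : MvPolynomial (Fin (N + 1)) K} {n : ℕ} (hp : p.IsHomogeneous n) (t : A)
    (y : Fin (N + 1) → A) : aeval (fun j => t * y j) p = t ^ n * aeval y p := by
  rw [aeval_def, aeval_def, eval₂_eq', eval₂_eq', Finset.mul_sum]
  refine Finset.sum_congr rfl fun d hd => ?_
  have hn : ∑ i, d i = n := by
    have := hp (mem_support_iff.mp hd)
    simpa [Finsupp.weight_apply, Finsupp.sum_fintype] using this
  simp_rw [mul_pow]
  rw [Finset.prod_mul_distrib, Finset.prod_pow_eq_pow_sum, hn]
  ring

theorem X_mem_homogeneous (i : Fin (N + 1)) :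
    (X i : MvPolynomial (Fin (N + 1)) K) ∈ homogeneousSubmodule (Fin (N + 1)) K 1 :=
  (mem_homogeneousSubmodule _ _).2 (isHomogeneous_X K i)

/-- The degree zero part of the localization of the polynomial ring at a polynomial. -/
abbrev AwayRing (f : MvPolynomial (Fin (N + 1)) K) : Type u :=
  Away (homogeneousSubmodule (Fin (N + 1)) K) f

/-- The structure map of the ring of functions on a basic open subset of projective space. -/
def awayStructure (f : MvPolynomial (Fin (N + 1)) K) : K →+* AwayRing f :=
  (fromZeroRingHom (homogeneousSubmodule (Fin (N + 1)) K) (Submonoid.powers f)).comp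
    (algebraMap K (homogeneousSubmodule (Fin (N + 1)) K 0))

/-- The ring of functions on a standard chart of projective space. -/
def awayAlg (i : Fin (N + 1)) : CommAlgCat.{u} K :=
  letI := (awayStructure (X i : MvPolynomial (Fin (N + 1)) K)).toAlgebra
  CommAlgCat.of K (AwayRing (X i : MvPolynomial (Fin (N + 1)) K))

/-- The coordinate function `x_j / x_i`. -/
def frac (i j : Fin (N + 1)) : awayAlg (K := K) i :=
  Away.mk (homogeneousSubmodule (Fin (N + 1)) K) (X_mem_homogeneous i) 1 (X j)
    (by rw [one_smul]; exact X_mem_homogeneous j)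

/-- The standard charts of projective space. -/
def projChart (i : Fin (N + 1)) : specOver (awayAlg (K := K) i) ⟶ projectiveSpace K N :=
  Over.homMk (Proj.awayι (homogeneousSubmodule (Fin (N + 1)) K) (X i) (X_mem_homogeneous i)
    one_pos) (by
      change Proj.awayι _ _ _ _ ≫ Proj.toSpecZero _ ≫ _ = _
      rw [← Category.assoc, Proj.awayι_toSpecZero, ← Spec.map_comp]
      rfl)

instance (i : Fin (N + 1)) : IsOpenImmersion (projChart (K := K) i).left :=
  inferInstanceAs (IsOpenImmersion (Proj.awayι (homogeneousSubmodule (Fin (N + 1)) K) (X i)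
    (X_mem_homogeneous i) one_pos))

/-- Evaluation of degree zero fractions. -/
def evalAway {A : Type u} [CommRing A] [Algebra K A] (c : Fin (N + 1) → A)
    (f : MvPolynomial (Fin (N + 1)) K) (h : IsUnit (aeval c f)) : AwayRing f →+* A :=
  (Localization.awayLift (aeval c).toRingHom f h).comp (algebraMap _ (Localization.Away f))

theorem evalAway_awayMap {A : Type u} [CommRing A] [Algebra K A] (c : Fin (N + 1) → A)
    {f g x : MvPolynomial (Fin (N + 1)) K} {e : ℕ}
    (hg : g ∈ homogeneousSubmodule (Fin (N + 1)) K e) (hx : x = f * g)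
    (h : IsUnit (aeval c f)) (h' : IsUnit (aeval c x)) :
    (evalAway c x h').comp (awayMap (homogeneousSubmodule (Fin (N + 1)) K) hg hx) =
      evalAway c f h := by
  have hf : IsUnit (algebraMap (MvPolynomial (Fin (N + 1)) K) (Localization.Away x) f) := by
    refine isUnit_of_mul_isUnit_left (y := algebraMap _ (Localization.Away x) g) ?_
    have h1 := IsLocalization.Away.algebraMap_isUnit (S := Localization.Away x) x
    have h2 : algebraMap (MvPolynomial (Fin (N + 1)) K) (Localization.Away x) x =
        algebraMap _ (Localization.Away x) f * algebraMap _ (Localization.Away x) g :=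
      (congrArg _ hx).trans (map_mul _ _ _)
    exact h2 ▸ h1
  have key : (Localization.awayLift (aeval c).toRingHom x h').comp
      (Localization.awayLift (algebraMap (MvPolynomial (Fin (N + 1)) K) (Localization.Away x)) f
        hf) =
      Localization.awayLift (aeval c).toRingHom f h := by
    apply IsLocalization.ringHom_ext (Submonoid.powers f)
    ext a
    · simp [Localization.awayLift, IsLocalization.Away.lift_eq]
    · simp [Localization.awayLift, IsLocalization.Away.lift_eq]
  ext a
  simp only [evalAway, RingHom.comp_apply, HomogeneousLocalization.algebraMap_apply]
  rw [val_awayMap, ← key]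
  rfl

/-- The map of algebras corresponding to a point with homogeneous coordinates `c`. -/
def evalChart {A : CommAlgCat.{u} K} (c : Fin (N + 1) → A) (i : Fin (N + 1))
    (h : IsUnit (c i)) : awayAlg (K := K) i ⟶ A :=
  letI := (awayStructure (X i : MvPolynomial (Fin (N + 1)) K)).toAlgebra
  CommAlgCat.ofHom (X := AwayRing (X i : MvPolynomial (Fin (N + 1)) K)) (Y := A)
    { evalAway c (X i) (by rwa [aeval_X]) with
      commutes' := fun r => by
        change Localization.awayLift (aeval c).toRingHom (X i)
          (show IsUnit (aeval c (X i)) by rwa [aeval_X]) (Localization.mk _ _) = _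
        have : (Localization.mk (algebraMap K (MvPolynomial (Fin (N + 1)) K) r)
          (1 : Submonoid.powers (X i : MvPolynomial (Fin (N + 1)) K))) =
          algebraMap _ (Localization.Away (X i : MvPolynomial (Fin (N + 1)) K))
            (algebraMap K (MvPolynomial (Fin (N + 1)) K) r) := Localization.mk_one_eq_algebraMap _
        refine (congrArg _ this).trans ?_
        refine (IsLocalization.Away.lift_eq _ _ _).trans ?_
        exact (aeval c).commutes r }

theorem evalChart_frac {A : CommAlgCat.{u} K} (c : Fin (N + 1) → A) (i : Fin (N + 1))
    (h : IsUnit (c i)) (j : Fin (N + 1)) : (evalChart c i h).hom (frac i j) * c i = c j := by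
  obtain ⟨u, hu⟩ := h
  have hv : (aeval c).toRingHom (X i : MvPolynomial (Fin (N + 1)) K) * (↑u⁻¹ : A) = 1 := by
    change aeval c (X i) * _ = 1
    rw [aeval_X, ← hu, Units.mul_inv]
  have := Localization.awayLift_mk (aeval c).toRingHom (X i : MvPolynomial (Fin (N + 1)) K) (X j)
    (↑u⁻¹ : A) hv 1
  have h2 : (evalChart c i ⟨u, hu⟩).hom (frac i j) = aeval c (X j) * (↑u⁻¹ : A) ^ 1 := this
  rw [h2, aeval_X, pow_one, ← hu, mul_assoc, Units.inv_mul, mul_one]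

theorem awayAlg_hom_ext {A : CommAlgCat.{u} K} {i : Fin (N + 1)} {θ θ' : awayAlg (K := K) i ⟶ A}
    (h : ∀ j, θ.hom (frac i j) = θ'.hom (frac i j)) : θ = θ' := by
  let S := awayAlg (K := K) i
  have key : ∀ a : S, ∃ p : MvPolynomial (Fin (N + 1)) K, a = aeval (frac i) p := by
    intro a
    obtain ⟨n, p, hp, rfl⟩ := Away.mk_surjective (homogeneousSubmodule (Fin (N + 1)) K)
      (X_mem_homogeneous i) a
    refine ⟨p, ?_⟩
    let L := Localization.Away (X i : MvPolynomial (Fin (N + 1)) K)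
    let v : S →ₐ[K] L :=
      { algebraMap (AwayRing (X i : MvPolynomial (Fin (N + 1)) K)) L with
        commutes' := fun r => Localization.mk_one_eq_algebraMap _ }
    have hv : Function.Injective v := val_injective _
    apply hv
    have h1 : v (aeval (frac i) p) = (aeval (fun j => v (frac i j)) p : L) := by
      rw [← comp_aeval]
      rfl
    rw [h1]
    have hp' : p.IsHomogeneous n := by
      have := (mem_homogeneousSubmodule _ _).1 hp
      rwa [smul_eq_mul, mul_one] at this
    have h2 (j) : algebraMap (MvPolynomial (Fin (N + 1)) K) L (X i) * v (frac i j) = algebraMap (MvPolynomial (Fin (N + 1)) K) L (X j) := by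
      change algebraMap (MvPolynomial (Fin (N + 1)) K) L (X i) * Localization.mk (X j) _ = _
      rw [Localization.mk_eq_mk', IsLocalization.mul_mk'_eq_mk'_of_mul]
      rw [mul_comm]
      rw [IsLocalization.mk'_eq_iff_eq_mul, ← map_mul]
      congr 1
      simp
    have h3 := aeval_mul_of_isHomogeneous hp' (algebraMap (MvPolynomial (Fin (N + 1)) K) L (X i)) (fun j => v (frac i j))
    simp_rw [h2] at h3
    have h4 : (aeval (fun j => algebraMap (MvPolynomial (Fin (N + 1)) K) L (X j)) p : L) =
        algebraMap (MvPolynomial (Fin (N + 1)) K) L p := by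
      have : (aeval (fun j => algebraMap (MvPolynomial (Fin (N + 1)) K) L (X j)) :
          MvPolynomial (Fin (N + 1)) K →ₐ[K] L) =
            (Algebra.ofId (MvPolynomial (Fin (N + 1)) K) L).restrictScalars K := by
        ext j
        simp [Algebra.ofId_apply]
      rw [this]
      rfl
    rw [h4] at h3
    change Localization.mk p _ = _
    rw [Localization.mk_eq_mk', IsLocalization.mk'_eq_iff_eq_mul, h3, map_pow, mul_comm]
  ext a
  obtain ⟨p, rfl⟩ := key a
  have e1 (θ : awayAlg (K := K) i ⟶ A) :
      θ.hom (aeval (frac i) p) = aeval (fun j => θ.hom (frac i j)) p := by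
    rw [← comp_aeval]
    rfl
  rw [e1, e1]
  simp_rw [h]

/-- The point `y` of projective space has homogeneous coordinates `c`, one of which is
invertible. -/
def IsCoord {A : CommAlgCat.{u} K} (y : specOver A ⟶ projectiveSpace K N)
    (c : Fin (N + 1) → A) : Prop :=
  ∃ (i : Fin (N + 1)) (h : IsUnit (c i)), y = res (evalChart c i h) (projChart i)

theorem IsCoord.isUnit {A : CommAlgCat.{u} K} {y : specOver A ⟶ projectiveSpace K N}
    {c : Fin (N + 1) → A} (h : IsCoord y c) : ∃ i, IsUnit (c i) :=
  ⟨h.choose, h.choose_spec.choose⟩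

theorem res_evalChart_eq {A : CommAlgCat.{u} K} (c : Fin (N + 1) → A) (i j : Fin (N + 1))
    (hi : IsUnit (c i)) (hj : IsUnit (c j)) :
    res (evalChart c i hi) (projChart i) = res (evalChart c j hj) (projChart j) := by
  let 𝒜 := homogeneousSubmodule (Fin (N + 1)) K
  let x : MvPolynomial (Fin (N + 1)) K := X i * X j
  have hx : IsUnit (aeval c x) := by
    simp only [x, map_mul, aeval_X]
    exact hi.mul hj
  have e1 := evalAway_awayMap c (X_mem_homogeneous j) (rfl : x = X i * X j) (by rwa [aeval_X]) hx
  have e2 := evalAway_awayMap c (X_mem_homogeneous i) (mul_comm _ _ : x = X j * X i)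
    (by rwa [aeval_X]) hx
  apply Over.OverMorphism.ext
  change Spec.map (CommRingCat.ofHom (evalAway c (X i) _)) ≫ Proj.awayι 𝒜 (X i) _ _ =
    Spec.map (CommRingCat.ofHom (evalAway c (X j) _)) ≫ Proj.awayι 𝒜 (X j) _ _
  rw [← e1, ← e2, CommRingCat.ofHom_comp, CommRingCat.ofHom_comp, Spec.map_comp, Spec.map_comp,
    Category.assoc, Category.assoc, Proj.SpecMap_awayMap_awayι 𝒜 (X_mem_homogeneous i) one_pos,
    Proj.SpecMap_awayMap_awayι 𝒜 (X_mem_homogeneous j) one_pos]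

theorem exists_isCoord {A : CommAlgCat.{u} K} (c : Fin (N + 1) → A) {i : Fin (N + 1)}
    (h : IsUnit (c i)) : ∃ y, IsCoord y c :=
  ⟨_, i, h, rfl⟩

theorem IsCoord.unique {A : CommAlgCat.{u} K} {y y' : specOver A ⟶ projectiveSpace K N}
    {c : Fin (N + 1) → A} (h : IsCoord y c) (h' : IsCoord y' c) : y = y' := by
  obtain ⟨i, hi, rfl⟩ := h
  obtain ⟨j, hj, rfl⟩ := h'
  exact res_evalChart_eq c i j hi hj

theorem isCoord_of_frac {A : CommAlgCat.{u} K} {c : Fin (N + 1) → A} {i : Fin (N + 1)}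
    (h : IsUnit (c i)) (θ : awayAlg i ⟶ A) (hθ : ∀ j, θ.hom (frac i j) * c i = c j) :
    IsCoord (res θ (projChart i)) c := by
  refine ⟨i, h, ?_⟩
  congr 1
  apply awayAlg_hom_ext
  intro j
  apply h.mul_left_injective
  exact (hθ j).trans (evalChart_frac c i h j).symm

theorem IsCoord.map {A B : CommAlgCat.{u} K} {y : specOver A ⟶ projectiveSpace K N}
    {c : Fin (N + 1) → A} (h : IsCoord y c) (f : A ⟶ B) :
    IsCoord (res f y) (fun j => f.hom (c j)) := by
  obtain ⟨i, hi, rfl⟩ := h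
  rw [res_res]
  refine isCoord_of_frac (hi.map f.hom) _ fun j => ?_
  change f.hom ((evalChart c i hi).hom (frac i j)) * f.hom (c i) = _
  rw [← map_mul, evalChart_frac]

theorem IsCoord.smul {A : CommAlgCat.{u} K} {y : specOver A ⟶ projectiveSpace K N}
    {c : Fin (N + 1) → A} (h : IsCoord y c) {a : A} (ha : IsUnit a) :
    IsCoord y (fun j => a * c j) := by
  obtain ⟨i, hi, rfl⟩ := h
  refine isCoord_of_frac (ha.mul hi) _ fun j => ?_
  rw [mul_left_comm, evalChart_frac]

theorem IsCoord.exists_unit {A : CommAlgCat.{u} K} {y : specOver A ⟶ projectiveSpace K N}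
    {c c' : Fin (N + 1) → A} (h : IsCoord y c) (h' : IsCoord y c') :
    ∃ a : A, IsUnit a ∧ ∀ j, c' j = a * c j := by
  obtain ⟨i, hi, rfl⟩ := h
  obtain ⟨i', hi', e⟩ := h'
  have hu : IsUnit ((evalChart c' i' hi').hom (frac i' i)) := by
    by_contra hn
    obtain ⟨m, hm, hmem⟩ := exists_max_ideal_of_mem_nonunits hn
    let p : PrimeSpectrum A := ⟨m, hm.isPrime⟩
    have h1 := congrArg (fun z : specOver A ⟶ projectiveSpace K N => z.left p) e
    have h2 : (projChart i).left (PrimeSpectrum.comap (evalChart c i hi).hom.toRingHom p) =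
        (projChart i').left (PrimeSpectrum.comap (evalChart c' i' hi').hom.toRingHom p) := h1
    have h3 : (projChart (K := K) i).left
        (PrimeSpectrum.comap (evalChart c i hi).hom.toRingHom p) ∈
        Proj.basicOpen (homogeneousSubmodule (Fin (N + 1)) K) (X i) := by
      rw [← Proj.opensRange_awayι (homogeneousSubmodule (Fin (N + 1)) K) (X i)
        (X_mem_homogeneous i) one_pos]
      exact ⟨_, rfl⟩
    rw [h2] at h3
    have h4 := Proj.awayι_preimage_basicOpen (homogeneousSubmodule (Fin (N + 1)) K)
      (X_mem_homogeneous (K := K) i') one_pos (X_mem_homogeneous (K := K) i) one_pos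
    have h5 : (PrimeSpectrum.comap (evalChart c' i' hi').hom.toRingHom p : PrimeSpectrum
        (AwayRing (X i' : MvPolynomial (Fin (N + 1)) K))) ∈
        Proj.awayι (homogeneousSubmodule (Fin (N + 1)) K) (X i') (X_mem_homogeneous i') one_pos ⁻¹ᵁ
          Proj.basicOpen (homogeneousSubmodule (Fin (N + 1)) K) (X i) := h3
    rw [h4] at h5
    apply h5
    change (evalChart c' i' hi').hom _ ∈ m
    have h6 : Away.isLocalizationElem (X_mem_homogeneous (K := K) i')
        (X_mem_homogeneous (K := K) i) = frac i' i := by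
      apply val_injective (Submonoid.powers (X i' : MvPolynomial (Fin (N + 1)) K))
      exact congrArg (fun z => Localization.mk z _) (pow_one (X i))
    exact (congrArg (evalChart c' i' hi').hom h6).symm ▸ hmem
  have hi2 : IsUnit (c' i) := by
    rw [← evalChart_frac c' i' hi' i]
    exact hu.mul hi'
  rw [res_evalChart_eq c' i' i hi' hi2] at e
  have e' : evalChart c i hi = evalChart c' i hi2 := by
    apply algSpec_map_injective
    exact injOnPoints_of_mono (projChart i) _ _ _ e
  obtain ⟨b, hb⟩ := hi.exists_left_inv
  refine ⟨c' i * b, hi2.mul (IsUnit.of_mul_eq_one _ hb), fun j => ?_⟩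
  rw [← evalChart_frac c i hi j, ← evalChart_frac c' i hi2 j, e']
  linear_combination (-(evalChart c' i hi2).hom (frac i j) * c' i) * hb

theorem exists_local_isCoord {A : CommAlgCat.{u} K} (y : specOver A ⟶ projectiveSpace K N)
    (p : PrimeSpectrum A) :
    ∃ r ∉ p.asIdeal, ∃ c, IsCoord (res (toLoc A r) y) c := by
  have hcov := Proj.iSup_basicOpen_eq_top' (homogeneousSubmodule (Fin (N + 1)) K)
    (fun i : Fin (N + 1) => (X i : MvPolynomial (Fin (N + 1)) K))
    (fun i => ⟨1, X_mem_homogeneous i⟩) (by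
      rw [eq_top_iff]
      intro q _
      have h1 : q ∈ Algebra.adjoin K (Set.range (X : Fin (N + 1) → MvPolynomial (Fin (N + 1)) K)) := by
        rw [adjoin_range_X]
        trivial
      induction h1 using Algebra.adjoin_induction with
      | mem x hx => exact Algebra.subset_adjoin hx
      | algebraMap r =>
        exact Subalgebra.algebraMap_mem _
          (algebraMap K (homogeneousSubmodule (Fin (N + 1)) K 0) r)
      | add x y _ _ hx hy => exact add_mem (hx trivial) (hy trivial)
      | mul x y _ _ hx hy => exact mul_mem (hx trivial) (hy trivial))
  have h1 : y.left p ∈ (⨆ i, Proj.basicOpen (homogeneousSubmodule (Fin (N + 1)) K)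
      (X i : MvPolynomial (Fin (N + 1)) K)) := by
    rw [hcov]
    trivial
  obtain ⟨i, hi⟩ := TopologicalSpace.Opens.mem_iSup.mp h1
  rw [← Proj.opensRange_awayι (homogeneousSubmodule (Fin (N + 1)) K) (X i)
        (X_mem_homogeneous i) one_pos] at hi
  obtain ⟨r, hr, f, hf⟩ := exists_local_factor (projChart i) y p hi
  refine ⟨r, hr, fun j => f.hom (frac i j), ?_⟩
  have h2 : frac (K := K) i i = 1 := by
    apply val_injective (Submonoid.powers (X i : MvPolynomial (Fin (N + 1)) K))
    change Localization.mk _ _ = Localization.mk 1 1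
    rw [Localization.mk_eq_mk_iff, Localization.r_iff_exists]
    exact ⟨1, by simp⟩
  rw [hf]
  refine isCoord_of_frac ?_ f fun j => ?_
  · rw [h2, _root_.map_one]
    exact isUnit_one
  · rw [h2, _root_.map_one, mul_one]

end ProjectivePoints

end

end OrthogonalGrassmannian

namespace OrthogonalGrassmannian

noncomputable section

section LinearAlgebra

variable {K : Type u} [Field K] {V : Type u} [AddCommGroup V] [Module K V]
  {A B C : Type u} [CommRing A] [Algebra K A] [CommRing B] [Algebra K B] [CommRing C] [Algebra K C]

/-- The map `A ⊗ V → B ⊗ V` induced by a map of algebras. -/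
abbrev push (f : A →ₐ[K] B) : A ⊗[K] V →ₗ[K] B ⊗[K] V := LinearMap.rTensor V f.toLinearMap

theorem push_smul (f : A →ₐ[K] B) (a : A) (x : A ⊗[K] V) : push f (a • x) = f a • push f x := by
  induction x with
  | zero => simp
  | tmul b v => simp [TensorProduct.smul_tmul']
  | add x y hx hy => simp only [smul_add, map_add, hx, hy]

theorem push_push (f : A →ₐ[K] B) (g : B →ₐ[K] C) (x : A ⊗[K] V) :
    push g (push f x) = push (g.comp f) x := by
  rw [push, push, push, AlgHom.comp_toLinearMap, LinearMap.rTensor_comp]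
  rfl

theorem push_tmul (f : A →ₐ[K] B) (a : A) (v : V) : push f (a ⊗ₜ[K] v) = f a ⊗ₜ[K] v := rfl

theorem push_sum_smul (f : A →ₐ[K] B) {ι : Type*} (s : Finset ι) (a : ι → A)
    (x : ι → A ⊗[K] V) : push f (∑ i ∈ s, a i • x i) = ∑ i ∈ s, f (a i) • push f (x i) := by
  rw [map_sum]
  exact Finset.sum_congr rfl fun i _ => push_smul f _ _

/-- The extension of a linear functional on `A ⊗ V` along a map of algebras. -/
def dualMap (f : A →ₐ[K] B) (ψ : A ⊗[K] V →ₗ[A] A) : B ⊗[K] V →ₗ[B] B :=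
  LinearMap.liftBaseChange B
    (f.toLinearMap ∘ₗ ψ.restrictScalars K ∘ₗ (TensorProduct.mk K A V 1))

theorem dualMap_push (f : A →ₐ[K] B) (ψ : A ⊗[K] V →ₗ[A] A) (x : A ⊗[K] V) :
    dualMap f ψ (push f x) = f (ψ x) := by
  induction x with
  | zero => simp
  | tmul a v =>
    have h : a ⊗ₜ[K] v = a • ((1 : A) ⊗ₜ[K] v) := by rw [TensorProduct.smul_tmul', smul_eq_mul, mul_one]
    rw [push_tmul, dualMap, LinearMap.liftBaseChange_tmul, h, map_smul, smul_eq_mul]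
    exact (map_mul f _ _).symm
  | add x y hx hy => simp only [map_add, hx, hy]

section Coordinates

variable {ι : Type*} [Fintype ι] (b : Module.Basis ι K V)

/-- The coordinates of elements of `A ⊗ V` with respect to a basis of `V`. -/
def crd (A : Type u) [CommRing A] [Algebra K A] : A ⊗[K] V ≃ₗ[A] (ι → A) :=
  (Algebra.TensorProduct.basis A b).equivFun

theorem crd_tmul (a : A) (v : V) (i : ι) : crd b A (a ⊗ₜ v) i = a * algebraMap K A (b.repr v i) := by
  rw [crd, Module.Basis.equivFun_apply, Algebra.TensorProduct.basis_repr_tmul]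
  simp

theorem crd_push (f : A →ₐ[K] B) (x : A ⊗[K] V) (i : ι) :
    crd b B (push f x) i = f (crd b A x i) := by
  induction x with
  | zero => simp
  | tmul a v => simp [crd_tmul]
  | add x y hx hy => simp only [map_add, Pi.add_apply, hx, hy]

theorem crd_symm_push (f : A →ₐ[K] B) (c : ι → A) :
    push f ((crd b A).symm c) = (crd b B).symm (fun i => f (c i)) := by
  apply (crd b B).injective
  ext i
  rw [crd_push, LinearEquiv.apply_symm_apply, LinearEquiv.apply_symm_apply]

end Coordinates

variable {m : ℕ}

/-- A Grassmannian submodule is the kernel of a projection. -/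
theorem exists_projector (N : Module.Grassmannian A (A ⊗[K] V) m) :
    ∃ π : A ⊗[K] V →ₗ[A] A ⊗[K] V, (∀ x, π x = 0 ↔ x ∈ N.toSubmodule) ∧
      ∀ x, x - π x ∈ N.toSubmodule := by
  obtain ⟨s, hs⟩ := Module.projective_lifting_property N.toSubmodule.mkQ LinearMap.id
    (Submodule.mkQ_surjective _)
  have hs' (z) : N.toSubmodule.mkQ (s z) = z := LinearMap.congr_fun hs z
  have h2 (x) : x - s (N.toSubmodule.mkQ x) ∈ N.toSubmodule := by
    rw [← Submodule.Quotient.mk_eq_zero]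
    change N.toSubmodule.mkQ (x - _) = 0
    rw [map_sub, hs', sub_self]
  refine ⟨s ∘ₗ N.toSubmodule.mkQ, fun x => ⟨fun h => ?_, fun h => ?_⟩, h2⟩
  · have := h2 x
    rw [LinearMap.comp_apply] at h
    rwa [h, sub_zero] at this
  · rw [LinearMap.comp_apply, (Submodule.Quotient.mk_eq_zero _).mpr h |> fun h => (h :
      N.toSubmodule.mkQ x = 0), map_zero]

theorem map_smul_mem_map (f : A →ₐ[K] B) (N : Module.Grassmannian A (A ⊗[K] V) m) {x : A ⊗[K] V}
    (hx : x ∈ N.toSubmodule) : push f x ∈ (Module.Grassmannian.map f N).toSubmodule := by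
  rw [map_eq_span]
  exact Submodule.subset_span ⟨x, hx, rfl⟩

theorem push_mem_of_dual (f : A →ₐ[K] B) (N : Module.Grassmannian A (A ⊗[K] V) m)
    (x : A ⊗[K] V) (h : push f x ∈ (Module.Grassmannian.map f N).toSubmodule)
    (ψ : A ⊗[K] V →ₗ[A] A) (hψ : ∀ y ∈ N.toSubmodule, ψ y = 0) : f (ψ x) = 0 := by
  rw [← dualMap_push, ← LinearMap.mem_ker]
  rw [map_eq_span] at h
  refine (Submodule.span_le.mpr ?_ : _ ≤ LinearMap.ker (dualMap f ψ)) h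
  rintro _ ⟨y, hy, rfl⟩
  change dualMap f ψ (push f y) = 0
  rw [dualMap_push, hψ y hy, map_zero]

theorem map_id_eq (N : Module.Grassmannian A (A ⊗[K] V) m) :
    Module.Grassmannian.map (AlgHom.id K A) N = N :=
  Module.Grassmannian.map_id _ (CommAlgCat.of K A) N

variable [Module.Finite K V]

/-- Finitely many equations of a submodule in the Grassmannian, compatible with base change. -/
theorem exists_equations (N : Module.Grassmannian A (A ⊗[K] V) m) :
    ∃ (n : ℕ) (φ : Fin n → A ⊗[K] V →ₗ[A] A), ∀ (B : Type u) [CommRing B] [Algebra K B]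
      (f : A →ₐ[K] B) (x : A ⊗[K] V),
      push f x ∈ (Module.Grassmannian.map f N).toSubmodule ↔ ∀ i, f (φ i x) = 0 := by
  obtain ⟨π, h1, h2⟩ := exists_projector N
  let b := Module.finBasis K V
  refine ⟨_, fun i => LinearMap.proj i ∘ₗ (crd b A).toLinearMap ∘ₗ π, fun B _ _ f x =>
    ⟨fun h i => push_mem_of_dual f N x h _ fun y hy => ?_, fun h => ?_⟩⟩
  · simp [(h1 y).mpr hy]
  · have h3 : push f (π x) = 0 := by
      apply (crd b B).injective
      ext i
      rw [crd_push, map_zero]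
      exact h i
    have := map_smul_mem_map f N (h2 x)
    rwa [map_sub, h3, sub_zero] at this

theorem exists_equations_self (N : Module.Grassmannian A (A ⊗[K] V) m) :
    ∃ (n : ℕ) (φ : Fin n → A ⊗[K] V →ₗ[A] A), (∀ x, x ∈ N.toSubmodule ↔ ∀ i, φ i x = 0) ∧
      ∀ (B : Type u) [CommRing B] [Algebra K B]
      (f : A →ₐ[K] B) (x : A ⊗[K] V),
      push f x ∈ (Module.Grassmannian.map f N).toSubmodule ↔ ∀ i, f (φ i x) = 0 := by
  obtain ⟨n, φ, h⟩ := exists_equations N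
  refine ⟨n, φ, fun x => ?_, h⟩
  have := h A (AlgHom.id K A) x
  rw [map_id_eq] at this
  simpa [push] using this

theorem eq_of_surjective {P Q : Type u} [AddCommGroup P] [Module A P] [AddCommGroup Q] [Module A Q]
    [Module.Finite A P] [Module.Projective A P] [Module.Finite A Q] [Module.Projective A Q]
    (h : Module.rankAtStalk (R := A) P = Module.rankAtStalk (R := A) Q) (g : P →ₗ[A] Q)
    (hg : Function.Surjective g) : Function.Injective g := by
  obtain ⟨s, hs⟩ := Module.projective_lifting_property g LinearMap.id hg
  have hex : Function.Exact (LinearMap.ker g).subtype g := g.exact_subtype_ker_map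
  obtain ⟨e, -, -⟩ := hex.splitSurjectiveEquiv (Submodule.injective_subtype _) ⟨s, hs⟩
  have : Module.Projective A (LinearMap.ker g × Q) := .of_equiv e
  have : Module.Finite A (LinearMap.ker g × Q) := .equiv e
  have : Module.Projective A (LinearMap.ker g) :=
    .of_split (LinearMap.inl A _ Q) (LinearMap.fst A _ Q) (by ext; rfl)
  have : Module.Finite A (LinearMap.ker g) := .of_surjective (LinearMap.fst A _ Q) fun x => ⟨(x, 0), rfl⟩
  have h2 := Module.rankAtStalk_eq_of_equiv e
  rw [Module.rankAtStalk_prod, h] at h2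
  have h3 : Module.rankAtStalk (R := A) (LinearMap.ker g) = 0 := by
    simpa using h2.symm
  have := Module.rankAtStalk_eq_zero_iff_subsingleton.mp h3
  rw [← LinearMap.ker_eq_bot]
  exact Submodule.subsingleton_iff_eq_bot.mp this

theorem eq_of_toSubmodule_le {N N' : Module.Grassmannian A (A ⊗[K] V) m}
    (h : N.toSubmodule ≤ N'.toSubmodule) : N = N' := by
  have h1 : Module.rankAtStalk (R := A) ((A ⊗[K] V) ⧸ N.toSubmodule) =
      Module.rankAtStalk (R := A) ((A ⊗[K] V) ⧸ N'.toSubmodule) := by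
    ext p
    rw [N.rankAtStalk_eq, N'.rankAtStalk_eq]
  have h2 := eq_of_surjective h1 (Submodule.factor h) (Submodule.factor_surjective h)
  refine Module.Grassmannian.ext (le_antisymm h fun x hx => ?_)
  rw [← Submodule.Quotient.mk_eq_zero]
  apply h2
  rw [map_zero]
  exact (Submodule.Quotient.mk_eq_zero _).mpr hx

/-- The submodule spanned by vectors for which there is a dual system of functionals. -/
def ofBasis {k : ℕ} (M : Fin k → A ⊗[K] V) (ψ : A ⊗[K] V →ₗ[A] (Fin k → A))
    (h : ∀ i, ψ (M i) = Pi.single i 1) :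
    Module.Grassmannian A (A ⊗[K] V) (Module.finrank K V - k) := by
  have h1 : ∀ c, ψ (Fintype.linearCombination A M c) = c := by
    intro c
    rw [Fintype.linearCombination_apply, map_sum]
    simp_rw [map_smul, h]
    ext i
    simp [Finset.sum_apply, Pi.single_apply]
  have hN : Submodule.span A (Set.range M) = LinearMap.range (Fintype.linearCombination A M) :=
    (Fintype.range_linearCombination A M).symm
  let N := Submodule.span A (Set.range M)
  have h2 : Function.Exact (Fintype.linearCombination A M) N.mkQ := by
    intro x
    rw [Submodule.mkQ_apply, Submodule.Quotient.mk_eq_zero]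
    change x ∈ Submodule.span A (Set.range M) ↔ _
    rw [hN]
    rfl
  have e := (h2.splitInjectiveEquiv (Submodule.mkQ_surjective N)
    ⟨ψ, LinearMap.ext h1⟩).1
  have : Module.Projective A ((Fin k → A) × ((A ⊗[K] V) ⧸ N)) := .of_equiv e
  have hp : Module.Projective A ((A ⊗[K] V) ⧸ N) :=
    .of_split (LinearMap.inr A (Fin k → A) _) (LinearMap.snd A _ _) (by ext; rfl)
  exact
    { toSubmodule := N
      finite_quotient := inferInstance
      projective_quotient := hp
      rankAtStalk_eq := fun p => by
        have : Nontrivial A := p.nontrivial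
        have h3 := congrFun (Module.rankAtStalk_eq_of_equiv e) p
        rw [Module.rankAtStalk_prod, Pi.add_apply, Module.rankAtStalk_eq_finrank_of_free,
          Module.rankAtStalk_eq_finrank_of_free, Module.finrank_baseChange] at h3
        simp at h3
        omega }

theorem ofBasis_toSubmodule {k : ℕ} (M : Fin k → A ⊗[K] V) (ψ : A ⊗[K] V →ₗ[A] (Fin k → A))
    (h : ∀ i, ψ (M i) = Pi.single i 1) :
    (ofBasis M ψ h).toSubmodule = Submodule.span A (Set.range M) := rfl

theorem map_toSubmodule_of_span (f : A →ₐ[K] B) {N : Module.Grassmannian A (A ⊗[K] V) m}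
    {ι : Type*} {M : ι → A ⊗[K] V} (h : N.toSubmodule = Submodule.span A (Set.range M)) :
    (Module.Grassmannian.map f N).toSubmodule = Submodule.span B (Set.range fun i => push f (M i)) := by
  rw [map_eq_span]
  apply le_antisymm
  · rw [Submodule.span_le]
    rintro _ ⟨x, hx, rfl⟩
    rw [SetLike.mem_coe, h] at hx
    induction hx using Submodule.span_induction with
    | mem x hx =>
      obtain ⟨i, rfl⟩ := hx
      exact Submodule.subset_span ⟨i, rfl⟩
    | zero => rw [map_zero]; exact zero_mem _
    | add x y _ _ hx hy => rw [map_add]; exact add_mem hx hy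
    | smul a x _ hx =>
      have := push_smul f a x
      rw [push] at this
      rw [this]
      exact Submodule.smul_mem _ _ hx
  · rw [Submodule.span_le]
    rintro _ ⟨i, rfl⟩
    refine Submodule.subset_span ⟨M i, ?_, rfl⟩
    rw [SetLike.mem_coe, h]
    exact Submodule.subset_span ⟨i, rfl⟩

/-- Over a field, the dimension of a subspace in the Grassmannian. -/
theorem finrank_of_field {L : Type u} [Field L] [Algebra K L] {k : ℕ} (hk : k ≤ Module.finrank K V)
    (N : Module.Grassmannian L (L ⊗[K] V) (Module.finrank K V - k)) :
    Module.finrank L N.toSubmodule = k := by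
  have h1 := Submodule.finrank_quotient_add_finrank N.toSubmodule
  have h2 := N.rankAtStalk_eq ⊥
  rw [Module.rankAtStalk_eq_finrank_of_free] at h2
  rw [Module.finrank_baseChange] at h1
  simp at h2
  omega

theorem exists_det_ne_zero {L ι : Type*} [Field L] [Fintype ι] {k : ℕ} {M : Matrix (Fin k) ι L}
    (hM : LinearIndependent L M.row) :
    ∃ I : Fin k → ι, Matrix.det (Matrix.of fun i j => M i (I j)) ≠ 0 := by
  have hr : M.rank = k := by
    rw [hM.rank_matrix, Fintype.card_fin]
  obtain ⟨I, hI⟩ : ∃ I : Fin k → ι, LinearIndependent L (fun j => M.col (I j)) := by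
    rw [Matrix.rank_eq_finrank_span_cols] at hr
    obtain ⟨t, ht1, ht2, ht3⟩ := exists_linearIndependent L (Set.range M.col)
    have hfin' : Fintype t := ht3.setFinite.fintype
    have hc' : Fintype.card t = k := by
      have := finrank_span_eq_card ht3
      rw [Subtype.range_coe, ht2, hr] at this
      exact this.symm
    let e' : Fin k ≃ t := (Fintype.equivFinOfCardEq hc').symm
    choose I hI using fun j => ht1 (e' j).2
    refine ⟨I, ?_⟩
    have := ht3.comp e' e'.injective
    have h : Subtype.val ∘ e' = fun j => M.col (I j) := funext fun j => (hI j).symm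
    rwa [h] at this
  refine ⟨I, fun h1 => ?_⟩
  have h2 : IsUnit (Matrix.of fun i j => M i (I j)) := by
    rw [← Matrix.linearIndependent_cols_iff_isUnit]
    exact hI
  rw [Matrix.isUnit_iff_isUnit_det, h1] at h2
  exact not_isUnit_zero h2

/-- A family of vectors whose images over the residue field are linearly independent has a minor
which does not vanish there. -/
theorem exists_minor_of_linearIndependent {ι : Type*} [Fintype ι] (b : Module.Basis ι K V) {k : ℕ}
    (p : PrimeSpectrum A) {u : Fin k → A ⊗[K] V}
    (h : LinearIndependent p.asIdeal.ResidueField fun i =>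
      push (IsScalarTower.toAlgHom K A p.asIdeal.ResidueField) (u i)) :
    ∃ I : Fin k → ι, Matrix.det (Matrix.of fun i j => crd b A (u i) (I j)) ∉ p.asIdeal := by
  let L := p.asIdeal.ResidueField
  let f : A →ₐ[K] L := IsScalarTower.toAlgHom K A L
  have hf (a : A) : f a = 0 ↔ a ∈ p.asIdeal := Ideal.algebraMap_residueField_eq_zero
  obtain ⟨I, hI⟩ := exists_det_ne_zero (M := Matrix.of fun i j => crd b L (push f (u i)) j)
    (h.map' (crd b L).toLinearMap (LinearEquiv.ker _))
  refine ⟨I, fun hmem => hI ?_⟩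
  rw [← hf, AlgHom.map_det] at hmem
  rw [← hmem]
  congr 1
  ext i j
  exact crd_push b f (u i) (I j)

theorem exists_minor {ι : Type*} [Fintype ι] (b : Module.Basis ι K V) {k : ℕ}
    (hk : k ≤ Module.finrank K V)
    (N : Module.Grassmannian A (A ⊗[K] V) (Module.finrank K V - k)) (p : PrimeSpectrum A) :
    ∃ (u : Fin k → A ⊗[K] V) (I : Fin k → ι), (∀ i, u i ∈ N.toSubmodule) ∧
      Matrix.det (Matrix.of fun i j => crd b A (u i) (I j)) ∉ p.asIdeal := by
  let L := p.asIdeal.ResidueField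
  let f : A →ₐ[K] L := IsScalarTower.toAlgHom K A L
  let N' := Module.Grassmannian.map f N
  have hd := finrank_of_field hk N'
  have hs : Submodule.span L (push f '' (N.toSubmodule : Set (A ⊗[K] V))) = N'.toSubmodule :=
    (map_eq_span f N).symm
  obtain ⟨s, hs1, hs2, hs3⟩ := exists_linearIndependent L (push f '' (N.toSubmodule : Set (A ⊗[K] V)))
  rw [hs] at hs2
  have hfin : Fintype s := hs3.setFinite.fintype
  have hc : Fintype.card s = k := by
    have := finrank_span_eq_card hs3
    rw [Subtype.range_coe, hs2, hd] at this
    exact this.symm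
  let e : Fin k ≃ s := (Fintype.equivFinOfCardEq hc).symm
  choose u hu hu' using fun i => hs1 (e i).2
  have hli : LinearIndependent L (fun i => push f (u i)) := by
    have := hs3.comp e e.injective
    have h : Subtype.val ∘ e = fun i => push f (u i) := funext fun i => (hu' i).symm
    rwa [h] at this
  obtain ⟨I, hI⟩ := exists_minor_of_linearIndependent b p hli
  exact ⟨u, I, hu, hI⟩

theorem eq_span_of_isUnit_minor {ι : Type*} [Fintype ι] (b : Module.Basis ι K V) {k : ℕ}
    (N : Module.Grassmannian A (A ⊗[K] V) (Module.finrank K V - k))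
    (u : Fin k → A ⊗[K] V) (I : Fin k → ι) (hu : ∀ i, u i ∈ N.toSubmodule)
    (h : IsUnit (Matrix.det (Matrix.of fun i j => crd b A (u i) (I j)))) :
    N.toSubmodule = Submodule.span A (Set.range u) ∧
      ∃ ψ : A ⊗[K] V →ₗ[A] (Fin k → A), ∀ i, ψ (u i) = Pi.single i 1 := by
  let D : Matrix (Fin k) (Fin k) A := Matrix.of fun i j => crd b A (u i) (I j)
  let ψ : A ⊗[K] V →ₗ[A] (Fin k → A) := (Matrix.vecMulLinear D⁻¹) ∘ₗ
    (LinearMap.funLeft A A I) ∘ₗ (crd b A).toLinearMap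
  have hψ (i) : ψ (u i) = Pi.single i 1 := by
    have h1 : ψ (u i) = Matrix.vecMul (D i) D⁻¹ := rfl
    rw [h1]
    have h2 : D i = Matrix.vecMul (Pi.single i 1) D := by
      rw [Matrix.single_one_vecMul]
      rfl
    rw [h2, Matrix.vecMul_vecMul, Matrix.mul_nonsing_inv _ h, Matrix.vecMul_one]
  have := eq_of_toSubmodule_le (N := ofBasis u ψ hψ) (N' := N) (by
    rw [ofBasis_toSubmodule, Submodule.span_le]
    rintro _ ⟨i, rfl⟩
    exact hu i)
  exact ⟨by rw [← this]; rfl, ψ, hψ⟩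

end LinearAlgebra

end

end OrthogonalGrassmannian

namespace OrthogonalGrassmannian

noncomputable section

section Localization

variable {K : Type u} [Field K]

instance (A : CommAlgCat.{u} K) (r : A) : Algebra A (loc A r) :=
  inferInstanceAs (Algebra A (Localization.Away r))

instance (A : CommAlgCat.{u} K) (r : A) : IsScalarTower K A (loc A r) :=
  inferInstanceAs (IsScalarTower K A (Localization.Away r))

instance (A : CommAlgCat.{u} K) (r : A) : IsLocalization.Away r (loc A r) :=
  inferInstanceAs (IsLocalization.Away r (Localization.Away r))

theorem exists_pow_mul_eq_zero {A : CommAlgCat.{u} K} {r a : A} (h : (toLoc A r).hom a = 0) :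
    ∃ n, r ^ n * a = 0 := by
  obtain ⟨⟨_, n, rfl⟩, hc⟩ := (IsLocalization.map_eq_zero_iff (Submonoid.powers r) (loc A r) a).mp h
  exact ⟨n, hc⟩

theorem exists_pow_mul_eq {A : CommAlgCat.{u} K} {r : A} (z : loc A r) :
    ∃ (n : ℕ) (a : A), (toLoc A r).hom r ^ n * z = (toLoc A r).hom a := by
  obtain ⟨⟨a, ⟨_, n, rfl⟩⟩, h⟩ := IsLocalization.surj (Submonoid.powers r) z
  exact ⟨n, a, by rw [mul_comm, ← map_pow]; exact h⟩

variable {V : Type u} [AddCommGroup V] [Module K V]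

theorem exists_pow_smul_eq_push {A : CommAlgCat.{u} K} {r : A} (z : loc A r ⊗[K] V) :
    ∃ (n : ℕ) (w : A ⊗[K] V), (toLoc A r).hom r ^ n • z = push (toLoc A r).hom w := by
  induction z with
  | zero => exact ⟨0, 0, by simp⟩
  | tmul a v =>
    obtain ⟨n, a', h⟩ := exists_pow_mul_eq a
    exact ⟨n, a' ⊗ₜ v, by rw [TensorProduct.smul_tmul', smul_eq_mul, h]; rfl⟩
  | add x y hx hy =>
    obtain ⟨n, a, h⟩ := hx
    obtain ⟨m, b, h'⟩ := hy
    refine ⟨n + m, r ^ m • a + r ^ n • b, ?_⟩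
    rw [smul_add, map_add, push_smul, push_smul, ← h, ← h', map_pow, map_pow, smul_smul, smul_smul,
      ← pow_add, ← pow_add, add_comm m n]

end Localization

section Sheaf

variable {K : Type u} [Field K] (V : Type u) [AddCommGroup V] [Module K V]

/-- The functor of points of a Grassmannian. -/
def Gr (m : ℕ) : CommAlgCat.{u} K ⥤ Type u where
  obj A := Module.Grassmannian A (A ⊗[K] V) m
  map f := ↾fun N => Module.Grassmannian.map f.hom N
  map_id A := by
    apply ConcreteCategory.hom_ext
    intro N
    exact Module.Grassmannian.map_id _ A N
  map_comp f g := by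
    apply ConcreteCategory.hom_ext
    intro N
    exact Module.Grassmannian.map_comp _ f.hom g.hom N

variable {V} [Module.Finite K V] {m : ℕ}

theorem Gr_le_of_local {A : CommAlgCat.{u} K} {N : (Gr V m).obj A} {x : A ⊗[K] V}
    (h : ∀ p : PrimeSpectrum A, ∃ r ∉ p.asIdeal,
      push (toLoc A r).hom x ∈ ((Gr V m).map (toLoc A r) N).toSubmodule) : x ∈ N.toSubmodule := by
  obtain ⟨n, φ, h1, h2⟩ := exists_equations_self (A := A) N
  rw [h1]
  intro i
  apply eq_zero_of_local
  intro p
  obtain ⟨r, hr, h3⟩ := h p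
  exact ⟨r, hr, (h2 _ (toLoc A r).hom x).mp h3 i⟩

theorem Gr_exists_pow {A : CommAlgCat.{u} K} {N : (Gr V m).obj A} {x : A ⊗[K] V} {r : A}
    (h : push (toLoc A r).hom x ∈ ((Gr V m).map (toLoc A r) N).toSubmodule) :
    ∃ n, r ^ n • x ∈ N.toSubmodule := by
  obtain ⟨n, φ, h1, h2⟩ := exists_equations_self (A := A) N
  choose d hd using fun i => exists_pow_mul_eq_zero ((h2 _ (toLoc A r).hom x).mp h i)
  refine ⟨∑ i, d i, (h1 _).mpr fun i => ?_⟩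
  rw [map_smul, smul_eq_mul, ← Finset.sum_erase_add _ _ (Finset.mem_univ i), pow_add, mul_assoc,
    hd, mul_zero]

theorem Gr_isZariskiSheaf : IsZariskiSheaf (Gr (K := K) V m) where
  separated A N N' h := by
    refine eq_of_toSubmodule_le (fun x hx => Gr_le_of_local fun p => ?_)
    obtain ⟨r, hr, e⟩ := h p
    refine ⟨r, hr, ?_⟩
    rw [← e]
    exact map_smul_mem_map _ _ hx
  glue A t ht x hx := by
    classical
    let N : Submodule A (A ⊗[K] V) :=
      { carrier := {z | ∀ r : t, push (toLoc A r.1).hom z ∈ (x r).toSubmodule}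
        add_mem' := fun ha hb r => by rw [map_add]; exact add_mem (ha r) (hb r)
        zero_mem' := fun r => by rw [map_zero]; exact zero_mem _
        smul_mem' := fun a z hz r => by rw [push_smul]; exact Submodule.smul_mem _ _ (hz r) }
    have hpow (r : t) (z : A ⊗[K] V) (hz : push (toLoc A r.1).hom z ∈ (x r).toSubmodule) :
        ∃ n, r.1 ^ n • z ∈ N := by
      have key (s : t) : ∃ n, push (toLoc A s.1).hom (r.1 ^ n • z) ∈ (x s).toSubmodule := by
        let r' := (toLoc A s.1).hom r.1
        obtain ⟨g, hg⟩ := exists_of_isUnit (r := r.1) (toLoc A s.1 ≫ toLoc (loc A s.1) r')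
          (isUnit_toLoc _ r')
        have h1 := hx r s _ g (toLoc (loc A s.1) r') hg
        have h2 : push (toLoc (loc A s.1) r').hom (push (toLoc A s.1).hom z) ∈
            ((Gr V m).map (toLoc (loc A s.1) r') (x s)).toSubmodule := by
          rw [← h1, push_push]
          have := map_smul_mem_map g.hom (x r) hz
          rw [push_push] at this
          exact (congrArg (fun (f : A ⟶ _) => push f.hom z) hg) ▸ this
        obtain ⟨n, hn⟩ := Gr_exists_pow h2
        refine ⟨n, ?_⟩
        rwa [← map_pow, ← push_smul] at hn
      choose d hd using key
      refine ⟨∑ s, d s, fun s => ?_⟩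
      rw [← Finset.sum_erase_add _ _ (Finset.mem_univ s), pow_add, mul_smul, push_smul]
      exact Submodule.smul_mem _ _ (hd s)
    let L (r : t) : A ⊗[K] V →ₗ[A] loc A r.1 ⊗[K] V :=
      { push (toLoc A r.1).hom with
        map_smul' := fun a z => (push_smul _ a z).trans (algebraMap_smul (loc A r.1) a _) }
    let g (r : t) : ((A ⊗[K] V) ⧸ N) →ₗ[A] ((loc A r.1 ⊗[K] V) ⧸ (x r).toSubmodule) :=
      N.liftQ (((x r).toSubmodule.mkQ.restrictScalars A) ∘ₗ L r) fun z hz =>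
        (Submodule.Quotient.mk_eq_zero _).mpr (hz r)
    have hloc (r : t) : IsLocalizedModule (Submonoid.powers r.1) (g r) := by
      have hu (n : ℕ) : IsUnit ((toLoc A r.1).hom r.1 ^ n) := (isUnit_toLoc A r.1).pow n
      have hsm (n : ℕ) (y : (loc A r.1 ⊗[K] V) ⧸ (x r).toSubmodule) :
          r.1 ^ n • y = ((toLoc A r.1).hom r.1 ^ n) • y := by
        rw [← map_pow]
        exact (algebraMap_smul (loc A r.1) (r.1 ^ n) y).symm
      refine ⟨?_, ?_, ?_⟩
      · rintro ⟨_, n, rfl⟩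
        refine (Module.End.isUnit_iff _).mpr ⟨fun y y' h => ?_, fun y => ?_⟩
        · have h' : r.1 ^ n • y = r.1 ^ n • y' := h
          rw [hsm, hsm] at h'
          exact (hu n).smul_left_cancel.mp h'
        · obtain ⟨c, hc⟩ := (hu n).exists_right_inv
          refine ⟨c • y, (hsm n (c • y)).trans ?_⟩
          exact (smul_smul _ _ _).trans (by rw [hc]; exact one_smul _ y)
      · intro y
        obtain ⟨z, rfl⟩ := Submodule.mkQ_surjective _ y
        obtain ⟨n, w, h⟩ := exists_pow_smul_eq_push z
        refine ⟨(N.mkQ w, ⟨_, n, rfl⟩), (hsm n _).trans ?_⟩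
        rw [← map_smul, h]
        rfl
      · intro y y' h
        obtain ⟨z, rfl⟩ := Submodule.mkQ_surjective _ y
        obtain ⟨z', rfl⟩ := Submodule.mkQ_surjective _ y'
        have h1 : (x r).toSubmodule.mkQ (push (toLoc A r.1).hom z) =
          (x r).toSubmodule.mkQ (push (toLoc A r.1).hom z') := h
        rw [← sub_eq_zero, ← map_sub, ← map_sub] at h1
        obtain ⟨n, hn⟩ := hpow r _ ((Submodule.Quotient.mk_eq_zero _).mp h1)
        refine ⟨⟨_, n, rfl⟩, ?_⟩
        change r.1 ^ n • N.mkQ z = r.1 ^ n • N.mkQ z'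
        rw [← sub_eq_zero, ← smul_sub, ← map_sub, ← map_smul]
        exact (Submodule.Quotient.mk_eq_zero _).mpr hn
    have hfp : Module.FinitePresentation A ((A ⊗[K] V) ⧸ N) :=
      Module.FinitePresentation.of_localizationSpan' (t : Set A) ht
        (Mₚ := fun r => (loc A r.1 ⊗[K] V) ⧸ (x r).toSubmodule) (Rₚ := fun r => loc A r.1) g
        fun r =>
          have := (x r).projective_quotient
          Module.finitePresentation_of_projective _ _
    have hfl : Module.Flat A ((A ⊗[K] V) ⧸ N) :=
      Module.flat_of_isLocalized_span A _ (t : Set A) ht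
        (fun r => (loc A r.1 ⊗[K] V) ⧸ (x r).toSubmodule) g fun r =>
          have := (x r).projective_quotient
          have : Module.Flat A (loc A r.1) := IsLocalization.flat (loc A r.1) (Submonoid.powers r.1)
          Module.Flat.trans A (loc A r.1) _
    have hproj := Module.Flat.projective_of_finitePresentation (R := A) (M := (A ⊗[K] V) ⧸ N)
    let N' : (Gr V m).obj A :=
      { toSubmodule := N
        finite_quotient := inferInstance
        projective_quotient := hproj
        rankAtStalk_eq := fun p => by
          obtain ⟨r, hr, hrt⟩ := exists_notMem_of_span ht p
          obtain ⟨q, hq⟩ := exists_prime_toLoc p hr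
          have h1 := (isLocalizedModule_iff_isBaseChange (Submonoid.powers r) (loc A r)
            (g ⟨r, hrt⟩)).mp (hloc ⟨r, hrt⟩)
          have h2 := Module.rankAtStalk_isBaseChange h1 q
          rw [(x ⟨r, hrt⟩).rankAtStalk_eq] at h2
          rw [h2, ← hq]
          rfl }
    refine ⟨N', fun r => ?_⟩
    refine eq_of_toSubmodule_le ?_
    refine (map_eq_span (toLoc A r.1).hom N').trans_le ?_
    rw [Submodule.span_le]
    rintro _ ⟨z, hz, rfl⟩
    exact hz r


end Sheaf

end

end OrthogonalGrassmannian

namespace OrthogonalGrassmannian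

noncomputable section

variable {K : Type u} [Field K]

section LocalClosedness

variable {F : CommAlgCat.{u} K ⥤ Type u} {Φ : ∀ A : CommAlgCat.{u} K, F.obj A → Prop}

theorem exists_loc_map {A B : CommAlgCat.{u} K} (f : A ⟶ B) (r : A) :
    ∃ g : loc A r ⟶ loc B (f.hom r), toLoc A r ≫ g = f ≫ toLoc B (f.hom r) :=
  exists_of_isUnit _ (isUnit_toLoc B (f.hom r))

theorem exists_loc_mul {A : CommAlgCat.{u} K} (r s : A) :
    (∃ g : loc A r ⟶ loc A (r * s), toLoc A r ≫ g = toLoc A (r * s)) ∧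
      ∃ g : loc A s ⟶ loc A (r * s), toLoc A s ≫ g = toLoc A (r * s) := by
  have h := isUnit_toLoc A (r * s)
  rw [map_mul] at h
  exact ⟨exists_of_isUnit _ (isUnit_of_mul_isUnit_left h),
    exists_of_isUnit _ (isUnit_of_mul_isUnit_right h)⟩

theorem mul_notMem {A : CommAlgCat.{u} K} {p : PrimeSpectrum A} {r s : A} (hr : r ∉ p.asIdeal)
    (hs : s ∉ p.asIdeal) : r * s ∉ p.asIdeal :=
  fun h => (p.isPrime.mem_or_mem h).elim hr hs

/-- Closedness of a condition can be checked locally. -/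
theorem isClosedCond_of_local_ideal
    (hmap : ∀ (A B : CommAlgCat.{u} K) (f : A ⟶ B) (x : F.obj A), Φ A x → Φ B (F.map f x))
    (hloc : ∀ (A : CommAlgCat.{u} K) (x : F.obj A), (∀ p : PrimeSpectrum A, ∃ r ∉ p.asIdeal,
      Φ _ (F.map (toLoc A r) x)) → Φ A x)
    (h : ∀ (A : CommAlgCat.{u} K) (x : F.obj A) (p : PrimeSpectrum A), ∃ r ∉ p.asIdeal,
      ∃ J : Ideal (loc A r), ∀ (B : CommAlgCat.{u} K) (f : loc A r ⟶ B),
        Φ B (F.map f (F.map (toLoc A r) x)) ↔ ∀ a ∈ J, f.hom a = 0) : IsClosedCond F Φ := by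
  classical
  intro A x
  obtain ⟨t, ht, h1⟩ := exists_finset_of_local (h A x)
  choose! J hJ using h1
  have key (r s : A) (hr : r ∈ t) (hs : s ∈ t) (a : A) (b : loc A r) (hb : b ∈ J r) (n : ℕ)
      (hab : (toLoc A r).hom r ^ n * b = (toLoc A r).hom a) :
      ∃ m, (toLoc A s).hom (r ^ m * a) ∈ J s := by
    let k := toLoc A s ≫ toQuot (loc A s) (J s)
    have h2 : Φ _ (F.map (toQuot (loc A s) (J s)) (F.map (toLoc A s) x)) :=
      (hJ s hs _ _).mpr fun c hc => toQuot_eq_zero.mpr hc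
    obtain ⟨g, hg⟩ := exists_loc_map k r
    have h3 := hmap _ _ (toLoc _ (k.hom r)) _ h2
    rw [map_map (toLoc A s), map_map, ← hg, ← map_map, hJ r hr] at h3
    have h4 : (toLoc _ (k.hom r)).hom (k.hom a) = 0 := by
      have h5 : g.hom ((toLoc A r).hom a) = (toLoc _ (k.hom r)).hom (k.hom a) :=
        congrArg (fun (z : A ⟶ _) => z.hom a) hg
      rw [← h5, ← hab, map_mul, h3 b hb, mul_zero]
    obtain ⟨m, hm⟩ := exists_pow_mul_eq_zero h4
    refine ⟨m, ?_⟩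
    rw [← map_pow, ← map_mul] at hm
    exact toQuot_eq_zero.mp hm
  refine ⟨⨅ r ∈ t, (J r).comap (toLoc A r).hom.toRingHom, fun B f => ⟨fun hf a ha => ?_,
    fun hf => hloc B _ fun q => ?_⟩⟩
  · refine eq_zero_of_local fun q => ?_
    obtain ⟨r, hr, hrt⟩ := exists_notMem_of_span ht (PrimeSpectrum.comap f.hom.toRingHom q)
    obtain ⟨g, hg⟩ := exists_loc_map f r
    refine ⟨f.hom r, hr, ?_⟩
    have h3 := hmap _ _ (toLoc _ (f.hom r)) _ hf
    rw [map_map, ← hg, ← map_map, hJ r hrt] at h3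
    have h5 : g.hom ((toLoc A r).hom a) = (toLoc _ (f.hom r)).hom (f.hom a) :=
      congrArg (fun (z : A ⟶ _) => z.hom a) hg
    rw [← h5]
    simp only [Submodule.mem_iInf] at ha
    exact h3 _ (ha r hrt)
  · obtain ⟨r, hr, hrt⟩ := exists_notMem_of_span ht (PrimeSpectrum.comap f.hom.toRingHom q)
    obtain ⟨g, hg⟩ := exists_loc_map f r
    refine ⟨f.hom r, hr, ?_⟩
    rw [map_map, ← hg, ← map_map, hJ r hrt]
    intro b hb
    obtain ⟨n, a, hab⟩ := exists_pow_mul_eq b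
    have key' : ∀ s : t, ∃ m, (toLoc A s.1).hom (r ^ m * a) ∈ J s.1 := fun s =>
      key r s.1 hrt s.2 a b hb n hab
    choose d hd using key'
    have h6 : r ^ (∑ s, d s) * a ∈ ⨅ r ∈ t, (J r).comap (toLoc A r).hom.toRingHom := by
      simp only [Submodule.mem_iInf]
      intro s hs
      rw [← Finset.sum_erase_add _ _ (Finset.mem_univ ⟨s, hs⟩), pow_add, mul_assoc]
      exact Ideal.mul_mem_left _ _ (hd ⟨s, hs⟩)
    have h7 := hf _ h6
    have h5 : g.hom ((toLoc A r).hom (r ^ (∑ s, d s) * a)) =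
        (toLoc _ (f.hom r)).hom (f.hom (r ^ (∑ s, d s) * a)) :=
      congrArg (fun (z : A ⟶ _) => z.hom _) hg
    rw [h7, map_zero, map_mul, ← hab, map_mul, map_mul] at h5
    have hu := ((isUnit_toLoc A r).map g.hom)
    rw [map_pow, map_pow, map_pow] at h5
    exact (hu.pow n).mul_right_eq_zero.mp ((hu.pow _).mul_right_eq_zero.mp h5)

end LocalClosedness

section Representability

/-- Homogeneous coordinates on the points of a functor which identify it locally with a closed
subfunctor of a projective space. -/
structure Coordinates (F : CommAlgCat.{u} K ⥤ Type u) (ι : Type) where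
  /-- the point `x` has homogeneous coordinates `c` -/
  rel : ∀ {A : CommAlgCat.{u} K}, F.obj A → (ι → A) → Prop
  map : ∀ {A B : CommAlgCat.{u} K} {x : F.obj A} {c : ι → A}, rel x c → ∀ f : A ⟶ B,
    rel (F.map f x) (fun i => f.hom (c i))
  smul : ∀ {A : CommAlgCat.{u} K} {x : F.obj A} {c : ι → A}, rel x c → ∀ {a : A}, IsUnit a →
    rel x (fun i => a * c i)
  isUnit : ∀ {A : CommAlgCat.{u} K} {x : F.obj A} {c : ι → A}, rel x c → ∃ i, IsUnit (c i)
  exists_unit : ∀ {A : CommAlgCat.{u} K} {x : F.obj A} {c c' : ι → A}, rel x c → rel x c' →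
    ∃ a : A, IsUnit a ∧ ∀ i, c' i = a * c i
  eq_of_rel : ∀ {A : CommAlgCat.{u} K} {x x' : F.obj A} {c : ι → A}, rel x c → rel x' c → x = x'
  exists_local : ∀ {A : CommAlgCat.{u} K} (x : F.obj A) (p : PrimeSpectrum A),
    ∃ r ∉ p.asIdeal, ∃ c, rel (F.map (toLoc A r) x) c
  closed : ∀ (A : CommAlgCat.{u} K) (c : ι → A), (∃ i, IsUnit (c i)) → ∃ J : Ideal A,
    ∀ (B : CommAlgCat.{u} K) (f : A ⟶ B),
      (∃ x : F.obj B, rel x (fun i => f.hom (c i))) ↔ ∀ a ∈ J, f.hom a = 0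

/-- A moduli scheme from a natural bijection on points. -/
def ModuliScheme.ofBijective {F : CommAlgCat.{u} K ⥤ Type u} (X : Over (Spec (CommRingCat.of K)))
    (η : ∀ A : CommAlgCat.{u} K, (specOver A ⟶ X) → F.obj A)
    (hη : ∀ (A B : CommAlgCat.{u} K) (f : A ⟶ B) (x : specOver A ⟶ X),
      η B (res f x) = F.map f (η A x))
    (hb : ∀ A, Function.Bijective (η A)) : ModuliScheme F where
  scheme := X
  points := NatIso.ofComponents (fun A => (Equiv.ofBijective (η A) (hb A)).toIso) fun {A B} f => by
    apply ConcreteCategory.hom_ext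
    intro x
    exact hη A B f x

namespace ModuliScheme

variable {F G : CommAlgCat.{u} K ⥤ Type u}

theorem exists_pt (M : ModuliScheme F) {A : CommAlgCat.{u} K} (x : F.obj A) :
    ∃ y : specOver A ⟶ M.scheme, M.pt y = x :=
  ⟨M.points.inv.app A x, ConcreteCategory.congr_hom (M.points.inv_hom_id_app A) x⟩

theorem pt_injective (M : ModuliScheme F) {A : CommAlgCat.{u} K} {y y' : specOver A ⟶ M.scheme}
    (h : M.pt y = M.pt y') : y = y' := by
  have h1 := congrArg (M.points.inv.app A) h
  have h2 (z : specOver A ⟶ M.scheme) : M.points.inv.app A (M.pt z) = z :=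
    ConcreteCategory.congr_hom (M.points.hom_inv_id_app A) z
  rwa [h2, h2] at h1

theorem pt_res (M : ModuliScheme F) {A B : CommAlgCat.{u} K} (f : A ⟶ B)
    (y : specOver A ⟶ M.scheme) : M.pt (res f y) = F.map f (M.pt y) := M.pt_comp f y

/-- Morphisms to a moduli scheme. -/
theorem exists_hom (M : ModuliScheme F) {T : Over (Spec (CommRingCat.of K))}
    (η : ∀ A : CommAlgCat.{u} K, (specOver A ⟶ T) → F.obj A)
    (hη : ∀ (A B : CommAlgCat.{u} K) (f : A ⟶ B) (x : specOver A ⟶ T),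
      η B (res f x) = F.map f (η A x)) :
    ∃ f : T ⟶ M.scheme, ∀ (A : CommAlgCat.{u} K) (x : specOver A ⟶ T), M.pt (x ≫ f) = η A x := by
  obtain ⟨f, hf⟩ := exists_hom_of_natural (X := T) (Y := M.scheme)
    (fun A x => (M.exists_pt (η A x)).choose) (fun A B f x => by
      apply M.pt_injective
      rw [M.pt_res, (M.exists_pt (η B (res f x))).choose_spec,
        (M.exists_pt (η A x)).choose_spec, hη])
  exact ⟨f, fun A x => by rw [hf, (M.exists_pt (η A x)).choose_spec]⟩

/-- The morphism of moduli schemes given by a transformation of functors. -/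
theorem exists_hom_of_app (M : ModuliScheme F) (M' : ModuliScheme G)
    (η : ∀ A : CommAlgCat.{u} K, F.obj A → G.obj A)
    (hη : ∀ (A B : CommAlgCat.{u} K) (f : A ⟶ B) (x : F.obj A),
      η B (F.map f x) = G.map f (η A x)) :
    ∃ f : M.scheme ⟶ M'.scheme, ∀ (A : CommAlgCat.{u} K) (x : specOver A ⟶ M.scheme),
      M'.pt (x ≫ f) = η A (M.pt x) :=
  M'.exists_hom (fun A x => η A (M.pt x)) fun A B f x => by rw [M.pt_res, hη]

/-- A morphism to a moduli scheme which is bijective on points is an isomorphism. -/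
theorem isIso_of_bijective (M : ModuliScheme F) {T : Over (Spec (CommRingCat.of K))}
    (f : T ⟶ M.scheme) (h : ∀ A : CommAlgCat.{u} K,
      Function.Bijective fun x : specOver A ⟶ T => M.pt (x ≫ f)) : IsIso f := by
  obtain ⟨e, he⟩ := exists_iso_of_same_points f (𝟙 M.scheme)
    (fun A x x' e => (h A).1 (congrArg M.pt e))
    (fun A x x' h => by simpa using h)
    (fun A y => ⟨fun _ => ⟨y, Category.comp_id y⟩, fun _ => by
      obtain ⟨x, hx⟩ := (h A).2 (M.pt y)
      exact ⟨x, M.pt_injective hx⟩⟩)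
  rw [Category.comp_id] at he
  rw [← he]
  infer_instance

theorem nonempty_iso (M M' : ModuliScheme F) : Nonempty (M.scheme ≅ M'.scheme) := by
  obtain ⟨f, hf⟩ := exists_hom_of_app M M' (fun _ x => x) fun _ _ _ _ => rfl
  have : IsIso f := isIso_of_bijective M' f fun A =>
    ⟨fun x x' h => M.pt_injective (by
      have h' : M'.pt (x ≫ f) = M'.pt (x' ≫ f) := h
      rwa [hf, hf] at h'), fun x => by
      obtain ⟨y, hy⟩ := M.exists_pt x
      exact ⟨y, (hf A y).trans hy⟩⟩
  exact ⟨asIso f⟩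

end ModuliScheme

namespace Coordinates

variable {F : CommAlgCat.{u} K ⥤ Type u} {N : ℕ} (C : Coordinates F (Fin (N + 1)))

/-- The point `y` of projective space corresponds to the point `x` of the functor. -/
def Corresponds {A : CommAlgCat.{u} K} (x : F.obj A) (y : specOver A ⟶ projectiveSpace K N) : Prop :=
  ∀ (B : CommAlgCat.{u} K) (f : A ⟶ B) (c : Fin (N + 1) → B), C.rel (F.map f x) c →
    IsCoord (res f y) c

variable {C}

theorem Corresponds.map {A B : CommAlgCat.{u} K} {x : F.obj A}
    {y : specOver A ⟶ projectiveSpace K N} (h : C.Corresponds x y) (f : A ⟶ B) :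
    C.Corresponds (F.map f x) (res f y) := by
  intro D g c hc
  rw [map_map] at hc
  rw [res_res]
  exact h D _ c hc

theorem corresponds_of_rel {A : CommAlgCat.{u} K} {x : F.obj A}
    {y : specOver A ⟶ projectiveSpace K N} {c : Fin (N + 1) → A} (h : C.rel x c)
    (h' : IsCoord y c) : C.Corresponds x y := by
  intro B f c' hc'
  obtain ⟨a, ha, e⟩ := C.exists_unit (C.map h f) hc'
  have := (h'.map f).smul ha
  rwa [← funext e] at this

theorem projective_separated {A : CommAlgCat.{u} K} {y y' : specOver A ⟶ projectiveSpace K N}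
    (h : ∀ p : PrimeSpectrum A, ∃ r ∉ p.asIdeal, res (toLoc A r) y = res (toLoc A r) y') :
    y = y' :=
  (pointFunctor_isZariskiSheaf (projectiveSpace K N)).separated A y y' h

theorem Corresponds.unique_right {A : CommAlgCat.{u} K} {x : F.obj A}
    {y y' : specOver A ⟶ projectiveSpace K N} (h : C.Corresponds x y) (h' : C.Corresponds x y') :
    y = y' := by
  apply projective_separated
  intro p
  obtain ⟨r, hr, c, hc⟩ := C.exists_local x p
  exact ⟨r, hr, (h _ _ c hc).unique (h' _ _ c hc)⟩

theorem corresponds_of_local {A : CommAlgCat.{u} K} {x : F.obj A}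
    {y : specOver A ⟶ projectiveSpace K N}
    (h : ∀ p : PrimeSpectrum A, ∃ r ∉ p.asIdeal,
      C.Corresponds (F.map (toLoc A r) x) (res (toLoc A r) y)) : C.Corresponds x y := by
  intro B f c hc
  obtain ⟨i, hi⟩ := C.isUnit hc
  obtain ⟨z, hz⟩ := exists_isCoord c hi
  have hz' := corresponds_of_rel hc hz
  suffices e : res f y = z by rwa [e]
  apply projective_separated
  intro q
  obtain ⟨r, hr, h1⟩ := h (PrimeSpectrum.comap f.hom.toRingHom q)
  obtain ⟨g, hg⟩ := exists_loc_map f r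
  refine ⟨f.hom r, hr, ?_⟩
  have h2 := h1.map g
  rw [map_map, hg, res_res, hg, ← map_map, ← res_res] at h2
  exact h2.unique_right (hz'.map _)

variable (hF : IsZariskiSheaf F)

include hF in
theorem Corresponds.unique_left {A : CommAlgCat.{u} K} {x x' : F.obj A}
    {y : specOver A ⟶ projectiveSpace K N} (h : C.Corresponds x y) (h' : C.Corresponds x' y) :
    x = x' := by
  apply hF.separated
  intro p
  obtain ⟨r, hr, c, hc⟩ := C.exists_local x p
  obtain ⟨s, hs, c', hc'⟩ := C.exists_local x' p
  obtain ⟨⟨g, hg⟩, g', hg'⟩ := exists_loc_mul r s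
  refine ⟨r * s, mul_notMem hr hs, ?_⟩
  have h1 := C.map hc g
  have h2 := C.map hc' g'
  rw [map_map, hg] at h1
  rw [map_map, hg'] at h2
  obtain ⟨a, ha, e⟩ := (h _ _ _ h1).exists_unit (h' _ _ _ h2)
  rw [funext e] at h2
  exact C.eq_of_rel (C.smul h1 ha) h2

theorem exists_corresponds {A : CommAlgCat.{u} K} (x : F.obj A) :
    ∃ y : specOver A ⟶ projectiveSpace K N, C.Corresponds x y := by
  obtain ⟨y, hy⟩ := (pointFunctor_isZariskiSheaf (projectiveSpace K N)).exists_of_local (A := A)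
    (fun B f y => C.Corresponds (F.map f x) y)
    (fun B D f g y h => by
      have := Corresponds.map h g
      rwa [map_map] at this)
    (fun B f y y' h h' => Corresponds.unique_right h h')
    (fun p => by
      obtain ⟨r, hr, c, hc⟩ := C.exists_local x p
      obtain ⟨i, hi⟩ := C.isUnit hc
      obtain ⟨z, hz⟩ := exists_isCoord c hi
      exact ⟨r, hr, z, corresponds_of_rel hc hz⟩)
  exact ⟨y, corresponds_of_local hy⟩

include hF in
theorem isClosedCond_corresponds : IsClosedCond (pointFunctor (projectiveSpace K N))
    (fun A y => ∃ x, C.Corresponds (A := A) x y) := by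
  apply isClosedCond_of_local_ideal
  · rintro A B f y ⟨x, hx⟩
    exact ⟨_, hx.map f⟩
  · intro A y h
    obtain ⟨x, hx⟩ := hF.exists_of_local (A := A)
      (fun B f x => C.Corresponds x (res f y))
      (fun B D f g x h => by
        have := Corresponds.map h g
        rwa [res_res] at this)
      (fun B f x x' h h' => Corresponds.unique_left hF h h') h
    exact ⟨x, corresponds_of_local hx⟩
  · intro A y p
    obtain ⟨r, hr, c, hc⟩ := exists_local_isCoord y p
    obtain ⟨J, hJ⟩ := C.closed _ c hc.isUnit
    refine ⟨r, hr, J, fun B f => ⟨fun ⟨x, hx⟩ a ha => eq_zero_of_local fun q => ?_, fun h => ?_⟩⟩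
    · obtain ⟨s, hs, c', hc'⟩ := C.exists_local x q
      refine ⟨s, hs, ?_⟩
      have h1 := hx _ _ c' hc'
      obtain ⟨b, hb, e⟩ := h1.exists_unit ((hc.map f).map (toLoc B s))
      have h2 := C.smul hc' hb
      rw [← funext e] at h2
      exact (hJ _ (f ≫ toLoc B s)).mp ⟨_, h2⟩ a ha
    · obtain ⟨x, hx⟩ := (hJ B f).mpr h
      exact ⟨x, corresponds_of_rel hx (hc.map f)⟩

variable (C)

include hF in
/-- A Zariski sheaf with homogeneous coordinates is represented by a projective scheme. -/
theorem exists_moduli : ∃ (M : ModuliScheme F) (i : M.scheme ⟶ projectiveSpace K N),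
    IsClosedImmersion i.left ∧ ∀ (A : CommAlgCat.{u} K) (x : specOver A ⟶ M.scheme),
      C.Corresponds (M.pt x) (x ≫ i) := by
  have h := isClosedCond_corresponds (C := C) hF
  obtain ⟨I, hI⟩ := exists_idealSheaf h
  have h1 {A : CommAlgCat.{u} K} (z : specOver A ⟶ subOver I) :
      ∃ x, C.Corresponds x (z ≫ subIncl I) := (mem_range_subIncl_iff h hI _).mpr ⟨z, rfl⟩
  choose η hη using @h1
  have hcl : IsClosedImmersion (subIncl I).left := inferInstance
  refine ⟨ModuliScheme.ofBijective (subOver I) (fun A z => η z) (fun A B f z => ?_)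
    (fun A => ⟨fun z z' e => ?_, fun x => ?_⟩), subIncl I,
    hcl, fun A x => hη x⟩
  · refine Corresponds.unique_left hF (hη (res f z)) ?_
    have := (hη z).map f
    rwa [res, ← Category.assoc] at this
  · apply injOnPoints_of_mono (subIncl I)
    refine (hη z).unique_right ?_
    have e' : η z = η z' := e
    rw [e']
    exact hη z'
  · obtain ⟨y, hy⟩ := C.exists_corresponds x
    obtain ⟨z, rfl⟩ := (mem_range_subIncl_iff h hI y).mp ⟨x, hy⟩
    exact ⟨z, Corresponds.unique_left hF (hη z) hy⟩

/-- If there are no equations, the representing scheme is projective space. -/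
theorem exists_iso_projectiveSpace (hF : IsZariskiSheaf F)
    (h0 : ∀ (A : CommAlgCat.{u} K) (c : Fin (N + 1) → A), (∃ i, IsUnit (c i)) → ∃ x, C.rel x c)
    (M : ModuliScheme F) : Nonempty (M.scheme ≅ projectiveSpace K N) := by
  obtain ⟨M', i, hi, hM⟩ := C.exists_moduli hF
  have hs {A : CommAlgCat.{u} K} (y : specOver A ⟶ projectiveSpace K N) : ∃ z, z ≫ i = y := by
    have h1 : ∃ x, C.Corresponds x y := by
      obtain ⟨x, hx⟩ := hF.exists_of_local (A := A)
        (fun B f x => C.Corresponds x (res f y))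
        (fun B D f g x h => by
          have := Corresponds.map h g
          rwa [res_res] at this)
        (fun B f x x' h h' => Corresponds.unique_left hF h h') (fun p => by
          obtain ⟨r, hr, c, hc⟩ := exists_local_isCoord y p
          obtain ⟨x, hx⟩ := h0 _ c hc.isUnit
          exact ⟨r, hr, x, corresponds_of_rel hx hc⟩)
      exact ⟨x, corresponds_of_local hx⟩
    obtain ⟨x, hx⟩ := h1
    refine ⟨M'.points.inv.app A x, ?_⟩
    refine (hM A _).unique_right ?_
    have e : M'.pt (M'.points.inv.app A x) = x :=
      ConcreteCategory.congr_hom (M'.points.inv_hom_id_app A) x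
    rwa [e]
  obtain ⟨e, -⟩ := exists_iso_of_same_points i (𝟙 (projectiveSpace K N)) (injOnPoints_of_mono i)
    (fun A x x' h => by simpa using h)
    (fun A y => ⟨fun _ => ⟨y, Category.comp_id y⟩, fun _ => hs y⟩)
  obtain ⟨e'⟩ := M.nonempty_iso M'
  exact ⟨e' ≪≫ e⟩

end Coordinates

end Representability

end

end OrthogonalGrassmannian

namespace OrthogonalGrassmannian

noncomputable section

variable {K : Type u} [Field K]

namespace Coordinates

variable {F G : CommAlgCat.{u} K ⥤ Type u} {ι ι' : Type}

/-- Reindexing of coordinates. -/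
def reindex (C : Coordinates F ι) (e : ι' ≃ ι) : Coordinates F ι' where
  rel x c := C.rel x (c ∘ e.symm)
  map h f := C.map h f
  smul h _ ha := C.smul h ha
  isUnit h := by
    obtain ⟨i, hi⟩ := C.isUnit h
    exact ⟨_, hi⟩
  exists_unit h h' := by
    obtain ⟨a, ha, e'⟩ := C.exists_unit h h'
    exact ⟨a, ha, fun i => by simpa using e' (e i)⟩
  eq_of_rel h h' := C.eq_of_rel h h'
  exists_local x p := by
    obtain ⟨r, hr, c, hc⟩ := C.exists_local x p
    refine ⟨r, hr, c ∘ e, ?_⟩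
    simpa [Function.comp_def] using hc
  closed A c h := by
    obtain ⟨i, hi⟩ := h
    exact C.closed A (c ∘ e.symm) ⟨e i, by simpa using hi⟩

/-- Coordinates on a closed subfunctor. -/
def sub (C : Coordinates F ι) (η : ∀ A : CommAlgCat.{u} K, G.obj A → F.obj A)
    (hη : ∀ (A B : CommAlgCat.{u} K) (f : A ⟶ B) (x : G.obj A), η B (G.map f x) = F.map f (η A x))
    (hinj : ∀ A, Function.Injective (η A)) {Φ : ∀ A : CommAlgCat.{u} K, F.obj A → Prop}
    (hΦ : IsClosedCond F Φ) (hr : ∀ A x, Φ A x ↔ ∃ z, η A z = x) : Coordinates G ι where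
  rel x c := C.rel (η _ x) c
  map h f := by
    rw [hη]
    exact C.map h f
  smul h _ ha := C.smul h ha
  isUnit h := C.isUnit h
  exists_unit h h' := C.exists_unit h h'
  eq_of_rel h h' := hinj _ (C.eq_of_rel h h')
  exists_local x p := by
    obtain ⟨r, hr, c, hc⟩ := C.exists_local (η _ x) p
    exact ⟨r, hr, c, by rwa [hη]⟩
  closed A c h := by
    obtain ⟨J, hJ⟩ := C.closed A c h
    obtain ⟨x, hx⟩ := (hJ _ (toQuot A J)).mpr fun a ha => toQuot_eq_zero.mpr ha
    obtain ⟨J', hJ'⟩ := hΦ _ x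
    refine ⟨J ⊔ J'.comap (toQuot A J).hom.toRingHom, fun B f => ⟨fun ⟨z, hz⟩ a ha => ?_, fun hf => ?_⟩⟩
    · have h1 := (hJ B f).mp ⟨_, hz⟩
      obtain ⟨g, rfl⟩ := exists_of_kills f h1
      have h2 := C.eq_of_rel (C.map hx g) hz
      have h3 := (hJ' B g).mp (by rw [h2]; exact (hr _ _).mpr ⟨z, rfl⟩)
      obtain ⟨b, hb, d, hd, rfl⟩ := Submodule.mem_sup.mp ha
      rw [map_add, h1 b hb, zero_add]
      exact h3 _ hd
    · obtain ⟨g, rfl⟩ := exists_of_kills f fun a ha => hf a (le_sup_left (α := Ideal A) ha)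
      have h3 := (hJ' B g).mpr fun a ha => by
        obtain ⟨a, rfl⟩ := Ideal.Quotient.mk_surjective a
        exact hf a (le_sup_right (α := Ideal A) (a := J) ha)
      obtain ⟨z, hz⟩ := (hr _ _).mp h3
      exact ⟨z, by rw [hz]; exact C.map hx g⟩

end Coordinates

theorem IsZariskiSheaf.sub {F G : CommAlgCat.{u} K ⥤ Type u} (hF : IsZariskiSheaf F)
    (η : ∀ A : CommAlgCat.{u} K, G.obj A → F.obj A)
    (hη : ∀ (A B : CommAlgCat.{u} K) (f : A ⟶ B) (x : G.obj A), η B (G.map f x) = F.map f (η A x))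
    (hinj : ∀ A, Function.Injective (η A)) {Φ : ∀ A : CommAlgCat.{u} K, F.obj A → Prop}
    (hΦ : IsClosedCond F Φ) (hr : ∀ A x, Φ A x ↔ ∃ z, η A z = x) : IsZariskiSheaf G where
  separated A x x' h := by
    apply hinj
    apply hF.separated
    intro p
    obtain ⟨r, hr, e⟩ := h p
    exact ⟨r, hr, by rw [← hη, ← hη, e]⟩
  glue A t ht x hx := by
    obtain ⟨y, hy⟩ := hF.glue A t ht (fun r => η _ (x r)) fun r r' B g h e => by
      rw [← hη, ← hη, hx r r' B g h e]
    obtain ⟨z, rfl⟩ := (hr A y).mp (hΦ.of_local fun p => by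
      obtain ⟨r, hr', hrt⟩ := exists_notMem_of_span ht p
      exact ⟨r, hr', by rw [hy ⟨r, hrt⟩]; exact (hr _ _).mpr ⟨_, rfl⟩⟩)
    exact ⟨z, fun r => hinj _ (by rw [hη, hy])⟩

section Product

variable (F G : CommAlgCat.{u} K ⥤ Type u)

/-- The product of two functors of points. -/
def prodFunctor : CommAlgCat.{u} K ⥤ Type u where
  obj A := F.obj A × G.obj A
  map f := ↾fun x => (F.map f x.1, G.map f x.2)
  map_id A := by
    apply ConcreteCategory.hom_ext
    intro x
    exact Prod.ext (map_one x.1) (map_one x.2)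
  map_comp f g := by
    apply ConcreteCategory.hom_ext
    intro x
    exact Prod.ext (map_map f g x.1).symm (map_map f g x.2).symm

variable {F G}

theorem IsZariskiSheaf.prod (hF : IsZariskiSheaf F) (hG : IsZariskiSheaf G) :
    IsZariskiSheaf (prodFunctor F G) where
  separated A x x' h := by
    refine Prod.ext (hF.separated A _ _ fun p => ?_) (hG.separated A _ _ fun p => ?_)
    · obtain ⟨r, hr, e⟩ := h p
      exact ⟨r, hr, congrArg Prod.fst e⟩
    · obtain ⟨r, hr, e⟩ := h p
      exact ⟨r, hr, congrArg Prod.snd e⟩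
  glue A t ht x hx := by
    obtain ⟨y, hy⟩ := hF.glue A t ht (fun r => (x r).1) fun r r' B g h e =>
      congrArg Prod.fst (hx r r' B g h e)
    obtain ⟨z, hz⟩ := hG.glue A t ht (fun r => (x r).2) fun r r' B g h e =>
      congrArg Prod.snd (hx r r' B g h e)
    exact ⟨(y, z), fun r => Prod.ext (hy r) (hz r)⟩

variable {ι ι' : Type}

/-- The coordinates of the Segre embedding. -/
def Coordinates.prod (C : Coordinates F ι) (D : Coordinates G ι') :
    Coordinates (prodFunctor F G) (ι × ι') where
  rel x c := ∃ d d', C.rel x.1 d ∧ D.rel x.2 d' ∧ ∀ i, c i = d i.1 * d' i.2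
  map := by
    rintro A B x c ⟨d, d', h, h', e⟩ f
    exact ⟨_, _, C.map h f, D.map h' f, fun i => (congrArg _ (e i)).trans (map_mul _ _ _)⟩
  smul := by
    rintro A x c ⟨d, d', h, h', e⟩ a ha
    exact ⟨_, _, C.smul h ha, h', fun i => (congrArg _ (e i)).trans (mul_assoc _ _ _).symm⟩
  isUnit := by
    rintro A x c ⟨d, d', h, h', e⟩
    obtain ⟨i, hi⟩ := C.isUnit h
    obtain ⟨i', hi'⟩ := D.isUnit h'
    exact ⟨(i, i'), by rw [e]; exact hi.mul hi'⟩
  exists_unit := by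
    rintro A x c c' ⟨d, d', h, h', e⟩ ⟨d₁, d₁', h₁, h₁', e₁⟩
    obtain ⟨a, ha, ea⟩ := C.exists_unit h h₁
    obtain ⟨a', ha', ea'⟩ := D.exists_unit h' h₁'
    exact ⟨a * a', ha.mul ha', fun i => by rw [e, e₁, ea, ea']; ring⟩
  eq_of_rel := by
    rintro A x x' c ⟨d, d', h, h', e⟩ ⟨d₁, d₁', h₁, h₁', e₁⟩
    obtain ⟨i, hi⟩ := C.isUnit h
    obtain ⟨i', hi'⟩ := D.isUnit h'
    have hu : IsUnit (d₁ i * d₁' i') := by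
      rw [← e₁ (i, i'), e (i, i')]
      exact hi.mul hi'
    obtain ⟨v, hv⟩ := hi.exists_left_inv
    obtain ⟨v', hv'⟩ := hi'.exists_left_inv
    refine Prod.ext ?_ ?_
    · have h2 := C.smul h₁ ((isUnit_of_mul_isUnit_right hu).mul (IsUnit.of_mul_eq_one _ hv'))
      refine C.eq_of_rel h ?_
      convert h2 using 1
      ext j
      have := (e (j, i')).symm.trans (e₁ (j, i'))
      linear_combination v' * this - d j * hv'
    · have h2 := D.smul h₁' ((isUnit_of_mul_isUnit_left hu).mul (IsUnit.of_mul_eq_one _ hv))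
      refine D.eq_of_rel h' ?_
      convert h2 using 1
      ext j
      have := (e (i, j)).symm.trans (e₁ (i, j))
      linear_combination v * this - d' j * hv
  exists_local := by
    intro A x p
    obtain ⟨r, hr, c, hc⟩ := C.exists_local x.1 p
    obtain ⟨s, hs, c', hc'⟩ := D.exists_local x.2 p
    obtain ⟨⟨g, hg⟩, g', hg'⟩ := exists_loc_mul r s
    have h1 := C.map hc g
    have h2 := D.map hc' g'
    rw [map_map, hg] at h1
    rw [map_map, hg'] at h2
    exact ⟨r * s, mul_notMem hr hs, _, _, _, h1, h2, fun i => rfl⟩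
  closed := by
    rintro A c ⟨⟨i, i'⟩, hi⟩
    obtain ⟨J, hJ⟩ := C.closed A (fun j => c (j, i')) ⟨i, hi⟩
    obtain ⟨J', hJ'⟩ := D.closed A (fun j => c (i, j)) ⟨i', hi⟩
    refine ⟨J ⊔ J' ⊔ Ideal.span (Set.range fun j : ι × ι' =>
      c j * c (i, i') - c (j.1, i') * c (i, j.2)), fun B f => ⟨?_, fun hf => ?_⟩⟩
    · rintro ⟨x, d, d', h, h', e⟩
      replace e : ∀ i, f.hom (c i) = d i.1 * d' i.2 := e
      have hu : IsUnit (d i * d' i') := by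
        rw [← e (i, i')]
        exact hi.map f.hom
      have h1 : (J ⊔ J' ⊔ Ideal.span (Set.range fun j : ι × ι' =>
        c j * c (i, i') - c (j.1, i') * c (i, j.2))) ≤ RingHom.ker f.hom.toRingHom := by
        refine sup_le (sup_le ?_ ?_) (Ideal.span_le.mpr ?_)
        · refine (hJ B f).mp ⟨x.1, ?_⟩
          convert C.smul h (isUnit_of_mul_isUnit_right hu) using 1
          ext j
          rw [e, mul_comm]
        · refine (hJ' B f).mp ⟨x.2, ?_⟩
          convert D.smul h' (isUnit_of_mul_isUnit_left hu) using 1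
          ext j
          rw [e]
        · rintro _ ⟨j, rfl⟩
          change f.hom _ = 0
          rw [map_sub, map_mul, map_mul, e, e, e, e]
          ring
      exact fun a ha => h1 ha
    · obtain ⟨x, hx⟩ := (hJ B f).mpr fun a ha =>
        hf a (le_sup_left (α := Ideal A) (le_sup_left (α := Ideal A) ha))
      obtain ⟨x', hx'⟩ := (hJ' B f).mpr fun a ha =>
        hf a (le_sup_left (α := Ideal A) (le_sup_right (α := Ideal A) ha))
      obtain ⟨v, hv⟩ := (hi.map f.hom).exists_left_inv
      refine ⟨(x, x'), _, _, C.smul hx (IsUnit.of_mul_eq_one _ hv), hx', fun j => ?_⟩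
      have h2 := hf (c j * c (i, i') - c (j.1, i') * c (i, j.2))
        (le_sup_right (α := Ideal A) (Ideal.subset_span ⟨j, rfl⟩))
      rw [map_sub, map_mul, map_mul] at h2
      linear_combination v * h2 - f.hom (c j) * hv

end Product

/-- A Zariski sheaf with homogeneous coordinates is represented by a projective scheme. -/
theorem Coordinates.exists_projective {F : CommAlgCat.{u} K ⥤ Type u} {ι : Type} [Finite ι]
    [Nonempty ι] (C : Coordinates F ι) (hF : IsZariskiSheaf F) :
    ∃ M : ModuliScheme F, IsProjective M.scheme := by
  have : Fintype ι := Fintype.ofFinite ι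
  obtain ⟨N, hN⟩ : ∃ N, Fintype.card ι = N + 1 := Nat.exists_eq_succ_of_ne_zero Fintype.card_ne_zero
  obtain ⟨M, i, hi, -⟩ := (C.reindex (Fintype.equivFinOfCardEq hN).symm).exists_moduli hF
  exact ⟨M, N, i, hi⟩

section Pluecker

variable {V : Type u} [AddCommGroup V] [Module K V] [Module.Finite K V] {n k : ℕ}
  (b : Module.Basis (Fin n) K V)

/-- The maximal minors of a family of vectors. -/
def minor {A : CommAlgCat.{u} K} (M : Fin k → A ⊗[K] V) (J : Fin k → Fin n) : A :=
  Matrix.det (Matrix.of fun i j => crd b A (M i) (J j))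

theorem minor_push {A B : CommAlgCat.{u} K} (f : A ⟶ B) (M : Fin k → A ⊗[K] V)
    (J : Fin k → Fin n) : minor b (fun i => push f.hom (M i)) J = f.hom (minor b M J) := by
  rw [minor, minor, AlgHom.map_det]
  congr 1
  ext i j
  exact crd_push b f.hom (M i) (J j)

theorem minor_sum {A : CommAlgCat.{u} K} (T : Matrix (Fin k) (Fin k) A) (M : Fin k → A ⊗[K] V)
    (J : Fin k → Fin n) :
    minor b (fun i => ∑ l, T i l • M l) J = T.det * minor b M J := by
  rw [minor, minor, ← Matrix.det_mul]
  congr 1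
  ext i j
  simp [Matrix.mul_apply]

/-- Plücker coordinates of a point of the Grassmannian. -/
def PlueckerRel {A : CommAlgCat.{u} K} (N : (Gr V (Module.finrank K V - k)).obj A)
    (c : (Fin k → Fin n) → A) : Prop :=
  ∃ (M : Fin k → A ⊗[K] V) (a : A), IsUnit a ∧ N.toSubmodule = Submodule.span A (Set.range M) ∧
    (∃ J, IsUnit (c J)) ∧ ∀ J, c J = a * minor b M J

variable {b}

theorem PlueckerRel.exists_unit {A : CommAlgCat.{u} K}
    {N : (Gr V (Module.finrank K V - k)).obj A} {c c' : (Fin k → Fin n) → A}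
    (h : PlueckerRel b N c) (h' : PlueckerRel b N c') :
    ∃ a : A, IsUnit a ∧ ∀ i, c' i = a * c i := by
  obtain ⟨M, a, ha, hM, -, e⟩ := h
  obtain ⟨M', a', ha', hM', ⟨J, hJ⟩, e'⟩ := h'
  have h1 (i) : M' i ∈ Submodule.span A (Set.range M) := by
    rw [← hM, hM']
    exact Submodule.subset_span ⟨i, rfl⟩
  choose T hT using fun i => (Submodule.mem_span_range_iff_exists_fun A).mp (h1 i)
  obtain ⟨v, hv⟩ := ha.exists_left_inv
  have h2 (I) : c' I = a' * Matrix.det (Matrix.of T) * v * c I := by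
    have h3 := minor_sum b (Matrix.of T) M I
    have h4 : (fun i => ∑ l, Matrix.of T i l • M l) = M' := funext hT
    rw [h4] at h3
    rw [e, e', h3]
    linear_combination (-a' * Matrix.det (Matrix.of T) * minor b M I) * hv
  refine ⟨_, ?_, h2⟩
  rw [h2] at hJ
  exact isUnit_of_mul_isUnit_left hJ

theorem PlueckerRel.exists_adjugate {A : CommAlgCat.{u} K}
    {M : Fin k → A ⊗[K] V} {a : A} {c : (Fin k → Fin n) → A}
    (e : ∀ J, c J = a * minor b M J) (I : Fin k → Fin n) (i : Fin k) :
    (crd b A).symm (fun l => c (Function.update I i l)) =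
      a • ∑ l, (Matrix.of fun i j => crd b A (M i) (I j)).adjugate i l • M l := by
  apply (crd b A).injective
  rw [LinearEquiv.apply_symm_apply]
  ext j
  have h1 : minor b M (Function.update I i j) = Matrix.cramer
      (Matrix.of fun i j => crd b A (M i) (I j)) (fun l => crd b A (M l) j) i := by
    rw [Matrix.cramer_apply, minor]
    congr 1
    ext l m
    by_cases hm : m = i
    · subst hm
      simp
    · simp [hm]
  rw [e, h1, Matrix.cramer_eq_adjugate_mulVec]
  simp [Matrix.mulVec, dotProduct]

theorem PlueckerRel.eq_span {A : CommAlgCat.{u} K}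
    {N : (Gr V (Module.finrank K V - k)).obj A} {c : (Fin k → Fin n) → A}
    (h : PlueckerRel b N c) {I : Fin k → Fin n} (hI : IsUnit (c I)) :
    N.toSubmodule = Submodule.span A
      (Set.range fun i => (crd b A).symm (fun l => c (Function.update I i l))) := by
  obtain ⟨M, a, ha, hM, -, e⟩ := h
  rw [hM]
  let D : Matrix (Fin k) (Fin k) A := Matrix.of fun i j => crd b A (M i) (I j)
  have hc : c I = a * D.det := e I
  apply le_antisymm
  · rw [Submodule.span_le]
    rintro _ ⟨l, rfl⟩
    have h1 : ∑ i, D l i • (crd b A).symm (fun l => c (Function.update I i l)) = c I • M l := by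
      simp_rw [PlueckerRel.exists_adjugate e, smul_comm _ a]
      rw [← Finset.smul_sum]
      simp_rw [Finset.smul_sum, smul_smul]
      rw [Finset.sum_comm]
      simp_rw [← Finset.sum_smul]
      have h2 (j) : ∑ i, D l i * D.adjugate i j = if l = j then D.det else 0 := by
        rw [← Matrix.mul_apply, Matrix.mul_adjugate]
        simp [Matrix.one_apply]
      simp_rw [← Finset.mul_sum]
      change ∑ j, (a * ∑ i, D l i * D.adjugate i j) • M j = _
      simp_rw [h2]
      simp [hc]
    obtain ⟨v, hv⟩ := hI.exists_left_inv
    have h3 : M l = v • c I • M l := by rw [smul_smul, hv, one_smul]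
    rw [SetLike.mem_coe, h3, ← h1]
    exact Submodule.smul_mem _ _ (sum_mem fun i _ => Submodule.smul_mem _ _
      (Submodule.subset_span ⟨i, rfl⟩))
  · rw [Submodule.span_le]
    rintro _ ⟨i, rfl⟩
    dsimp only
    rw [PlueckerRel.exists_adjugate e]
    exact Submodule.smul_mem _ _ (sum_mem fun i _ => Submodule.smul_mem _ _
      (Submodule.subset_span ⟨i, rfl⟩))

theorem PlueckerRel.update_apply {A : CommAlgCat.{u} K}
    {N : (Gr V (Module.finrank K V - k)).obj A} {c : (Fin k → Fin n) → A}
    (h : PlueckerRel b N c) (I : Fin k → Fin n) (i j : Fin k) :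
    c (Function.update I i (I j)) = if i = j then c I else 0 := by
  obtain ⟨M, a, ha, hM, -, e⟩ := h
  split_ifs with hij
  · subst hij
    rw [Function.update_eq_self]
  · rw [e, minor, Matrix.det_zero_of_column_eq hij, mul_zero]
    intro l
    simp [Function.update_of_ne (Ne.symm hij)]

/-- Plücker coordinates. -/
def plueckerCoordinates (b : Module.Basis (Fin n) K V) (hk : k ≤ Module.finrank K V) :
    Coordinates (Gr (K := K) V (Module.finrank K V - k)) (Fin k → Fin n) where
  rel N c := PlueckerRel b N c
  map := by
    rintro A B N c ⟨M, a, ha, hM, ⟨J, hJ⟩, e⟩ f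
    refine ⟨fun i => push f.hom (M i), f.hom a, ha.map f.hom, map_toSubmodule_of_span f.hom hM,
      ⟨J, hJ.map f.hom⟩, fun I => ?_⟩
    rw [minor_push]
    exact (congrArg f.hom (e I)).trans (map_mul _ _ _)
  smul := by
    rintro A N c ⟨M, a, ha, hM, ⟨J, hJ⟩, e⟩ a' ha'
    exact ⟨M, a' * a, ha'.mul ha, hM, ⟨J, ha'.mul hJ⟩, fun I => (congrArg _ (e I)).trans (mul_assoc _ _ _).symm⟩
  isUnit := by
    rintro A N c ⟨M, a, ha, hM, hJ, e⟩
    exact hJ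
  exists_unit := PlueckerRel.exists_unit
  eq_of_rel := by
    intro A N N' c h h'
    obtain ⟨J, hJ⟩ : ∃ J, IsUnit (c J) := h.choose_spec.choose_spec.2.2.1
    exact Module.Grassmannian.ext ((h.eq_span hJ).trans (h'.eq_span hJ).symm)
  exists_local := by
    intro A N p
    obtain ⟨M, I, hM, hI⟩ := exists_minor b hk N p
    refine ⟨_, hI, minor b (fun i => push (toLoc A _).hom (M i)), _, 1, isUnit_one, ?_, ⟨I, ?_⟩,
      fun J => (one_mul _).symm⟩
    · refine (eq_span_of_isUnit_minor b _ _ I (fun i => map_smul_mem_map _ _ (hM i)) ?_).1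
      have := minor_push b (toLoc A (Matrix.det (Matrix.of fun i j => crd b A (M i) (I j)))) M I
      rw [minor] at this
      rw [this]
      exact isUnit_toLoc A _
    · rw [minor_push]
      exact isUnit_toLoc A _
  closed := by
    rintro A c ⟨I, hI⟩
    obtain ⟨w, hw⟩ := hI.exists_left_inv
    let m (i : Fin k) : A ⊗[K] V := (crd b A).symm fun l => w * c (Function.update I i l)
    refine ⟨Ideal.span (Set.range fun z : Fin k × Fin k =>
      c (Function.update I z.1 (I z.2)) - if z.1 = z.2 then c I else 0) ⊔
      Ideal.span (Set.range fun J => c J - c I * minor b m J), fun B f => ?_⟩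
    have key (h : ∀ i j, f.hom (c (Function.update I i (I j))) =
        if i = j then f.hom (c I) else 0) (i j) :
        crd b B (push f.hom (m i)) (I j) = if i = j then 1 else 0 := by
      rw [crd_push]
      simp only [m, LinearEquiv.apply_symm_apply, map_mul]
      rw [h]
      split_ifs
      · rw [← map_mul, hw, _root_.map_one]
      · rw [mul_zero]
    have key' (h : ∀ i j, f.hom (c (Function.update I i (I j))) =
        if i = j then f.hom (c I) else 0) : minor b (fun i => push f.hom (m i)) I = 1 := by
      rw [minor]
      convert Matrix.det_one (n := Fin k) (R := B)
      ext i j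
      rw [Matrix.of_apply, key h, Matrix.one_apply]
    constructor
    · rintro ⟨N, hN⟩
      have h1 : ∀ i j, f.hom (c (Function.update I i (I j))) =
        if i = j then f.hom (c I) else 0 := fun i j => hN.update_apply I i j
      have h2 := hN.eq_span (hI.map f.hom)
      have hw' : f.hom w * f.hom (c I) = 1 := by rw [← map_mul, hw, _root_.map_one]
      have hm (i) : push f.hom (m i) = f.hom w •
          (crd b B).symm (fun l => f.hom (c (Function.update I i l))) := by
        rw [crd_symm_push, ← map_smul]
        congr 1
        ext l
        simp
      have h3 : N.toSubmodule = Submodule.span B (Set.range fun i => push f.hom (m i)) := by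
        rw [h2]
        apply le_antisymm
        · rw [Submodule.span_le]
          rintro _ ⟨i, rfl⟩
          have : (crd b B).symm (fun l => f.hom (c (Function.update I i l))) =
              f.hom (c I) • push f.hom (m i) := by
            rw [hm, smul_smul, mul_comm, hw', one_smul]
          dsimp only
          rw [SetLike.mem_coe, this]
          exact Submodule.smul_mem _ _ (Submodule.subset_span ⟨i, rfl⟩)
        · rw [Submodule.span_le]
          rintro _ ⟨i, rfl⟩
          dsimp only
          rw [SetLike.mem_coe, hm]
          exact Submodule.smul_mem _ _ (Submodule.subset_span ⟨i, rfl⟩)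
      have h4 : PlueckerRel b N fun J => f.hom (c I) * minor b (fun i => push f.hom (m i)) J :=
        ⟨_, f.hom (c I), hI.map f.hom, h3, ⟨I, by
          change IsUnit (f.hom (c I) * minor b (fun i => push f.hom (m i)) I)
          rw [key' h1, mul_one]
          exact hI.map f.hom⟩, fun J => rfl⟩
      obtain ⟨a, -, ea⟩ := hN.exists_unit h4
      have h5 := ea I
      simp only [key' h1, mul_one] at h5
      have h6 : a = 1 := by linear_combination (a - 1) * (-hw') - f.hom w * h5
      have h7 : (Ideal.span (Set.range fun z : Fin k × Fin k =>
          c (Function.update I z.1 (I z.2)) - if z.1 = z.2 then c I else 0) ⊔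
          Ideal.span (Set.range fun J => c J - c I * minor b m J)) ≤
          RingHom.ker f.hom.toRingHom := by
        refine sup_le (Ideal.span_le.mpr ?_) (Ideal.span_le.mpr ?_)
        · rintro _ ⟨⟨i, j⟩, rfl⟩
          change f.hom _ = 0
          rw [map_sub, h1, apply_ite f.hom, map_zero, sub_self]
        · rintro _ ⟨J, rfl⟩
          change f.hom _ = 0
          rw [map_sub, map_mul, ← minor_push, ea J, h6, one_mul, sub_self]
      exact fun a ha => h7 ha
    · intro hf
      have h1 : ∀ i j, f.hom (c (Function.update I i (I j))) =
          if i = j then f.hom (c I) else 0 := by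
        intro i j
        have := hf _ (le_sup_left (α := Ideal A) (Ideal.subset_span ⟨(i, j), rfl⟩))
        rw [map_sub, apply_ite f.hom, map_zero, sub_eq_zero] at this
        exact this
      refine ⟨ofBasis (fun i => push f.hom (m i)) (LinearMap.funLeft B B I ∘ₗ
        (crd b B).toLinearMap) fun i => ?_, _, f.hom (c I), hI.map f.hom, rfl,
        ⟨I, hI.map f.hom⟩, fun J => ?_⟩
      · ext j
        change crd b B (push f.hom (m i)) (I j) = _
        rw [key h1, Pi.single_apply]
        exact if_congr eq_comm rfl rfl
      · have := hf _ (le_sup_right (α := Ideal A) (Ideal.subset_span ⟨J, rfl⟩))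
        rw [map_sub, map_mul, ← minor_push, sub_eq_zero] at this
        exact this

end Pluecker

end

end OrthogonalGrassmannian

namespace OrthogonalGrassmannian

noncomputable section

variable {K : Type u} [Field K]

section Linear

variable {V V' : Type u} [AddCommGroup V] [Module K V] [AddCommGroup V'] [Module K V']

theorem baseChange_push {A B : Type u} [CommRing A] [Algebra K A] [CommRing B] [Algebra K B]
    (p : V →ₗ[K] V') (f : A →ₐ[K] B) (x : A ⊗[K] V) :
    p.baseChange B (push f x) = push f (p.baseChange A x) := by
  induction x with
  | zero => simp
  | tmul a v => simp
  | add x y hx hy => simp only [map_add, hx, hy]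

variable [Module.Finite K V'] {m m' : ℕ}

theorem isClosedCond_le (p : V →ₗ[K] V') : IsClosedCond (prodFunctor (Gr V m) (Gr V' m'))
    (fun A x => (x.1 : Module.Grassmannian A (A ⊗[K] V) m).toSubmodule ≤
      (x.2 : Module.Grassmannian A (A ⊗[K] V') m').toSubmodule.comap (p.baseChange A)) := by
  rintro A ⟨N, N'⟩
  obtain ⟨n, φ, h⟩ := exists_equations (A := A) N'
  refine ⟨Ideal.span {a | ∃ i, ∃ u ∈ N.toSubmodule, a = φ i (p.baseChange A u)}, fun B f =>
    ⟨fun hle a ha => ?_, fun hf => ?_⟩⟩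
  · refine (Ideal.span_le.mpr ?_ : _ ≤ RingHom.ker f.hom.toRingHom) ha
    rintro _ ⟨i, u, hu, rfl⟩
    refine (h B f.hom _).mp ?_ i
    rw [← baseChange_push]
    exact hle (map_smul_mem_map f.hom N hu)
  · refine (map_eq_span f.hom N).trans_le ?_
    rw [Submodule.span_le]
    rintro _ ⟨u, hu, rfl⟩
    rw [SetLike.mem_coe, Submodule.mem_comap]
    change p.baseChange B (push f.hom u) ∈ _
    rw [baseChange_push]
    exact (h B f.hom _).mpr fun i => hf _ (Ideal.subset_span ⟨i, u, hu, rfl⟩)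

theorem isClosedCond_mem (w : V') : IsClosedCond (Gr V' m')
    (fun A x => (1 : A) ⊗ₜ[K] w ∈ (x : Module.Grassmannian A (A ⊗[K] V') m').toSubmodule) := by
  intro A N
  obtain ⟨n, φ, h⟩ := exists_equations (A := A) N
  refine ⟨Ideal.span (Set.range fun i => φ i (1 ⊗ₜ w)), fun B f => ?_⟩
  have h1 := h B f.hom (1 ⊗ₜ w)
  rw [push_tmul, _root_.map_one] at h1
  refine h1.trans ⟨fun hi a ha => ?_, fun hf i => hf _ (Ideal.subset_span ⟨i, rfl⟩)⟩
  refine (Ideal.span_le.mpr ?_ : _ ≤ RingHom.ker f.hom.toRingHom) ha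
  rintro _ ⟨i, rfl⟩
  exact hi i

end Linear

variable [CharZero K] {V : Type u} [AddCommGroup V] [Module K V] {q : QuadraticForm K V}

section Forms

variable {A B : Type u} [CommRing A] [Algebra K A] [CommRing B] [Algebra K B]

theorem isUnit_two (A : Type u) [CommRing A] [Algebra K A] : IsUnit (2 : A) := by
  have := (isUnit_iff_ne_zero.mpr (two_ne_zero (α := K))).map (algebraMap K A)
  rwa [map_ofNat] at this

theorem polar_self_eq (x : A ⊗[K] V) : QuadraticMap.polar (formBaseChange q A) x x =
    2 * formBaseChange q A x := by
  rw [QuadraticMap.polar_self, two_smul, two_mul]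

theorem formBaseChange_push (f : A →ₐ[K] B) (x : A ⊗[K] V) :
    formBaseChange q B (push f x) = f (formBaseChange q A x) := by
  apply (isUnit_two (K := K) B).mul_left_cancel
  rw [← polar_self_eq, push, polar_rTensor, polar_self_eq, map_mul, map_ofNat]

theorem IsIsotropic.polar_eq_zero {U : Submodule A (A ⊗[K] V)} (hU : IsIsotropic q A U)
    {x y : A ⊗[K] V} (hx : x ∈ U) (hy : y ∈ U) :
    QuadraticMap.polar (formBaseChange q A) x y = 0 := by
  rw [QuadraticMap.polar, hU _ hx, hU _ hy, hU _ (add_mem hx hy)]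
  simp

/-- A submodule is isotropic if its generators are isotropic and orthogonal. -/
theorem isIsotropic_span {S : Set (A ⊗[K] V)}
    (h : ∀ x ∈ S, ∀ y ∈ S, QuadraticMap.polar (formBaseChange q A) x y = 0) :
    IsIsotropic q A (Submodule.span A S) := by
  have key : ∀ y ∈ Submodule.span A S, ∀ z ∈ Submodule.span A S,
      QuadraticMap.polar (formBaseChange q A) y z = 0 := by
    intro y hy z hz
    induction hy, hz using Submodule.span_induction₂ with
    | mem_mem x y hx hy => exact h x hx y hy
    | zero_left => simp
    | zero_right => simp
    | add_left x y z _ _ _ h1 h2 => rw [QuadraticMap.polar_add_left, h1, h2, add_zero]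
    | add_right x y z _ _ _ h1 h2 => rw [QuadraticMap.polar_add_right, h1, h2, add_zero]
    | smul_left r x y _ _ h => rw [QuadraticMap.polar_smul_left, h, smul_zero]
    | smul_right r x y _ _ h => rw [QuadraticMap.polar_smul_right, h, smul_zero]
  intro u hu
  have := key u hu u hu
  rw [polar_self_eq] at this
  exact (isUnit_two (K := K) A).mul_right_eq_zero.mp this

end Forms

theorem isClosedCond_isIsotropic (q : QuadraticForm K V) {m : ℕ} : IsClosedCond (Gr V m)
    (fun A x => IsIsotropic q A (x : Module.Grassmannian A (A ⊗[K] V) m).toSubmodule) := by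
  intro A N
  refine ⟨Ideal.span {a | ∃ u ∈ N.toSubmodule, a = formBaseChange q A u}, fun B f =>
    ⟨fun hle a ha => ?_, fun hf => ?_⟩⟩
  · refine (Ideal.span_le.mpr ?_ : _ ≤ RingHom.ker f.hom.toRingHom) ha
    rintro _ ⟨u, hu, rfl⟩
    refine (formBaseChange_push f.hom u).symm.trans ?_
    exact hle _ (map_smul_mem_map f.hom N hu)
  · have h1 := map_eq_span f.hom N
    change IsIsotropic q B (Module.Grassmannian.map f.hom N).toSubmodule
    rw [h1]
    apply isIsotropic_span
    rintro _ ⟨u, hu, rfl⟩ _ ⟨w, hw, rfl⟩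
    have h2 (z) (hz : z ∈ N.toSubmodule) : f.hom (formBaseChange q A z) = 0 :=
      hf _ (Ideal.subset_span ⟨z, hz, rfl⟩)
    rw [polar_rTensor, QuadraticMap.polar, map_sub, map_sub, h2 _ hu, h2 _ hw, h2 _ (add_mem hu hw)]
    simp

section Moduli

variable [Module.Finite K V] {k : ℕ}

theorem OGr_map_val {A B : CommAlgCat.{u} K} (f : A ⟶ B) (x : (OGr q k).obj A) :
    ((OGr q k).map f x).1 = (Gr V _).map f x.1 := rfl

theorem OGr_isZariskiSheaf : IsZariskiSheaf (OGr q k) :=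
  Gr_isZariskiSheaf.sub (fun A x => x.1) (fun _ _ _ _ => rfl) (fun _ => Subtype.val_injective)
    (isClosedCond_isIsotropic q) fun A x => ⟨fun h => ⟨⟨x, h⟩, rfl⟩, by rintro ⟨z, rfl⟩; exact z.2⟩

theorem OGr_coordinates (hk : k ≤ Module.finrank K V) :
    Nonempty (Coordinates (OGr q k) (Fin k → Fin (Module.finrank K V))) :=
  ⟨(plueckerCoordinates (Module.finBasis K V) hk).sub (fun A x => x.1) (fun _ _ _ _ => rfl)
    (fun _ => Subtype.val_injective)
    (isClosedCond_isIsotropic q) fun A x => ⟨fun h => ⟨⟨x, h⟩, rfl⟩, by rintro ⟨z, rfl⟩; exact z.2⟩⟩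

theorem nonempty_index {n : ℕ} (hk : k ≤ n) : Nonempty (Fin k → Fin n) :=
  ⟨fun i => ⟨i, i.2.trans_le hk⟩⟩

theorem exists_moduli_OGr (q : QuadraticForm K V) (hk : k ≤ Module.finrank K V) :
    ∃ M : ModuliScheme (OGr q k), IsProjective M.scheme := by
  obtain ⟨C⟩ := OGr_coordinates (q := q) hk
  have := nonempty_index hk
  exact C.exists_projective OGr_isZariskiSheaf

variable {V' : Type u} [AddCommGroup V'] [Module K V'] [Module.Finite K V']
  {q' : QuadraticForm K V'} {k' : ℕ}

theorem isClosedCond_OGr_le (p : V →ₗ[K] V') : IsClosedCond (prodFunctor (OGr q k) (OGr q' k'))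
    (fun A x => subspace x.1 ≤ (subspace x.2).comap (p.baseChange A)) :=
  (isClosedCond_le p).of_iso (G := prodFunctor (OGr q k) (OGr q' k'))
    { app := fun A => ↾fun x => (x.1.1, x.2.1)
      naturality := fun A B f => by
        apply ConcreteCategory.hom_ext
        intro x
        rfl }

theorem exists_moduli_TOGr (q : QuadraticForm K V) (L : Submodule K V)
    (q' : QuadraticForm K (V ⧸ L)) (hk : k ≤ Module.finrank K V)
    (hk' : k ≤ Module.finrank K (V ⧸ L)) :
    ∃ M : ModuliScheme (TOGr q L q' k), IsProjective M.scheme := by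
  obtain ⟨C⟩ := OGr_coordinates (q := q) hk
  obtain ⟨D⟩ := OGr_coordinates (q := q') hk'
  have := nonempty_index hk
  have := nonempty_index hk'
  have hr (A : CommAlgCat.{u} K) (x : (prodFunctor (OGr q k) (OGr q' k)).obj A) :
      subspace x.1 ≤ (subspace x.2).comap (L.mkQ.baseChange A) ↔
        ∃ z : (TOGr q L q' k).obj A, z.1 = x :=
    ⟨fun h => ⟨⟨x, h⟩, rfl⟩, by rintro ⟨z, rfl⟩; exact z.2⟩
  exact ((C.prod D).sub (G := TOGr q L q' k) (fun A x => x.1) (fun _ _ _ _ => rfl)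
    (fun _ => Subtype.val_injective) (isClosedCond_OGr_le L.mkQ) hr).exists_projective
    ((OGr_isZariskiSheaf.prod OGr_isZariskiSheaf).sub (fun A x => x.1) (fun _ _ _ _ => rfl)
    (fun _ => Subtype.val_injective) (isClosedCond_OGr_le L.mkQ) hr)

theorem exists_moduli_OFl (q : QuadraticForm K V) (hk : k ≤ Module.finrank K V)
    (hk' : k' ≤ Module.finrank K V) :
    ∃ M : ModuliScheme (OFl q k k'), IsProjective M.scheme := by
  obtain ⟨C⟩ := OGr_coordinates (q := q) hk
  obtain ⟨D⟩ := OGr_coordinates (q := q) hk'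
  have := nonempty_index hk
  have := nonempty_index hk'
  have hr (A : CommAlgCat.{u} K) (x : (prodFunctor (OGr q k) (OGr q k')).obj A) :
      subspace x.1 ≤ (subspace x.2).comap (LinearMap.id.baseChange A) ↔
        ∃ z : (OFl q k k').obj A, z.1 = x := by
    rw [LinearMap.baseChange_id, Submodule.comap_id]
    exact ⟨fun h => ⟨⟨x, h⟩, rfl⟩, by rintro ⟨z, rfl⟩; exact z.2⟩
  exact ((C.prod D).sub (G := OFl q k k') (fun A x => x.1) (fun _ _ _ _ => rfl)
    (fun _ => Subtype.val_injective) (isClosedCond_OGr_le LinearMap.id) hr).exists_projective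
    ((OGr_isZariskiSheaf.prod OGr_isZariskiSheaf).sub (fun A x => x.1) (fun _ _ _ _ => rfl)
    (fun _ => Subtype.val_injective) (isClosedCond_OGr_le LinearMap.id) hr)

end Moduli

section Cone

variable {v : V} (hv : LinearMap.ker (QuadraticMap.polarBilin q) = Submodule.span K {v})

theorem projection_surjective (L : Submodule K V) (A : Type u) [CommRing A] [Algebra K A] :
    Function.Surjective (projection L A) :=
  LinearMap.baseChange_surjective A (Submodule.mkQ_surjective L)

theorem projection_push (L : Submodule K V) {A B : Type u} [CommRing A] [Algebra K A] [CommRing B]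
    [Algebra K B] (f : A →ₐ[K] B) (x : A ⊗[K] V) :
    projection L B (push f x) = push f (projection L A x) := baseChange_push _ f x

theorem projection_eq_zero {A : Type u} [CommRing A] [Algebra K A] {x : A ⊗[K] V} :
    projection (Submodule.span K {v}) A x = 0 ↔ ∃ a : A, x = a ⊗ₜ v := by
  constructor
  · intro hx
    obtain ⟨s, hs⟩ := (Submodule.span K {v}).mkQ.exists_rightInverse_of_surjective
      (Submodule.range_mkQ _)
    have key : ∀ x : A ⊗[K] V, ∃ a : A,
        x = s.baseChange A (projection (Submodule.span K {v}) A x) + a ⊗ₜ v := by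
      intro x
      induction x with
      | zero => exact ⟨0, by simp⟩
      | add x y hx hy =>
        obtain ⟨a, ha⟩ := hx
        obtain ⟨b, hb⟩ := hy
        refine ⟨a + b, ?_⟩
        rw [map_add, map_add, TensorProduct.add_tmul]
        nth_rw 1 [ha, hb]
        abel
      | tmul a w =>
        have h1 : w - s ((Submodule.span K {v}).mkQ w) ∈ Submodule.span K {v} := by
          rw [← Submodule.Quotient.mk_eq_zero, ← Submodule.mkQ_apply, map_sub, sub_eq_zero]
          exact (LinearMap.congr_fun hs _).symm
        obtain ⟨c, hc⟩ := Submodule.mem_span_singleton.mp h1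
        refine ⟨c • a, ?_⟩
        rw [TensorProduct.smul_tmul, hc, projection, LinearMap.baseChange_tmul,
          LinearMap.baseChange_tmul, ← TensorProduct.tmul_add]
        simp
    obtain ⟨a, ha⟩ := key x
    rw [hx, map_zero, zero_add] at ha
    exact ⟨a, ha⟩
  · rintro ⟨a, rfl⟩
    rw [projection, LinearMap.baseChange_tmul, Submodule.mkQ_apply,
      (Submodule.Quotient.mk_eq_zero _).mpr (Submodule.mem_span_singleton_self v),
      TensorProduct.tmul_zero]

theorem polar_projection {A : Type u} [CommRing A] [Algebra K A] (x y : A ⊗[K] V) :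
    QuadraticMap.polar (formBaseChange (reducedForm hv) A) (projection _ A x) (projection _ A y) =
      QuadraticMap.polar (formBaseChange q A) x y := by
  induction x with
  | zero => simp
  | add x x' hx hx' => simp only [map_add, QuadraticMap.polar_add_left, hx, hx']
  | tmul a w =>
    induction y with
    | zero => simp
    | add x x' hx hx' => simp only [map_add, QuadraticMap.polar_add_right, hx, hx']
    | tmul b w' =>
      rw [projection, LinearMap.baseChange_tmul, LinearMap.baseChange_tmul,
        polar_formBaseChange_tmul, polar_formBaseChange_tmul]
      rfl

theorem formBaseChange_projection {A : Type u} [CommRing A] [Algebra K A] (x : A ⊗[K] V) :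
    formBaseChange (reducedForm hv) A (projection _ A x) = formBaseChange q A x := by
  apply (isUnit_two (K := K) A).mul_left_cancel
  rw [← polar_self_eq, polar_projection, polar_self_eq]

theorem subspace_ext {W : Type u} [AddCommGroup W] [Module K W] {p : QuadraticForm K W} {k : ℕ}
    {A : CommAlgCat.{u} K} {x y : (OGr p k).obj A} (h : subspace x = subspace y) : x = y :=
  Subtype.ext (Module.Grassmannian.ext h)

theorem subspace_eq_of_le {W : Type u} [AddCommGroup W] [Module K W] [Module.Finite K W]
    {p : QuadraticForm K W} {k : ℕ}
    {A : CommAlgCat.{u} K} {x y : (OGr p k).obj A} (h : subspace x ≤ subspace y) : x = y :=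
  Subtype.ext (eq_of_toSubmodule_le h)

/-- The submodules `U` and `U / (A ⊗ L)` have isomorphic quotients. -/
def quotEquiv {L : Submodule K V} {A : Type u} [CommRing A] [Algebra K A]
    (W : Submodule A (A ⊗[K] (V ⧸ L))) (U : Submodule A (A ⊗[K] V))
    (h : U = W.comap (projection L A)) : ((A ⊗[K] V) ⧸ U) ≃ₗ[A] ((A ⊗[K] (V ⧸ L)) ⧸ W) :=
  (Submodule.quotEquivOfEq U (LinearMap.ker (W.mkQ ∘ₗ projection L A)) (by
    rw [LinearMap.ker_comp, Submodule.ker_mkQ, h])) ≪≫ₗ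
  (W.mkQ ∘ₗ projection L A).quotKerEquivOfSurjective
    ((Submodule.mkQ_surjective W).comp (projection_surjective L A))

variable [Module.Finite K V] {k : ℕ}

theorem finrank_quotient_span (hv0 : v ≠ 0) : Module.finrank K (V ⧸ Submodule.span K {v}) + 1 =
    Module.finrank K V := by
  have := Submodule.finrank_quotient_add_finrank (Submodule.span K {v})
  rwa [finrank_span_singleton hv0] at this

/-- The preimage in `V` of an isotropic subspace of the quotient by the kernel. -/
def preimage (hk : 1 ≤ k) (hv0 : v ≠ 0) {A : CommAlgCat.{u} K} (W : (OGr (reducedForm hv) (k - 1)).obj A) :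
    (OGr q k).obj A :=
  have e := quotEquiv (subspace W) _ rfl
  ⟨{  toSubmodule := (subspace W).comap (projection _ A)
      finite_quotient :=
        have := W.1.finite_quotient
        Module.Finite.equiv e.symm
      projective_quotient :=
        have : Module.Projective A (_ ⧸ subspace W) := W.1.projective_quotient
        Module.Projective.of_equiv e.symm
      rankAtStalk_eq := fun p => by
        rw [Module.rankAtStalk_eq_of_equiv e]
        refine (W.1.rankAtStalk_eq p).trans ?_
        have := finrank_quotient_span (K := K) hv0
        omega }, fun u hu => by
    rw [← formBaseChange_projection hv]
    exact W.2 _ hu⟩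

theorem subspace_preimage (hk : 1 ≤ k) (hv0 : v ≠ 0) {A : CommAlgCat.{u} K} (W : (OGr (reducedForm hv) (k - 1)).obj A) :
    subspace (preimage hv hk hv0 W) = (subspace W).comap (projection _ A) := rfl

theorem preimage_map (hk : 1 ≤ k) (hv0 : v ≠ 0) {A B : CommAlgCat.{u} K} (f : A ⟶ B)
    (W : (OGr (reducedForm hv) (k - 1)).obj A) :
    preimage hv hk hv0 ((OGr _ _).map f W) = (OGr _ _).map f (preimage hv hk hv0 W) := by
  refine (subspace_eq_of_le ?_).symm
  rw [subspace_map, Submodule.span_le]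
  rintro _ ⟨u, hu, rfl⟩
  rw [subspace_preimage, SetLike.mem_coe, Submodule.mem_comap]
  change projection _ _ (push f.hom u) ∈ _
  rw [projection_push]
  exact map_mem_subspace f W hu

theorem comap_map_projection {A : CommAlgCat.{u} K} {U : Submodule A (A ⊗[K] V)}
    (h : (1 : A) ⊗ₜ[K] v ∈ U) :
    (U.map (projection (Submodule.span K {v}) A)).comap (projection _ A) = U := by
  rw [Submodule.comap_map_eq, sup_eq_left]
  intro x hx
  obtain ⟨a, rfl⟩ := projection_eq_zero.mp hx
  have : a ⊗ₜ[K] v = a • ((1 : A) ⊗ₜ[K] v) := by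
    rw [TensorProduct.smul_tmul', smul_eq_mul, mul_one]
  rw [this]
  exact Submodule.smul_mem _ _ h

theorem exists_preimage_iff (hk : 1 ≤ k) (hv0 : v ≠ 0) {A : CommAlgCat.{u} K} (U : (OGr q k).obj A) :
    (∃ W, preimage hv hk hv0 W = U) ↔ (1 : A) ⊗ₜ[K] v ∈ subspace U := by
  constructor
  · rintro ⟨W, rfl⟩
    rw [subspace_preimage, Submodule.mem_comap, projection_eq_zero.mpr ⟨1, rfl⟩]
    exact zero_mem _
  · intro h
    have e := quotEquiv ((subspace U).map (projection (Submodule.span K {v}) A)) (subspace U)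
      (comap_map_projection h).symm
    refine ⟨⟨{
      toSubmodule := (subspace U).map (projection _ A)
      finite_quotient :=
        have := U.1.finite_quotient
        Module.Finite.equiv e
      projective_quotient :=
        have : Module.Projective A (_ ⧸ subspace U) := U.1.projective_quotient
        Module.Projective.of_equiv e
      rankAtStalk_eq := fun p => by
        rw [← Module.rankAtStalk_eq_of_equiv e]
        refine (U.1.rankAtStalk_eq p).trans ?_
        have := finrank_quotient_span (K := K) hv0
        omega }, ?_⟩, subspace_ext (comap_map_projection h)⟩
    rintro _ ⟨u, hu, rfl⟩
    rw [formBaseChange_projection]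
    exact U.2 u hu

end Cone

end

end OrthogonalGrassmannian

namespace OrthogonalGrassmannian

noncomputable section

section QuadraticSpaces

variable {K : Type u} [Field K] [CharZero K] {V : Type u} [AddCommGroup V] [Module K V]
  (q : QuadraticForm K V)

/-- The orthogonal complement of a subspace. -/
def perp (I : Submodule K V) : Submodule K V := LinearMap.BilinForm.orthogonal (QuadraticMap.polarBilin q) I

variable {q}

theorem mem_perp {I : Submodule K V} {x : V} : x ∈ perp q I ↔ ∀ y ∈ I, QuadraticMap.polar q y x = 0 :=
  LinearMap.BilinForm.mem_orthogonal_iff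

theorem polar_self_two (x : V) : QuadraticMap.polar q x x = 2 * q x := by
  rw [QuadraticMap.polar_self, two_smul, two_mul]

theorem form_eq_zero_of_polar {x : V} (h : QuadraticMap.polar q x x = 0) : q x = 0 := by
  rw [polar_self_two] at h
  exact (mul_eq_zero.mp h).resolve_left two_ne_zero

theorem form_eq_zero {I : Submodule K V} (hI : I ≤ perp q I) {x : V} (hx : x ∈ I) : q x = 0 :=
  form_eq_zero_of_polar (mem_perp.mp (hI hx) x hx)

theorem le_perp_perp (I : Submodule K V) : I ≤ perp q (perp q I) := by
  intro x hx
  rw [mem_perp]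
  intro y hy
  rw [QuadraticMap.polar_comm]
  exact mem_perp.mp hy x hx

theorem perp_anti {I J : Submodule K V} (h : I ≤ J) : perp q J ≤ perp q I := by
  intro x hx
  rw [mem_perp] at hx ⊢
  exact fun y hy => hx y (h hy)

theorem mem_perp_sup {I J : Submodule K V} {x : V} :
    x ∈ perp q (I ⊔ J) ↔ x ∈ perp q I ∧ x ∈ perp q J := by
  refine ⟨fun h => ⟨perp_anti le_sup_left h, perp_anti le_sup_right h⟩, fun ⟨h, h'⟩ => ?_⟩
  rw [mem_perp]
  intro y hy
  obtain ⟨a, ha, b, hb, rfl⟩ := Submodule.mem_sup.mp hy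
  rw [QuadraticMap.polar_add_left, mem_perp.mp h a ha, mem_perp.mp h' b hb, add_zero]

theorem mem_perp_span_singleton {x y : V} :
    x ∈ perp q (Submodule.span K {y}) ↔ QuadraticMap.polar q y x = 0 := by
  rw [mem_perp]
  refine ⟨fun h => h y (Submodule.mem_span_singleton_self y), fun h z hz => ?_⟩
  obtain ⟨c, rfl⟩ := Submodule.mem_span_singleton.mp hz
  rw [QuadraticMap.polar_smul_left, h, smul_zero]

theorem form_add (x y : V) : q (x + y) = q x + q y + QuadraticMap.polar q x y := by
  rw [QuadraticMap.polar]
  ring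

theorem form_smul (c : K) (x : V) : q (c • x) = c * c * q x := QuadraticMap.map_smul q c x

variable {v : V}

section Kernel

variable (hv : LinearMap.ker (QuadraticMap.polarBilin q) = Submodule.span K {v})

include hv

theorem polar_kernel_left (x : V) : QuadraticMap.polar q v x = 0 := by
  have : v ∈ LinearMap.ker (QuadraticMap.polarBilin q) := by
    rw [hv]
    exact Submodule.mem_span_singleton_self v
  exact LinearMap.congr_fun this x

theorem polar_kernel_right (x : V) : QuadraticMap.polar q x v = 0 := by
  rw [QuadraticMap.polar_comm]
  exact polar_kernel_left hv x

theorem kernel_mem_perp (I : Submodule K V) : v ∈ perp q I :=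
  mem_perp.mpr fun y _ => polar_kernel_right hv y

theorem mem_span_of_polar {x : V} (h : ∀ y, QuadraticMap.polar q x y = 0) :
    x ∈ Submodule.span K {v} := by
  rw [← hv, LinearMap.mem_ker]
  ext y
  exact h y

variable [Module.Finite K V] (hv0 : v ≠ 0)

include hv0

theorem finrank_perp {I : Submodule K V} (hI : v ∈ I) :
    Module.finrank K I + Module.finrank K (perp q I) = Module.finrank K V + 1 := by
  have hr : (QuadraticMap.polarBilin q).IsRefl := fun x y h => by
    rw [QuadraticMap.polarBilin_apply_apply] at h ⊢
    rwa [QuadraticMap.polar_comm]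
  have h1 := LinearMap.BilinForm.finrank_add_finrank_orthogonal hr I
  have h2 : I ⊓ LinearMap.BilinForm.orthogonal (QuadraticMap.polarBilin q) ⊤ = Submodule.span K {v} := by
    apply le_antisymm
    · rintro x ⟨-, hx⟩
      refine mem_span_of_polar hv fun y => ?_
      rw [QuadraticMap.polar_comm]
      exact mem_perp.mp hx y trivial
    · rw [Submodule.span_singleton_le_iff_mem]
      exact ⟨hI, kernel_mem_perp hv ⊤⟩
  rw [h2, finrank_span_singleton hv0] at h1
  exact h1

theorem perp_perp {I : Submodule K V} (hI : v ∈ I) : perp q (perp q I) = I := by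
  refine (Submodule.eq_of_le_of_finrank_eq (le_perp_perp I) ?_).symm
  have h1 := finrank_perp hv hv0 hI
  have h2 := finrank_perp hv hv0 (kernel_mem_perp hv I)
  omega

theorem exists_polar_ne_zero {I : Submodule K V} (hI : v ∈ I) {d : V} (hd : d ∉ I) :
    ∃ y ∈ perp q I, QuadraticMap.polar q y d ≠ 0 := by
  by_contra! h
  apply hd
  rw [← perp_perp hv hv0 hI]
  exact mem_perp.mpr h

/-- The orthogonal complement of a hyperbolic plane in `I^⊥ / I` is not totally isotropic. -/
theorem exists_form_ne_zero {I : Submodule K V} (hvI : v ∈ I)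
    (hn : 2 * Module.finrank K I + 2 ≤ Module.finrank K V) {d d' : V} (hd : d ∈ perp q I)
    (hd' : d' ∈ perp q I) (hq : q d = 0) (hq' : q d' = 0) (hdd : QuadraticMap.polar q d d' ≠ 0) :
    ∃ w ∈ perp q (I ⊔ (Submodule.span K {d} ⊔ Submodule.span K {d'})), q w ≠ 0 := by
  obtain ⟨J, hJ⟩ : ∃ J, J = I ⊔ (Submodule.span K {d} ⊔ Submodule.span K {d'}) := ⟨_, rfl⟩
  have hvJ : v ∈ J := hJ ▸ le_sup_left (α := Submodule K V) hvI
  rw [← hJ]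
  by_contra! h
  have h1 : perp q J ≤ J := by
    intro x hx
    rw [← perp_perp hv hv0 hvJ, mem_perp]
    intro y hy
    have := form_add (q := q) y x
    rw [h _ (add_mem hy hx), h _ hx, h _ hy] at this
    simpa using this.symm
  have h2 : perp q J ≤ I := by
    intro x hx
    have hxJ := h1 hx
    rw [hJ] at hx hxJ
    rw [Submodule.mem_sup] at hxJ
    obtain ⟨z, hz, y, hy, rfl⟩ := hxJ
    rw [Submodule.mem_sup] at hy
    obtain ⟨y, hy, y', hy', rfl⟩ := hy
    rw [Submodule.mem_span_singleton] at hy hy'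
    obtain ⟨a, rfl⟩ := hy
    obtain ⟨b, rfl⟩ := hy'
    rw [mem_perp_sup, mem_perp_sup, mem_perp_span_singleton, mem_perp_span_singleton] at hx
    obtain ⟨-, h3, h4⟩ := hx
    have h5 := mem_perp.mp hd z hz
    have h6 := mem_perp.mp hd' z hz
    rw [QuadraticMap.polar_comm] at h5 h6
    simp only [QuadraticMap.polar_add_right, QuadraticMap.polar_smul_right, polar_self_two, hq,
      hq', h5, h6, smul_eq_mul, mul_zero, zero_add, add_zero] at h3 h4
    rw [QuadraticMap.polar_comm] at h4
    have ha := (mul_eq_zero.mp h4).resolve_right hdd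
    have hb := (mul_eq_zero.mp h3).resolve_right hdd
    simpa [ha, hb] using hz
  have h3 := Submodule.finrank_mono h2
  have h4 := finrank_perp hv hv0 hvJ
  have h5 : Module.finrank K J ≤ Module.finrank K I + 2 := by
    have e1 := Submodule.finrank_sup_add_finrank_inf_eq I
      (Submodule.span K {d} ⊔ Submodule.span K {d'})
    have e2 := Submodule.finrank_sup_add_finrank_inf_eq (Submodule.span K {d})
      (Submodule.span K {d'})
    have e3 := finrank_span_le_card (R := K) ({d} : Set V)
    have e4 := finrank_span_le_card (R := K) ({d'} : Set V)
    simp only [Set.toFinset_singleton, Finset.card_singleton] at e3 e4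
    rw [hJ]
    omega
  omega

/-- An isotropic vector which is orthogonal to neither of two isotropic vectors. -/
theorem exists_isotropic_vector {I : Submodule K V} (hvI : v ∈ I) (hI : I ≤ perp q I)
    (hn : 2 * Module.finrank K I + 2 ≤ Module.finrank K V) {d d' : V} (hd : d ∈ perp q I)
    (hd' : d' ∈ perp q I) (hdI : d ∉ I) (hdI' : d' ∉ I) (hq : q d = 0) (hq' : q d' = 0) :
    ∃ x ∈ perp q I, q x = 0 ∧ QuadraticMap.polar q x d ≠ 0 ∧ QuadraticMap.polar q x d' ≠ 0 := by
  by_cases hdd : QuadraticMap.polar q d d' = 0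
  · obtain ⟨y, hy, h1, h2⟩ : ∃ y ∈ perp q I, QuadraticMap.polar q y d ≠ 0 ∧
        QuadraticMap.polar q y d' ≠ 0 := by
      obtain ⟨y, hy, h1⟩ := exists_polar_ne_zero hv hv0 hvI hdI
      obtain ⟨y', hy', h1'⟩ := exists_polar_ne_zero hv hv0 hvI hdI'
      by_cases h2 : QuadraticMap.polar q y d' = 0
      · by_cases h2' : QuadraticMap.polar q y' d = 0
        · refine ⟨y + y', add_mem hy hy', ?_, ?_⟩
          · rwa [QuadraticMap.polar_add_left, h2', add_zero]
          · rwa [QuadraticMap.polar_add_left, h2, zero_add]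
        · exact ⟨y', hy', h2', h1'⟩
      · exact ⟨y, hy, h1, h2⟩
    refine ⟨y + (-(q y) / QuadraticMap.polar q y d) • d, add_mem hy (Submodule.smul_mem _ _ hd),
      ?_, ?_, ?_⟩
    · rw [form_add, form_smul, hq, QuadraticMap.polar_smul_right, smul_eq_mul]
      field_simp
      ring
    · rw [QuadraticMap.polar_add_left, QuadraticMap.polar_smul_left, polar_self_two, hq]
      simpa using h1
    · rw [QuadraticMap.polar_add_left, QuadraticMap.polar_smul_left, hdd]
      simpa using h2
  · obtain ⟨w, hw, hqw⟩ := exists_form_ne_zero hv hv0 hvI hn hd hd' hq hq' hdd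
    rw [mem_perp_sup, mem_perp_sup, mem_perp_span_singleton, mem_perp_span_singleton] at hw
    obtain ⟨hw1, hw2, hw3⟩ := hw
    have hw2' : QuadraticMap.polar q w d = 0 := by rwa [QuadraticMap.polar_comm]
    have hw3' : QuadraticMap.polar q w d' = 0 := by rwa [QuadraticMap.polar_comm]
    have hdd' : QuadraticMap.polar q d' d = QuadraticMap.polar q d d' := QuadraticMap.polar_comm _ _ _
    refine ⟨d + (-(q w) / QuadraticMap.polar q d d') • d' + w, add_mem (add_mem hd
      (Submodule.smul_mem _ _ hd')) hw1, ?_, ?_, ?_⟩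
    · rw [form_add, form_add, form_smul, hq, hq', QuadraticMap.polar_smul_right,
        QuadraticMap.polar_add_left, QuadraticMap.polar_smul_left, hw2, hw3]
      simp only [smul_eq_mul]
      field_simp
      ring
    · rw [QuadraticMap.polar_add_left, QuadraticMap.polar_add_left, QuadraticMap.polar_smul_left,
        polar_self_two, hq, hw2', hdd']
      simp only [smul_eq_mul]
      field_simp
      simpa using hqw
    · rw [QuadraticMap.polar_add_left, QuadraticMap.polar_add_left, QuadraticMap.polar_smul_left,
        polar_self_two, hq', hw3']
      simpa using hdd

omit hv hv0 [CharZero K] in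
theorem finrank_sup_span_singleton {I : Submodule K V} {x : V} (hx : x ∉ I) :
    Module.finrank K (I ⊔ Submodule.span K {x} : Submodule K V) = Module.finrank K I + 1 := by
  have h1 := Submodule.finrank_sup_add_finrank_inf_eq I (Submodule.span K {x})
  have h2 : I ⊓ Submodule.span K {x} = ⊥ := by
    rw [eq_bot_iff]
    rintro y ⟨hy, hy'⟩
    obtain ⟨c, rfl⟩ := Submodule.mem_span_singleton.mp hy'
    by_cases hc : c = 0
    · simp [hc]
    · exact (hx ((Submodule.smul_mem_iff _ hc).mp hy)).elim
  have h3 : x ≠ 0 := fun h => hx (h ▸ zero_mem _)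
  rw [h2, finrank_bot, finrank_span_singleton h3] at h1
  omega

omit hv hv0 [CharZero K] in
theorem finrank_inf_ker {S : Submodule K V} (φ : V →ₗ[K] K) {d : V} (hd : d ∈ S) (h : φ d ≠ 0) :
    Module.finrank K (S ⊓ LinearMap.ker φ : Submodule K V) + 1 = Module.finrank K S := by
  have h1 : φ ∘ₗ S.subtype ≠ 0 := fun h' => h (LinearMap.congr_fun h' ⟨d, hd⟩)
  have h2 := Module.Dual.finrank_ker_add_one_of_ne_zero h1
  rw [← h2, LinearMap.ker_comp]
  congr 1
  rw [← Submodule.finrank_map_subtype_eq, Submodule.map_comap_subtype]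

theorem isotropic_sup_span {I : Submodule K V} (hI : I ≤ perp q I) {x : V} (hx : x ∈ perp q I)
    (hq : q x = 0) : I ⊔ Submodule.span K {x} ≤ perp q (I ⊔ Submodule.span K {x}) := by
  rw [sup_le_iff, Submodule.span_singleton_le_iff_mem]
  refine ⟨fun y hy => mem_perp_sup.mpr ⟨hI hy, mem_perp_span_singleton.mpr ?_⟩,
    mem_perp_sup.mpr ⟨hx, mem_perp_span_singleton.mpr ?_⟩⟩
  · rw [QuadraticMap.polar_comm]
    exact mem_perp.mp hx y hy
  · rw [polar_self_two, hq, mul_zero]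

/-- Two isotropic subspaces of the same dimension have a common transversal isotropic subspace. -/
theorem exists_common_transversal {k : ℕ} (hk : 2 * k + 2 ≤ Module.finrank K V)
    {D D' : Submodule K V} (hvD : v ∈ D) (hvD' : v ∈ D') (hD : D ≤ perp q D) (hD' : D' ≤ perp q D')
    (hr : Module.finrank K D = k + 1) (hr' : Module.finrank K D' = k + 1) :
    ∃ I : Submodule K V, v ∈ I ∧ I ≤ perp q I ∧ Module.finrank K I = k + 1 ∧
      D ⊓ perp q I ≤ Submodule.span K {v} ∧ D' ⊓ perp q I ≤ Submodule.span K {v} := by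
  have hsv (S : Submodule K V) (hS : v ∈ S) (h : 1 < Module.finrank K S) :
      ∃ d ∈ S, d ∉ Submodule.span K {v} := by
    by_contra! hn
    have := Submodule.finrank_mono hn
    rw [finrank_span_singleton hv0] at this
    omega
  have key : ∀ i ≤ k, ∃ I : Submodule K V, v ∈ I ∧ I ≤ perp q I ∧ Module.finrank K I = i + 1 ∧
      (Module.finrank K (D ⊓ perp q I : Submodule K V) + i = k + 1 ∧ I ⊓ D ≤ Submodule.span K {v}) ∧
      Module.finrank K (D' ⊓ perp q I : Submodule K V) + i = k + 1 ∧
        I ⊓ D' ≤ Submodule.span K {v} := by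
    intro i
    induction i with
    | zero =>
      intro _
      have hp : perp q (Submodule.span K {v}) = ⊤ := by
        rw [eq_top_iff]
        intro x _
        exact mem_perp_span_singleton.mpr (polar_kernel_left hv x)
      refine ⟨Submodule.span K {v}, Submodule.mem_span_singleton_self v, ?_,
        finrank_span_singleton hv0, ⟨?_, inf_le_left⟩, ?_, inf_le_left⟩
      · rw [hp]; exact le_top
      · rw [hp, inf_top_eq, hr]
      · rw [hp, inf_top_eq, hr']
    | succ i ih =>
      intro hi
      obtain ⟨I, hvI, hI, hrI, ⟨h1, h2⟩, h1', h2'⟩ := ih (by omega)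
      obtain ⟨d, ⟨hdD, hdI⟩, hd⟩ := hsv (D ⊓ perp q I) ⟨hvD, kernel_mem_perp hv I⟩ (by omega)
      obtain ⟨d', ⟨hdD', hdI'⟩, hd'⟩ := hsv (D' ⊓ perp q I) ⟨hvD', kernel_mem_perp hv I⟩ (by omega)
      obtain ⟨x, hx, hqx, hxd, hxd'⟩ := exists_isotropic_vector hv hv0 hvI hI (by omega) hdI hdI'
        (fun h => hd (h2 ⟨h, hdD⟩)) (fun h => hd' (h2' ⟨h, hdD'⟩)) (form_eq_zero hD hdD)
        (form_eq_zero hD' hdD')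
      have hxI : x ∉ I := fun h => hxd (mem_perp.mp hdI x h)
      have hstep (E : Submodule K V) (hE : E ≤ perp q E) (e : V) (heE : e ∈ E) (heI : e ∈ perp q I)
          (hxe : QuadraticMap.polar q x e ≠ 0)
          (h1 : Module.finrank K (E ⊓ perp q I : Submodule K V) + i = k + 1)
          (h2 : I ⊓ E ≤ Submodule.span K {v}) :
          Module.finrank K (E ⊓ perp q (I ⊔ Submodule.span K {x}) : Submodule K V) + (i + 1) = k + 1 ∧
            (I ⊔ Submodule.span K {x}) ⊓ E ≤ Submodule.span K {v} := by
        constructor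
        · have h3 : E ⊓ perp q (I ⊔ Submodule.span K {x}) =
              (E ⊓ perp q I) ⊓ LinearMap.ker (QuadraticMap.polarBilin q x) := by
            ext y
            simp only [Submodule.mem_inf, mem_perp_sup, mem_perp_span_singleton, LinearMap.mem_ker,
              QuadraticMap.polarBilin_apply_apply, and_assoc]
          have h4 := finrank_inf_ker (S := E ⊓ perp q I) (QuadraticMap.polarBilin q x) ⟨heE, heI⟩ hxe
          rw [h3]
          omega
        · rintro y ⟨hy, hyE⟩
          obtain ⟨z, hz, w, hw, rfl⟩ := Submodule.mem_sup.mp hy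
          obtain ⟨c, rfl⟩ := Submodule.mem_span_singleton.mp hw
          have h5 := mem_perp.mp (hE heE) _ hyE
          rw [QuadraticMap.polar_add_left, QuadraticMap.polar_smul_left, mem_perp.mp heI z hz,
            zero_add, smul_eq_mul] at h5
          have hc := (mul_eq_zero.mp h5).resolve_right hxe
          rw [hc, zero_smul, add_zero] at hyE ⊢
          exact h2 ⟨hz, hyE⟩
      exact ⟨I ⊔ Submodule.span K {x}, le_sup_left (α := Submodule K V) hvI,
        isotropic_sup_span hv hv0 hI hx hqx, by rw [finrank_sup_span_singleton hxI, hrI],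
        hstep D hD d hdD hdI hxd h1 h2, hstep D' hD' d' hdD' hdI' hxd' h1' h2'⟩
  obtain ⟨I, hvI, hI, hrI, ⟨h1, -⟩, h1', -⟩ := key k le_rfl
  have hfin (E : Submodule K V) (hvE : v ∈ E)
      (h : Module.finrank K (E ⊓ perp q I : Submodule K V) + k = k + 1) :
      E ⊓ perp q I ≤ Submodule.span K {v} := by
    by_contra hn
    obtain ⟨d, hd, hd'⟩ := Set.not_subset.mp hn
    have h3 : Submodule.span K {v} ⊔ Submodule.span K {d} ≤ E ⊓ perp q I := by
      rw [sup_le_iff, Submodule.span_singleton_le_iff_mem, Submodule.span_singleton_le_iff_mem]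
      exact ⟨⟨hvE, kernel_mem_perp hv I⟩, hd⟩
    have h4 := Submodule.finrank_mono h3
    rw [finrank_sup_span_singleton hd', finrank_span_singleton hv0] at h4
    omega
  exact ⟨I, hvI, hI, hrI, hfin D hvD h1, hfin D' hvD' h1'⟩

/-- Over an algebraically closed field, isotropic subspaces can be enlarged. -/
theorem exists_isotropic_extension [IsAlgClosed K] {I : Submodule K V}
    (hn : Module.finrank K I + 2 ≤ Module.finrank K (perp q I)) :
    ∃ x ∈ perp q I, x ∉ I ∧ q x = 0 := by
  have hex (J : Submodule K V) (h : Module.finrank K J < Module.finrank K (perp q I)) :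
      ∃ x ∈ perp q I, x ∉ J := by
    by_contra! h'
    have := Submodule.finrank_mono h'
    omega
  obtain ⟨x, hx, hxI⟩ := hex I (by omega)
  obtain ⟨y, hy, hyI⟩ := hex (I ⊔ Submodule.span K {x}) (by
    rw [finrank_sup_span_singleton hxI]
    omega)
  by_cases hq : q y = 0
  · exact ⟨y, hy, fun h => hyI (le_sup_left (α := Submodule K V) h), hq⟩
  · obtain ⟨s, hs⟩ := IsAlgClosed.exists_pow_nat_eq
      (QuadraticMap.polar q x y ^ 2 - 4 * q x * q y) two_pos
    let t := (-QuadraticMap.polar q x y + s) / (2 * q y)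
    refine ⟨x + t • y, add_mem hx (Submodule.smul_mem _ _ hy), fun h => ?_, ?_⟩
    · by_cases ht : t = 0
      · rw [ht, zero_smul, add_zero] at h
        exact hxI h
      · apply hyI
        rw [← Submodule.smul_mem_iff _ ht]
        have : t • y = (x + t • y) - x := by abel
        rw [this]
        exact sub_mem (le_sup_left (α := Submodule K V) h) (le_sup_right (α := Submodule K V)
          (Submodule.mem_span_singleton_self x))
    · rw [form_add, form_smul, QuadraticMap.polar_smul_right, smul_eq_mul]
      simp only [t]
      field_simp
      linear_combination hs

end Kernel

end QuadraticSpaces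

end

end OrthogonalGrassmannian

namespace OrthogonalGrassmannian

noncomputable section

section Polar

variable {R M : Type*} [CommRing R] [AddCommGroup M] [Module R M] {q : QuadraticForm R M}

theorem polar_sum_left {ι : Type*} (s : Finset ι) (c : ι → R) (x : ι → M) (y : M) :
    QuadraticMap.polar q (∑ i ∈ s, c i • x i) y = ∑ i ∈ s, c i * QuadraticMap.polar q (x i) y := by
  change QuadraticMap.polarBilin q (∑ i ∈ s, c i • x i) y = _
  rw [map_sum, LinearMap.sum_apply]
  exact Finset.sum_congr rfl fun i _ => QuadraticMap.polar_smul_left q (c i) (x i) y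

theorem polar_sum_right {ι : Type*} (s : Finset ι) (c : ι → R) (x : ι → M) (y : M) :
    QuadraticMap.polar q y (∑ i ∈ s, c i • x i) = ∑ i ∈ s, c i * QuadraticMap.polar q y (x i) := by
  rw [QuadraticMap.polar_comm, polar_sum_left]
  exact Finset.sum_congr rfl fun i _ => by rw [QuadraticMap.polar_comm]

end Polar

section Frames

variable {K : Type u} [Field K] [CharZero K] {V : Type u} [AddCommGroup V] [Module K V]

/-- A basis of a quadratic space with kernel spanned by `v` which consists of `k` hyperbolic pairs
and of vectors orthogonal to them, among which `v` is the first one. -/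
structure Frame (q : QuadraticForm K V) (v : V) (k : ℕ) where
  /-- one less than the number of vectors orthogonal to the hyperbolic pairs -/
  r : ℕ
  /-- the basis -/
  basis : Module.Basis ((Fin k ⊕ Fin k) ⊕ Fin (r + 1)) K V
  basis_zero : basis (Sum.inr 0) = v
  polar_left_left : ∀ a b, QuadraticMap.polar q (basis (Sum.inl (Sum.inl a)))
    (basis (Sum.inl (Sum.inl b))) = 0
  polar_right_right : ∀ a b, QuadraticMap.polar q (basis (Sum.inl (Sum.inr a)))
    (basis (Sum.inl (Sum.inr b))) = 0
  polar_left_right : ∀ a b, QuadraticMap.polar q (basis (Sum.inl (Sum.inl a)))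
    (basis (Sum.inl (Sum.inr b))) = if a = b then 1 else 0
  polar_left_inr : ∀ a c, QuadraticMap.polar q (basis (Sum.inl (Sum.inl a))) (basis (Sum.inr c)) = 0
  polar_right_inr : ∀ a c, QuadraticMap.polar q (basis (Sum.inl (Sum.inr a))) (basis (Sum.inr c)) = 0

variable {q : QuadraticForm K V} {v : V} {k : ℕ}

theorem exists_dual_family (hv : LinearMap.ker (QuadraticMap.polarBilin q) = Submodule.span K {v})
    {e : Fin k → V} (he : ∀ c : Fin k → K, ∑ a, c a • e a ∈ Submodule.span K {v} → c = 0)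
    (hee : ∀ a b, QuadraticMap.polar q (e a) (e b) = 0) :
    ∃ f : Fin k → V, (∀ a b, QuadraticMap.polar q (e a) (f b) = if a = b then 1 else 0) ∧
      ∀ a b, QuadraticMap.polar q (f a) (f b) = 0 := by
  have hs : Function.Surjective (LinearMap.pi fun a => QuadraticMap.polarBilin q (e a)) := by
    rw [← LinearMap.range_eq_top]
    by_contra hn
    obtain ⟨g, hg, hle⟩ := Submodule.exists_le_ker_of_lt_top _ (lt_top_iff_ne_top.mpr hn)
    apply hg
    have h0 : (fun a => g (fun j => if a = j then 1 else 0)) = 0 := by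
      apply he
      refine mem_span_of_polar hv fun y => ?_
      rw [polar_sum_left]
      have h1 : g (LinearMap.pi (fun a => QuadraticMap.polarBilin q (e a)) y) = 0 :=
        hle ⟨y, rfl⟩
      refine Eq.trans ?_ ((LinearMap.pi_apply_eq_sum_univ g _).symm.trans h1)
      exact Finset.sum_congr rfl fun a _ => mul_comm _ _
    refine LinearMap.ext fun x => (LinearMap.pi_apply_eq_sum_univ g x).trans ?_
    exact Finset.sum_eq_zero fun a _ => (congrArg _ (congrFun h0 a)).trans (smul_zero _)
  choose f hf using fun b => hs (Pi.single b 1)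
  have hef (a b) : QuadraticMap.polar q (e a) (f b) = if a = b then 1 else 0 := by
    have := congrFun (hf b) a
    simpa [Pi.single_apply] using this
  refine ⟨fun b => f b - (2⁻¹ : K) • ∑ c, QuadraticMap.polar q (f b) (f c) • e c, ?_, ?_⟩
  · intro a b
    rw [QuadraticMap.polar_sub_right, QuadraticMap.polar_smul_right, polar_sum_right, hef]
    simp [hee]
  · intro a b
    have hfe (a b) : QuadraticMap.polar q (f b) (e a) = if a = b then 1 else 0 := by
      rw [QuadraticMap.polar_comm, hef]
    rw [QuadraticMap.polar_sub_right, QuadraticMap.polar_smul_right, polar_sum_right]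
    simp only [QuadraticMap.polar_sub_left, QuadraticMap.polar_smul_left, polar_sum_left, hef, hfe,
      hee]
    simp only [mul_zero, Finset.sum_const_zero, sub_zero, mul_ite, mul_one,
      Finset.sum_ite_eq', Finset.mem_univ, if_true, smul_eq_mul]
    rw [QuadraticMap.polar_comm q (f b) (f a)]
    ring

theorem exists_frame [Module.Finite K V]
    (hv : LinearMap.ker (QuadraticMap.polarBilin q) = Submodule.span K {v}) (hv0 : v ≠ 0)
    {e f : Fin k → V} (hee : ∀ a b, QuadraticMap.polar q (e a) (e b) = 0)
    (hff : ∀ a b, QuadraticMap.polar q (f a) (f b) = 0)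
    (hef : ∀ a b, QuadraticMap.polar q (e a) (f b) = if a = b then 1 else 0) :
    ∃ S : Frame q v k, (∀ a, S.basis (Sum.inl (Sum.inl a)) = e a) ∧
      ∀ a, S.basis (Sum.inl (Sum.inr a)) = f a := by
  have hfe (a b) : QuadraticMap.polar q (f b) (e a) = if a = b then 1 else 0 := by
    rw [QuadraticMap.polar_comm, hef]
  let L : Submodule K V := LinearMap.ker (LinearMap.pi fun a => QuadraticMap.polarBilin q (e a)) ⊓
    LinearMap.ker (LinearMap.pi fun a => QuadraticMap.polarBilin q (f a))
  have hL (x : V) : x ∈ L ↔ (∀ a, QuadraticMap.polar q (e a) x = 0) ∧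
      ∀ a, QuadraticMap.polar q (f a) x = 0 := by
    rw [Submodule.mem_inf, LinearMap.mem_ker, LinearMap.mem_ker, funext_iff, funext_iff]
    rfl
  have hvL : v ∈ L := (hL v).mpr
    ⟨fun a => polar_kernel_right hv (e a), fun a => polar_kernel_right hv (f a)⟩
  obtain ⟨N, hN⟩ := Submodule.exists_isCompl (Submodule.span K {(⟨v, hvL⟩ : L)})
  let bL := Module.Basis.mkFinCons (⟨v, hvL⟩ : L) (Module.finBasis K N)
    (fun c x hx h => by
      by_contra hc
      have h1 : c • (⟨v, hvL⟩ : L) ∈ N := by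
        rw [eq_neg_of_add_eq_zero_left h]
        exact neg_mem hx
      have h2 := Submodule.disjoint_def.mp hN.disjoint _ (Submodule.mem_span_singleton_self _)
        ((Submodule.smul_mem_iff _ hc).mp h1)
      exact hv0 (congrArg Subtype.val h2))
    (fun z => by
      obtain ⟨y, hy, w, hw, h⟩ := Submodule.mem_sup.mp
        (hN.sup_eq_top ▸ Submodule.mem_top (x := z) :
          z ∈ Submodule.span K {(⟨v, hvL⟩ : L)} ⊔ N)
      obtain ⟨c, rfl⟩ := Submodule.mem_span_singleton.mp hy
      refine ⟨-c, ?_⟩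
      rw [← h, neg_smul, add_comm (c • _) w, add_neg_cancel_right]
      exact hw)
  have hbL : bL 0 = ⟨v, hvL⟩ := by simp [bL]
  let pr (x : V) : V := x - (∑ a, QuadraticMap.polar q (f a) x • e a) -
    ∑ a, QuadraticMap.polar q (e a) x • f a
  have hpr (x : V) : pr x ∈ L := by
    rw [hL]
    constructor
    · intro a
      rw [QuadraticMap.polar_sub_right, QuadraticMap.polar_sub_right, polar_sum_right,
        polar_sum_right]
      simp [hee, hef]
    · intro a
      rw [QuadraticMap.polar_sub_right, QuadraticMap.polar_sub_right, polar_sum_right,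
        polar_sum_right]
      simp [hff, hfe]
  let Θ : (((Fin k → K) × (Fin k → K)) × L) →ₗ[K] V :=
    ((Fintype.linearCombination K e).coprod (Fintype.linearCombination K f)).coprod L.subtype
  have hΘ (x) : Θ x = ((∑ a, x.1.1 a • e a) + ∑ a, x.1.2 a • f a) + (x.2 : V) := rfl
  have hinj : Function.Injective Θ := by
    rw [injective_iff_map_eq_zero]
    rintro ⟨⟨c, d⟩, l⟩ h
    rw [hΘ] at h
    obtain ⟨l1, l2⟩ := (hL l).mp l.2
    have hd : d = 0 := by
      funext a
      have := congrArg (QuadraticMap.polar q (e a)) h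
      rw [QuadraticMap.polar_add_right, QuadraticMap.polar_add_right, polar_sum_right,
        polar_sum_right, l1] at this
      simpa [hee, hef] using this
    have hc : c = 0 := by
      funext a
      have := congrArg (QuadraticMap.polar q (f a)) h
      rw [QuadraticMap.polar_add_right, QuadraticMap.polar_add_right, polar_sum_right,
        polar_sum_right, l2] at this
      simpa [hff, hfe] using this
    subst hc hd
    have hl : l = 0 := Subtype.ext (by simpa using h)
    rw [hl]
    rfl
  have hsurj : Function.Surjective Θ := fun x =>
    ⟨((fun a => QuadraticMap.polar q (f a) x, fun a => QuadraticMap.polar q (e a) x),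
      ⟨pr x, hpr x⟩), by
      rw [hΘ]
      simp only [pr]
      abel⟩
  let b := (((Pi.basisFun K (Fin k)).prod (Pi.basisFun K (Fin k))).prod bL).map
    (LinearEquiv.ofBijective Θ ⟨hinj, hsurj⟩)
  have hb (i) : b i = Θ ((((Pi.basisFun K (Fin k)).prod (Pi.basisFun K (Fin k))).prod bL) i) := rfl
  have be (a) : b (Sum.inl (Sum.inl a)) = e a := by
    rw [hb, hΘ]
    simp [Module.Basis.prod_apply, Pi.single_apply]
  have bf (a) : b (Sum.inl (Sum.inr a)) = f a := by
    rw [hb, hΘ]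
    simp [Module.Basis.prod_apply, Pi.single_apply]
  have bw (c) : b (Sum.inr c) = bL c := by
    rw [hb, hΘ]
    simp [Module.Basis.prod_apply]
  refine ⟨⟨Module.finrank K N, b, ?_, ?_, ?_, ?_, ?_, ?_⟩, be, bf⟩
  · rw [bw, hbL]
  · intro a c; rw [be, be, hee]
  · intro a c; rw [bf, bf, hff]
  · intro a c; rw [be, bf, hef]
  · intro a c; rw [be, bw]; exact ((hL _).mp (bL c).2).1 a
  · intro a c; rw [bf, bw]; exact ((hL _).mp (bL c).2).2 a

end Frames

end

end OrthogonalGrassmannian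

namespace OrthogonalGrassmannian

noncomputable section

section LocalConditions

variable {K : Type u} [Field K]

theorem isOpenCond_of_local_unit {F : CommAlgCat.{u} K ⥤ Type u}
    {Φ : ∀ A : CommAlgCat.{u} K, F.obj A → Prop}
    (hmap : ∀ (A B : CommAlgCat.{u} K) (f : A ⟶ B) (x : F.obj A), Φ A x → Φ B (F.map f x))
    (hloc : ∀ (A : CommAlgCat.{u} K) (x : F.obj A), (∀ p : PrimeSpectrum A, ∃ r ∉ p.asIdeal,
      Φ _ (F.map (toLoc A r) x)) → Φ A x)
    (h : ∀ (A : CommAlgCat.{u} K) (x : F.obj A) (p : PrimeSpectrum A), ∃ r ∉ p.asIdeal,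
      ∃ d : loc A r, ∀ (B : CommAlgCat.{u} K) (f : loc A r ⟶ B),
        Φ B (F.map f (F.map (toLoc A r) x)) ↔ IsUnit (f.hom d)) : IsOpenCond F Φ := by
  intro A x
  refine ⟨Ideal.span {a | Φ _ (F.map (toLoc A a) x)}, fun B f => ⟨fun hB => ?_, fun hJ => ?_⟩⟩
  · by_contra hn
    obtain ⟨m, hm, hle⟩ := Ideal.exists_le_maximal _ hn
    let q : PrimeSpectrum B := ⟨m, hm.isPrime⟩
    let p : PrimeSpectrum A := PrimeSpectrum.comap f.hom.toRingHom q
    obtain ⟨r, hr, d, hd⟩ := h A x p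
    obtain ⟨g, hg⟩ := exists_loc_map f r
    obtain ⟨n, a, ha⟩ := exists_pow_mul_eq d
    have h1 : IsUnit (g.hom d) := by
      rw [← hd, map_map, hg, ← map_map]
      exact hmap _ _ _ _ hB
    have h2 : IsUnit ((toLoc B (f.hom r)).hom (f.hom a)) := by
      have : (toLoc B (f.hom r)).hom (f.hom a) = g.hom ((toLoc A r).hom a) :=
        (ConcreteCategory.congr_hom hg a).symm
      rw [this, ← ha, map_mul, map_pow]
      exact (((isUnit_toLoc A r).map g.hom).pow n).mul h1
    have hfr : f.hom r ∉ q.asIdeal := hr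
    obtain ⟨q', hq'⟩ := exists_prime_toLoc q hfr
    have h3 : f.hom a ∉ q.asIdeal := by
      intro hmem
      rw [← hq'] at hmem
      exact q'.isPrime.ne_top (Ideal.eq_top_of_isUnit_mem _ hmem h2)
    have h4 : Φ _ (F.map (toLoc A (r * a)) x) := by
      obtain ⟨⟨g1, hg1⟩, -⟩ := exists_loc_mul r a
      rw [← hg1, ← map_map, hd]
      have h5 := isUnit_toLoc A (r * a)
      rw [map_mul, ← hg1] at h5
      have h6 : IsUnit (g1.hom ((toLoc A r).hom a)) := isUnit_of_mul_isUnit_right h5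
      rw [← ha, map_mul] at h6
      exact isUnit_of_mul_isUnit_right h6
    exact mul_notMem (p := q) hfr h3 (by
      have h7 := hle (Ideal.mem_map_of_mem f.hom.toRingHom (Ideal.subset_span (s :=
        {a | Φ _ (F.map (toLoc A a) x)}) h4))
      have h8 : f.hom.toRingHom (r * a) = f.hom r * f.hom a := map_mul f.hom r a
      rw [h8] at h7
      exact h7)
  · apply hloc
    intro q
    rw [Ideal.map_span] at hJ
    obtain ⟨_, hr, a, ha, rfl⟩ := exists_notMem_of_span hJ q
    refine ⟨f.hom a, hr, ?_⟩
    obtain ⟨g, hg⟩ := exists_loc_map f a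
    rw [map_map, ← hg, ← map_map]
    exact hmap _ _ _ _ ha

theorem isOpenImmersion_of_local_unit {X Z : Over (Spec (CommRingCat.of K))} (c : Z ⟶ X)
    (hc : InjOnPoints c)
    (h : ∀ (A : CommAlgCat.{u} K) (y : specOver A ⟶ X) (p : PrimeSpectrum A), ∃ r ∉ p.asIdeal,
      ∃ d : loc A r, ∀ (B : CommAlgCat.{u} K) (f : loc A r ⟶ B),
        (∃ z, z ≫ c = res f (res (toLoc A r) y)) ↔ IsUnit (f.hom d)) :
    IsOpenImmersion c.left := by
  have h1 : IsOpenCond (pointFunctor X) (fun A y => ∃ z, z ≫ c = y) := by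
    refine isOpenCond_of_local_unit ?_ ?_ h
    · rintro A B f _ ⟨z, rfl⟩
      exact ⟨res f z, Category.assoc _ _ _⟩
    · intro A y hy
      obtain ⟨z, hz⟩ := (pointFunctor_isZariskiSheaf Z).exists_of_local
        (fun B f z => z ≫ c = res f y) (fun B C f g z hz => by
          change (res g z) ≫ c = _
          rw [← res_res, ← hz]
          exact Category.assoc _ _ _)
        (fun B f z z' hz hz' => hc B z z' (hz.trans hz'.symm)) hy
      refine ⟨z, (pointFunctor_isZariskiSheaf X).separated A (z ≫ c) y fun p => ?_⟩
      obtain ⟨r, hr, hz⟩ := hz p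
      exact ⟨r, hr, (Category.assoc _ _ _).symm.trans hz⟩
  obtain ⟨U, hU⟩ := exists_opens h1
  exact (isOpenImmersion_of_points c hc hU).1

theorem exists_dual_generators_iff {A M : Type*} [CommRing A] [AddCommGroup M] [Module A M] {k : ℕ}
    {N : Submodule A M} {u : Fin k → M} (hN : N = Submodule.span A (Set.range u))
    (ψ : M →ₗ[A] (Fin k → A)) :
    (∃ n : Fin k → M, N = Submodule.span A (Set.range n) ∧ ∀ i, ψ (n i) = Pi.single i 1) ↔
      IsUnit (Matrix.det (Matrix.of fun i j => ψ (u i) j)) := by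
  have hcomb (C : Matrix (Fin k) (Fin k) A) (w : Fin k → M) (i : Fin k) :
      ψ (∑ j, C i j • w j) = (C * Matrix.of fun i j => ψ (w i) j) i := by
    ext l
    rw [map_sum, Finset.sum_apply, Matrix.mul_apply]
    simp
  constructor
  · rintro ⟨n, hn, hψ⟩
    have hmem (i) : ∃ c : Fin k → A, ∑ j, c j • u j = n i := by
      rw [← Submodule.mem_span_range_iff_exists_fun, ← hN, hn]
      exact Submodule.subset_span ⟨i, rfl⟩
    choose C hC using hmem
    have : Matrix.of C * (Matrix.of fun i j => ψ (u i) j) = 1 := by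
      refine funext fun i => (hcomb (Matrix.of C) u i).symm.trans ?_
      change ψ (∑ j, C i j • u j) = _
      rw [hC, hψ]
      funext j
      rw [Matrix.one_apply, Pi.single_apply]
      simp [eq_comm]
    exact Matrix.isUnit_det_of_left_inverse this
  · intro h
    have hM := Matrix.nonsing_inv_mul (Matrix.of fun i j => ψ (u i) j) h
    set M := Matrix.of fun i j => ψ (u i) j with hMd
    refine ⟨fun i => ∑ j, M⁻¹ i j • u j, ?_, fun i => ?_⟩
    · rw [hN]
      apply le_antisymm
      · rw [Submodule.span_le]
        rintro _ ⟨i, rfl⟩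
        have : u i = ∑ l, M i l • ∑ j, M⁻¹ l j • u j := by
          simp_rw [Finset.smul_sum, smul_smul]
          rw [Finset.sum_comm]
          simp_rw [← Finset.sum_smul, ← Matrix.mul_apply, Matrix.mul_nonsing_inv M h,
            Matrix.one_apply]
          simp
        rw [this]
        exact sum_mem fun l _ => Submodule.smul_mem _ _ (Submodule.subset_span ⟨l, rfl⟩)
      · rw [Submodule.span_le]
        rintro _ ⟨i, rfl⟩
        exact sum_mem fun l _ => Submodule.smul_mem _ _ (Submodule.subset_span ⟨l, rfl⟩)
    · rw [hcomb, hM]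
      funext j
      rw [Matrix.one_apply, Pi.single_apply]
      simp [eq_comm]

theorem eq_sum_of_dual {A M : Type*} [CommRing A] [AddCommGroup M] [Module A M] {k : ℕ}
    {n : Fin k → M} (ψ : M →ₗ[A] (Fin k → A)) (hψ : ∀ i, ψ (n i) = Pi.single i 1) {x : M}
    (hx : x ∈ Submodule.span A (Set.range n)) : x = ∑ i, ψ x i • n i := by
  obtain ⟨c, rfl⟩ := (Submodule.mem_span_range_iff_exists_fun A).mp hx
  refine Finset.sum_congr rfl fun i _ => ?_
  rw [map_sum, Finset.sum_apply]
  simp [hψ, Pi.single_apply]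

end LocalConditions

end

end OrthogonalGrassmannian

namespace OrthogonalGrassmannian

noncomputable section

namespace Frame

variable {K : Type u} [Field K] [CharZero K] {V : Type u} [AddCommGroup V] [Module K V]
  {q : QuadraticForm K V} {v : V} {k : ℕ} (S : Frame q v k)
  (A : Type u) [CommRing A] [Algebra K A] {B : Type u} [CommRing B] [Algebra K B]

/-- The vectors of the basis over a `K`-algebra. -/
def vec (i : (Fin k ⊕ Fin k) ⊕ Fin (S.r + 1)) : A ⊗[K] V := 1 ⊗ₜ S.basis i

variable {A}

theorem sum_crd (x : A ⊗[K] V) : ∑ i, crd S.basis A x i • S.vec A i = x :=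
  (Finset.sum_congr rfl fun i _ => by rw [vec, ← Algebra.TensorProduct.basis_apply]; rfl).trans
    ((Algebra.TensorProduct.basis A S.basis).sum_equivFun x)

theorem crd_vec (i j : (Fin k ⊕ Fin k) ⊕ Fin (S.r + 1)) :
    crd S.basis A (S.vec A i) j = if i = j then 1 else 0 := by
  rw [vec, crd_tmul, one_mul, Module.Basis.repr_self, Finsupp.single_apply]
  split_ifs <;> simp

theorem push_vec (f : A →ₐ[K] B) (i) : push f (S.vec A i) = S.vec B i := by
  rw [vec, push_tmul, _root_.map_one, vec]

theorem polar_vec (i j) : QuadraticMap.polar (formBaseChange q A) (S.vec A i) (S.vec A j) =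
    algebraMap K A (QuadraticMap.polar q (S.basis i) (S.basis j)) := by
  rw [vec, vec, polar_formBaseChange_tmul, one_mul, mul_one]

theorem polar_right_left (a b) : QuadraticMap.polar q (S.basis (Sum.inl (Sum.inr b)))
    (S.basis (Sum.inl (Sum.inl a))) = if a = b then 1 else 0 := by
  rw [QuadraticMap.polar_comm, S.polar_left_right]

theorem polar_right (x : A ⊗[K] V) (b : Fin k) :
    QuadraticMap.polar (formBaseChange q A) (S.vec A (Sum.inl (Sum.inr b))) x =
      crd S.basis A x (Sum.inl (Sum.inl b)) := by
  conv_lhs => rw [← S.sum_crd x]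
  rw [polar_sum_right]
  simp only [polar_vec, Fintype.sum_sum_type, S.polar_right_right, S.polar_right_left,
    S.polar_right_inr, map_zero, mul_zero, Finset.sum_const_zero, add_zero, apply_ite (algebraMap K A),
    _root_.map_one, mul_ite, mul_one, Finset.sum_ite_eq', Finset.mem_univ, if_true]

theorem polar_left (x : A ⊗[K] V) (b : Fin k) :
    QuadraticMap.polar (formBaseChange q A) (S.vec A (Sum.inl (Sum.inl b))) x =
      crd S.basis A x (Sum.inl (Sum.inr b)) := by
  conv_lhs => rw [← S.sum_crd x]
  rw [polar_sum_right]
  simp only [polar_vec, Fintype.sum_sum_type, S.polar_left_left, S.polar_left_right,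
    S.polar_left_inr, map_zero, mul_zero, Finset.sum_const_zero, add_zero, zero_add,
    apply_ite (algebraMap K A),
    _root_.map_one, mul_ite, mul_one, Finset.sum_ite_eq, Finset.mem_univ, if_true]

/-- The combination of the vectors orthogonal to the hyperbolic pairs with given coefficients. -/
def tail (z : Fin (S.r + 1) → A) : A ⊗[K] V := ∑ c, z c • S.vec A (Sum.inr c)

theorem crd_tail_inl (z : Fin (S.r + 1) → A) (i) : crd S.basis A (S.tail z) (Sum.inl i) = 0 := by
  rw [tail, map_sum, Finset.sum_apply]
  simp [crd_vec]

theorem push_tail (f : A →ₐ[K] B) (z : Fin (S.r + 1) → A) :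
    push f (S.tail z) = S.tail fun c => f (z c) := by
  rw [tail, push_sum_smul]
  simp only [push_vec]
  rfl

theorem polar_tail (x : A ⊗[K] V) (z : Fin (S.r + 1) → A) :
    QuadraticMap.polar (formBaseChange q A) x (S.tail z) =
      QuadraticMap.polar (formBaseChange q A) (S.tail fun c => crd S.basis A x (Sum.inr c))
        (S.tail z) := by
  conv_lhs => rw [← S.sum_crd x]
  rw [polar_sum_left, Fintype.sum_sum_type, Fintype.sum_sum_type]
  simp only [polar_left, polar_right, crd_tail_inl, mul_zero, Finset.sum_const_zero, zero_add]
  rw [← polar_sum_left]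
  rfl

theorem polar_eq (x y : A ⊗[K] V) : QuadraticMap.polar (formBaseChange q A) x y =
    (∑ a, crd S.basis A x (Sum.inl (Sum.inr a)) * crd S.basis A y (Sum.inl (Sum.inl a))) +
    (∑ a, crd S.basis A x (Sum.inl (Sum.inl a)) * crd S.basis A y (Sum.inl (Sum.inr a))) +
    QuadraticMap.polar (formBaseChange q A) (S.tail fun c => crd S.basis A x (Sum.inr c))
      (S.tail fun c => crd S.basis A y (Sum.inr c)) := by
  have h : y = (∑ a, crd S.basis A y (Sum.inl (Sum.inl a)) • S.vec A (Sum.inl (Sum.inl a))) +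
      (∑ a, crd S.basis A y (Sum.inl (Sum.inr a)) • S.vec A (Sum.inl (Sum.inr a))) +
      S.tail fun c => crd S.basis A y (Sum.inr c) := by
    conv_lhs => rw [← S.sum_crd y, Fintype.sum_sum_type, Fintype.sum_sum_type]
    rfl
  conv_lhs => rw [h]
  rw [QuadraticMap.polar_add_right, QuadraticMap.polar_add_right, polar_sum_right, polar_sum_right,
    polar_tail]
  congr 2
  · refine Finset.sum_congr rfl fun a _ => ?_
    rw [QuadraticMap.polar_comm, polar_left, mul_comm]
  · refine Finset.sum_congr rfl fun a _ => ?_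
    rw [QuadraticMap.polar_comm, polar_right, mul_comm]

/-- The coordinates of the generators of an isotropic subspace transversal to the span of `v` and
the second halves of the hyperbolic pairs, and of a hyperplane in its preimage. -/
abbrev Param : Type := {p : Fin k × Fin k // p.1 < p.2} ⊕ (Fin k × Fin S.r) ⊕ Fin k

variable (P : S.Param → A)

/-- The tail of a generator. -/
def gtail (a : Fin k) : Fin (S.r + 1) → A :=
  Fin.cons 0 fun c => P (Sum.inr (Sum.inl (a, c)))

theorem comp_gtail (f : A →ₐ[K] B) (a : Fin k) :
    (fun c => f (S.gtail P a c)) = S.gtail (fun i => f (P i)) a := by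
  funext c
  refine Fin.cases ?_ (fun c => ?_) c
  · exact map_zero f
  · rfl

/-- The skew part of a generator. -/
def entry (a b : Fin k) : A :=
  if h : a < b then P (Sum.inl ⟨(a, b), h⟩) else
    if h : b < a then - P (Sum.inl ⟨(b, a), h⟩) -
      QuadraticMap.polar (formBaseChange q A) (S.tail (S.gtail P a)) (S.tail (S.gtail P b)) else
      - formBaseChange q A (S.tail (S.gtail P a))

theorem entry_add (a b : Fin k) : S.entry P a b + S.entry P b a +
    QuadraticMap.polar (formBaseChange q A) (S.tail (S.gtail P a)) (S.tail (S.gtail P b)) = 0 := by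
  rcases lt_trichotomy a b with h | rfl | h
  · rw [entry, dif_pos h, entry, dif_neg h.asymm, dif_pos h, QuadraticMap.polar_comm]
    ring
  · rw [entry, dif_neg (lt_irrefl _), dif_neg (lt_irrefl _), polar_self_eq]
    ring
  · rw [entry, dif_neg h.asymm, dif_pos h, entry, dif_pos h]
    ring

theorem map_entry (f : A →ₐ[K] B) (a b : Fin k) :
    f (S.entry P a b) = S.entry (fun i => f (P i)) a b := by
  rw [entry, entry]
  split_ifs with h h'
  · rfl
  · rw [map_sub, map_neg, ← polar_rTensor]
    change _ - QuadraticMap.polar _ (push f _) (push f _) = _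
    rw [push_tail, push_tail, comp_gtail, comp_gtail]
  · rw [map_neg, ← formBaseChange_push, push_tail, comp_gtail]

/-- The generators of the isotropic subspace. -/
def lift (a : Fin k) : A ⊗[K] V := (crd S.basis A).symm
  (Sum.elim (Sum.elim (Pi.single a 1) (S.entry P a)) (S.gtail P a))

theorem crd_lift (a : Fin k) : crd S.basis A (S.lift P a) =
    Sum.elim (Sum.elim (Pi.single a 1) (S.entry P a)) (S.gtail P a) := by
  rw [lift, LinearEquiv.apply_symm_apply]

theorem push_lift (f : A →ₐ[K] B) (a : Fin k) :
    push f (S.lift P a) = S.lift (fun i => f (P i)) a := by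
  rw [lift, crd_symm_push, lift]
  congr 1
  funext i
  rcases i with (i | i) | i
  · simp only [Sum.elim_inl, Pi.single_apply]
    split_ifs
    · exact _root_.map_one f
    · exact map_zero f
  · exact S.map_entry P f a i
  · exact congrFun (S.comp_gtail P f a) i

theorem polar_lift (a b : Fin k) :
    QuadraticMap.polar (formBaseChange q A) (S.lift P a) (S.lift P b) = 0 := by
  rw [S.polar_eq, crd_lift, crd_lift]
  simp only [Sum.elim_inl, Sum.elim_inr, Pi.single_apply]
  refine Eq.trans ?_ (S.entry_add P a b)
  simp

theorem eq_lift {u : Fin k → A ⊗[K] V}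
    (h1 : ∀ a, ∀ b, crd S.basis A (u a) (Sum.inl (Sum.inl b)) = (Pi.single a 1 : Fin k → A) b)
    (h2 : ∀ a, crd S.basis A (u a) (Sum.inr 0) = 0)
    (h3 : ∀ a b, QuadraticMap.polar (formBaseChange q A) (u a) (u b) = 0)
    (hP : ∀ a b (h : a < b), P (Sum.inl ⟨(a, b), h⟩) = crd S.basis A (u a) (Sum.inl (Sum.inr b)))
    (hP' : ∀ a c, P (Sum.inr (Sum.inl (a, c))) = crd S.basis A (u a) (Sum.inr c.succ)) (a : Fin k) :
    u a = S.lift P a := by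
  have ht (a) : (fun c => crd S.basis A (u a) (Sum.inr c)) = S.gtail P a := by
    funext c
    refine Fin.cases ?_ (fun c => ?_) c
    · exact h2 a
    · exact (hP' a c).symm
  have h4 (a b) : crd S.basis A (u a) (Sum.inl (Sum.inr b)) +
      crd S.basis A (u b) (Sum.inl (Sum.inr a)) +
      QuadraticMap.polar (formBaseChange q A) (S.tail (S.gtail P a)) (S.tail (S.gtail P b)) = 0 := by
    rw [← h3 a b, S.polar_eq (u a) (u b), ht, ht]
    simp only [h1, Pi.single_apply]
    simp
  rw [lift, LinearEquiv.eq_symm_apply]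
  funext i
  rcases i with (b | b) | c
  · exact h1 a b
  · change _ = S.entry P a b
    have e1 := h4 a b
    have e2 := S.entry_add P a b
    rcases lt_trichotomy a b with h | rfl | h
    · rw [entry, dif_pos h, hP]
    · rw [entry, dif_neg (lt_irrefl _), dif_neg (lt_irrefl _)] at e2 ⊢
      have : (2 : A) * (crd S.basis A (u a) (Sum.inl (Sum.inr a)) -
        -formBaseChange q A (S.tail (S.gtail P a))) = 0 := by linear_combination e1 - e2
      exact sub_eq_zero.mp ((isUnit_two (K := K) A).mul_right_eq_zero.mp this)
    · have e3 : S.entry P b a = crd S.basis A (u b) (Sum.inl (Sum.inr a)) := by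
        rw [entry, dif_pos h, hP]
      linear_combination e1 - e2 + e3
  · exact congrFun (ht a) c

end Frame

end

end OrthogonalGrassmannian

namespace OrthogonalGrassmannian

noncomputable section

section LocalBasis

variable {K : Type u} [Field K] {V : Type u} [AddCommGroup V] [Module K V] [Module.Finite K V]

theorem exists_local_basis {A : CommAlgCat.{u} K} {k : ℕ} (hk : k ≤ Module.finrank K V)
    (N : Module.Grassmannian A (A ⊗[K] V) (Module.finrank K V - k)) (p : PrimeSpectrum A) :
    ∃ d ∉ p.asIdeal, ∃ u : Fin k → A ⊗[K] V, (∀ i, u i ∈ N.toSubmodule) ∧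
      ∀ (B : CommAlgCat.{u} K) (f : A ⟶ B), IsUnit (f.hom d) →
        (Module.Grassmannian.map f.hom N).toSubmodule =
          Submodule.span B (Set.range fun i => push f.hom (u i)) ∧
        ∃ ψ : B ⊗[K] V →ₗ[B] (Fin k → B), ∀ i, ψ (push f.hom (u i)) = Pi.single i 1 := by
  obtain ⟨u, I, hu, hd⟩ := exists_minor (Module.finBasis K V) hk N p
  refine ⟨_, hd, u, hu, fun B f hf => ?_⟩
  refine eq_span_of_isUnit_minor (Module.finBasis K V) (Module.Grassmannian.map f.hom N)
    (fun i => push f.hom (u i)) I (fun i => map_smul_mem_map f.hom N (hu i)) ?_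
  have h : (Matrix.of fun i j => crd (Module.finBasis K V) B (push f.hom (u i)) (I j)) =
      f.hom.toRingHom.mapMatrix
        (Matrix.of fun i j => crd (Module.finBasis K V) A (u i) (I j)) := by
    ext i j
    exact crd_push (Module.finBasis K V) f.hom (u i) (I j)
  rw [h, ← RingHom.map_det]
  exact hf

end LocalBasis

namespace Frame

variable {K : Type u} [Field K] [CharZero K] {V : Type u} [AddCommGroup V] [Module K V]
  {q : QuadraticForm K V} {v : V} {k : ℕ} (S : Frame q v k)

theorem card_eq_finrank : k + k + (S.r + 1) = Module.finrank K V := by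
  rw [Module.finrank_eq_card_basis S.basis]
  simp

include S in
theorem ne_zero : v ≠ 0 := fun h => S.basis.ne_zero (Sum.inr 0) (S.basis_zero.trans h)

variable [NeZero k] {A : Type u} [CommRing A] [Algebra K A] {B : Type u} [CommRing B] [Algebra K B]

/-- The coordinates on `A ⊗ V` used to normalize the hyperplane. -/
def index (b : Fin k) : (Fin k ⊕ Fin k) ⊕ Fin (S.r + 1) :=
  if b = 0 then Sum.inr 0 else Sum.inl (Sum.inl b)

variable (A) in
/-- The coordinates on `A ⊗ V` which are dual to the generators of the hyperplane. -/
def mixed : A ⊗[K] V →ₗ[A] (Fin k → A) :=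
  LinearMap.funLeft A A S.index ∘ₗ (crd S.basis A).toLinearMap

theorem mixed_apply (x : A ⊗[K] V) (b : Fin k) : S.mixed A x b = crd S.basis A x (S.index b) := rfl

theorem mixed_push (f : A →ₐ[K] B) (x : A ⊗[K] V) (b : Fin k) :
    S.mixed B (push f x) b = f (S.mixed A x b) := by
  rw [mixed_apply, mixed_apply, crd_push]

/-- The generators of the hyperplane. -/
def gen (P : S.Param → A) (l : Fin k) : A ⊗[K] V :=
  (if l = 0 then S.vec A (Sum.inr 0) else S.lift P l) + P (Sum.inr (Sum.inr l)) • S.lift P 0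

theorem mixed_lift_zero (P : S.Param → A) : S.mixed A (S.lift P 0) = 0 := by
  funext b
  rw [mixed_apply, index, crd_lift]
  split_ifs with h
  · rfl
  · simp [h]

theorem mixed_gen (P : S.Param → A) (l : Fin k) : S.mixed A (S.gen P l) = Pi.single l 1 := by
  rw [gen, map_add, map_smul, mixed_lift_zero, smul_zero, add_zero]
  funext b
  rw [mixed_apply, index]
  by_cases hl : l = 0
  · rw [if_pos hl, crd_vec]
    by_cases hb : b = 0 <;> simp [hb, hl]
  · rw [if_neg hl, crd_lift]
    by_cases hb : b = 0
    · simp [hb, hl, gtail]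
    · simp [hb]

theorem push_gen (f : A →ₐ[K] B) (P : S.Param → A) (l : Fin k) :
    push f (S.gen P l) = S.gen (fun i => f (P i)) l := by
  rw [gen, gen, map_add, push_smul, push_lift]
  congr 1
  split_ifs
  · exact S.push_vec f _
  · exact S.push_lift P f l

variable (hv : LinearMap.ker (QuadraticMap.polarBilin q) = Submodule.span K {v})

theorem projection_vec_zero : projection (Submodule.span K {v}) A (S.vec A (Sum.inr 0)) = 0 :=
  projection_eq_zero.mpr ⟨1, by rw [vec, S.basis_zero]⟩

include hv in
theorem polar_vec_zero (x : A ⊗[K] V) :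
    QuadraticMap.polar (formBaseChange q A) (S.vec A (Sum.inr 0)) x = 0 := by
  rw [← polar_projection hv, projection_vec_zero, QuadraticMap.polar_zero_left]

include hv in
theorem polar_gen (P : S.Param → A) (l m : Fin k) :
    QuadraticMap.polar (formBaseChange q A) (S.gen P l) (S.gen P m) = 0 := by
  have h (x : A ⊗[K] V) :
      QuadraticMap.polar (formBaseChange q A) x (S.vec A (Sum.inr 0)) = 0 := by
    rw [QuadraticMap.polar_comm, S.polar_vec_zero hv]
  rw [gen, gen]
  split_ifs <;>
  simp only [QuadraticMap.polar_add_left, QuadraticMap.polar_add_right, QuadraticMap.polar_smul_left,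
    QuadraticMap.polar_smul_right, polar_lift, S.polar_vec_zero hv, h, smul_zero, add_zero]

variable (A) in
/-- The pairing with the second halves of the hyperbolic pairs. -/
def pairing : A ⊗[K] (V ⧸ Submodule.span K {v}) →ₗ[A] (Fin k → A) :=
  LinearMap.pi fun b => QuadraticMap.polarBilin (formBaseChange (reducedForm hv) A)
    (projection _ A (S.vec A (Sum.inl (Sum.inr b))))

theorem pairing_projection (x : A ⊗[K] V) (b : Fin k) :
    S.pairing A hv (projection _ A x) b = crd S.basis A x (Sum.inl (Sum.inl b)) :=
  (polar_projection hv _ _).trans (S.polar_right x b)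

theorem pairing_push (f : A →ₐ[K] B) (x : A ⊗[K] (V ⧸ Submodule.span K {v})) (b : Fin k) :
    S.pairing B hv (push f x) b = f (S.pairing A hv x b) := by
  obtain ⟨x, rfl⟩ := projection_surjective _ A x
  rw [← projection_push, pairing_projection, pairing_projection, crd_push]

theorem pairing_lift (P : S.Param → A) (l : Fin k) :
    S.pairing A hv (projection _ A (S.lift P l)) = Pi.single l 1 := by
  funext b
  rw [pairing_projection, crd_lift]
  rfl

theorem projection_gen_mem (P : S.Param → A) (l : Fin k) :
    projection (Submodule.span K {v}) A (S.gen P l) ∈ Submodule.span A (Set.range fun a =>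
      projection (Submodule.span K {v}) A (S.lift P a)) := by
  rw [gen, map_add, map_smul]
  refine add_mem ?_ (Submodule.smul_mem _ _ (Submodule.subset_span ⟨0, rfl⟩))
  split_ifs
  · rw [projection_vec_zero]
    exact zero_mem _
  · exact Submodule.subset_span ⟨l, rfl⟩

variable [Module.Finite K V]

/-- The point with given coordinates. -/
def point {A : CommAlgCat.{u} K} (P : S.Param → A) :
    (TOGr q (Submodule.span K {v}) (reducedForm hv) k).obj A :=
  ⟨(⟨ofBasis (S.gen P) (S.mixed A) (S.mixed_gen P), by
      refine isIsotropic_span ?_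
      rintro _ ⟨l, rfl⟩ _ ⟨m, rfl⟩
      exact S.polar_gen hv P l m⟩,
    ⟨ofBasis (fun a => projection _ A (S.lift P a)) (S.pairing A hv) (S.pairing_lift hv P), by
      refine isIsotropic_span ?_
      rintro _ ⟨l, rfl⟩ _ ⟨m, rfl⟩
      rw [polar_projection]
      exact S.polar_lift P l m⟩), by
    change Submodule.span A (Set.range (S.gen P)) ≤ (Submodule.span A
      (Set.range fun a => projection (Submodule.span K {v}) A (S.lift P a))).comap _
    rw [Submodule.span_le]
    rintro _ ⟨l, rfl⟩
    exact S.projection_gen_mem P l⟩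

theorem subspace_point_fst {A : CommAlgCat.{u} K} (P : S.Param → A) :
    subspace (S.point hv P).1.1 = Submodule.span A (Set.range (S.gen P)) := rfl

theorem subspace_point_snd {A : CommAlgCat.{u} K} (P : S.Param → A) :
    subspace (S.point hv P).1.2 =
      Submodule.span A (Set.range fun a => projection (Submodule.span K {v}) A (S.lift P a)) := rfl

theorem map_point {A B : CommAlgCat.{u} K} (f : A ⟶ B) (P : S.Param → A) :
    (TOGr q (Submodule.span K {v}) (reducedForm hv) k).map f (S.point hv P) =
      S.point hv (fun i => f.hom (P i)) := by
  apply Subtype.ext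
  refine Prod.ext (subspace_ext ?_) (subspace_ext ?_)
  · refine (map_toSubmodule_of_span f.hom (S.subspace_point_fst hv P)).trans ?_
    rw [subspace_point_fst]
    congr 2
    funext l
    exact S.push_gen f.hom P l
  · refine (map_toSubmodule_of_span f.hom (S.subspace_point_snd hv P)).trans ?_
    rw [subspace_point_snd]
    congr 2
    funext l
    rw [← projection_push, push_lift]

theorem eq_of_projection_eq {x y : A ⊗[K] V}
    (h : projection (Submodule.span K {v}) A x = projection _ A y)
    (h0 : crd S.basis A x (Sum.inr 0) = crd S.basis A y (Sum.inr 0)) : x = y := by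
  have h1 : projection (Submodule.span K {v}) A (x - y) = 0 := by rw [map_sub, h, sub_self]
  obtain ⟨a, ha⟩ := projection_eq_zero.mp h1
  have h2 : crd S.basis A (x - y) (Sum.inr 0) = a := by
    have h3 : a ⊗ₜ[K] v = a ⊗ₜ S.basis (Sum.inr 0) := by rw [S.basis_zero]
    rw [ha, h3, crd_tmul]
    simp
  rw [map_sub, Pi.sub_apply, h0, sub_self] at h2
  rw [← h2, TensorProduct.zero_tmul] at ha
  exact sub_eq_zero.mp ha

theorem crd_lift_zero (P : S.Param → A) (a : Fin k) :
    crd S.basis A (S.lift P a) (Sum.inr 0) = 0 := by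
  rw [crd_lift]
  rfl

theorem crd_gen_zero (P : S.Param → A) (l : Fin k) :
    crd S.basis A (S.gen P l) (Sum.inl (Sum.inl 0)) = P (Sum.inr (Sum.inr l)) := by
  rw [gen, map_add, map_smul, Pi.add_apply, Pi.smul_apply, crd_lift]
  by_cases h : l = 0
  · simp [h, crd_vec]
  · simp [h, crd_lift]

theorem point_injective {A : CommAlgCat.{u} K} {P P' : S.Param → A}
    (h : S.point hv P = S.point hv P') : P = P' := by
  have h1 (a) : S.lift P a = S.lift P' a := by
    refine S.eq_of_projection_eq ?_ (by rw [crd_lift_zero, crd_lift_zero])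
    have h2 : projection _ A (S.lift P a) ∈ Submodule.span A (Set.range fun a =>
        projection (Submodule.span K {v}) A (S.lift P' a)) := by
      rw [← S.subspace_point_snd hv, ← h]
      exact Submodule.subset_span ⟨a, rfl⟩
    rw [eq_sum_of_dual _ (S.pairing_lift hv P') h2, pairing_lift]
    simp [Pi.single_apply]
  have h3 (l) : S.gen P l = S.gen P' l := by
    have h2 : S.gen P l ∈ Submodule.span A (Set.range (S.gen P')) := by
      rw [← S.subspace_point_fst hv, ← h]
      exact Submodule.subset_span ⟨l, rfl⟩
    rw [eq_sum_of_dual _ (S.mixed_gen P') h2, mixed_gen]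
    simp [Pi.single_apply]
  have h4 (a i) : Sum.elim (Sum.elim (Pi.single a 1) (S.entry P a)) (S.gtail P a) i =
      Sum.elim (Sum.elim (Pi.single a 1) (S.entry P' a)) (S.gtail P' a) i := by
    rw [← crd_lift, ← crd_lift, h1]
  funext i
  rcases i with ⟨⟨a, b⟩, hab⟩ | ⟨a, c⟩ | l
  · have := h4 a (Sum.inl (Sum.inr b))
    rw [Sum.elim_inl, Sum.elim_inr, Sum.elim_inl, Sum.elim_inr, entry, entry, dif_pos hab,
      dif_pos hab] at this
    exact this
  · exact h4 a (Sum.inr c.succ)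
  · have := congrArg (fun x => crd S.basis A x (Sum.inl (Sum.inl 0))) (h3 l)
    simp only [crd_gen_zero] at this
    exact this

theorem exists_point_iff {A : CommAlgCat.{u} K}
    (x : (TOGr q (Submodule.span K {v}) (reducedForm hv) k).obj A) :
    (∃ P, S.point hv P = x) ↔
      (∃ n : Fin k → A ⊗[K] V, subspace x.1.1 = Submodule.span A (Set.range n) ∧
        ∀ i, S.mixed A (n i) = Pi.single i 1) ∧
      ∃ m : Fin k → A ⊗[K] (V ⧸ Submodule.span K {v}),
        subspace x.1.2 = Submodule.span A (Set.range m) ∧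
        ∀ i, S.pairing A hv (m i) = Pi.single i 1 := by
  constructor
  · rintro ⟨P, rfl⟩
    exact ⟨⟨_, S.subspace_point_fst hv P, S.mixed_gen P⟩,
      ⟨_, S.subspace_point_snd hv P, S.pairing_lift hv P⟩⟩
  · rintro ⟨⟨n, hn, hnψ⟩, m, hm, hmψ⟩
    have hex (a) : ∃ u : A ⊗[K] V, projection _ A u = m a ∧ crd S.basis A u (Sum.inr 0) = 0 := by
      obtain ⟨u, hu⟩ := projection_surjective (Submodule.span K {v}) A (m a)
      refine ⟨u - crd S.basis A u (Sum.inr 0) • S.vec A (Sum.inr 0), ?_, ?_⟩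
      · rw [map_sub, map_smul, projection_vec_zero, smul_zero, sub_zero, hu]
      · rw [map_sub, map_smul, Pi.sub_apply, Pi.smul_apply, crd_vec]
        simp
    choose u hu hu0 using hex
    have hpu (a b) : crd S.basis A (u a) (Sum.inl (Sum.inl b)) = (Pi.single a 1 : Fin k → A) b := by
      rw [← S.pairing_projection hv, hu, hmψ]
    let P : S.Param → A := Sum.elim (fun p => crd S.basis A (u p.1.1) (Sum.inl (Sum.inr p.1.2)))
      (Sum.elim (fun p => crd S.basis A (u p.1) (Sum.inr p.2.succ))
        (fun l => crd S.basis A (n l) (Sum.inl (Sum.inl 0))))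
    have hlift (a) : u a = S.lift P a := by
      refine S.eq_lift P hpu hu0 (fun a b => ?_) (fun a b h => rfl) (fun a c => rfl) a
      rw [← polar_projection hv, hu, hu]
      refine IsIsotropic.polar_eq_zero x.1.2.2 (x := m a) (y := m b) ?_ ?_
      · exact hm.ge (Submodule.subset_span ⟨a, rfl⟩)
      · exact hm.ge (Submodule.subset_span ⟨b, rfl⟩)
    refine ⟨P, Subtype.ext (Prod.ext (subspace_ext ?_) (subspace_ext ?_))⟩
    · rw [subspace_point_fst, hn]
      congr 2
      funext l
      have h1 : projection _ A (n l) ∈ Submodule.span A (Set.range m) :=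
        hm.le (x.2 (hn.ge (Submodule.subset_span ⟨l, rfl⟩)))
      have h2 := eq_sum_of_dual _ hmψ h1
      simp only [pairing_projection] at h2
      have h3 (b) : crd S.basis A (n l) (S.index b) = (Pi.single l 1 : Fin k → A) b := by
        rw [← mixed_apply, hnψ]
      have h30 := h3 0
      rw [index, if_pos rfl] at h30
      refine S.eq_of_projection_eq ?_ ?_
      · rw [h2, gen, map_add, map_smul]
        have h4 (a) : crd S.basis A (n l) (Sum.inl (Sum.inl a)) • m a =
            (if a = 0 then crd S.basis A (n l) (Sum.inl (Sum.inl 0)) • m 0 else 0) +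
            if l = a then (if l = 0 then 0 else m l) else 0 := by
          by_cases ha : a = 0
          · subst ha
            by_cases hl : l = 0 <;> simp [hl]
          · have h5 := h3 a
            rw [index, if_neg ha] at h5
            rw [h5, if_neg ha, zero_add]
            by_cases hla : l = a
            · subst hla
              rw [if_pos rfl, if_neg ha, Pi.single_apply, if_pos rfl, one_smul]
            · rw [Pi.single_apply, if_neg (Ne.symm hla), zero_smul, if_neg hla]
        rw [Finset.sum_congr rfl fun a _ => h4 a]
        rw [Finset.sum_add_distrib, Finset.sum_ite_eq', Finset.sum_ite_eq]
        simp only [Finset.mem_univ, if_true]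
        rw [← hlift 0, hu]
        refine (add_comm _ _).trans (congrArg _ ?_)
        split_ifs
        · exact S.projection_vec_zero
        · rw [← hlift l, hu]
      · rw [h30, gen, map_add, map_smul, Pi.add_apply, Pi.smul_apply, crd_lift_zero, smul_zero,
          add_zero]
        by_cases hl : l = 0
        · simp [hl, crd_vec]
        · rw [if_neg hl, crd_lift_zero, Pi.single_apply, if_neg (Ne.symm hl)]
    · rw [subspace_point_snd, hm]
      congr 2
      funext a
      rw [← hlift, hu]

end Frame

end

end OrthogonalGrassmannian

namespace OrthogonalGrassmannian

noncomputable section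

namespace Frame

variable {K : Type u} [Field K] [CharZero K] {V : Type u} [AddCommGroup V] [Module K V]
  {q : QuadraticForm K V} {v : V} {k : ℕ} (S : Frame q v k)

/-- The coordinate ring of the affine space of parameters. -/
abbrev paramRing : CommAlgCat.{u} K := CommAlgCat.of K (MvPolynomial S.Param K)

/-- The parameters given by a point of affine space. -/
def paramsOf {A : CommAlgCat.{u} K} (f : S.paramRing ⟶ A) : S.Param → A :=
  fun i => f.hom (MvPolynomial.X i)

theorem paramsOf_injective {A : CommAlgCat.{u} K} {f g : S.paramRing ⟶ A}
    (h : S.paramsOf f = S.paramsOf g) : f = g := by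
  apply CommAlgCat.hom_ext
  apply MvPolynomial.algHom_ext
  exact fun i => congrFun h i

theorem exists_paramsOf {A : CommAlgCat.{u} K} (P : S.Param → A) :
    ∃ f : S.paramRing ⟶ A, S.paramsOf f = P :=
  ⟨CommAlgCat.ofHom (MvPolynomial.aeval P), funext fun i => MvPolynomial.aeval_X P i⟩

variable [NeZero k] [Module.Finite K V]
  (hv : LinearMap.ker (QuadraticMap.polarBilin q) = Submodule.span K {v})
  (T : ModuliScheme (TOGr q (Submodule.span K {v}) (reducedForm hv) k))

/-- The morphism to the moduli scheme given by the universal parameters. -/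
def toScheme : specOver S.paramRing ⟶ T.scheme :=
  (T.exists_pt (S.point hv (S.paramsOf (𝟙 S.paramRing)))).choose

theorem pt_toScheme {A : CommAlgCat.{u} K} (f : S.paramRing ⟶ A) :
    T.pt (res f (S.toScheme hv T)) = S.point hv (S.paramsOf f) := by
  rw [T.pt_res, toScheme, (T.exists_pt (S.point hv (S.paramsOf (𝟙 S.paramRing)))).choose_spec,
    map_point]
  rfl

theorem exists_toScheme_iff {A : CommAlgCat.{u} K} (y : specOver A ⟶ T.scheme) :
    (∃ z, z ≫ S.toScheme hv T = y) ↔ ∃ P, S.point hv P = T.pt y := by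
  constructor
  · rintro ⟨z, rfl⟩
    obtain ⟨f, rfl⟩ := exists_algSpec_map z
    exact ⟨S.paramsOf f, (S.pt_toScheme hv T f).symm⟩
  · rintro ⟨P, hP⟩
    obtain ⟨f, rfl⟩ := S.exists_paramsOf P
    refine ⟨(algSpec (CommRingCat.of K)).map f.op, T.pt_injective ?_⟩
    rw [← hP]
    exact S.pt_toScheme hv T f

theorem injOnPoints_toScheme : InjOnPoints (S.toScheme hv T) := by
  intro A z z' h
  obtain ⟨f, rfl⟩ := exists_algSpec_map z
  obtain ⟨f', rfl⟩ := exists_algSpec_map z'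
  have h1 : S.point hv (S.paramsOf f) = S.point hv (S.paramsOf f') := by
    rw [← S.pt_toScheme hv T, ← S.pt_toScheme hv T]
    exact congrArg T.pt h
  rw [S.paramsOf_injective (S.point_injective hv h1)]

instance : IsOpenImmersion (S.toScheme hv T).left := by
  refine isOpenImmersion_of_local_unit _ (S.injOnPoints_toScheme hv T) fun A y p => ?_
  have hk : k ≤ Module.finrank K V := by
    have := S.card_eq_finrank
    omega
  have hk' : k ≤ Module.finrank K (V ⧸ Submodule.span K {v}) := by
    have := S.card_eq_finrank
    have := finrank_quotient_span (K := K) S.ne_zero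
    omega
  obtain ⟨d, hd, u, -, hu⟩ := exists_local_basis hk (T.pt y).1.1.1 p
  obtain ⟨d', hd', u', -, hu'⟩ := exists_local_basis hk' (T.pt y).1.2.1 p
  refine ⟨d * d', mul_notMem hd hd',
    Matrix.det (Matrix.of fun i j => S.mixed (loc A (d * d')) (push (toLoc A (d * d')).hom (u i)) j) *
    Matrix.det (Matrix.of fun i j =>
      S.pairing (loc A (d * d')) hv (push (toLoc A (d * d')).hom (u' i)) j), fun B f => ?_⟩
  have hunit : IsUnit ((toLoc A (d * d') ≫ f).hom (d * d')) :=
    (isUnit_toLoc A (d * d')).map f.hom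
  rw [map_mul] at hunit
  obtain ⟨h1, -⟩ := hu B (toLoc A (d * d') ≫ f) (isUnit_of_mul_isUnit_left hunit)
  obtain ⟨h2, -⟩ := hu' B (toLoc A (d * d') ≫ f) (isUnit_of_mul_isUnit_right hunit)
  have hx : T.pt (res f (res (toLoc A (d * d')) y)) =
      (TOGr q (Submodule.span K {v}) (reducedForm hv) k).map (toLoc A (d * d') ≫ f) (T.pt y) := by
    rw [res_res, T.pt_res]
  rw [S.exists_toScheme_iff, hx, S.exists_point_iff, map_mul, IsUnit.mul_iff]
  refine and_congr ((exists_dual_generators_iff h1 (S.mixed B)).trans ?_)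
    ((exists_dual_generators_iff h2 (S.pairing B hv)).trans ?_)
  · have e : (Matrix.of fun i j => S.mixed B (push (toLoc A (d * d') ≫ f).hom (u i)) j) =
        f.hom.toRingHom.mapMatrix (Matrix.of fun i j =>
          S.mixed (loc A (d * d')) (push (toLoc A (d * d')).hom (u i)) j) := by
      ext i j
      change S.mixed B (push (f.hom.comp (toLoc A (d * d')).hom) (u i)) j = f.hom _
      rw [← push_push, mixed_push]
      rfl
    rw [e, ← RingHom.map_det]
    rfl
  · have e : (Matrix.of fun i j => S.pairing B hv (push (toLoc A (d * d') ≫ f).hom (u' i)) j) =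
        f.hom.toRingHom.mapMatrix (Matrix.of fun i j =>
          S.pairing (loc A (d * d')) hv (push (toLoc A (d * d')).hom (u' i)) j) := by
      ext i j
      change S.pairing B hv (push (f.hom.comp (toLoc A (d * d')).hom) (u' i)) j = f.hom _
      rw [← push_push, pairing_push]
      rfl
    rw [e, ← RingHom.map_det]
    rfl

end Frame

end

end OrthogonalGrassmannian

namespace OrthogonalGrassmannian

noncomputable section

section ClosedPoints

variable {K : Type u} [Field K]

instance locallyOfFiniteType_projectiveSpace (n : ℕ) :
    LocallyOfFiniteType (projectiveSpace K n).hom := by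
  unfold projectiveSpace
  dsimp only [Over.mk_hom]
  let _ := MvPolynomial.gradedAlgebra (σ := Fin (n + 1)) (R := K)
  have : IsScalarTower K (MvPolynomial.homogeneousSubmodule (Fin (n + 1)) K 0)
      (MvPolynomial (Fin (n + 1)) K) :=
    ⟨fun a b c => smul_mul_assoc a (b : MvPolynomial (Fin (n + 1)) K) c⟩
  have : Algebra.FiniteType (MvPolynomial.homogeneousSubmodule (Fin (n + 1)) K 0)
      (MvPolynomial (Fin (n + 1)) K) := Algebra.FiniteType.of_restrictScalars_finiteType K _ _
  have : LocallyOfFiniteType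
      (Proj.toSpecZero (MvPolynomial.homogeneousSubmodule (Fin (n + 1)) K)) := inferInstance
  have : LocallyOfFiniteType (Spec.map (CommRingCat.ofHom
      (algebraMap K (MvPolynomial.homogeneousSubmodule (Fin (n + 1)) K 0)))) := by
    rw [HasRingHomProperty.Spec_iff (P := @LocallyOfFiniteType)]
    apply RingHom.FiniteType.of_surjective
    rintro ⟨p, hp⟩
    rw [MvPolynomial.homogeneousSubmodule_zero, Submodule.mem_one] at hp
    obtain ⟨c, hc⟩ := hp
    exact ⟨c, Subtype.ext hc⟩
  infer_instance

theorem IsProjective.locallyOfFiniteType {X : Over (Spec (CommRingCat.of K))}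
    (h : IsProjective X) : LocallyOfFiniteType X.hom := by
  obtain ⟨n, i, hi⟩ := h
  rw [← Over.w i]
  infer_instance

/-- The ground field as an algebra over itself. -/
abbrev ground (K : Type u) [Field K] : CommAlgCat.{u} K := CommAlgCat.of K K

variable [IsAlgClosed K]

theorem exists_ground_point {X : Over (Spec (CommRingCat.of K))} [LocallyOfFiniteType X.hom]
    {Z : Set X.left} (hZ : IsLocallyClosed Z) (hne : Z.Nonempty) :
    ∃ y : specOver (ground K) ⟶ X, ∀ p, y.left p ∈ Z := by
  have : JacobsonSpace X.left := LocallyOfFiniteType.jacobsonSpace X.hom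
  obtain ⟨x, hxZ, hx⟩ := nonempty_inter_closedPoints hne hZ
  refine ⟨Over.homMk (pointOfClosedPoint X.hom x hx) ?_, fun p => ?_⟩
  · exact (pointOfClosedPoint_comp X.hom x hx).trans (Spec.map_id _).symm
  · have : pointOfClosedPoint X.hom x hx p = x := pointOfClosedPoint_apply X.hom x hx p
    change pointOfClosedPoint X.hom x hx p ∈ Z
    rwa [this]

end ClosedPoints

section Fibres

variable {K : Type u} [Field K] {V : Type u} [AddCommGroup V] [Module K V]

/-- The subspace of `V` corresponding to a subspace of `K ⊗ V`. -/
def fibre (N : Submodule K (K ⊗[K] V)) : Submodule K V :=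
  N.map (TensorProduct.lid K V).toLinearMap

theorem one_tmul_lid (x : K ⊗[K] V) : (1 : K) ⊗ₜ[K] (TensorProduct.lid K V x) = x := by
  rw [← TensorProduct.lid_symm_apply, LinearEquiv.symm_apply_apply]

theorem mem_fibre {N : Submodule K (K ⊗[K] V)} {x : V} : x ∈ fibre N ↔ (1 : K) ⊗ₜ[K] x ∈ N := by
  constructor
  · rintro ⟨y, hy, rfl⟩
    rwa [LinearEquiv.coe_coe, one_tmul_lid]
  · intro h
    exact ⟨_, h, by simp⟩

theorem lid_mem_fibre {N : Submodule K (K ⊗[K] V)} {x : K ⊗[K] V} (h : x ∈ N) :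
    TensorProduct.lid K V x ∈ fibre N := ⟨x, h, rfl⟩

theorem finrank_fibre (N : Submodule K (K ⊗[K] V)) : Module.finrank K (fibre N) =
    Module.finrank K N := LinearEquiv.finrank_map_eq (TensorProduct.lid K V) N

theorem exists_dual_generators_of_injective {L M : Type*} [Field L] [AddCommGroup M] [Module L M]
    {k : ℕ} {N : Submodule L M} [Module.Finite L N] (hN : Module.finrank L N = k)
    (ψ : M →ₗ[L] (Fin k → L)) (h : ∀ x ∈ N, ψ x = 0 → x = 0) :
    ∃ n : Fin k → M, N = Submodule.span L (Set.range n) ∧ ∀ i, ψ (n i) = Pi.single i 1 := by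
  have hi : Function.Injective (ψ ∘ₗ N.subtype) := by
    rw [injective_iff_map_eq_zero]
    exact fun x hx => Subtype.ext (h x x.2 hx)
  let e := LinearEquiv.ofInjectiveOfFinrankEq (ψ ∘ₗ N.subtype) hi (by simp [hN])
  have he (x) : e x = ψ x := rfl
  refine ⟨fun i => e.symm (Pi.single i 1), le_antisymm ?_ ?_, fun i => ?_⟩
  · intro x hx
    have h1 : (⟨x, hx⟩ : N) = ∑ i, ψ x i • e.symm (Pi.single i 1) := by
      apply e.injective
      rw [map_sum]
      simp only [map_smul, LinearEquiv.apply_symm_apply]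
      rw [he]
      funext j
      simp [Pi.single_apply]
    have h2 : x = ∑ i, ψ x i • (e.symm (Pi.single i 1) : M) := by
      have h3 := congrArg Subtype.val h1
      rw [AddSubmonoidClass.coe_finsetSum] at h3
      exact h3
    rw [h2]
    exact sum_mem fun i _ => Submodule.smul_mem _ _ (Submodule.subset_span ⟨i, rfl⟩)
  · rw [Submodule.span_le]
    rintro _ ⟨i, rfl⟩
    exact (e.symm (Pi.single i 1)).2
  · rw [← he, LinearEquiv.apply_symm_apply]

theorem exists_basis_head {M : Type*} [AddCommGroup M] [Module K M] [Module.Finite K M] {n : ℕ}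
    (hn : Module.finrank K M = n + 1) {x : M} (hx : x ≠ 0) :
    ∃ b : Module.Basis (Fin (n + 1)) K M, b 0 = x := by
  obtain ⟨N, hN⟩ := Submodule.exists_isCompl (Submodule.span K {x})
  have hd : Module.finrank K N = n := by
    have := Submodule.finrank_add_eq_of_isCompl hN
    rw [finrank_span_singleton hx] at this
    omega
  let b := Module.Basis.mkFinCons x (Module.finBasisOfFinrankEq K N hd)
    (fun c y hy h => by
      by_contra hc
      have h1 : c • x ∈ N := by
        rw [eq_neg_of_add_eq_zero_left h]
        exact neg_mem hy
      exact hx (Submodule.disjoint_def.mp hN.disjoint _ (Submodule.mem_span_singleton_self _)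
        ((Submodule.smul_mem_iff _ hc).mp h1)))
    (fun z => by
      obtain ⟨y, hy, w, hw, h⟩ := Submodule.mem_sup.mp
        (hN.sup_eq_top ▸ Submodule.mem_top (x := z) : z ∈ Submodule.span K {x} ⊔ N)
      obtain ⟨c, rfl⟩ := Submodule.mem_span_singleton.mp hy
      refine ⟨-c, ?_⟩
      rw [← h, neg_smul, add_comm (c • _) w, add_neg_cancel_right]
      exact hw)
  exact ⟨b, by simp [b]⟩

variable [CharZero K] {q : QuadraticForm K V} {k : ℕ}

theorem polar_one_tmul (x y : V) :
    QuadraticMap.polar (formBaseChange q K) ((1 : K) ⊗ₜ[K] x) ((1 : K) ⊗ₜ[K] y) =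
      QuadraticMap.polar q x y := by
  rw [polar_formBaseChange_tmul, mul_one, mul_one]
  rfl

theorem polar_fibre_eq_zero (W : (OGr q k).obj (ground K)) {x y : V} (hx : x ∈ fibre (subspace W))
    (hy : y ∈ fibre (subspace W)) : QuadraticMap.polar q x y = 0 := by
  rw [← polar_one_tmul]
  exact IsIsotropic.polar_eq_zero W.2 (mem_fibre.mp hx) (mem_fibre.mp hy)

variable [Module.Finite K V]

theorem finrank_fibre_subspace (hk : k ≤ Module.finrank K V) (W : (OGr q k).obj (ground K)) :
    Module.finrank K (fibre (subspace W)) = k :=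
  (finrank_fibre _).trans (finrank_of_field hk W.1)

theorem exists_OGr_fibre {U : Submodule K V} (hU : Module.finrank K U = k)
    (h : ∀ x ∈ U, ∀ y ∈ U, QuadraticMap.polar q x y = 0) :
    ∃ W : (OGr q k).obj (ground K), fibre (subspace W) = U := by
  let b := Module.finBasisOfFinrankEq K U hU
  obtain ⟨ρ, hρ⟩ := LinearMap.exists_leftInverse_of_injective U.subtype (Submodule.ker_subtype U)
  let M : Fin k → K ⊗[K] V := fun i => 1 ⊗ₜ (b i : V)
  let ψ : K ⊗[K] V →ₗ[K] (Fin k → K) :=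
    b.equivFun.toLinearMap ∘ₗ ρ ∘ₗ (TensorProduct.lid K V).toLinearMap
  have hψ (i) : ψ (M i) = Pi.single i 1 := by
    have h1 : ρ (b i : V) = b i := LinearMap.congr_fun hρ (b i)
    simp only [ψ, M, LinearMap.comp_apply, LinearEquiv.coe_coe, TensorProduct.lid_tmul, one_smul, h1]
    funext j
    rw [Module.Basis.equivFun_apply, Module.Basis.repr_self]
    simp [Pi.single_apply, Finsupp.single_apply, eq_comm]
  refine ⟨⟨ofBasis M ψ hψ, ?_⟩, ?_⟩
  · refine isIsotropic_span ?_
    rintro _ ⟨i, rfl⟩ _ ⟨j, rfl⟩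
    exact (polar_one_tmul _ _).trans (h _ (b i).2 _ (b j).2)
  · change fibre (Submodule.span K (Set.range M)) = U
    rw [fibre, Submodule.map_span, ← Set.range_comp]
    have h2 : (TensorProduct.lid K V).toLinearMap ∘ M = U.subtype ∘ b := by
      funext i
      simp [M]
    rw [h2, Set.range_comp, ← Submodule.map_span, b.span_eq, Submodule.map_subtype_top]

end Fibres

end

end OrthogonalGrassmannian

namespace OrthogonalGrassmannian

noncomputable section

section ClosedPointsOfTOGr

variable {K : Type u} [Field K] [CharZero K] {V : Type u} [AddCommGroup V] [Module K V]
  {q : QuadraticForm K V} {v : V} {k : ℕ}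
  (hv : LinearMap.ker (QuadraticMap.polarBilin q) = Submodule.span K {v})

theorem polar_reducedForm (x y : V) :
    QuadraticMap.polar (reducedForm hv) ((Submodule.span K {v}).mkQ x)
      ((Submodule.span K {v}).mkQ y) = QuadraticMap.polar q x y := by
  rw [QuadraticMap.polar, ← map_add]
  rfl

theorem projection_one_tmul (x : V) : projection (Submodule.span K {v}) K ((1 : K) ⊗ₜ[K] x) =
    (1 : K) ⊗ₜ ((Submodule.span K {v}).mkQ x) := LinearMap.baseChange_tmul _ _ _

variable {hv}

/-- The isotropic subspace containing `v` corresponding to a point over the ground field. -/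
def coneFibre (W : (OGr (reducedForm hv) k).obj (ground K)) : Submodule K V :=
  (fibre (subspace W)).comap (Submodule.span K {v}).mkQ

theorem mem_coneFibre {W : (OGr (reducedForm hv) k).obj (ground K)} {x : V} :
    x ∈ coneFibre W ↔ projection (Submodule.span K {v}) K ((1 : K) ⊗ₜ[K] x) ∈ subspace W := by
  rw [projection_one_tmul]
  exact mem_fibre

theorem kernel_mem_coneFibre (W : (OGr (reducedForm hv) k).obj (ground K)) : v ∈ coneFibre W := by
  have h : (Submodule.span K {v}).mkQ v = 0 :=
    (Submodule.Quotient.mk_eq_zero _).mpr (Submodule.mem_span_singleton_self v)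
  change (Submodule.span K {v}).mkQ v ∈ fibre (subspace W)
  rw [h]
  exact zero_mem _

theorem fibre_le_coneFibre (x : (TOGr q (Submodule.span K {v}) (reducedForm hv) k).obj (ground K)) :
    fibre (subspace x.1.1) ≤ coneFibre x.1.2 := by
  intro z hz
  exact mem_coneFibre.mpr (x.2 (mem_fibre.mp hz))

theorem finrank_map_mkQ [Module.Finite K V] (hv0 : v ≠ 0) {D : Submodule K V} (hD : v ∈ D) :
    Module.finrank K (D.map (Submodule.span K {v}).mkQ) + 1 = Module.finrank K D := by
  have h1 := ((Submodule.span K {v}).mkQ.domRestrict D).finrank_range_add_finrank_ker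
  have h2 : LinearMap.range ((Submodule.span K {v}).mkQ.domRestrict D) =
      D.map (Submodule.span K {v}).mkQ := LinearMap.range_domRestrict _ _
  have h3 : LinearMap.ker ((Submodule.span K {v}).mkQ.domRestrict D) =
      Submodule.span K {(⟨v, hD⟩ : D)} := by
    ext x
    rw [LinearMap.mem_ker, LinearMap.domRestrict_apply, Submodule.mkQ_apply,
      Submodule.Quotient.mk_eq_zero, Submodule.mem_span_singleton, Submodule.mem_span_singleton]
    simp [Subtype.ext_iff]
  rw [h2, h3, finrank_span_singleton (fun h => hv0 (congrArg Subtype.val h))] at h1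
  exact h1

theorem comap_map_mkQ {D : Submodule K V} (hD : v ∈ D) :
    (D.map (Submodule.span K {v}).mkQ).comap (Submodule.span K {v}).mkQ = D := by
  rw [Submodule.comap_map_mkQ, sup_eq_right, Submodule.span_singleton_le_iff_mem]
  exact hD

theorem exists_TOGr_fibre [Module.Finite K V] (hv0 : v ≠ 0) {U D : Submodule K V} (hU : U ≤ D)
    (hvD : v ∈ D)
    (hrU : Module.finrank K U = k) (hrD : Module.finrank K D = k + 1) (hD : D ≤ perp q D) :
    ∃ x : (TOGr q (Submodule.span K {v}) (reducedForm hv) k).obj (ground K),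
      fibre (subspace x.1.1) = U ∧ coneFibre x.1.2 = D := by
  have hp : ∀ x ∈ D, ∀ y ∈ D, QuadraticMap.polar q x y = 0 := fun x hx y hy => mem_perp.mp (hD hy) x hx
  obtain ⟨W, hW⟩ := exists_OGr_fibre (q := q) hrU fun x hx y hy => hp x (hU hx) y (hU hy)
  obtain ⟨W', hW'⟩ := exists_OGr_fibre (q := reducedForm hv) (k := k)
    (U := D.map (Submodule.span K {v}).mkQ) (by
      have := finrank_map_mkQ hv0 hvD
      omega) (by
      rintro _ ⟨x, hx, rfl⟩ _ ⟨y, hy, rfl⟩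
      rw [polar_reducedForm]
      exact hp x hx y hy)
  have hW2 : coneFibre W' = D := by
    rw [coneFibre, hW', comap_map_mkQ hvD]
  refine ⟨⟨(W, W'), fun y hy => ?_⟩, hW, hW2⟩
  have h1 : TensorProduct.lid K V y ∈ coneFibre W' := hW2 ▸ hU (hW ▸ lid_mem_fibre hy)
  rw [mem_coneFibre, one_tmul_lid] at h1
  exact h1

variable [Module.Finite K V] [NeZero k]

omit [Module.Finite K V] [NeZero k] in
theorem Frame.crd_one_tmul (S : Frame q v k) (z : V) (i) :
    crd S.basis K ((1 : K) ⊗ₜ[K] z) i = S.basis.repr z i := by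
  rw [crd_tmul, one_mul]
  rfl

theorem Frame.exists_point_of_fibre (S : Frame q v k)
    (x : (TOGr q (Submodule.span K {v}) (reducedForm hv) k).obj (ground K))
    (hD : ∀ z ∈ coneFibre x.1.2, (∀ b, S.basis.repr z (Sum.inl (Sum.inl b)) = 0) →
      z ∈ Submodule.span K {v})
    (hU : ∀ z ∈ fibre (subspace x.1.1), (∀ b, S.basis.repr z (S.index b) = 0) → z = 0) :
    ∃ P, S.point hv P = x := by
  have hk : k + 1 ≤ Module.finrank K V := by
    have := S.card_eq_finrank
    omega
  have hk' : k ≤ Module.finrank K (V ⧸ Submodule.span K {v}) := by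
    have := finrank_quotient_span (K := K) S.ne_zero
    omega
  rw [S.exists_point_iff]
  constructor
  · refine exists_dual_generators_of_injective (finrank_of_field (by omega) x.1.1.1)
      (S.mixed K) fun y hy h0 => ?_
    have h1 := hU _ (lid_mem_fibre hy) fun b => by
      rw [← S.crd_one_tmul, one_tmul_lid]
      exact congrFun h0 b
    rw [← one_tmul_lid y, h1, TensorProduct.tmul_zero]
  · refine exists_dual_generators_of_injective (finrank_of_field hk' x.1.2.1)
      (S.pairing K hv) fun y hy h0 => ?_
    obtain ⟨z, rfl⟩ := projection_surjective (Submodule.span K {v}) K y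
    have h1 := hD (TensorProduct.lid K V z) (by rwa [mem_coneFibre, one_tmul_lid]) fun b => by
      rw [← S.crd_one_tmul, one_tmul_lid, ← S.pairing_projection hv, h0]
      rfl
    rw [← one_tmul_lid z, projection_eq_zero]
    obtain ⟨c, hc⟩ := Submodule.mem_span_singleton.mp h1
    exact ⟨c, by rw [← hc, TensorProduct.tmul_smul, TensorProduct.smul_tmul', smul_eq_mul, mul_one]⟩

theorem exists_mem_notMem {U D : Submodule K V} (hv0 : v ≠ 0) (hU : U ≤ D) (hvD : v ∈ D)
    (hk : 0 < Module.finrank K U) (h : Module.finrank K U < Module.finrank K D) :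
    ∃ x ∈ D, x ∉ U ∧ x ∉ Submodule.span K {v} := by
  obtain ⟨x, hx, hxU⟩ : ∃ x ∈ D, x ∉ U := by
    by_contra! hn
    have := Submodule.finrank_mono hn
    omega
  by_cases hxv : x ∈ Submodule.span K {v}
  · obtain ⟨c, rfl⟩ := Submodule.mem_span_singleton.mp hxv
    have hvU : v ∉ U := fun h => hxU (Submodule.smul_mem _ _ h)
    have : Nontrivial U := Module.nontrivial_of_finrank_pos hk
    obtain ⟨⟨y, hy⟩, hy0⟩ := exists_ne (0 : U)
    refine ⟨y + v, add_mem (hU hy) hvD, fun h' => hvU ((add_mem_cancel_left hy).mp h'), fun h' => ?_⟩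
    have hyv := (add_mem_cancel_right (Submodule.mem_span_singleton_self v)).mp h'
    obtain ⟨c, rfl⟩ := Submodule.mem_span_singleton.mp hyv
    have hc : c ≠ 0 := fun hc => hy0 (Subtype.ext (by simp [hc]))
    exact hvU ((Submodule.smul_mem_iff _ hc).mp hy)
  · exact ⟨x, hx, hxU, hxv⟩

theorem exists_frame_point (hv0 : v ≠ 0) (hk : k + 1 ≤ Module.finrank K V)
    (x : (TOGr q (Submodule.span K {v}) (reducedForm hv) k).obj (ground K)) :
    ∃ (S : Frame q v k) (P : S.Param → ground K), S.point hv P = x := by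
  have hkk : k ≠ 0 := NeZero.ne k
  obtain ⟨n, rfl⟩ := Nat.exists_eq_succ_of_ne_zero hkk
  have hk' : n + 1 ≤ Module.finrank K (V ⧸ Submodule.span K {v}) := by
    have := finrank_quotient_span (K := K) hv0
    omega
  have hrU := finrank_fibre_subspace (by omega) x.1.1
  have hrW := finrank_fibre_subspace hk' x.1.2
  have hrD : Module.finrank K (coneFibre x.1.2) = n + 1 + 1 := by
    rw [← finrank_map_mkQ hv0 (kernel_mem_coneFibre x.1.2), coneFibre,
      Submodule.map_comap_eq_of_surjective (Submodule.mkQ_surjective _), hrW]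
  obtain ⟨y, hyD, hyU, hyv⟩ := exists_mem_notMem hv0 (fibre_le_coneFibre x)
    (kernel_mem_coneFibre x.1.2) (lt_of_lt_of_eq n.succ_pos hrU.symm) (by
      refine lt_of_eq_of_lt hrU (lt_of_lt_of_eq ?_ hrD.symm)
      exact Nat.lt_succ_self _)
  have hy0 : (⟨(Submodule.span K {v}).mkQ y, hyD⟩ : fibre (subspace x.1.2)) ≠ 0 := fun h =>
    hyv ((Submodule.Quotient.mk_eq_zero _).mp (congrArg Subtype.val h))
  obtain ⟨b, hb⟩ := exists_basis_head hrW hy0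
  have hex (a : Fin (n + 1)) : ∃ z, (Submodule.span K {v}).mkQ z = b a ∧ (a = 0 → z = y) := by
    by_cases ha : a = 0
    · subst ha
      exact ⟨y, by rw [hb], fun _ => rfl⟩
    · obtain ⟨z, hz⟩ := Submodule.mkQ_surjective (Submodule.span K {v}) (b a)
      exact ⟨z, hz, fun h => (ha h).elim⟩
  choose e he he0 using hex
  have hee (a c) : QuadraticMap.polar q (e a) (e c) = 0 := by
    rw [← polar_reducedForm hv, he, he]
    exact polar_fibre_eq_zero x.1.2 (b a).2 (b c).2
  obtain ⟨f, hef, hff⟩ := exists_dual_family hv (e := e) (fun c hc => by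
    have h1 : (Submodule.span K {v}).mkQ (∑ a, c a • e a) = 0 :=
      (Submodule.Quotient.mk_eq_zero _).mpr hc
    rw [map_sum] at h1
    simp only [map_smul, he] at h1
    have h2 : ∑ a, c a • b a = 0 := Subtype.ext (by simpa using h1)
    funext a
    exact Fintype.linearIndependent_iff.mp b.linearIndependent c h2 a) hee
  obtain ⟨S, hSe, -⟩ := exists_frame hv hv0 hee hff hef
  have hspan (z) (hz : z ∈ coneFibre x.1.2) : z = (∑ a, S.basis.repr z (Sum.inl (Sum.inl a)) • e a) +
      S.basis.repr z (Sum.inr 0) • v := by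
    have h1 : ∃ (c : Fin (n + 1) → K) (d : K), z = (∑ a, c a • e a) + d • v := by
      refine ⟨fun a => b.repr ⟨(Submodule.span K {v}).mkQ z, hz⟩ a, ?_⟩
      have h2 : (Submodule.span K {v}).mkQ
          (z - ∑ a, b.repr ⟨(Submodule.span K {v}).mkQ z, hz⟩ a • e a) = 0 := by
        rw [map_sub, map_sum]
        simp only [map_smul, he]
        have h3 := congrArg Subtype.val (b.sum_repr ⟨(Submodule.span K {v}).mkQ z, hz⟩)
        rw [AddSubmonoidClass.coe_finsetSum] at h3
        rw [sub_eq_zero]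
        exact h3.symm
      obtain ⟨d, hd⟩ := Submodule.mem_span_singleton.mp ((Submodule.Quotient.mk_eq_zero _).mp h2)
      exact ⟨d, by rw [hd]; abel⟩
    obtain ⟨c, d, rfl⟩ := h1
    have h2 (i) : S.basis.repr ((∑ a, c a • e a) + d • v) i =
        (∑ a, c a * if Sum.inl (Sum.inl a) = i then 1 else 0) +
          d * if Sum.inr 0 = i then 1 else 0 := by
      rw [map_add, map_sum, Finsupp.add_apply, Finsupp.finsetSum_apply]
      congr 1
      · refine Finset.sum_congr rfl fun a _ => ?_
        rw [← hSe, map_smul, Module.Basis.repr_self, Finsupp.smul_apply, Finsupp.single_apply,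
          smul_eq_mul]
      · have h3 : S.basis.repr v = S.basis.repr (S.basis (Sum.inr 0)) := by rw [S.basis_zero]
        rw [map_smul, h3, Module.Basis.repr_self, Finsupp.smul_apply, Finsupp.single_apply,
          smul_eq_mul]
    simp only [h2]
    simp
  refine ⟨S, S.exists_point_of_fibre x ?_ ?_⟩
  · intro z hz h
    rw [hspan z hz]
    simp only [h, zero_smul, Finset.sum_const_zero, zero_add]
    exact Submodule.smul_mem _ _ (Submodule.mem_span_singleton_self v)
  · intro z hz h
    have h1 := hspan z (fibre_le_coneFibre x hz)
    have h2 : S.basis.repr z (Sum.inr 0) = 0 := by simpa [Frame.index] using h 0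
    have h3 (a) (ha : a ≠ 0) : S.basis.repr z (Sum.inl (Sum.inl a)) = 0 := by
      simpa [Frame.index, ha] using h a
    rw [h2, zero_smul, add_zero, Finset.sum_eq_single 0 (fun a _ ha => by rw [h3 a ha, zero_smul])
      (fun h => (h (Finset.mem_univ _)).elim), he0 0 rfl] at h1
    by_contra hz0
    have hc : S.basis.repr z (Sum.inl (Sum.inl 0)) ≠ 0 := fun hc => hz0 (by rw [h1, hc, zero_smul])
    rw [h1, Submodule.smul_mem_iff _ hc] at hz
    exact hyU hz

end ClosedPointsOfTOGr

end

end OrthogonalGrassmannian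

namespace OrthogonalGrassmannian

noncomputable section

section Irreducible

variable {K : Type u} [Field K] [CharZero K] {V : Type u} [AddCommGroup V] [Module K V]
  {q : QuadraticForm K V} {v : V} {k : ℕ}

theorem exists_functional {x y : V} (hx : x ≠ 0) (hy : y ≠ 0) :
    ∃ φ : V →ₗ[K] K, φ x ≠ 0 ∧ φ y ≠ 0 := by
  have hex {x : V} (hx : x ≠ 0) : ∃ φ : V →ₗ[K] K, φ x ≠ 0 := by
    by_contra! h
    exact hx ((Module.forall_dual_apply_eq_zero_iff K x).mp h)
  obtain ⟨φ, hφ⟩ := hex hx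
  obtain ⟨φ', hφ'⟩ := hex hy
  by_cases h1 : φ y = 0
  · by_cases h2 : φ' x = 0
    · exact ⟨φ + φ', by simpa [h2] using hφ, by simpa [h1] using hφ'⟩
    · exact ⟨φ', h2, hφ'⟩
  · exact ⟨φ, hφ, h1⟩

theorem Frame.polar_basis_right (S : Frame q v k) (z : V) (b : Fin k) :
    QuadraticMap.polar q (S.basis (Sum.inl (Sum.inr b))) z =
      S.basis.repr z (Sum.inl (Sum.inl b)) := by
  rw [← S.crd_one_tmul, ← S.polar_right, Frame.vec, polar_one_tmul]

variable (hv : LinearMap.ker (QuadraticMap.polarBilin q) = Submodule.span K {v})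

include hv in
/-- The isotropic subspace spanned by the second halves of the hyperbolic pairs and the kernel. -/
theorem Frame.exists_right (S : Frame q v k) : ∃ D : Submodule K V, v ∈ D ∧ D ≤ perp q D ∧
    Module.finrank K D = k + 1 ∧ ∀ z, (∀ b, S.basis.repr z (Sum.inl (Sum.inl b)) = 0) →
      z ∈ perp q D := by
  let b : Fin k ⊕ Unit → V := Sum.elim (fun a => S.basis (Sum.inl (Sum.inr a))) (fun _ => v)
  have hb : b = S.basis ∘ Sum.elim (fun a => Sum.inl (Sum.inr a)) (fun _ => Sum.inr 0) := by
    funext i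
    rcases i with a | a
    · rfl
    · exact S.basis_zero.symm
  have hinj : Function.Injective (Sum.elim (fun a : Fin k => Sum.inl (Sum.inr a))
      (fun _ : Unit => (Sum.inr 0 : (Fin k ⊕ Fin k) ⊕ Fin (S.r + 1)))) := by
    rintro (a | a) (c | c) h <;> simp at h ⊢
    exact h
  have hli : LinearIndependent K b := by
    rw [hb]
    exact S.basis.linearIndependent.comp _ hinj
  refine ⟨Submodule.span K (Set.range b), Submodule.subset_span ⟨Sum.inr (), rfl⟩, ?_, ?_, ?_⟩
  · rw [Submodule.span_le]
    rintro _ ⟨i, rfl⟩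
    rw [SetLike.mem_coe, mem_perp]
    intro y hy
    induction hy using Submodule.span_induction with
    | mem y hy =>
      obtain ⟨j, rfl⟩ := hy
      rcases i with a | a
      · rcases j with c | c
        · exact S.polar_right_right _ _
        · exact polar_kernel_left hv _
      · exact polar_kernel_right hv _
    | zero => simp
    | add y z _ _ hy hz => rw [QuadraticMap.polar_add_left, hy, hz, add_zero]
    | smul c y _ hy => rw [QuadraticMap.polar_smul_left, hy, smul_zero]
  · rw [finrank_span_eq_card hli]
    simp
  · intro z hz
    rw [mem_perp]
    intro y hy
    induction hy using Submodule.span_induction with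
    | mem y hy =>
      obtain ⟨j, rfl⟩ := hy
      rcases j with c | c
      · exact (S.polar_basis_right z c).trans (hz c)
      · exact polar_kernel_left hv _
    | zero => simp
    | add y z _ _ hy hz => rw [QuadraticMap.polar_add_left, hy, hz, add_zero]
    | smul c y _ hy => rw [QuadraticMap.polar_smul_left, hy, smul_zero]

variable [NeZero k] [Module.Finite K V]

/-- The condition on a hyperplane of a transversal isotropic subspace for being in a chart. -/
theorem Frame.exists_condition (S : Frame q v k) {I : Submodule K V}
    (hr : Module.finrank K I = k + 1)
    (hI : ∀ z ∈ I, (∀ b, S.basis.repr z (Sum.inl (Sum.inl b)) = 0) → z ∈ Submodule.span K {v}) :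
    ∃ g ∈ I, g ≠ 0 ∧ ∀ z ∈ I, (∀ b, S.basis.repr z (S.index b) = 0) → ∃ c : K, z = c • g := by
  by_cases h : ∃ g ∈ I, g ≠ 0 ∧ ∀ b, S.basis.repr g (S.index b) = 0
  · obtain ⟨g, hg, hg0, hgb⟩ := h
    have hzero (z) (hz : z ∈ I) (hb : ∀ b, S.basis.repr z (S.index b) = 0)
        (h0 : S.basis.repr z (Sum.inl (Sum.inl 0)) = 0) : z = 0 := by
      have h1 := hI z hz fun b => by
        by_cases hb0 : b = 0
        · rw [hb0, h0]
        · simpa [Frame.index, hb0] using hb b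
      obtain ⟨c, rfl⟩ := Submodule.mem_span_singleton.mp h1
      have h2 : S.basis.repr (c • v) (Sum.inr 0) = 0 := by simpa [Frame.index] using hb 0
      have h3 : S.basis.repr v = S.basis.repr (S.basis (Sum.inr 0)) := by rw [S.basis_zero]
      rw [map_smul, h3, Module.Basis.repr_self] at h2
      have hc : c = 0 := by simpa using h2
      rw [hc, zero_smul]
    have hg1 : S.basis.repr g (Sum.inl (Sum.inl 0)) ≠ 0 := fun h => hg0 (hzero g hg hgb h)
    refine ⟨g, hg, hg0, fun z hz hb => ⟨S.basis.repr z (Sum.inl (Sum.inl 0)) /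
      S.basis.repr g (Sum.inl (Sum.inl 0)), ?_⟩⟩
    rw [← sub_eq_zero]
    refine hzero _ (sub_mem hz (Submodule.smul_mem _ _ hg)) (fun b => ?_) ?_
    · rw [map_sub, map_smul, Finsupp.sub_apply, Finsupp.smul_apply, hb, hgb, smul_zero, sub_zero]
    · rw [map_sub, map_smul, Finsupp.sub_apply, Finsupp.smul_apply, smul_eq_mul,
        div_mul_cancel₀ _ hg1, sub_self]
  · push Not at h
    have : Nontrivial I := Module.nontrivial_of_finrank_pos (R := K) (by omega)
    obtain ⟨⟨g, hgI⟩, hg⟩ := exists_ne (0 : I)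
    refine ⟨g, hgI, fun h => hg (Subtype.ext h), fun z hz hb => ⟨0, ?_⟩⟩
    by_contra hz0
    obtain ⟨b, hb'⟩ := h z hz (by simpa using hz0)
    exact hb' (hb b)

theorem exists_common_point (hk : 2 * k + 2 ≤ Module.finrank K V) (S S' : Frame q v k) :
    ∃ (x : (TOGr q (Submodule.span K {v}) (reducedForm hv) k).obj (ground K))
      (P : S.Param → ground K) (P' : S'.Param → ground K), S.point hv P = x ∧
      S'.point hv P' = x := by
  have hv0 := S.ne_zero
  obtain ⟨D, hvD, hD, hrD, hSD⟩ := S.exists_right hv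
  obtain ⟨D', hvD', hD', hrD', hSD'⟩ := S'.exists_right hv
  obtain ⟨I, hvI, hI, hrI, h1, h2⟩ :=
    exists_common_transversal hv hv0 hk hvD hvD' hD hD' hrD hrD'
  have hcond (S : Frame q v k) (D : Submodule K V) (hvD : v ∈ D)
      (hrD : Module.finrank K D = k + 1)
      (hSD : ∀ z, (∀ b, S.basis.repr z (Sum.inl (Sum.inl b)) = 0) → z ∈ perp q D)
      (h1 : D ⊓ perp q I ≤ Submodule.span K {v}) :
      ∀ z ∈ I, (∀ b, S.basis.repr z (Sum.inl (Sum.inl b)) = 0) → z ∈ Submodule.span K {v} := by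
    intro z hz hb
    have htop : D ⊔ perp q I = ⊤ := by
      apply Submodule.eq_top_of_finrank_eq
      have e1 := Submodule.finrank_sup_add_finrank_inf_eq D (perp q I)
      have e2 := finrank_perp hv hv0 hvI
      have e3 := Submodule.finrank_mono h1
      rw [finrank_span_singleton hv0] at e3
      have e4 := Submodule.finrank_le (D ⊔ perp q I)
      omega
    refine mem_span_of_polar hv fun y => ?_
    obtain ⟨d, hd, w, hw, rfl⟩ := Submodule.mem_sup.mp (htop ▸ Submodule.mem_top (x := y))
    rw [QuadraticMap.polar_add_right, mem_perp.mp hw z hz, QuadraticMap.polar_comm,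
      mem_perp.mp (hSD z hb) d hd, add_zero]
  have hc1 := hcond S D hvD hrD hSD h1
  have hc2 := hcond S' D' hvD' hrD' hSD' h2
  obtain ⟨g, hgI, hg0, hg⟩ := S.exists_condition hrI hc1
  obtain ⟨g', -, hg0', hg'⟩ := S'.exists_condition hrI hc2
  obtain ⟨φ, hφ, hφ'⟩ := exists_functional (K := K) hg0 hg0'
  have hrU := finrank_inf_ker (S := I) φ hgI hφ
  obtain ⟨x, hxU, hxI⟩ := exists_TOGr_fibre (hv := hv) (k := k) hv0
    (inf_le_left : I ⊓ LinearMap.ker φ ≤ I) hvI (by omega) hrI hI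
  have hfin (S : Frame q v k)
      (hc : ∀ z ∈ I, (∀ b, S.basis.repr z (Sum.inl (Sum.inl b)) = 0) → z ∈ Submodule.span K {v})
      (g : V) (hg : ∀ z ∈ I, (∀ b, S.basis.repr z (S.index b) = 0) → ∃ c : K, z = c • g)
      (hφ : φ g ≠ 0) : ∃ P, S.point hv P = x := by
    refine S.exists_point_of_fibre x (fun z hz => hc z (hxI ▸ hz)) fun z hz hb => ?_
    rw [hxU] at hz
    obtain ⟨c, rfl⟩ := hg z hz.1 hb
    have h3 := LinearMap.mem_ker.mp hz.2
    rw [map_smul, smul_eq_mul] at h3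
    rw [(mul_eq_zero.mp h3).resolve_right hφ, zero_smul]
  obtain ⟨P, hP⟩ := hfin S hc1 g hg hφ
  obtain ⟨P', hP'⟩ := hfin S' hc2 g' hg' hφ'
  exact ⟨x, P, P', hP, hP'⟩

include hv in
theorem exists_isotropic_subspace [IsAlgClosed K] (hv0 : v ≠ 0) (hk : 2 * k + 2 ≤ Module.finrank K V) :
    ∃ D : Submodule K V, v ∈ D ∧ D ≤ perp q D ∧ Module.finrank K D = k + 1 := by
  have key : ∀ i ≤ k, ∃ D : Submodule K V, v ∈ D ∧ D ≤ perp q D ∧ Module.finrank K D = i + 1 := by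
    intro i
    induction i with
    | zero =>
      intro _
      refine ⟨Submodule.span K {v}, Submodule.mem_span_singleton_self v, ?_,
        finrank_span_singleton hv0⟩
      rw [Submodule.span_singleton_le_iff_mem]
      exact kernel_mem_perp hv _
    | succ i ih =>
      intro hi
      obtain ⟨D, hvD, hD, hr⟩ := ih (by omega)
      have e := finrank_perp hv hv0 hvD
      obtain ⟨x, hx, hxD, hqx⟩ := exists_isotropic_extension hv hv0 (I := D) (by omega)
      exact ⟨D ⊔ Submodule.span K {x}, le_sup_left (α := Submodule K V) hvD,
        isotropic_sup_span hv hv0 hD hx hqx, by rw [finrank_sup_span_singleton hxD, hr]⟩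
  exact key k le_rfl

end Irreducible

end

end OrthogonalGrassmannian

namespace OrthogonalGrassmannian

noncomputable section

section Geometry

variable {K : Type u} [Field K] [CharZero K] {V : Type u} [AddCommGroup V] [Module K V]
  {q : QuadraticForm K V} {v : V} {k : ℕ} [NeZero k] [Module.Finite K V]
  (hv : LinearMap.ker (QuadraticMap.polarBilin q) = Submodule.span K {v})
  (T : ModuliScheme (TOGr q (Submodule.span K {v}) (reducedForm hv) k))

theorem Frame.apply_mem_range (S : Frame q v k) {A : CommAlgCat.{u} K} {y : specOver A ⟶ T.scheme}
    (h : ∃ P, S.point hv P = T.pt y) (p : (specOver A).left) :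
    y.left p ∈ Set.range (S.toScheme hv T).left := by
  obtain ⟨z, rfl⟩ := (S.exists_toScheme_iff hv T y).mpr h
  exact ⟨z.left p, rfl⟩

instance : Nonempty (specOver (ground K)).left :=
  (inferInstance : Nonempty (PrimeSpectrum K))

instance (S : Frame q v k) : IrreducibleSpace (specOver S.paramRing).left :=
  (inferInstance : IrreducibleSpace (PrimeSpectrum (MvPolynomial S.Param K)))

theorem Frame.isIrreducible_range (S : Frame q v k) :
    IsIrreducible (Set.range (S.toScheme hv T).left) := by
  rw [← Set.image_univ]
  exact (IrreducibleSpace.isIrreducible_univ _).image _ (S.toScheme hv T).left.continuous.continuousOn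

theorem ranges_meet (hk : 2 * k + 2 ≤ Module.finrank K V) (S S' : Frame q v k) :
    (Set.range (S.toScheme hv T).left ∩ Set.range (S'.toScheme hv T).left).Nonempty := by
  obtain ⟨x, P, P', h, h'⟩ := exists_common_point hv hk S S'
  obtain ⟨y, rfl⟩ := T.exists_pt x
  obtain ⟨p⟩ : Nonempty (specOver (ground K)).left := inferInstance
  exact ⟨y.left p, S.apply_mem_range hv T ⟨P, h⟩ p, S'.apply_mem_range hv T ⟨P', h'⟩ p⟩

variable [IsAlgClosed K] (hT : IsProjective T.scheme) (hv0 : v ≠ 0)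

include hT hv0

theorem exists_frame_mem (hk : k + 1 ≤ Module.finrank K V) (t : T.scheme.left) :
    ∃ S : Frame q v k, t ∈ Set.range (S.toScheme hv T).left := by
  by_contra hn
  have hft := hT.locallyOfFiniteType
  have hc : IsClosed (⋃ S : Frame q v k, Set.range (S.toScheme hv T).left)ᶜ := by
    rw [isClosed_compl_iff]
    exact isOpen_iUnion fun S => (S.toScheme hv T).left.isOpenEmbedding.isOpen_range
  obtain ⟨y, hy⟩ := exists_ground_point hc.isLocallyClosed ⟨t, by simpa using hn⟩
  obtain ⟨S, P, hP⟩ := exists_frame_point hv0 hk (T.pt y)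
  obtain ⟨p⟩ : Nonempty (specOver (ground K)).left := inferInstance
  exact hy p (Set.mem_iUnion.mpr ⟨S, S.apply_mem_range hv T ⟨P, hP⟩ p⟩)

omit hT in
include hv in
theorem nonempty_frame (hk : 2 * k + 2 ≤ Module.finrank K V) : Nonempty (Frame q v k) := by
  obtain ⟨D, hvD, hD, hr⟩ := exists_isotropic_subspace hv hv0 hk
  obtain ⟨U, hU, hrU⟩ : ∃ U ≤ D, Module.finrank K U = k := by
    obtain ⟨φ, hφ, -⟩ := exists_functional (K := K) hv0 hv0
    have := finrank_inf_ker (S := D) φ hvD hφ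
    exact ⟨D ⊓ LinearMap.ker φ, inf_le_left, by omega⟩
  obtain ⟨x, -, -⟩ := exists_TOGr_fibre (hv := hv) hv0 hU hvD hrU hr hD
  obtain ⟨S, -⟩ := exists_frame_point hv0 (by omega) x
  exact ⟨S⟩

theorem irreducibleSpace_TOGr (hk : 2 * k + 2 ≤ Module.finrank K V) :
    IrreducibleSpace T.scheme.left := by
  have hcov := exists_frame_mem hv T hT hv0 (by omega)
  obtain ⟨S0⟩ := nonempty_frame hv hv0 hk
  have hne : Nonempty T.scheme.left := ⟨(ranges_meet hv T hk S0 S0).some⟩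
  suffices h : PreirreducibleSpace T.scheme.left from { h with toNonempty := hne }
  refine ⟨fun O O' hO hO' ⟨t, _, ht⟩ ⟨t', _, ht'⟩ => ?_⟩
  obtain ⟨S, hS⟩ := hcov t
  obtain ⟨S', hS'⟩ := hcov t'
  have hopen (S : Frame q v k) : IsOpen (Set.range (S.toScheme hv T).left) :=
    (S.toScheme hv T).left.isOpenEmbedding.isOpen_range
  obtain ⟨y, hyS', hyS, hyO⟩ := (S.isIrreducible_range hv T).2 _ _ (hopen S')
    hO (ranges_meet hv T hk S S') ⟨t, hS, ht⟩
  · obtain ⟨z, -, ⟨-, hzO⟩, hzO'⟩ := (S'.isIrreducible_range hv T).2 _ _ ((hopen S).inter hO) hO'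
      ⟨y, hyS, hyS', hyO⟩ ⟨t', hS', ht'⟩
    exact ⟨z, trivial, hzO, hzO'⟩

omit hT hv0 [IsAlgClosed K] in
/-- The covering by the affine spaces of parameters. -/
def frameCover (S : T.scheme.left → Frame q v k)
    (hS : ∀ t, t ∈ Set.range ((S t).toScheme hv T).left) : T.scheme.left.OpenCover :=
  Scheme.Cover.mkOfCovers T.scheme.left (fun t => (specOver (S t).paramRing).left)
    (fun t => ((S t).toScheme hv T).left) (fun t => ⟨t, hS t⟩) fun t => inferInstance

theorem smooth_TOGr (hk : k + 1 ≤ Module.finrank K V) : Smooth T.scheme.hom := by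
  choose S hS using exists_frame_mem hv T hT hv0 hk
  have := HasRingHomProperty.instIsZariskiLocalAtSource (P := @Smooth.{u}) (Q := RingHom.Smooth)
  rw [IsZariskiLocalAtSource.iff_of_openCover (P := @Smooth.{u}) (frameCover hv T S hS)]
  intro t
  have h : ((S t).toScheme hv T).left ≫ T.scheme.hom = (specOver (S t).paramRing).hom :=
    Over.w ((S t).toScheme hv T)
  refine (congrArg Smooth h).mpr ?_
  change Smooth (Spec.map (CommRingCat.ofHom (algebraMap K (MvPolynomial (S t).Param K))))
  rw [HasRingHomProperty.Spec_iff (P := @Smooth), CommRingCat.hom_ofHom, RingHom.smooth_algebraMap]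
  constructor <;> infer_instance

theorem isReduced_TOGr (hk : k + 1 ≤ Module.finrank K V) : AlgebraicGeometry.IsReduced T.scheme.left := by
  choose S hS using exists_frame_mem hv T hT hv0 hk
  have hr : ∀ t, AlgebraicGeometry.IsReduced ((frameCover hv T S hS).X t) := fun t => by
    change AlgebraicGeometry.IsReduced (Spec (CommRingCat.of (MvPolynomial (S t).Param K)))
    infer_instance
  exact AlgebraicGeometry.IsReduced.of_openCover _ (frameCover hv T S hS)

theorem isSmoothProjectiveVariety_TOGr (hk : 2 * k + 2 ≤ Module.finrank K V) :
    IsSmoothProjectiveVariety T.scheme where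
  smooth := smooth_TOGr hv T hT hv0 (by omega)
  projective := hT
  integral := by
    have := irreducibleSpace_TOGr hv T hT hv0 hk
    have := isReduced_TOGr hv T hT hv0 (by omega)
    exact isIntegral_of_irreducibleSpace_of_isReduced _

end Geometry

end

end OrthogonalGrassmannian

namespace OrthogonalGrassmannian

noncomputable section

section Transport

variable {A : Type u} [CommRing A] {P M : Type u} [AddCommGroup P] [Module A P] [AddCommGroup M]
  [Module A M] (ι : P →ₗ[A] M) (ψ : M →ₗ[A] P) (h : ∀ x, ψ (ι x) = x)

/-- The quotient of `M` by a submodule of a direct summand. -/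
def quotMapEquiv (N : Submodule A P) : (M ⧸ N.map ι) ≃ₗ[A] (P ⧸ N) × LinearMap.ker ψ :=
  let g : M →ₗ[A] (P ⧸ N) × LinearMap.ker ψ := (N.mkQ ∘ₗ ψ).prod
    ((LinearMap.id - ι ∘ₗ ψ).codRestrict _ fun x => by simp [h])
  (Submodule.quotEquivOfEq _ _ (by
    ext x
    rw [LinearMap.mem_ker]
    constructor
    · rintro ⟨y, hy, rfl⟩
      refine Prod.ext ?_ (Subtype.ext ?_)
      · change N.mkQ (ψ (ι y)) = 0
        rw [h]
        exact (Submodule.Quotient.mk_eq_zero N).mpr hy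
      · change ι y - ι (ψ (ι y)) = 0
        rw [h, sub_self]
    · intro hx
      have h1 : N.mkQ (ψ x) = 0 := congrArg Prod.fst hx
      have h2 : x - ι (ψ x) = 0 := congrArg (fun z => ((z.2 : LinearMap.ker ψ) : M)) hx
      exact ⟨ψ x, (Submodule.Quotient.mk_eq_zero N).mp h1, (sub_eq_zero.mp h2).symm⟩)).trans
    (g.quotKerEquivOfSurjective (by
      rintro ⟨y, z, hz⟩
      obtain ⟨y, rfl⟩ := N.mkQ_surjective y
      have hz' : ψ z = 0 := hz
      refine ⟨ι y + z, Prod.ext ?_ (Subtype.ext ?_)⟩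
      · change N.mkQ (ψ (ι y + z)) = _
        rw [map_add, h, hz', add_zero]
      · change ι y + z - ι (ψ (ι y + z)) = z
        rw [map_add, h, hz', add_zero, add_sub_cancel_left]))

include h in
theorem projective_ker_retraction [Module.Projective A M] : Module.Projective A (LinearMap.ker ψ) :=
  .of_split (LinearMap.ker ψ).subtype ((LinearMap.id - ι ∘ₗ ψ).codRestrict _ fun x => by simp [h])
    (by
      ext x
      have : ψ x = 0 := x.2
      simp [this])

include h in
theorem finite_ker_retraction [Module.Finite A M] : Module.Finite A (LinearMap.ker ψ) :=
  .of_surjective (M := M) ((LinearMap.id - ι ∘ₗ ψ).codRestrict (LinearMap.ker ψ) fun x => by simp [h])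
    fun x => ⟨x, by
      have : ψ x = 0 := x.2
      ext
      simp [this]⟩

end Transport

section Grassmannian

variable {K : Type u} [Field K] {V W : Type u} [AddCommGroup V] [Module K V] [Module.Finite K V]
  [AddCommGroup W] [Module K W] [Module.Finite K W] {A : Type u} [CommRing A] [Algebra K A]
  (ι : A ⊗[K] W →ₗ[A] A ⊗[K] V) (ψ : A ⊗[K] V →ₗ[A] A ⊗[K] W) (h : ∀ x, ψ (ι x) = x)

include h in
theorem rankAtStalk_ker_retraction (p : PrimeSpectrum A) :
    Module.finrank K W + Module.rankAtStalk (R := A) (LinearMap.ker ψ) p = Module.finrank K V := by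
  have : Nontrivial A := p.nontrivial
  have := projective_ker_retraction ι ψ h
  have := finite_ker_retraction ι ψ h
  have e : (A ⊗[K] V) ≃ₗ[A] (A ⊗[K] W) × LinearMap.ker ψ :=
    (Submodule.quotEquivOfEqBot _ (Submodule.map_bot ι)).symm.trans
      ((quotMapEquiv ι ψ h ⊥).trans (.prodCongr (Submodule.quotEquivOfEqBot _ rfl) (.refl _ _)))
  have h1 := congrFun (Module.rankAtStalk_eq_of_equiv (R := A) (M := A ⊗[K] V)
    (N := (A ⊗[K] W) × LinearMap.ker ψ) e) p
  rw [Module.rankAtStalk_prod, Pi.add_apply, Module.rankAtStalk_eq_finrank_of_free,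
    Module.rankAtStalk_eq_finrank_of_free, Module.finrank_baseChange, Module.finrank_baseChange] at h1
  simpa using h1.symm

/-- A subspace of a direct summand as a subspace of the whole space. -/
def transport {k : ℕ} (hk : k ≤ Module.finrank K W)
    (N : Module.Grassmannian A (A ⊗[K] W) (Module.finrank K W - k)) :
    Module.Grassmannian A (A ⊗[K] V) (Module.finrank K V - k) where
  toSubmodule := N.toSubmodule.map ι
  finite_quotient := by
    have := finite_ker_retraction ι ψ h
    exact .equiv (quotMapEquiv ι ψ h N.toSubmodule).symm
  projective_quotient := by
    have := projective_ker_retraction ι ψ h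
    exact .of_equiv (quotMapEquiv ι ψ h N.toSubmodule).symm
  rankAtStalk_eq p := by
    have := projective_ker_retraction ι ψ h
    have := finite_ker_retraction ι ψ h
    have h1 := rankAtStalk_ker_retraction ι ψ h p
    have h2 := congrFun (Module.rankAtStalk_eq_of_equiv (R := A)
      (M := (A ⊗[K] V) ⧸ N.toSubmodule.map ι) (N := ((A ⊗[K] W) ⧸ N.toSubmodule) × LinearMap.ker ψ)
      (quotMapEquiv ι ψ h N.toSubmodule)) p
    rw [Module.rankAtStalk_prod, Pi.add_apply, N.rankAtStalk_eq] at h2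
    exact h2.trans (by omega)

theorem transport_toSubmodule {k : ℕ} (hk : k ≤ Module.finrank K W)
    (N : Module.Grassmannian A (A ⊗[K] W) (Module.finrank K W - k)) :
    (transport ι ψ h hk N).toSubmodule = N.toSubmodule.map ι := rfl

include h in
theorem exists_transport {k : ℕ} (hk : k ≤ Module.finrank K W)
    (U : Module.Grassmannian A (A ⊗[K] V) (Module.finrank K V - k))
    (hU : U.toSubmodule ≤ LinearMap.range ι) : ∃ N, transport ι ψ h hk N = U := by
  have e0 : (U.toSubmodule.comap ι).map ι = U.toSubmodule := by
    rw [Submodule.map_comap_eq]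
    exact inf_eq_right.mpr hU
  have := projective_ker_retraction ι ψ h
  have := finite_ker_retraction ι ψ h
  have e : ((A ⊗[K] V) ⧸ U.toSubmodule) ≃ₗ[A]
      ((A ⊗[K] W) ⧸ U.toSubmodule.comap ι) × LinearMap.ker ψ :=
    (Submodule.quotEquivOfEq _ _ e0.symm).trans (quotMapEquiv ι ψ h _)
  have hfin : Module.Finite A ((A ⊗[K] W) ⧸ U.toSubmodule.comap ι) := inferInstance
  have h3 : Module.Projective A (((A ⊗[K] W) ⧸ U.toSubmodule.comap ι) × LinearMap.ker ψ) :=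
    .of_equiv e
  have hproj : Module.Projective A ((A ⊗[K] W) ⧸ U.toSubmodule.comap ι) :=
    .of_split (LinearMap.inl A _ (LinearMap.ker ψ)) (LinearMap.fst A _ _) (by ext; rfl)
  refine ⟨⟨U.toSubmodule.comap ι, hfin, hproj, fun p => ?_⟩, ?_⟩
  · have h1 := rankAtStalk_ker_retraction ι ψ h p
    have h2 := congrFun (Module.rankAtStalk_eq_of_equiv (R := A) (M := (A ⊗[K] V) ⧸ U.toSubmodule)
      (N := ((A ⊗[K] W) ⧸ U.toSubmodule.comap ι) × LinearMap.ker ψ) e) p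
    rw [Module.rankAtStalk_prod, Pi.add_apply, U.rankAtStalk_eq] at h2
    omega
  · exact Module.Grassmannian.ext e0

end Grassmannian

section Hyperplanes

variable {K : Type u} [Field K] {V : Type u} [AddCommGroup V] [Module K V] [Module.Finite K V]
  {k : ℕ} (hk : Module.finrank K V = k + 1)

include hk in
theorem le_of_finrank_succ : k ≤ Module.finrank K V := by omega

/-- The kernel of a surjective linear functional. -/
def ofFunctional {A : Type u} [CommRing A] [Algebra K A] (φ : A ⊗[K] V →ₗ[A] A)
    (hφ : Function.Surjective φ) :
    Module.Grassmannian A (A ⊗[K] V) (Module.finrank K V - k) where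
  toSubmodule := LinearMap.ker φ
  finite_quotient := inferInstance
  projective_quotient := .of_equiv (φ.quotKerEquivOfSurjective hφ).symm
  rankAtStalk_eq p := by
    have : Nontrivial A := p.nontrivial
    rw [Module.rankAtStalk_eq_of_equiv (φ.quotKerEquivOfSurjective hφ), Module.rankAtStalk_self]
    exact (Nat.sub_eq_of_eq_add' hk).symm

variable (b : Module.Basis (Fin (k + 1)) K V)

/-- The linear functional with given coefficients. -/
def functional {A : Type u} [CommRing A] [Algebra K A] (c : Fin (k + 1) → A) : A ⊗[K] V →ₗ[A] A :=
  (Fintype.linearCombination A c) ∘ₗ (crd b A).toLinearMap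

theorem functional_apply {A : Type u} [CommRing A] [Algebra K A] (c : Fin (k + 1) → A)
    (x : A ⊗[K] V) : functional b c x = ∑ i, crd b A x i * c i := rfl

theorem functional_basis {A : Type u} [CommRing A] [Algebra K A] (c : Fin (k + 1) → A)
    (i : Fin (k + 1)) : functional b c (1 ⊗ₜ b i) = c i := by
  rw [functional_apply]
  simp [crd_tmul, Finsupp.single_apply]

theorem functional_surjective {A : Type u} [CommRing A] [Algebra K A] {c : Fin (k + 1) → A}
    (h : ∃ i, IsUnit (c i)) : Function.Surjective (functional b c) := by
  obtain ⟨i, hi⟩ := h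
  obtain ⟨d, hd⟩ := hi.exists_left_inv
  exact fun x => ⟨(x * d) • (1 ⊗ₜ b i), by
    rw [map_smul, functional_basis, smul_eq_mul, mul_assoc, hd, mul_one]⟩

theorem functional_push {A B : Type u} [CommRing A] [Algebra K A] [CommRing B] [Algebra K B]
    (f : A →ₐ[K] B) (c : Fin (k + 1) → A) (x : A ⊗[K] V) :
    functional b (fun i => f (c i)) (push f x) = f (functional b c x) := by
  simp only [functional_apply, crd_push, map_sum, map_mul]

include hk in
theorem exists_functional_local {A : CommAlgCat.{u} K}
    (N : Module.Grassmannian A (A ⊗[K] V) (Module.finrank K V - k)) (p : PrimeSpectrum A) :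
    ∃ r ∉ p.asIdeal, ∃ c : Fin (k + 1) → loc A r, (∃ i, IsUnit (c i)) ∧
      (Module.Grassmannian.map (toLoc A r).hom N).toSubmodule = LinearMap.ker (functional b c) := by
  obtain ⟨u, I, hu, hd⟩ := exists_minor b (le_of_finrank_succ hk) N p
  refine ⟨_, hd, ?_⟩
  set r := (Matrix.of fun i j => crd b A (u i) (I j)).det with hr
  set f := toLoc A r
  have hdu : IsUnit (Matrix.of fun i j => crd b (loc A r) (push f.hom (u i)) (I j)).det := by
    have := isUnit_toLoc A r
    rw [hr, AlgHom.map_det] at this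
    simp only [crd_push]
    exact this
  obtain ⟨hspan, -⟩ := eq_span_of_isUnit_minor b (Module.Grassmannian.map f.hom N)
    (fun i => push f.hom (u i)) I (fun i => map_smul_mem_map f.hom N (hu i)) hdu
  obtain ⟨n, hn, hn'⟩ := (exists_dual_generators_iff hspan
    (LinearMap.funLeft (loc A r) (loc A r) I ∘ₗ (crd b (loc A r)).toLinearMap)).mpr hdu
  have hn1 (j i) : crd b (loc A r) (n j) (I i) = (Pi.single j 1 : Fin k → loc A r) i :=
    congrFun (hn' j) i
  obtain ⟨i, hi⟩ : ∃ i, i ∉ Set.range I := by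
    by_contra! hc
    simpa using Fintype.card_le_of_surjective I hc
  let φ : loc A r ⊗[K] V →ₗ[loc A r] loc A r := LinearMap.proj i ∘ₗ (crd b (loc A r)).toLinearMap -
    ∑ j, crd b (loc A r) (n j) i • (LinearMap.proj (I j) ∘ₗ (crd b (loc A r)).toLinearMap)
  have hφ (x) : φ x = crd b (loc A r) x i -
      ∑ j, crd b (loc A r) (n j) i * crd b (loc A r) x (I j) := by
    simp only [φ, LinearMap.sub_apply, LinearMap.sum_apply]
    rfl
  let c : Fin (k + 1) → loc A r := fun l => φ (1 ⊗ₜ b l)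
  have hc : functional b c = φ := by
    apply LinearMap.ext
    intro x
    obtain ⟨y, rfl⟩ := (crd b (loc A r)).symm.surjective x
    have : (crd b (loc A r)).symm y = ∑ l, y l • ((1 : loc A r) ⊗ₜ[K] b l) := by
      apply (crd b (loc A r)).injective
      rw [LinearEquiv.apply_symm_apply, map_sum]
      ext l
      simp [crd_tmul, Finsupp.single_apply]
    rw [this, map_sum, map_sum]
    exact Finset.sum_congr rfl fun l _ => by rw [map_smul, map_smul, functional_basis]
  have hci : c i = 1 := by
    change φ _ = 1
    rw [hφ]
    have h1 : ∀ j, crd b (loc A r) ((1 : loc A r) ⊗ₜ[K] b i) (I j) = 0 := fun j => by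
      have : i ≠ I j := fun h => hi ⟨j, h.symm⟩
      simp [crd_tmul, this]
    simp [h1, crd_tmul]
  have hu1 : ∃ i, IsUnit (c i) := ⟨i, hci ▸ isUnit_one⟩
  refine ⟨c, hu1, ?_⟩
  have := eq_of_toSubmodule_le (N := Module.Grassmannian.map f.hom N)
    (N' := ofFunctional hk _ (functional_surjective b hu1)) (by
      rw [hn, Submodule.span_le]
      rintro _ ⟨j, rfl⟩
      change functional b c (n j) = 0
      rw [hc, hφ, Finset.sum_congr rfl fun l _ => by rw [hn1]]
      simp [Pi.single_apply])
  rw [this]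
  rfl

/-- The coefficients of an equation as homogeneous coordinates of a hyperplane. -/
def hyperplaneCoordinates : Coordinates (Gr (K := K) V (Module.finrank K V - k)) (Fin (k + 1)) where
  rel {A} N c := (∃ i, IsUnit (c i)) ∧
    (N : Module.Grassmannian A (A ⊗[K] V) _).toSubmodule = LinearMap.ker (functional b c)
  map {A B N c} h f := by
    obtain ⟨⟨i, hi⟩, h2⟩ := h
    have hu : ∃ i, IsUnit (f.hom (c i)) := ⟨i, hi.map f.hom⟩
    refine ⟨hu, ?_⟩
    have := eq_of_toSubmodule_le (N := Module.Grassmannian.map f.hom N)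
      (N' := ofFunctional hk _ (functional_surjective b hu)) (by
        refine (map_eq_span f.hom N).le.trans ?_
        rw [Submodule.span_le]
        rintro _ ⟨x, hx, rfl⟩
        rw [SetLike.mem_coe, h2, LinearMap.mem_ker] at hx
        change functional b _ (push f.hom x) = 0
        have h3 := functional_push b f.hom c x
        rw [hx, map_zero] at h3
        exact h3)
    exact congrArg (fun z : Module.Grassmannian B (B ⊗[K] V) _ => z.toSubmodule) this
  smul {A N c} h a ha := by
    obtain ⟨⟨i, hi⟩, h2⟩ := h
    refine ⟨⟨i, ha.mul hi⟩, h2.trans ?_⟩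
    ext x
    rw [LinearMap.mem_ker, LinearMap.mem_ker]
    have : functional b (fun i => a * c i) x = a * functional b c x := by
      simp only [functional_apply, Finset.mul_sum]
      exact Finset.sum_congr rfl fun _ _ => by ring
    rw [this, ha.mul_right_eq_zero]
  isUnit h := h.1
  exists_unit {A N c c'} h h' := by
    obtain ⟨⟨i, hi⟩, h2⟩ := h
    obtain ⟨⟨j, hj⟩, h2'⟩ := h'
    obtain ⟨d, hd⟩ := hi.exists_right_inv
    have hker := h2.symm.trans h2'
    have key (l) : c' l = (d * c' i) * c l := by
      have h3 : (1 : A) ⊗ₜ[K] b l - (d * c l) • ((1 : A) ⊗ₜ[K] b i) ∈ LinearMap.ker (functional b c) := by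
        rw [LinearMap.mem_ker, map_sub, map_smul, functional_basis, functional_basis, smul_eq_mul]
        linear_combination (-c l) * hd
      rw [hker, LinearMap.mem_ker, map_sub, map_smul, functional_basis, functional_basis,
        smul_eq_mul] at h3
      linear_combination h3
    refine ⟨_, ?_, key⟩
    rw [key j] at hj
    exact isUnit_of_mul_isUnit_left hj
  eq_of_rel h h' := Module.Grassmannian.ext (h.2.trans h'.2.symm)
  exists_local N p := exists_functional_local hk b N p
  closed A c h := by
    obtain ⟨i, hi⟩ := h
    refine ⟨⊥, fun B f => ⟨fun _ a ha => ?_, fun _ => ?_⟩⟩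
    · rw [Ideal.mem_bot.mp ha, map_zero]
    · have hu : ∃ i, IsUnit (f.hom (c i)) := ⟨i, hi.map f.hom⟩
      exact ⟨ofFunctional hk _ (functional_surjective b hu), hu, rfl⟩

include hk in
/-- Projective space parametrizes hyperplanes. -/
theorem exists_projectiveSpace_moduli :
    ∃ M : ModuliScheme (Gr (K := K) V (Module.finrank K V - k)), Nonempty (M.scheme ≅ projectiveSpace K k) := by
  have b : Module.Basis (Fin (k + 1)) K V := Module.finBasisOfFinrankEq K V hk
  obtain ⟨M, -⟩ := (hyperplaneCoordinates hk b).exists_moduli Gr_isZariskiSheaf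
  exact ⟨M, (hyperplaneCoordinates hk b).exists_iso_projectiveSpace Gr_isZariskiSheaf
    (fun A c h => ⟨ofFunctional hk _ (functional_surjective b h), h, rfl⟩) M⟩

end Hyperplanes

end

end OrthogonalGrassmannian

namespace OrthogonalGrassmannian

noncomputable section

section ConeBasis

variable {K : Type u} [Field K] {V : Type u} [AddCommGroup V] [Module K V] {k : ℕ}

/-- The linear map from the free module `A ⊗ K ^ (k + 1)` given by a family of `k + 1` vectors. -/
def combination {A : Type u} [CommRing A] [Algebra K A] (t : Fin (k + 1) → A ⊗[K] V) :
    A ⊗[K] (Fin (k + 1) → K) →ₗ[A] A ⊗[K] V :=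
  Fintype.linearCombination A t ∘ₗ (crd (Pi.basisFun K (Fin (k + 1))) A).toLinearMap

theorem combination_apply {A : Type u} [CommRing A] [Algebra K A] (t : Fin (k + 1) → A ⊗[K] V)
    (x : A ⊗[K] (Fin (k + 1) → K)) :
    combination t x = ∑ i, crd (Pi.basisFun K (Fin (k + 1))) A x i • t i := rfl

theorem combination_push {A B : Type u} [CommRing A] [Algebra K A] [CommRing B] [Algebra K B]
    (f : A →ₐ[K] B) (t : Fin (k + 1) → A ⊗[K] V) (x : A ⊗[K] (Fin (k + 1) → K)) :
    combination (fun i => push f (t i)) (push f x) = push f (combination t x) := by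
  simp only [combination_apply, crd_push, push_sum_smul]

theorem range_combination {A : Type u} [CommRing A] [Algebra K A] (t : Fin (k + 1) → A ⊗[K] V) :
    LinearMap.range (combination t) = Submodule.span A (Set.range t) := by
  rw [combination, LinearMap.range_comp, LinearEquiv.range, Submodule.map_top,
    Fintype.range_linearCombination]

theorem combination_retraction {A : Type u} [CommRing A] [Algebra K A]
    {t : Fin (k + 1) → A ⊗[K] V} {ψ : A ⊗[K] V →ₗ[A] (Fin (k + 1) → A)}
    (hψ : ∀ i, ψ (t i) = Pi.single i 1) (x : A ⊗[K] (Fin (k + 1) → K)) :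
    ((crd (Pi.basisFun K (Fin (k + 1))) A).symm.toLinearMap ∘ₗ ψ) (combination t x) = x := by
  apply (crd (Pi.basisFun K (Fin (k + 1))) A).injective
  rw [combination_apply, LinearMap.comp_apply, LinearEquiv.coe_coe, LinearEquiv.apply_symm_apply,
    map_sum]
  ext i
  simp [hψ, Pi.single_apply]

theorem combination_injective {A : Type u} [CommRing A] [Algebra K A]
    {t : Fin (k + 1) → A ⊗[K] V} {ψ : A ⊗[K] V →ₗ[A] (Fin (k + 1) → A)}
    (hψ : ∀ i, ψ (t i) = Pi.single i 1) : Function.Injective (combination t) :=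
  Function.LeftInverse.injective (combination_retraction hψ)

/-- A dual family stays dual after a base change. -/
theorem exists_dual_push {A B : Type u} [CommRing A] [Algebra K A] [CommRing B] [Algebra K B]
    (f : A →ₐ[K] B) {ι : Type*} [DecidableEq ι] {t : ι → A ⊗[K] V} {ψ : A ⊗[K] V →ₗ[A] (ι → A)}
    (hψ : ∀ i, ψ (t i) = Pi.single i 1) :
    ∃ ψ' : B ⊗[K] V →ₗ[B] (ι → B), ∀ i, ψ' (push f (t i)) = Pi.single i 1 := by
  refine ⟨LinearMap.pi fun j => dualMap f (LinearMap.proj j ∘ₗ ψ), fun i => ?_⟩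
  ext j
  rw [LinearMap.pi_apply, dualMap_push, LinearMap.comp_apply, hψ, LinearMap.proj_apply,
    Pi.single_apply, Pi.single_apply]
  split_ifs <;> simp

variable [CharZero K] {v : V}

theorem comap_span_eq {A : Type u} [CommRing A] [Algebra K A]
    {u : Fin k → A ⊗[K] (V ⧸ Submodule.span K {v})} {t : Fin (k + 1) → A ⊗[K] V}
    (h0 : t 0 = 1 ⊗ₜ v) (h1 : ∀ i : Fin k, projection _ A (t i.succ) = u i) :
    (Submodule.span A (Set.range u)).comap (projection (Submodule.span K {v}) A) =
      Submodule.span A (Set.range t) := by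
  apply le_antisymm
  · intro x hx
    obtain ⟨c, hc⟩ := (Submodule.mem_span_range_iff_exists_fun A).mp hx
    obtain ⟨a, ha⟩ := (projection_eq_zero (v := v) (x := x - ∑ i, c i • t i.succ)).mp (by
      rw [map_sub, map_sum, sub_eq_zero, ← hc]
      exact Finset.sum_congr rfl fun i _ => by rw [map_smul, h1])
    have : x = a • t 0 + ∑ i, c i • t i.succ := by
      rw [h0, TensorProduct.smul_tmul', smul_eq_mul, mul_one, ← ha, sub_add_cancel]
    rw [this]
    exact add_mem (Submodule.smul_mem _ _ (Submodule.subset_span ⟨0, rfl⟩))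
      (sum_mem fun i _ => Submodule.smul_mem _ _ (Submodule.subset_span ⟨_, rfl⟩))
  · rw [Submodule.span_le]
    rintro _ ⟨i, rfl⟩
    rw [SetLike.mem_coe, Submodule.mem_comap]
    refine Fin.cases ?_ (fun i => ?_) i
    · rw [h0, projection_eq_zero.mpr ⟨1, rfl⟩]
      exact zero_mem _
    · rw [h1]
      exact Submodule.subset_span ⟨i, rfl⟩

theorem exists_cone_basis (hv0 : v ≠ 0) {A : Type u} [CommRing A] [Algebra K A]
    {u : Fin k → A ⊗[K] (V ⧸ Submodule.span K {v})}
    {ψ : A ⊗[K] (V ⧸ Submodule.span K {v}) →ₗ[A] (Fin k → A)} (hψ : ∀ i, ψ (u i) = Pi.single i 1) :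
    ∃ t : Fin (k + 1) → A ⊗[K] V, t 0 = 1 ⊗ₜ v ∧ (∀ i : Fin k, projection _ A (t i.succ) = u i) ∧
      ∃ φ : A ⊗[K] V →ₗ[A] (Fin (k + 1) → A), ∀ i, φ (t i) = Pi.single i 1 := by
  obtain ⟨η, hη⟩ : ∃ η : V →ₗ[K] K, η v = 1 := by
    obtain ⟨f, hf, -⟩ := exists_functional (K := K) hv0 hv0
    exact ⟨(f v)⁻¹ • f, by simp [hf]⟩
  let ηA : A ⊗[K] V →ₗ[A] A := (TensorProduct.AlgebraTensorModule.rid K A A).toLinearMap ∘ₗ η.baseChange A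
  have hηA : ηA (1 ⊗ₜ v) = 1 := by simp [ηA, hη]
  choose s hs using fun i => projection_surjective (Submodule.span K {v}) A (u i)
  have hpv : projection (Submodule.span K {v}) A (1 ⊗ₜ v) = 0 := projection_eq_zero.mpr ⟨1, rfl⟩
  have hp (i) : projection _ A (s i - ηA (s i) • ((1 : A) ⊗ₜ[K] v)) = u i := by
    rw [map_sub, map_smul, hs, hpv, smul_zero, sub_zero]
  refine ⟨Fin.cons (1 ⊗ₜ v) fun i => s i - ηA (s i) • ((1 : A) ⊗ₜ[K] v), rfl, fun i => ?_,
    LinearMap.pi (Fin.cons ηA fun i => LinearMap.proj i ∘ₗ ψ ∘ₗ projection _ A), fun i => ?_⟩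
  · rw [Fin.cons_succ]
    exact hp i
  · ext j
    rw [LinearMap.pi_apply]
    refine Fin.cases ?_ (fun i => ?_) i <;> refine Fin.cases ?_ (fun j => ?_) j
    · simp [hηA]
    · simp [hpv]
    · simp only [Fin.cons_zero, Fin.cons_succ, map_sub, map_smul, hηA]
      simp
    · simp only [Fin.cons_succ, LinearMap.comp_apply, hp, hψ]
      simp [Pi.single_apply]

end ConeBasis

section Fibre

variable {K : Type u} [Field K] [CharZero K] {V : Type u} [AddCommGroup V] [Module K V]
  [Module.Finite K V] {q : QuadraticForm K V} {v : V} {k : ℕ}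
  (hv : LinearMap.ker (QuadraticMap.polarBilin q) = Submodule.span K {v})

/-- A hyperplane of the cone over a point of the base, for a basis `t` of the cone. -/
abbrev Hyperplane (K : Type u) [Field K] (k : ℕ) : CommAlgCat.{u} K ⥤ Type u :=
  Gr (K := K) (Fin (k + 1) → K) (Module.finrank K (Fin (k + 1) → K) - k)

variable {A : CommAlgCat.{u} K} {y : (OGr (reducedForm hv) k).obj A} {t : Fin (k + 1) → A ⊗[K] V}
  {ψ : A ⊗[K] V →ₗ[A] (Fin (k + 1) → A)}
  (ht : (subspace y).comap (projection _ A) = Submodule.span A (Set.range t))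
  (hψ : ∀ i, ψ (t i) = Pi.single i 1)

include ht hψ

theorem exists_point_of_hyperplane (N : (Hyperplane K k).obj A) :
    ∃ x : (TOGr q (Submodule.span K {v}) (reducedForm hv) k).obj A, x.1.2 = y ∧
      subspace x.1.1 = (N : Module.Grassmannian A _ _).toSubmodule.map (combination t) := by
  have hle : (N : Module.Grassmannian A _ _).toSubmodule.map (combination t) ≤
      (subspace y).comap (projection _ A) := by
    rw [ht, ← range_combination]
    exact LinearMap.map_le_range
  refine ⟨⟨(⟨transport _ _ (combination_retraction hψ) (by simp) N, fun x hx => ?_⟩, y), hle⟩,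
    rfl, rfl⟩
  rw [← formBaseChange_projection hv]
  exact y.2 _ (hle hx)

theorem exists_hyperplane_of_point (x : (TOGr q (Submodule.span K {v}) (reducedForm hv) k).obj A)
    (hx : x.1.2 = y) : ∃ N : (Hyperplane K k).obj A,
      subspace x.1.1 = (N : Module.Grassmannian A _ _).toSubmodule.map (combination t) := by
  obtain ⟨N, hN⟩ := exists_transport _ _ (combination_retraction hψ) (by simp) x.1.1.1 (by
    rw [range_combination, ← ht, ← hx]
    exact x.2)
  exact ⟨N, by rw [subspace, ← hN]; rfl⟩

end Fibre

section Fibration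

variable {K : Type u} [Field K] [CharZero K] {V : Type u} [AddCommGroup V] [Module K V]
  [Module.Finite K V] {q : QuadraticForm K V} {v : V} {k : ℕ}
  {hv : LinearMap.ker (QuadraticMap.polarBilin q) = Submodule.span K {v}}

theorem map_combination {A B : CommAlgCat.{u} K} (g : A ⟶ B) (t : Fin (k + 1) → A ⊗[K] V)
    (N : (Hyperplane K k).obj A) {U : (OGr q k).obj A}
    (h : subspace U = (N : Module.Grassmannian A _ _).toSubmodule.map (combination t)) :
    subspace ((OGr q k).map g U) =
      ((Hyperplane K k).map g N : Module.Grassmannian B _ _).toSubmodule.map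
        (combination fun i => push g.hom (t i)) := by
  rw [subspace_map, h]
  refine Eq.trans ?_ (congrArg (Submodule.map _) (map_eq_span g.hom N).symm)
  rw [Submodule.map_span, Submodule.map_coe, Set.image_image, Set.image_image]
  congr 1
  exact Set.image_congr fun x _ => (combination_push g.hom t x).symm

variable {Y : ModuliScheme (OGr (reducedForm hv) k)}
  {T : ModuliScheme (TOGr q (Submodule.span K {v}) (reducedForm hv) k)}

/-- Affine neighbourhoods on which the tautological bundle of the base is trivial. -/
theorem exists_trivialization (hv0 : v ≠ 0) (hk : k + 1 ≤ Module.finrank K V)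
    (y : Y.scheme.left) : ∃ (R : CommAlgCat.{u} K) (c : specOver R ⟶ Y.scheme),
      IsOpenImmersion c.left ∧ y ∈ Set.range c.left ∧ ∃ t : Fin (k + 1) → R ⊗[K] V,
        ∀ (A : CommAlgCat.{u} K) (f : R ⟶ A),
          (subspace (Y.pt (res f c))).comap (projection _ A) =
            Submodule.span A (Set.range fun i => push f.hom (t i)) ∧
          ∃ ψ : A ⊗[K] V →ₗ[A] (Fin (k + 1) → A), ∀ i, ψ (push f.hom (t i)) = Pi.single i 1 := by
  obtain ⟨W, hW, -⟩ := exists_affineOpen y ⊤ trivial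
  have hy : y ∈ Set.range (chart W).left := by
    rw [range_chart]
    exact hW
  obtain ⟨p, rfl⟩ := hy
  have hf := finrank_quotient_span (K := K) hv0
  obtain ⟨d, hd, u, hu, h⟩ := exists_local_basis (by omega) (Y.pt (chart W)).1 p
  obtain ⟨h1, ψ, hψ⟩ := h _ (toLoc _ d) (isUnit_toLoc _ d)
  obtain ⟨t, ht0, ht1, φ, hφ⟩ := exists_cone_basis hv0 hψ
  have : IsOpenImmersion (Spec.map (CommRingCat.ofHom (toLoc (coordAlg W) d).hom.toRingHom)) :=
    IsOpenImmersion.of_isLocalization (R := CommRingCat.of (coordAlg W)) (S := loc (coordAlg W) d) d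
  have hc : IsOpenImmersion (res (toLoc _ d) (chart W)).left :=
    MorphismProperty.comp_mem @IsOpenImmersion.{u} _ (chart W).left this inferInstance
  obtain ⟨p', hp'⟩ := exists_prime_toLoc p hd
  refine ⟨loc _ d, res (toLoc _ d) (chart W), hc, ⟨p', ?_⟩, t, fun A f => ⟨?_, ?_⟩⟩
  · exact (res_left_apply _ _ _).trans (congrArg (chart W).left hp')
  · rw [← comap_span_eq (u := fun i => push f.hom (push (toLoc _ d).hom (u i))) (by
        rw [ht0, push_tmul, _root_.map_one]) (fun i => by rw [projection_push, ht1])]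
    congr 1
    rw [Y.pt_res, Y.pt_res]
    exact map_toSubmodule_of_span f.hom h1
  · exact exists_dual_push f.hom hφ

theorem isProjectiveFibration_of_points (hv0 : v ≠ 0) (hk : k + 1 ≤ Module.finrank K V)
    (p₂ : T.scheme ⟶ Y.scheme)
    (hp₂ : ∀ (A : CommAlgCat.{u} K) (x : specOver A ⟶ T.scheme), Y.pt (x ≫ p₂) = (T.pt x).1.2) :
    IsProjectiveFibration k p₂ := by
  intro y
  obtain ⟨R, c, hc, hy, t, htR⟩ := exists_trivialization (Y := Y) hv0 hk y
  obtain ⟨M, ⟨κ⟩⟩ := exists_projectiveSpace_moduli (K := K) (V := Fin (k + 1) → K) (k := k) (by simp)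
  let W : Y.scheme.left.Opens := c.left.opensRange
  let S : Over (Spec (CommRingCat.of K)) :=
    Over.mk (Limits.pullback.fst (W.ι ≫ Y.scheme.hom) (projectiveSpace K k).hom ≫
      W.ι ≫ Y.scheme.hom)
  let a : S ⟶ openOver W := Over.homMk (Limits.pullback.fst _ _) rfl
  let b : S ⟶ projectiveSpace K k := Over.homMk (Limits.pullback.snd _ _)
    Limits.pullback.condition.symm
  have hS {A : CommAlgCat.{u} K} {x x' : specOver A ⟶ S} (h1 : x ≫ a = x' ≫ a)
      (h2 : x ≫ b = x' ≫ b) : x = x' :=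
    Over.OverMorphism.ext (Limits.pullback.hom_ext (congrArg Over.Hom.left h1)
      (congrArg Over.Hom.left h2))
  have hS' {A : CommAlgCat.{u} K} (z : specOver A ⟶ openOver W)
      (w : specOver A ⟶ projectiveSpace K k) : ∃ x : specOver A ⟶ S, x ≫ a = z ∧ x ≫ b = w := by
    have hzw : z.left ≫ W.ι ≫ Y.scheme.hom = w.left ≫ (projectiveSpace K k).hom :=
      (Over.w z).trans (Over.w w).symm
    refine ⟨Over.homMk (Limits.pullback.lift z.left w.left hzw) ?_, ?_, ?_⟩
    · exact (Limits.pullback.lift_fst_assoc z.left w.left hzw _).trans (Over.w z)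
    · exact Over.OverMorphism.ext (Limits.pullback.lift_fst _ _ _)
    · exact Over.OverMorphism.ext (Limits.pullback.lift_snd _ _ _)
  have hfac (A : CommAlgCat.{u} K) (z : specOver A ⟶ openOver W) :
      ∃ f : R ⟶ A, z ≫ openIncl W = res f c :=
    exists_factor c _ ((mem_range_openIncl_iff W _).mp ⟨z, rfl⟩)
  have hcinj {A : CommAlgCat.{u} K} {f f' : R ⟶ A} (h : res f c = res f' c) : f = f' :=
    algSpec_map_injective (injOnPoints_of_mono c _ _ _ h)
  choose f hf using fun A (x : specOver A ⟶ S) => hfac A (x ≫ a)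
  have hfr (A B : CommAlgCat.{u} K) (g : A ⟶ B) (x : specOver A ⟶ S) : f B (res g x) = f A x ≫ g := by
    apply hcinj
    rw [← hf, ← res_res, ← hf]
    rfl
  let N (A : CommAlgCat.{u} K) (x : specOver A ⟶ S) : (Hyperplane K k).obj A :=
    M.pt (x ≫ b ≫ κ.inv)
  have hN (A B : CommAlgCat.{u} K) (g : A ⟶ B) (x : specOver A ⟶ S) :
      N B (res g x) = (Hyperplane K k).map g (N A x) := M.pt_res g (x ≫ b ≫ κ.inv)
  have hη (A : CommAlgCat.{u} K) (x : specOver A ⟶ S) :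
      ∃ z : (TOGr q (Submodule.span K {v}) (reducedForm hv) k).obj A,
        z.1.2 = Y.pt (x ≫ a ≫ openIncl W) ∧
        subspace z.1.1 = (N A x : Module.Grassmannian A _ _).toSubmodule.map
          (combination fun i => push (f A x).hom (t i)) := by
    obtain ⟨h1, ψ, hψ⟩ := htR A (f A x)
    rw [← hf] at h1
    exact exists_point_of_hyperplane hv h1 hψ (N A x)
  choose η hη1 hη2 using hη
  obtain ⟨h, hh⟩ := T.exists_hom η fun A B g x => by
    refine Subtype.ext (Prod.ext (subspace_ext ?_) ?_)
    · refine (hη2 B (res g x)).trans ?_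
      have h2 := map_combination g _ _ (hη2 A x)
      refine Eq.trans ?_ h2.symm
      rw [hN, hfr]
      congr 2
      funext i
      exact (push_push _ _ _).symm
    · exact (hη1 B (res g x)).trans ((Y.pt_res g _).trans (congrArg _ (hη1 A x).symm))
  have hcomm : h ≫ p₂ = a ≫ openIncl W := hom_ext_points fun A x => by
    apply Y.pt_injective
    rw [← Category.assoc, hp₂, hh, hη1]
  have hinj : InjOnPoints h := by
    intro A x x' hxx
    have e1 : x ≫ a = x' ≫ a := by
      apply injOnPoints_of_mono (openIncl W) A
      rw [Category.assoc, Category.assoc, ← hcomm, ← Category.assoc, hxx, Category.assoc]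
    have e2 : f A x = f A x' := hcinj (by rw [← hf, ← hf, e1])
    have e3 : η A x = η A x' := by rw [← hh, ← hh, hxx]
    have e4 := (hη2 A x).symm.trans ((congrArg (fun z => subspace z.1.1) e3).trans (hη2 A x'))
    rw [e2] at e4
    obtain ⟨-, ψ, hψ⟩ := htR A (f A x')
    have e5 : N A x = N A x' :=
      Module.Grassmannian.ext (Submodule.map_injective_of_injective (combination_injective hψ) e4)
    have e6 := M.pt_injective e5
    refine hS e1 ?_
    have := congrArg (· ≫ κ.hom) e6
    simpa using this
  have hpre {A : CommAlgCat.{u} K} (z : specOver A ⟶ T.scheme) :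
      Set.range z.left ⊆ (p₂.left ⁻¹ᵁ W : T.scheme.left.Opens) ↔
        Set.range (z ≫ p₂).left ⊆ (W : Set Y.scheme.left) := by
    rw [Set.range_subset_iff, Set.range_subset_iff]
    rfl
  obtain ⟨e, he⟩ := exists_iso_of_same_points h (openIncl (p₂.left ⁻¹ᵁ W)) hinj
    (injOnPoints_of_mono _) fun A z => by
      rw [mem_range_openIncl_iff, hpre, ← mem_range_openIncl_iff]
      constructor
      · rintro ⟨x, rfl⟩
        exact ⟨x ≫ a, by rw [Category.assoc, Category.assoc, hcomm]⟩
      · rintro ⟨z', hz'⟩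
        obtain ⟨g, hg⟩ := hfac A z'
        obtain ⟨h1, ψ, hψ⟩ := htR A g
        rw [← hg, hz', hp₂] at h1
        obtain ⟨N', hN'⟩ := exists_hyperplane_of_point hv h1 hψ (T.pt z) rfl
        obtain ⟨w, hw⟩ := M.exists_pt N'
        obtain ⟨x, hx1, hx2⟩ := hS' z' (w ≫ κ.hom)
        refine ⟨x, T.pt_injective ?_⟩
        have e1 : f A x = g := hcinj (by rw [← hf, ← hg, hx1])
        have e2 : N A x = N' := by
          change M.pt (x ≫ b ≫ κ.inv) = _
          rw [← Category.assoc, hx2, Category.assoc, κ.hom_inv_id, Category.comp_id, hw]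
        rw [hh]
        refine Subtype.ext (Prod.ext (subspace_ext ?_) ?_)
        · rw [hη2, e1, e2, hN']
        · rw [hη1, ← Category.assoc, hx1, hz', hp₂]
  refine ⟨W, hy, (Over.forget _).mapIso e.symm, ?_⟩
  rw [← cancel_mono W.ι, morphismRestrict_ι]
  have e1 : e.inv ≫ a ≫ openIncl W = openIncl (p₂.left ⁻¹ᵁ W) ≫ p₂ := by
    rw [← hcomm, ← he, Category.assoc, e.inv_hom_id_assoc]
  exact (Category.assoc _ _ _).trans (congrArg Over.Hom.left e1)

end Fibration

end

end OrthogonalGrassmannian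

namespace OrthogonalGrassmannian

noncomputable section

section ComplementOfRange

variable {K : Type u} [Field K] {X Z : Over (Spec (CommRingCat.of K))}
  {Φ : ∀ A : CommAlgCat.{u} K, (specOver A ⟶ X) → Prop}

/-- The points in the complement of a closed subscheme. -/
theorem complCond_iff_range (i : Z ⟶ X) (hi : InjOnPoints i)
    (h : IsClosedCond (pointFunctor X) Φ)
    (hΦ : ∀ (A : CommAlgCat.{u} K) (y : specOver A ⟶ X), Φ A y ↔ ∃ z, z ≫ i = y)
    {A : CommAlgCat.{u} K} (y : specOver A ⟶ X) :
    ComplCond (pointFunctor X) Φ A y ↔ Set.range y.left ⊆ (Set.range i.left)ᶜ := by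
  obtain ⟨hc, hJ⟩ := isClosedImmersion_of_points i hi h hΦ
  constructor
  · rintro hy _ ⟨p, rfl⟩ hp
    obtain ⟨W, hWU, hpW, r, hr, f, hf⟩ := exists_chart_factor y p ⊤ trivial
    obtain ⟨p', hp'⟩ := exists_prime_toLoc p hr
    have e1 : y.left p = (chart W).left (PrimeSpectrum.comap f.hom.toRingHom p') := by
      refine Eq.trans ?_ ((congrArg (fun w : specOver (loc A r) ⟶ X => w.left p') hf).trans (res_left_apply _ _ _))
      exact (congrArg y.left hp').symm.trans (res_left_apply _ _ _).symm
    have hmem : (chart W).left (PrimeSpectrum.comap f.hom.toRingHom p') ∈ i.left.ker.support := by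
      rw [← e1]
      have : (i.left.ker.support : Set X.left) = closure (Set.range i.left) :=
        Scheme.Hom.support_ker i.left
      exact (Set.ext_iff.mp this _).mpr (subset_closure hp)
    have hle : coordIdeal i.left.ker W ≤ (PrimeSpectrum.comap f.hom.toRingHom p').asIdeal := by
      have h1 := Scheme.IdealSheafData.coe_support_inter i.left.ker W
      have h2 : (chart W).left (PrimeSpectrum.comap f.hom.toRingHom p') ∈
          (i.left.ker.support : Set X.left) ∩ (W.1 : Set X.left) :=
        ⟨hmem, (range_chart W).le ⟨_, rfl⟩⟩
      obtain ⟨z, hz, hz'⟩ := (h1.trans ((isAffine W).fromSpec_image_zeroLocus _).symm).le h2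
      have : z = PrimeSpectrum.comap f.hom.toRingHom p' :=
        (isAffine W).fromSpec.isOpenEmbedding.injective hz'
      rw [← this]
      exact hz
    have := hy _ (toLoc A r ≫ toQuot _ p'.asIdeal) (by
      change Φ _ (res _ y)
      rw [← res_res, hf, res_res, hJ]
      intro a ha
      exact toQuot_eq_zero.mpr (hle ha))
    exact p'.isPrime.ne_top (Ideal.Quotient.subsingleton_iff.mp this)
  · intro hy B f hB
    by_contra hn
    rw [not_subsingleton_iff_nontrivial] at hn
    obtain ⟨q⟩ : Nonempty (PrimeSpectrum B) := inferInstance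
    obtain ⟨z, hz⟩ := (hΦ _ _).mp hB
    refine hy ⟨PrimeSpectrum.comap f.hom.toRingHom q, rfl⟩ ⟨z.left q, ?_⟩
    rw [← res_left_apply]
    exact congrArg (fun w : specOver B ⟶ X => w.left q) hz

end ComplementOfRange

variable {K : Type u} [Field K] [CharZero K] {V : Type u} [AddCommGroup V] [Module K V]
  {q : QuadraticForm K V} {v : V} {k : ℕ}
  {hv : LinearMap.ker (QuadraticMap.polarBilin q) = Submodule.span K {v}}

section Diagram

variable (k hv) in
/-- The moduli schemes and the morphisms of the resolution of the orthogonal Grassmannian of a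
cone. -/
structure Diagram where
  X : ModuliScheme (OGr q k)
  Y : ModuliScheme (OGr (reducedForm hv) k)
  T : ModuliScheme (TOGr q (Submodule.span K {v}) (reducedForm hv) k)
  Z : ModuliScheme (OGr (reducedForm hv) (k - 1))
  F : ModuliScheme (OFl (reducedForm hv) (k - 1) k)
  p₁ : T.scheme ⟶ X.scheme
  p₂ : T.scheme ⟶ Y.scheme
  j : F.scheme ⟶ T.scheme
  r : F.scheme ⟶ Z.scheme
  i : Z.scheme ⟶ X.scheme
  pt_p₁ (A : CommAlgCat.{u} K) (x : specOver A ⟶ T.scheme) : X.pt (x ≫ p₁) = (T.pt x).1.1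
  pt_p₂ (A : CommAlgCat.{u} K) (x : specOver A ⟶ T.scheme) : Y.pt (x ≫ p₂) = (T.pt x).1.2
  pt_j_fst (A : CommAlgCat.{u} K) (x : specOver A ⟶ F.scheme) : subspace (T.pt (x ≫ j)).1.1 =
    (subspace (F.pt x).1.1).comap (projection (Submodule.span K {v}) A)
  pt_j_snd (A : CommAlgCat.{u} K) (x : specOver A ⟶ F.scheme) : (T.pt (x ≫ j)).1.2 = (F.pt x).1.2
  pt_r (A : CommAlgCat.{u} K) (x : specOver A ⟶ F.scheme) : Z.pt (x ≫ r) = (F.pt x).1.1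
  pt_i (A : CommAlgCat.{u} K) (x : specOver A ⟶ Z.scheme) : subspace (X.pt (x ≫ i)) =
    (subspace (Z.pt x)).comap (projection (Submodule.span K {v}) A)

variable [Module.Finite K V]

theorem exists_diagram (hv0 : v ≠ 0) (hk : 1 ≤ k) (hn : k + 1 ≤ Module.finrank K V) :
    ∃ D : Diagram k hv, IsProjective D.T.scheme ∧ IsProjective D.X.scheme := by
  have hf := finrank_quotient_span (K := K) hv0
  obtain ⟨X, hX⟩ := exists_moduli_OGr q (k := k) (by omega)
  obtain ⟨Y, -⟩ := exists_moduli_OGr (reducedForm hv) (k := k) (by omega)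
  obtain ⟨T, hT⟩ := exists_moduli_TOGr q (Submodule.span K {v}) (reducedForm hv) (k := k) (by omega)
    (by omega)
  obtain ⟨Z, -⟩ := exists_moduli_OGr (reducedForm hv) (k := k - 1) (by omega)
  obtain ⟨F, -⟩ := exists_moduli_OFl (reducedForm hv) (k := k - 1) (k' := k) (by omega) (by omega)
  obtain ⟨p₁, hp₁⟩ := T.exists_hom_of_app X (fun A x => x.1.1) fun _ _ _ _ => rfl
  obtain ⟨p₂, hp₂⟩ := T.exists_hom_of_app Y (fun A x => x.1.2) fun _ _ _ _ => rfl
  obtain ⟨r, hr⟩ := F.exists_hom_of_app Z (fun A x => x.1.1) fun _ _ _ _ => rfl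
  obtain ⟨i, hi⟩ := Z.exists_hom_of_app X (fun A x => preimage hv hk hv0 x)
    fun _ _ f x => preimage_map hv hk hv0 f x
  obtain ⟨j, hj⟩ := F.exists_hom_of_app T
    (fun A x => ⟨(preimage hv hk hv0 x.1.1, x.1.2), Submodule.comap_mono x.2⟩)
    fun _ _ f x => Subtype.ext (Prod.ext (preimage_map hv hk hv0 f x.1.1) rfl)
  exact ⟨⟨X, Y, T, Z, F, p₁, p₂, j, r, i, hp₁, hp₂, fun A x => by rw [hj]; rfl,
    fun A x => by rw [hj], hr, fun A x => by rw [hi]; rfl⟩, hT, hX⟩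

theorem isClosedCond_kernel_mem {F : CommAlgCat.{u} K ⥤ Type u} (M : ModuliScheme F)
    (η : ∀ A : CommAlgCat.{u} K, F.obj A → (OGr q k).obj A)
    (hη : ∀ (A B : CommAlgCat.{u} K) (f : A ⟶ B) (x : F.obj A),
      η B (F.map f x) = (OGr q k).map f (η A x)) (w : V) :
    IsClosedCond (pointFunctor M.scheme) fun A y => (1 : A) ⊗ₜ[K] w ∈ subspace (η A (M.pt y)) :=
  (isClosedCond_mem (K := K) (m' := Module.finrank K V - k) w).of_iso (G := pointFunctor M.scheme)
    { app := fun A => ↾fun y => (η A (M.pt y)).1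
      naturality := fun A B f => by
        apply ConcreteCategory.hom_ext
        intro y
        exact congrArg Subtype.val ((congrArg _ (M.pt_res f y)).trans (hη A B f _)) }

namespace Diagram

variable (D : Diagram k hv)

theorem j_comp_p₁ : D.j ≫ D.p₁ = D.r ≫ D.i := hom_ext_points fun A x => by
  apply D.X.pt_injective
  apply subspace_ext
  rw [← Category.assoc, D.pt_p₁, D.pt_j_fst, ← Category.assoc, D.pt_i, D.pt_r]

omit [Module.Finite K V] in
theorem comap_projection_injective (A : CommAlgCat.{u} K) :
    Function.Injective (Submodule.comap (projection (Submodule.span K {v}) A)) :=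
  Submodule.comap_injective_of_surjective (projection_surjective _ A)

theorem injOnPoints_i : InjOnPoints D.i := fun A x x' h => by
  apply D.Z.pt_injective
  apply subspace_ext
  apply comap_projection_injective
  rw [← D.pt_i, ← D.pt_i, h]

theorem injOnPoints_j : InjOnPoints D.j := fun A x x' h => by
  apply D.F.pt_injective
  refine Subtype.ext (Prod.ext (subspace_ext (comap_projection_injective A ?_)) ?_)
  · rw [← D.pt_j_fst, ← D.pt_j_fst, h]
  · rw [← D.pt_j_snd, ← D.pt_j_snd, h]

theorem isClosedCond_X : IsClosedCond (pointFunctor D.X.scheme)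
    fun A y => (1 : A) ⊗ₜ[K] v ∈ subspace (D.X.pt y) :=
  isClosedCond_kernel_mem D.X (fun _ x => x) (fun _ _ _ _ => rfl) v

theorem isClosedCond_T : IsClosedCond (pointFunctor D.T.scheme)
    fun A y => (1 : A) ⊗ₜ[K] v ∈ subspace (D.T.pt y).1.1 :=
  isClosedCond_kernel_mem D.T (fun _ x => x.1.1) (fun _ _ _ _ => rfl) v

variable (hv0 : v ≠ 0) (hk : 1 ≤ k)
include hv0 hk

theorem exists_comp_i_iff {A : CommAlgCat.{u} K} (x : specOver A ⟶ D.X.scheme) :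
    (1 : A) ⊗ₜ[K] v ∈ subspace (D.X.pt x) ↔ ∃ z, z ≫ D.i = x := by
  rw [← exists_preimage_iff hv hk hv0]
  constructor
  · rintro ⟨W, hW⟩
    obtain ⟨z, hz⟩ := D.Z.exists_pt W
    refine ⟨z, D.X.pt_injective (subspace_ext ?_)⟩
    rw [D.pt_i, hz, ← hW, subspace_preimage]
  · rintro ⟨z, rfl⟩
    exact ⟨D.Z.pt z, subspace_ext (D.pt_i A z).symm⟩

theorem exists_comp_j_iff {A : CommAlgCat.{u} K} (x : specOver A ⟶ D.T.scheme) :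
    (1 : A) ⊗ₜ[K] v ∈ subspace (D.T.pt x).1.1 ↔ ∃ z, z ≫ D.j = x := by
  rw [← exists_preimage_iff hv hk hv0]
  constructor
  · rintro ⟨W, hW⟩
    have hle : subspace W ≤ subspace (D.T.pt x).1.2 := by
      have := (D.T.pt x).2
      rw [← hW, subspace_preimage] at this
      exact (Submodule.comap_le_comap_iff_of_surjective (projection_surjective _ A)).mp this
    obtain ⟨z, hz⟩ := D.F.exists_pt (⟨(W, (D.T.pt x).1.2), hle⟩ : (OFl _ _ _).obj A)
    refine ⟨z, D.T.pt_injective (Subtype.ext (Prod.ext (subspace_ext ?_) ?_))⟩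
    · rw [D.pt_j_fst, hz, ← hW, subspace_preimage]
    · rw [D.pt_j_snd, hz]
  · rintro ⟨z, rfl⟩
    exact ⟨(D.F.pt z).1.1, subspace_ext (D.pt_j_fst A z).symm⟩

theorem isClosedImmersion_i : IsClosedImmersion D.i.left :=
  (isClosedImmersion_of_points D.i D.injOnPoints_i D.isClosedCond_X
    fun _ x => D.exists_comp_i_iff hv0 hk x).1

theorem isClosedImmersion_j : IsClosedImmersion D.j.left :=
  (isClosedImmersion_of_points D.j D.injOnPoints_j D.isClosedCond_T
    fun _ x => D.exists_comp_j_iff hv0 hk x).1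

theorem mem_coordIdeal_iff (W : D.T.scheme.left.affineOpens) (B : CommAlgCat.{u} K)
    (f : coordAlg W ⟶ B) :
    (1 : B) ⊗ₜ[K] v ∈ subspace (D.T.pt (res f (chart W))).1.1 ↔
      ∀ a ∈ coordIdeal D.j.left.ker W, f.hom a = 0 :=
  (isClosedImmersion_of_points D.j D.injOnPoints_j D.isClosedCond_T
    fun _ x => D.exists_comp_j_iff hv0 hk x).2 W B f

/-- The open subset of all `U` which do not contain the kernel. -/
def openX : D.X.scheme.left.Opens :=
  ⟨(Set.range D.i.left)ᶜ, by
    have := D.isClosedImmersion_i hv0 hk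
    exact D.i.left.isClosedEmbedding.isClosed_range.isOpen_compl⟩

/-- The open subset of all pairs `(U, U')` such that `U` does not contain the kernel. -/
def openT : D.T.scheme.left.Opens :=
  ⟨(Set.range D.j.left)ᶜ, by
    have := D.isClosedImmersion_j hv0 hk
    exact D.j.left.isClosedEmbedding.isClosed_range.isOpen_compl⟩

theorem range_subset_openX_iff {A : CommAlgCat.{u} K} (x : specOver A ⟶ D.X.scheme) :
    Set.range x.left ⊆ (D.openX hv0 hk : Set D.X.scheme.left) ↔
      ∀ (B : CommAlgCat.{u} K) (f : A ⟶ B),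
        (1 : B) ⊗ₜ[K] v ∈ subspace ((OGr q k).map f (D.X.pt x)) → Subsingleton B := by
  have := complCond_iff_range D.i D.injOnPoints_i D.isClosedCond_X
    (fun _ x => D.exists_comp_i_iff hv0 hk x) x
  refine this.symm.trans (forall_congr' fun B => forall_congr' fun f => ?_)
  rw [← D.X.pt_res]
  exact Iff.rfl

theorem range_subset_openT_iff {A : CommAlgCat.{u} K} (x : specOver A ⟶ D.T.scheme) :
    Set.range x.left ⊆ (D.openT hv0 hk : Set D.T.scheme.left) ↔
      ∀ (B : CommAlgCat.{u} K) (f : A ⟶ B),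
        (1 : B) ⊗ₜ[K] v ∈ subspace ((OGr q k).map f (D.T.pt x).1.1) → Subsingleton B := by
  have := complCond_iff_range D.j D.injOnPoints_j D.isClosedCond_T
    (fun _ x => D.exists_comp_j_iff hv0 hk x) x
  refine this.symm.trans (forall_congr' fun B => forall_congr' fun f => ?_)
  have e : (D.T.pt (res f x)).1.1 = (OGr q k).map f (D.T.pt x).1.1 :=
    congrArg (fun z => z.1.1) (D.T.pt_res f x)
  rw [← e]
  exact Iff.rfl

theorem range_comp_p₁_subset_iff {A : CommAlgCat.{u} K} (x : specOver A ⟶ D.T.scheme) :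
    Set.range (x ≫ D.p₁).left ⊆ (D.openX hv0 hk : Set D.X.scheme.left) ↔
      Set.range x.left ⊆ (D.openT hv0 hk : Set D.T.scheme.left) := by
  rw [range_subset_openX_iff, range_subset_openT_iff, D.pt_p₁]

end Diagram

end Diagram

section Transversal

variable [Module.Finite K V] {A : CommAlgCat.{u} K} {U : (OGr q k).obj A}

variable (hv) in
/-- A subspace which does not contain the kernel projects isomorphically, locally on the base. -/
theorem exists_local_image (hn : k + 1 ≤ Module.finrank K V) (hv0 : v ≠ 0)
    (hU : ∀ (B : CommAlgCat.{u} K) (f : A ⟶ B),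
      (1 : B) ⊗ₜ[K] v ∈ subspace ((OGr q k).map f U) → Subsingleton B) (p : PrimeSpectrum A) :
    ∃ r ∉ p.asIdeal, ∃ z : (OGr (reducedForm hv) k).obj (loc A r),
      subspace z = (subspace ((OGr q k).map (toLoc A r) U)).map (projection _ (loc A r)) := by
  obtain ⟨d, hd, u, hu, h⟩ := exists_local_basis (by omega) U.1 p
  let L : CommAlgCat.{u} K := CommAlgCat.of K p.asIdeal.ResidueField
  let f : A ⟶ L := CommAlgCat.ofHom (IsScalarTower.toAlgHom K A p.asIdeal.ResidueField)
  have hf (a : A) : f.hom a = 0 ↔ a ∈ p.asIdeal := Ideal.algebraMap_residueField_eq_zero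
  obtain ⟨h1, ψ, hψ⟩ := h L f ((isUnit_iff_ne_zero (G₀ := p.asIdeal.ResidueField)).mpr fun h => hd ((hf d).mp h))
  have hli : LinearIndependent p.asIdeal.ResidueField fun i =>
      push (IsScalarTower.toAlgHom K A p.asIdeal.ResidueField) (projection (Submodule.span K {v}) A (u i)) := by
    rw [Fintype.linearIndependent_iff]
    intro c hc
    obtain ⟨a, ha⟩ := (projection_eq_zero (v := v) (A := p.asIdeal.ResidueField)
      (x := ∑ i, c i • push f.hom (u i))).mp (by
        rw [map_sum, ← hc]
        exact Finset.sum_congr rfl fun i _ => by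
          rw [map_smul, projection_push]
          rfl)
    have ha0 : a = 0 := by
      by_contra hne
      refine not_subsingleton p.asIdeal.ResidueField (hU L f ?_)
      have h2 : (1 : p.asIdeal.ResidueField) ⊗ₜ[K] v = a⁻¹ • ∑ i, c i • push f.hom (u i) := by
        rw [ha, TensorProduct.smul_tmul', smul_eq_mul, inv_mul_cancel₀ hne]
      rw [subspace, OGr_map_val]
      refine (Set.ext_iff.mp (congrArg SetLike.coe h1) _).mpr ?_
      refine Eq.subst (motive := fun z => z ∈ Submodule.span p.asIdeal.ResidueField
        (Set.range fun i => push f.hom (u i))) h2.symm ?_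
      exact Submodule.smul_mem _ _ (sum_mem fun i _ =>
        Submodule.smul_mem _ _ (Submodule.subset_span ⟨i, rfl⟩))
    intro i
    have h3 := congrArg (fun z => ψ z i) ha
    rw [ha0, TensorProduct.zero_tmul, map_zero] at h3
    simp only [map_sum, map_smul, hψ] at h3
    simpa [Finset.sum_apply, Pi.single_apply] using h3
  let b := Module.finBasis K (V ⧸ Submodule.span K {v})
  obtain ⟨I, hI⟩ := exists_minor_of_linearIndependent b p hli
  set δ := (Matrix.of fun i j => crd b A (projection (Submodule.span K {v}) A (u i)) (I j)).det with hδ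
  refine ⟨d * δ, mul_notMem hd hI, ?_⟩
  have hunit := isUnit_toLoc A (d * δ)
  rw [map_mul, IsUnit.mul_iff] at hunit
  set g := toLoc A (d * δ)
  obtain ⟨h2, -⟩ := h _ g hunit.1
  have hdet : IsUnit (Matrix.of fun i j =>
      (LinearMap.funLeft (loc A (d * δ)) (loc A (d * δ)) I ∘ₗ (crd b (loc A (d * δ))).toLinearMap)
        (projection (Submodule.span K {v}) _ (push g.hom (u i))) j).det := by
    have := hunit.2
    rw [show g.hom δ = _ from (congrArg g.hom hδ).trans (AlgHom.map_det g.hom _)] at this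
    refine (congrArg (fun M => IsUnit (Matrix.det M)) (Matrix.ext fun i j => ?_)).mpr this
    change crd b _ (projection _ _ (push g.hom (u i))) (I j) = g.hom (crd b A _ (I j))
    rw [projection_push, crd_push]
  obtain ⟨n, hn1, hn2⟩ := (exists_dual_generators_iff rfl _).mpr hdet
  have hsub : subspace ((OGr q k).map g U) = Submodule.span _ (Set.range fun i => push g.hom (u i)) := h2
  have hmap : (subspace ((OGr q k).map g U)).map (projection (Submodule.span K {v}) _) =
      Submodule.span _ (Set.range n) := by
    rw [hsub, Submodule.map_span, ← Set.range_comp, ← hn1]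
    rfl
  refine ⟨⟨ofBasis n _ hn2, ?_⟩, hmap.symm⟩
  rw [ofBasis_toSubmodule, ← hmap]
  rintro _ ⟨x, hx, rfl⟩
  rw [formBaseChange_projection]
  exact ((OGr q k).map g U).2 x hx

theorem map_le_of_le_comap {B : CommAlgCat.{u} K} (f : A ⟶ B) {z : (OGr (reducedForm hv) k).obj A}
    (h : subspace U ≤ (subspace z).comap (projection _ A)) :
    subspace ((OGr q k).map f U) ≤ (subspace ((OGr _ k).map f z)).comap (projection _ B) :=
  ((TOGr q (Submodule.span K {v}) (reducedForm hv) k).map f ⟨(U, z), h⟩).2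

theorem eq_of_le_comap (hn : k + 1 ≤ Module.finrank K V) (hv0 : v ≠ 0)
    (hU : ∀ (B : CommAlgCat.{u} K) (f : A ⟶ B),
      (1 : B) ⊗ₜ[K] v ∈ subspace ((OGr q k).map f U) → Subsingleton B)
    {z z' : (OGr (reducedForm hv) k).obj A}
    (h : subspace U ≤ (subspace z).comap (projection _ A))
    (h' : subspace U ≤ (subspace z').comap (projection _ A)) : z = z' := by
  refine OGr_isZariskiSheaf.separated A z z' fun p => ?_
  obtain ⟨r, hr, w, hw⟩ := exists_local_image hv hn hv0 hU p
  have key {y : (OGr (reducedForm hv) k).obj A}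
      (h : subspace U ≤ (subspace y).comap (projection _ A)) : w = (OGr _ k).map (toLoc A r) y :=
    subspace_eq_of_le (hw.le.trans (Submodule.map_le_iff_le_comap.mpr (map_le_of_le_comap _ h)))
  exact ⟨r, hr, (key h).symm.trans (key h')⟩

variable (hv) in
theorem exists_image (hn : k + 1 ≤ Module.finrank K V) (hv0 : v ≠ 0)
    (hU : ∀ (B : CommAlgCat.{u} K) (f : A ⟶ B),
      (1 : B) ⊗ₜ[K] v ∈ subspace ((OGr q k).map f U) → Subsingleton B) :
    ∃ z : (OGr (reducedForm hv) k).obj A, subspace U ≤ (subspace z).comap (projection _ A) := by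
  obtain ⟨z, hz⟩ := OGr_isZariskiSheaf.exists_of_local (F := OGr (reducedForm hv) k) (A := A)
    (fun B f z => subspace z = (subspace ((OGr q k).map f U)).map (projection _ B))
    (fun B C f g z hz => by
      rw [OGr_map_comp, subspace_map g z, hz, subspace_map g, Submodule.map_span, Submodule.map_coe,
        Set.image_image, Set.image_image]
      congr 1
      exact Set.image_congr fun x _ => (projection_push _ g.hom x).symm)
    (fun B f z z' hz hz' => subspace_ext (hz.trans hz'.symm))
    (exists_local_image hv hn hv0 hU)
  refine ⟨z, fun x hx => Gr_le_of_local (N := z.1) fun p => ?_⟩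
  obtain ⟨r, hr, h⟩ := hz p
  refine ⟨r, hr, ?_⟩
  rw [← projection_push]
  exact h.ge ⟨_, map_mem_subspace (toLoc A r) U hx, rfl⟩

end Transversal

namespace Diagram

variable [Module.Finite K V] (D : Diagram k hv) (hv0 : v ≠ 0) (hk : 1 ≤ k)
  (hn : k + 1 ≤ Module.finrank K V)

include hn in
theorem injOnPoints_openIncl_p₁ : InjOnPoints (openIncl (D.openT hv0 hk) ≫ D.p₁) := by
  intro A x x' h
  apply injOnPoints_of_mono (openIncl _) A
  have h1 : (D.T.pt (x ≫ openIncl _)).1.1 = (D.T.pt (x' ≫ openIncl _)).1.1 := by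
    rw [← D.pt_p₁, ← D.pt_p₁, Category.assoc, h, Category.assoc]
  refine D.T.pt_injective (Subtype.ext (Prod.ext h1 ?_))
  refine eq_of_le_comap (U := (D.T.pt (x ≫ openIncl _)).1.1) hn hv0 ?_ (D.T.pt _).2 ?_
  · exact (D.range_subset_openT_iff hv0 hk _).mp ((mem_range_openIncl_iff _ _).mp ⟨x, rfl⟩)
  · rw [h1]
    exact (D.T.pt _).2

include hn in
theorem exists_comp_openIncl_p₁_iff {A : CommAlgCat.{u} K} (y : specOver A ⟶ D.X.scheme) :
    (∃ x, x ≫ openIncl (D.openT hv0 hk) ≫ D.p₁ = y) ↔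
      Set.range y.left ⊆ (D.openX hv0 hk : Set D.X.scheme.left) := by
  constructor
  · rintro ⟨x, rfl⟩
    rw [← Category.assoc, range_comp_p₁_subset_iff]
    exact (mem_range_openIncl_iff _ _).mp ⟨x, rfl⟩
  · intro hy
    obtain ⟨z, hz⟩ := exists_image hv hn hv0 ((D.range_subset_openX_iff hv0 hk y).mp hy)
    obtain ⟨x, hx⟩ := D.T.exists_pt (⟨(D.X.pt y, z), hz⟩ : (TOGr _ _ _ _).obj A)
    have hxy : x ≫ D.p₁ = y := D.X.pt_injective (by rw [D.pt_p₁, hx])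
    rw [← hxy, range_comp_p₁_subset_iff, ← mem_range_openIncl_iff] at hy
    obtain ⟨w, hw⟩ := hy
    exact ⟨w, by rw [← Category.assoc, hw, hxy]⟩

include hn in
theorem isOpenImmersion_openIncl_p₁ :
    IsOpenImmersion (openIncl (D.openT hv0 hk) ≫ D.p₁).left ∧
      Set.range (openIncl (D.openT hv0 hk) ≫ D.p₁).left = (D.openX hv0 hk : Set D.X.scheme.left) :=
  isOpenImmersion_of_points _ (D.injOnPoints_openIncl_p₁ hv0 hk hn)
    fun _ y => D.exists_comp_openIncl_p₁_iff hv0 hk hn y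

end Diagram

end

end OrthogonalGrassmannian

namespace OrthogonalGrassmannian

noncomputable section

variable {K : Type u} [Field K] [CharZero K]

section DualNumbers

/-- The ring of dual numbers. -/
abbrev dualNumbers (K : Type u) [Field K] : CommAlgCat.{u} K := CommAlgCat.of K (DualNumber K)

/-- The inclusion of the constants in the dual numbers. -/
abbrev toDual (K : Type u) [Field K] : ground K ⟶ dualNumbers K :=
  CommAlgCat.ofHom (Algebra.ofId K (DualNumber K))

/-- The reduction of the dual numbers. -/
abbrev ofDual (K : Type u) [Field K] : dualNumbers K ⟶ ground K :=
  CommAlgCat.ofHom (TrivSqZeroExt.fstHom K K K)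

theorem toDual_ofDual : toDual K ≫ ofDual K = 𝟙 (ground K) := by
  ext x

omit [CharZero K] in
theorem exists_comap_ofDual (p : PrimeSpectrum (DualNumber K)) :
    ∃ p₀ : PrimeSpectrum K, PrimeSpectrum.comap (ofDual K).hom.toRingHom p₀ = p := by
  refine ⟨⊥, PrimeSpectrum.ext (Ideal.ext fun x => ?_)⟩
  have hε : (DualNumber.eps : DualNumber K) ∈ p.asIdeal :=
    p.isPrime.mem_of_pow_mem 2 (by rw [pow_two, DualNumber.eps_mul_eps]; exact zero_mem _)
  have hx : x = algebraMap K (DualNumber K) x.fst + x.snd • DualNumber.eps := by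
    ext <;> simp [TrivSqZeroExt.algebraMap_eq_inl]
  have h2 : x.snd • (DualNumber.eps : DualNumber K) ∈ p.asIdeal := by
    rw [Algebra.smul_def]
    exact p.asIdeal.mul_mem_left _ hε
  change x.fst = 0 ↔ x ∈ p.asIdeal
  constructor
  · intro h
    rw [hx, h, map_zero, zero_add]
    exact h2
  · intro h
    by_contra hne
    rw [hx, Ideal.add_mem_iff_left _ h2] at h
    exact p.isPrime.ne_top (Ideal.eq_top_of_isUnit_mem _ h ((IsUnit.mk0 _ hne).map _))

end DualNumbers

variable {V : Type u} [AddCommGroup V] [Module K V]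

section Shear

variable (l : V →ₗ[K] K) (w : V)

/-- The infinitesimal shear `x ↦ x + ε l(x) w`. -/
def shear (s : K) : DualNumber K ⊗[K] V →ₗ[DualNumber K] DualNumber K ⊗[K] V :=
  LinearMap.id + (s • (DualNumber.eps : DualNumber K)) • (l.smulRight w).baseChange (DualNumber K)

theorem shear_one_tmul (s : K) (x : V) : shear l w s ((1 : DualNumber K) ⊗ₜ x) =
    1 ⊗ₜ x + (s * l x) • ((DualNumber.eps : DualNumber K) ⊗ₜ[K] w) := by
  rw [shear, LinearMap.add_apply, LinearMap.id_apply, LinearMap.smul_apply,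
    LinearMap.baseChange_tmul, LinearMap.smulRight_apply, TensorProduct.smul_tmul',
    smul_eq_mul, mul_one, ← TensorProduct.smul_tmul, mul_smul, smul_comm s (l x)]
  rfl

theorem shear_shear (x : DualNumber K ⊗[K] V) : shear l w (-1) (shear l w 1 x) = x := by
  suffices h : shear l w (-1) ∘ₗ shear l w 1 = LinearMap.id from LinearMap.congr_fun h x
  have hε : (DualNumber.eps : DualNumber K) • (DualNumber.eps : DualNumber K) = 0 :=
    DualNumber.eps_mul_eps
  apply LinearMap.ext
  intro x
  have key (y : DualNumber K ⊗[K] V) (s : K) : shear l w s y =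
    y + (s • (DualNumber.eps : DualNumber K)) • (l.smulRight w).baseChange (DualNumber K) y := rfl
  rw [LinearMap.comp_apply, key, key]
  simp only [map_add, map_smul, smul_add, smul_smul, LinearMap.id_apply]
  have h1 : (-1 : K) • (DualNumber.eps : DualNumber K) * (1 : K) • (DualNumber.eps : DualNumber K) = 0 := by
    simp
  rw [h1, zero_smul, add_zero, add_assoc, ← add_smul]
  simp

end Shear

variable {q : QuadraticForm K V} {v : V} {k : ℕ}
  {hv : LinearMap.ker (QuadraticMap.polarBilin q) = Submodule.span K {v}}

section Deformation

theorem subspace_eq_span_fibre {V : Type u} [AddCommGroup V] [Module K V] {q : QuadraticForm K V}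
    (x : (OGr q k).obj (ground K)) {B : CommAlgCat.{u} K}
    (f : ground K ⟶ B) : subspace ((OGr q k).map f x) =
      Submodule.span B ((fun n : V => (1 : B) ⊗ₜ[K] n) '' (fibre (subspace x) : Set V)) := by
  rw [subspace_map]
  congr 1
  ext z
  constructor
  · rintro ⟨y, hy, rfl⟩
    refine ⟨TensorProduct.lid K V y, lid_mem_fibre hy, ?_⟩
    have := congrArg (push f.hom) (one_tmul_lid y)
    rw [push_tmul, _root_.map_one] at this
    exact this
  · rintro ⟨n, hn, rfl⟩
    refine ⟨(1 : K) ⊗ₜ n, mem_fibre.mp hn, ?_⟩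
    exact (push_tmul f.hom 1 n).trans (by rw [_root_.map_one])

variable [Module.Finite K V]

/-- A pair `(U, U')` such that `U` contains the kernel can be deformed with `U` fixed. -/
theorem exists_deformation (hv0 : v ≠ 0) (hn : 2 * k + 2 ≤ Module.finrank K V)
    (x : (TOGr q (Submodule.span K {v}) (reducedForm hv) k).obj (ground K))
    (hx : (1 : K) ⊗ₜ[K] v ∈ subspace x.1.1) :
    ∃ z : (TOGr q (Submodule.span K {v}) (reducedForm hv) k).obj (dualNumbers K),
      (TOGr q (Submodule.span K {v}) (reducedForm hv) k).map (ofDual K) z = x ∧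
      z.1.1 = (OGr q k).map (toDual K) x.1.1 ∧
      z.1.2 ≠ (OGr (reducedForm hv) k).map (toDual K) x.1.2 := by
  have hq := finrank_quotient_span (K := K) hv0
  set N := fibre (subspace x.1.2) with hN
  have hrN : Module.finrank K N = k := finrank_fibre_subspace (by omega) x.1.2
  set U := fibre (subspace x.1.1) with hU
  have hrU : Module.finrank K U = k := finrank_fibre_subspace (by omega) x.1.1
  have hvU : v ∈ U := mem_fibre.mpr hx
  have hvD : v ∈ coneFibre x.1.2 := kernel_mem_coneFibre _
  have hrD : Module.finrank K (coneFibre x.1.2) = k + 1 := by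
    rw [← finrank_map_mkQ hv0 hvD]
    have : (coneFibre x.1.2).map (Submodule.span K {v}).mkQ = N :=
      Submodule.map_comap_eq_of_surjective (Submodule.mkQ_surjective _) _
    rw [this, hrN]
  have hrP := finrank_perp hv hv0 hvD
  obtain ⟨w, hwP, hwD⟩ : ∃ w ∈ perp q (coneFibre x.1.2), w ∉ coneFibre x.1.2 := by
    by_contra! hc
    have := Submodule.finrank_mono hc
    omega
  have hpol (n) (hn : n ∈ N) :
      QuadraticMap.polar (reducedForm hv) n ((Submodule.span K {v}).mkQ w) = 0 := by
    obtain ⟨d, rfl⟩ := Submodule.mkQ_surjective _ n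
    rw [polar_reducedForm]
    exact mem_perp.mp hwP d hn
  have hwN : (Submodule.span K {v}).mkQ w ∉ N := hwD
  set w' := (Submodule.span K {v}).mkQ w
  have hUN : U.map (Submodule.span K {v}).mkQ ≤ N :=
    Submodule.map_le_iff_le_comap.mpr (fibre_le_coneFibre x)
  obtain ⟨y, hyN, hyU⟩ : ∃ y ∈ N, y ∉ U.map (Submodule.span K {v}).mkQ := by
    by_contra! hc
    have h1 : Module.finrank K (U.map (Submodule.span K {v}).mkQ) + 1 = Module.finrank K U :=
      finrank_map_mkQ hv0 hvU
    have h2 : Module.finrank K N ≤ Module.finrank K (U.map (Submodule.span K {v}).mkQ) :=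
      Submodule.finrank_mono hc
    rw [hrN] at h2
    have h3 : Module.finrank K U = k := hrU
    rw [h3] at h1
    omega
  obtain ⟨l, hly, hlU⟩ := Submodule.exists_le_ker_of_notMem hyU
  obtain ⟨μ, hμw, hμN⟩ := Submodule.exists_le_ker_of_notMem hwN
  let N' : Module.Grassmannian (DualNumber K) (DualNumber K ⊗[K] (V ⧸ Submodule.span K {v}))
      (Module.finrank K (V ⧸ Submodule.span K {v}) - k) :=
    transport (shear l w' 1) (shear l w' (-1)) (shear_shear l w') (by omega)
      ((OGr (reducedForm hv) k).map (toDual K) x.1.2).1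
  have hN' : N'.toSubmodule = Submodule.span (DualNumber K)
      ((fun n => 1 ⊗ₜ n + (l n) • ((DualNumber.eps : DualNumber K) ⊗ₜ[K] w')) '' (N : Set _)) := by
    rw [transport_toSubmodule]
    refine (congrArg (Submodule.map _) (subspace_eq_span_fibre x.1.2 (toDual K))).trans ?_
    rw [Submodule.map_span, Set.image_image]
    congr 1
    refine Set.image_congr fun n _ => ?_
    exact (shear_one_tmul l w' 1 n).trans (by rw [one_mul])
  have hiso : IsIsotropic (reducedForm hv) (DualNumber K) N'.toSubmodule := by
    rw [hN']
    apply isIsotropic_span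
    rintro _ ⟨n, hn, rfl⟩ _ ⟨m, hm, rfl⟩
    have h1 : QuadraticMap.polar (reducedForm hv) n m = 0 := polar_fibre_eq_zero _ hn hm
    have h2 : QuadraticMap.polar (reducedForm hv) w' m = 0 := by
      rw [QuadraticMap.polar_comm, hpol m hm]
    simp only [TensorProduct.smul_tmul', QuadraticMap.polar_add_left, QuadraticMap.polar_add_right,
      polar_formBaseChange_tmul, h1, h2, hpol n hn]
    simp
  have hUle : subspace ((OGr q k).map (toDual K) x.1.1) ≤
      N'.toSubmodule.comap (projection _ (DualNumber K)) := by
    rw [subspace_eq_span_fibre, Submodule.span_le]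
    rintro _ ⟨n, hn, rfl⟩
    have hln : l ((Submodule.span K {v}).mkQ n) = 0 := hlU ⟨n, hn, rfl⟩
    rw [SetLike.mem_coe, Submodule.mem_comap, hN']
    refine Submodule.subset_span ⟨(Submodule.span K {v}).mkQ n, hUN ⟨n, hn, rfl⟩, ?_⟩
    simp only [hln, zero_smul, add_zero]
    exact (LinearMap.baseChange_tmul _ _ _).symm
  refine ⟨⟨((OGr q k).map (toDual K) x.1.1, ⟨N', hiso⟩), hUle⟩, ?_, rfl, fun h => ?_⟩
  · refine Subtype.ext (Prod.ext ?_ ?_)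
    · refine (OGr_map_comp _ _ _).symm.trans ?_
      rw [toDual_ofDual, OGr_map_id]
    · refine subspace_eq_of_le ?_
      refine (map_toSubmodule_of_span (ofDual K).hom (N := N')
        (M := fun n : N => 1 ⊗ₜ n.1 + (l n.1) • ((DualNumber.eps : DualNumber K) ⊗ₜ[K] w')) ?_).le.trans ?_
      · rw [hN']
        congr 1
        ext z
        simp
      · rw [Submodule.span_le]
        rintro _ ⟨n, rfl⟩
        have h0 : push (ofDual K).hom ((1 : DualNumber K) ⊗ₜ[K] n.1 +
            (l n.1) • ((DualNumber.eps : DualNumber K) ⊗ₜ[K] w')) = (1 : K) ⊗ₜ n.1 := by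
          have : (ofDual K).hom (DualNumber.eps : DualNumber K) = 0 := rfl
          rw [map_add, TensorProduct.smul_tmul', push_tmul, push_tmul, map_smul, this, smul_zero,
            TensorProduct.zero_tmul, add_zero, _root_.map_one]
        refine Eq.subst (motive := fun z => z ∈ subspace x.1.2) h0.symm ?_
        exact mem_fibre.mp n.2
  · have h1 : (1 : DualNumber K) ⊗ₜ y + (l y) • ((DualNumber.eps : DualNumber K) ⊗ₜ[K] w') ∈
        N'.toSubmodule := by
      rw [hN']
      exact Submodule.subset_span ⟨y, hyN, rfl⟩
    have h2 : N'.toSubmodule = Submodule.span (DualNumber K)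
        ((fun n => (1 : DualNumber K) ⊗ₜ[K] n) '' (N : Set _)) :=
      (congrArg subspace h).trans (subspace_eq_span_fibre x.1.2 (toDual K))
    have h3 : N'.toSubmodule ≤ LinearMap.ker (μ.baseChange (DualNumber K)) := by
      rw [h2, Submodule.span_le]
      rintro _ ⟨n, hn, rfl⟩
      have : μ n = 0 := hμN hn
      simp [this]
    have h4 := h3 h1
    have hμy : μ y = 0 := hμN hyN
    rw [LinearMap.mem_ker, map_add, TensorProduct.smul_tmul', LinearMap.baseChange_tmul,
      LinearMap.baseChange_tmul, hμy, TensorProduct.tmul_zero, zero_add] at h4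
    have h5 := congrArg (fun z => ((TensorProduct.rid K (DualNumber K)) z).snd) h4
    simp at h5
    tauto

end Deformation

end

end OrthogonalGrassmannian

namespace OrthogonalGrassmannian

noncomputable section

section Lift

variable {K : Type u} [Field K] {X Z : Over (Spec (CommRingCat.of K))}

theorem exists_comp_of_range_subset (i : Z ⟶ X) [IsOpenImmersion i.left] {A : CommAlgCat.{u} K}
    (y : specOver A ⟶ X) (h : Set.range y.left ⊆ Set.range i.left) : ∃ z, z ≫ i = y := by
  have hl := IsOpenImmersion.lift_fac i.left y.left h
  refine ⟨Over.homMk (IsOpenImmersion.lift i.left y.left h) ?_, ?_⟩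
  · rw [← Over.w i, ← Category.assoc, hl, Over.w y]
  · apply Over.OverMorphism.ext
    exact hl

end Lift

variable {K : Type u} [Field K] [CharZero K] {V : Type u} [AddCommGroup V] [Module K V]
  {q : QuadraticForm K V} {v : V} {k : ℕ}
  {hv : LinearMap.ker (QuadraticMap.polarBilin q) = Submodule.span K {v}}

namespace Frame

variable [NeZero k] (S : Frame q v k)

/-- The coordinate whose zero locus is the exceptional divisor. -/
def lastParam : S.paramRing := MvPolynomial.X (Sum.inr (Sum.inr 0))

variable [Module.Finite K V]

theorem mem_point_iff {A : CommAlgCat.{u} K} (P : S.Param → A) :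
    (1 : A) ⊗ₜ[K] v ∈ subspace (S.point hv P).1.1 ↔ P (Sum.inr (Sum.inr 0)) = 0 := by
  have h0 : S.gen P 0 = S.vec A (Sum.inr 0) + P (Sum.inr (Sum.inr 0)) • S.lift P 0 := by
    rw [gen, if_pos rfl]
  have hvec : S.vec A (Sum.inr 0) = (1 : A) ⊗ₜ[K] v := by rw [vec, S.basis_zero]
  rw [subspace_point_fst, ← hvec]
  constructor
  · intro h
    have h1 := eq_sum_of_dual (S.mixed A) (S.mixed_gen P) h
    have h2 : S.mixed A (S.vec A (Sum.inr 0)) = Pi.single 0 1 := by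
      rw [← S.mixed_gen P, h0, map_add, map_smul, mixed_lift_zero, smul_zero, add_zero]
    rw [h2, Finset.sum_eq_single 0 (fun b _ hb => by rw [Pi.single_eq_of_ne hb, zero_smul])
      (by simp), Pi.single_eq_same, one_smul] at h1
    rw [← S.crd_gen_zero P, ← h1, crd_vec, if_neg (by simp)]
  · intro h
    rw [h, zero_smul, add_zero] at h0
    exact h0 ▸ Submodule.subset_span ⟨0, rfl⟩

end Frame

namespace Diagram

variable [Module.Finite K V] (D : Diagram k hv) (hv0 : v ≠ 0) (hk : 1 ≤ k)

section Reduced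

variable [NeZero k]

include hv0 hk in
theorem exists_reduced_chart (S : Frame q v k) :
    ∃ c : specOver (quot S.paramRing (Ideal.span {S.lastParam})) ⟶
      D.F.scheme, IsOpenImmersion c.left ∧
        D.j.left ⁻¹' Set.range (S.toScheme hv D.T).left ⊆ Set.range c.left := by
  have key {A : CommAlgCat.{u} K} (f : S.paramRing ⟶ A) :
      (∃ z, z ≫ D.j = res f (S.toScheme hv D.T)) ↔
        f.hom S.lastParam = 0 := by
    rw [← D.exists_comp_j_iff hv0 hk, S.pt_toScheme, S.mem_point_iff]
    exact Iff.rfl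
  obtain ⟨c, hc⟩ := (key (toQuot S.paramRing (Ideal.span {S.lastParam}))).mpr (toQuot_eq_zero.mpr (Ideal.subset_span rfl))
  have hres {A : CommAlgCat.{u} K} (g) : res (B := A) g c ≫ D.j =
      res (toQuot _ _ ≫ g) (S.toScheme hv D.T) := by
    rw [← res_res, ← hc]
    exact Category.assoc _ _ _
  let U : D.F.scheme.left.Opens := D.j.left ⁻¹ᵁ (S.toScheme hv D.T).left.opensRange
  have hU : (U : Set D.F.scheme.left) = D.j.left ⁻¹' Set.range (S.toScheme hv D.T).left := rfl
  have h := isOpenImmersion_of_points (U := U) c ?_ ?_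
  · exact ⟨c, h.1, by rw [h.2, hU]⟩
  · intro A x x' hx
    obtain ⟨g, rfl⟩ := exists_algSpec_map x
    obtain ⟨g', rfl⟩ := exists_algSpec_map x'
    have h1 : res g c ≫ D.j = res g' c ≫ D.j := congrArg (· ≫ D.j) hx
    rw [hres, hres] at h1
    have h2 := algSpec_map_injective (S.injOnPoints_toScheme hv D.T A _ _ h1)
    have h3 : g = g' := by
      ext a
      obtain ⟨a, rfl⟩ := Ideal.Quotient.mk_surjective a
      exact ConcreteCategory.congr_hom h2 a
    rw [h3]
  · intro A y
    rw [hU]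
    constructor
    · rintro ⟨z, rfl⟩ _ ⟨p, rfl⟩
      obtain ⟨g, rfl⟩ := exists_algSpec_map z
      have h1 := congrArg (fun z => z.left p) (hres g)
      exact ⟨_, h1.symm⟩
    · intro hy
      obtain ⟨z, hz⟩ := exists_comp_of_range_subset (S.toScheme hv D.T) (y ≫ D.j) (by
        rintro _ ⟨p, rfl⟩
        exact hy ⟨p, rfl⟩)
      obtain ⟨f, rfl⟩ := exists_algSpec_map z
      obtain ⟨g, rfl⟩ := exists_of_kills (I := Ideal.span {S.lastParam}) f (by
          have := (key f).mp ⟨y, hz.symm⟩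
          intro a ha
          obtain ⟨b, rfl⟩ := Ideal.mem_span_singleton'.mp ha
          rw [map_mul, this, mul_zero])
      refine ⟨(algSpec (CommRingCat.of K)).map g.op, D.injOnPoints_j A _ _ ?_⟩
      exact (hres g).trans hz

variable [IsAlgClosed K] (hT : IsProjective D.T.scheme) (hn : k + 1 ≤ Module.finrank K V)

include hv0 hk hT hn in
theorem isReduced_F : AlgebraicGeometry.IsReduced D.F.scheme.left := by
  choose S hS using exists_frame_mem hv D.T hT hv0 hn
  choose c hc hcS using fun S => D.exists_reduced_chart hv0 hk S
  let 𝒰 : D.F.scheme.left.OpenCover := Scheme.Cover.mkOfCovers D.F.scheme.left _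
    (fun t => (c (S (D.j.left t))).left) (fun t => ⟨t, hcS _ (hS (D.j.left t))⟩) fun t => hc _
  have hr : ∀ t, AlgebraicGeometry.IsReduced (𝒰.X t) := fun t => by
    have : (Ideal.span {(S (D.j.left t)).lastParam}).IsPrime :=
      (Ideal.span_singleton_prime (MvPolynomial.X_ne_zero _)).mpr (MvPolynomial.X_prime)
    change AlgebraicGeometry.IsReduced (Spec (CommRingCat.of ((S (D.j.left t)).paramRing ⧸
      Ideal.span {(S (D.j.left t)).lastParam})))
    infer_instance
  exact AlgebraicGeometry.IsReduced.of_openCover _ 𝒰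

include hv0 hk hT hn in
theorem vanishingIdeal_support_ker :
    Scheme.IdealSheafData.vanishingIdeal D.j.left.ker.support = D.j.left.ker := by
  have := D.isClosedImmersion_j hv0 hk
  have := D.isReduced_F hv0 hk hT hn
  rw [Scheme.IdealSheafData.vanishingIdeal_support]
  refine le_antisymm (fun U a ha => ?_) (Scheme.IdealSheafData.le_radical _)
  obtain ⟨m, hm⟩ := ha
  rw [Scheme.Hom.ker_apply, RingHom.mem_ker, map_pow] at hm
  rw [Scheme.Hom.ker_apply, RingHom.mem_ker]
  exact eq_zero_of_pow_eq_zero hm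

end Reduced

section ExceptionalLocus

variable [IsAlgClosed K] (hT : IsProjective D.T.scheme) (hn : 2 * k + 2 ≤ Module.finrank K V)

include hT hn in
theorem le_openT (U : D.T.scheme.left.Opens) (hU : IsOpenImmersion (U.ι ≫ D.p₁.left)) :
    U ≤ D.openT hv0 hk := by
  by_contra hc
  obtain ⟨t, htU, ht⟩ := SetLike.not_le_iff_exists.mp hc
  have := hT.locallyOfFiniteType
  obtain ⟨y, hy⟩ := exists_ground_point (X := D.T.scheme)
    (Z := (U : Set D.T.scheme.left) ∩ (D.openT hv0 hk : Set D.T.scheme.left)ᶜ)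
    (U.isOpen.isLocallyClosed.inter (D.openT hv0 hk).isOpen.isClosed_compl.isLocallyClosed)
    ⟨t, htU, ht⟩
  have hyv : (1 : K) ⊗ₜ[K] v ∈ subspace (D.T.pt y).1.1 := by
    have h1 : ¬ Set.range y.left ⊆ (D.openT hv0 hk : Set D.T.scheme.left) := fun h =>
      (hy (⊥ : PrimeSpectrum K)).2 (h ⟨_, rfl⟩)
    have h0 := complCond_iff_range D.j D.injOnPoints_j D.isClosedCond_T
      (fun _ x => D.exists_comp_j_iff hv0 hk x) y
    obtain ⟨J, hJ⟩ := D.isClosedCond_T _ y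
    have h2 := hJ _ (𝟙 _)
    rw [CategoryTheory.Functor.map_id] at h2
    refine h2.mpr fun a ha => ?_
    by_contra ha0
    have hJ1 : J = ⊤ := Ideal.eq_top_of_isUnit_mem _ ha (IsUnit.mk0 (G₀ := K) a ha0)
    refine h1 (h0.mp fun B f hf => ?_)
    have h3 := (hJ B f).mp hf 1 (hJ1 ▸ trivial)
    rw [_root_.map_one] at h3
    exact subsingleton_of_zero_eq_one h3.symm
  obtain ⟨z, hz1, hz2, hz3⟩ := exists_deformation hv0 hn (D.T.pt y) hyv
  obtain ⟨t, rfl⟩ := D.T.exists_pt z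
  have ht : res (ofDual K) t = y := D.T.pt_injective ((D.T.pt_res _ _).trans hz1)
  have hr1 : Set.range t.left ⊆ (U : Set D.T.scheme.left) := by
    rintro _ ⟨p, rfl⟩
    obtain ⟨p₀, rfl⟩ := exists_comap_ofDual (K := K) p
    exact ((congrArg (fun z => z.left p₀ ∈ U) ht).mpr (hy p₀).1 :)
  have hr2 : Set.range (res (toDual K) y).left ⊆ (U : Set D.T.scheme.left) := by
    rintro _ ⟨p, rfl⟩
    exact (hy _).1
  obtain ⟨w, hw⟩ := (mem_range_openIncl_iff U _).mpr hr1
  obtain ⟨w', hw'⟩ := (mem_range_openIncl_iff U _).mpr hr2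
  have hpt := D.T.pt_res (toDual K) y
  have h1 : t ≫ D.p₁ = res (toDual K) y ≫ D.p₁ := D.X.pt_injective (by
    rw [D.pt_p₁, D.pt_p₁, hz2, hpt]
    rfl)
  have : IsOpenImmersion (openIncl U ≫ D.p₁).left := hU
  have h2 : w = w' := injOnPoints_of_mono (openIncl U ≫ D.p₁) _ _ _ (by
    rw [← Category.assoc, hw, h1, ← hw', Category.assoc])
  apply hz3
  rw [← hw, h2, hw', hpt]
  rfl

include hv0 hk hT hn in
theorem exceptionalLocus_eq : (exceptionalLocus D.p₁.left : Set D.T.scheme.left) =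
    Set.range D.j.left := by
  have h : sSup {U : D.T.scheme.left.Opens | IsOpenImmersion (U.ι ≫ D.p₁.left)} =
      D.openT hv0 hk :=
    le_antisymm (sSup_le fun U hU => D.le_openT hv0 hk hT hn U hU)
      (le_sSup (D.isOpenImmersion_openIncl_p₁ hv0 hk (by omega)).1)
  rw [exceptionalLocus, h]
  exact compl_compl _

include hv0 hk hT hn in
theorem exceptionalIdeal_eq : exceptionalIdeal D.p₁.left = D.j.left.ker := by
  have : NeZero k := ⟨by omega⟩
  have := D.isClosedImmersion_j hv0 hk
  rw [← D.vanishingIdeal_support_ker hv0 hk hT (by omega), exceptionalIdeal]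
  congr 1
  apply SetLike.coe_injective
  refine (D.exceptionalLocus_eq hv0 hk hT hn).trans (Eq.trans ?_ D.j.left.support_ker.symm)
  rw [D.j.left.isClosedEmbedding.isClosed_range.closure_eq]

include hv0 hk hT hn in
theorem exists_exceptional_iso :
    ∃ e : D.F.scheme.left ≅ (exceptionalIdeal D.p₁.left).subscheme,
      e.hom ≫ (exceptionalIdeal D.p₁.left).subschemeι = D.j.left ∧
      (exceptionalIdeal D.p₁.left).subschemeι ≫ D.p₁.left = e.inv ≫ D.r.left ≫ D.i.left := by
  have := D.isClosedImmersion_j hv0 hk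
  have hker : (exceptionalIdeal D.p₁.left).subschemeι.ker = D.j.left.ker := by
    rw [Scheme.IdealSheafData.ker_subschemeι, D.exceptionalIdeal_eq hv0 hk hT hn]
  have := IsClosedImmersion.isIso_lift _ _ hker
  have h1 := IsClosedImmersion.lift_fac _ _ hker.le
  refine ⟨asIso (IsClosedImmersion.lift _ _ hker.le), h1, ?_⟩
  rw [Iso.eq_inv_comp, asIso_hom, ← Category.assoc, h1]
  exact congrArg Over.Hom.left D.j_comp_p₁

end ExceptionalLocus

end Diagram

end

end OrthogonalGrassmannian

namespace OrthogonalGrassmannian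

noncomputable section

variable {K : Type u} [Field K] [CharZero K] {V : Type u} [AddCommGroup V] [Module K V]
  {q : QuadraticForm K V} {v : V} {k : ℕ}
  {hv : LinearMap.ker (QuadraticMap.polarBilin q) = Submodule.span K {v}}

namespace Diagram

variable [Module.Finite K V] (D : Diagram k hv) (hv0 : v ≠ 0) (hk : 1 ≤ k)
  [IsAlgClosed K] (hT : IsProjective D.T.scheme) (hX : IsProjective D.X.scheme)
  (hn : 2 * k + 2 ≤ Module.finrank K V)

include hv0 hn in
theorem exists_lift_ground (y : specOver (ground K) ⟶ D.X.scheme) : ∃ x, x ≫ D.p₁ = y := by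
  set U := fibre (subspace (D.X.pt y)) with hU
  have hrU : Module.finrank K U = k := finrank_fibre_subspace (by omega) _
  have hUU : U ≤ perp q U := fun x hx => mem_perp.mpr fun z hz => polar_fibre_eq_zero _ hz hx
  obtain ⟨x, hxU, hx, hqx, hvx⟩ : ∃ x ∉ U, x ∈ perp q U ∧ q x = 0 ∧
      v ∈ U ⊔ Submodule.span K {x} := by
    by_cases hvU : v ∈ U
    · have := finrank_perp hv hv0 hvU
      obtain ⟨x, hx, hxU, hqx⟩ := exists_isotropic_extension hv hv0 (I := U) (by omega)
      exact ⟨x, hxU, hx, hqx, le_sup_left (α := Submodule K V) hvU⟩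
    · have hker (z) : QuadraticMap.polar q v z = 0 := LinearMap.congr_fun
        (LinearMap.mem_ker.mp (hv.ge (Submodule.mem_span_singleton_self v))) z
      refine ⟨v, hvU, mem_perp.mpr fun z _ => ?_, ?_,
        le_sup_right (α := Submodule K V) (Submodule.mem_span_singleton_self v)⟩
      · rw [QuadraticMap.polar_comm, hker]
      · have := hker v
        rw [QuadraticMap.polar_self, two_smul, ← two_mul] at this
        exact (mul_eq_zero.mp this).resolve_left two_ne_zero
  obtain ⟨t, ht, -⟩ := exists_TOGr_fibre (hv := hv) (k := k) hv0
    (U := U) (D := U ⊔ Submodule.span K {x})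
    (le_sup_left (α := Submodule K V)) hvx hrU
    (by rw [finrank_sup_span_singleton hxU, hrU]) (isotropic_sup_span hv hv0 hUU hx hqx)
  obtain ⟨x, rfl⟩ := D.T.exists_pt t
  refine ⟨x, D.X.pt_injective (subspace_eq_of_le fun z hz => ?_)⟩
  rw [D.pt_p₁] at hz
  have h := lid_mem_fibre hz
  rw [ht, hU, mem_fibre, one_tmul_lid] at h
  exact h

include hT hn in
theorem dense_openT : Dense (D.openT hv0 hk : Set D.T.scheme.left) := by
  have : NeZero k := ⟨by omega⟩
  have := irreducibleSpace_TOGr hv D.T hT hv0 hn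
  refine (D.openT hv0 hk).isOpen.dense ?_
  obtain ⟨S⟩ := nonempty_frame hv hv0 hn
  obtain ⟨f, hf⟩ := S.exists_paramsOf (A := ground K) fun _ => (1 : K)
  have hy : Set.range (res f (S.toScheme hv D.T)).left ⊆
      (D.openT hv0 hk : Set D.T.scheme.left) := by
    rw [range_subset_openT_iff]
    intro B g hB
    have h1 := congrArg (fun z => z.1.1) (S.map_point hv g (S.paramsOf f))
    rw [S.pt_toScheme] at hB
    have h2 : (1 : B) ⊗ₜ[K] v ∈ subspace (S.point hv (fun i => g.hom (S.paramsOf f i))).1.1 :=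
      h1 ▸ hB
    rw [S.mem_point_iff, hf] at h2
    exact subsingleton_of_zero_eq_one (h2.symm.trans (_root_.map_one g.hom))
  exact ⟨_, hy ⟨(⊥ : PrimeSpectrum K), rfl⟩⟩

include hT hX hn in
theorem dense_openX : Dense (D.openX hv0 hk : Set D.X.scheme.left) := by
  rw [dense_iff_closure_eq]
  by_contra hc
  have := hX.locallyOfFiniteType
  obtain ⟨y, hy⟩ := exists_ground_point (X := D.X.scheme)
    (Z := (closure (D.openX hv0 hk : Set D.X.scheme.left))ᶜ)
    (isClosed_closure.isOpen_compl.isLocallyClosed) (Set.nonempty_compl.mpr hc)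
  obtain ⟨x, rfl⟩ := D.exists_lift_ground hv0 hn y
  refine hy (⊥ : PrimeSpectrum K) ?_
  have h1 := D.dense_openT hv0 hk hT hn (x.left (⊥ : PrimeSpectrum K))
  refine (mem_closure_image D.p₁.left.continuous.continuousAt h1 |> closure_mono ?_ :)
  rintro _ ⟨t, ht, rfl⟩
  rw [← (D.isOpenImmersion_openIncl_p₁ hv0 hk (by omega)).2]
  exact ⟨⟨t, ht⟩, rfl⟩

include hv0 hk hT hX hn in
theorem isBirational_p₁ : IsBirational D.p₁.left := by
  have h := D.isOpenImmersion_openIncl_p₁ hv0 hk (by omega)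
  obtain ⟨e, he⟩ := exists_iso_of_same_points (openIncl (D.openT hv0 hk) ≫ D.p₁)
    (openIncl (D.openX hv0 hk)) (D.injOnPoints_openIncl_p₁ hv0 hk (by omega))
    (injOnPoints_of_mono _) fun A y => by
      rw [D.exists_comp_openIncl_p₁_iff hv0 hk (by omega), mem_range_openIncl_iff]
  exact ⟨⟨D.openT hv0 hk, D.dense_openT hv0 hk hT hn, D.openX hv0 hk,
    D.dense_openX hv0 hk hT hX hn, (Over.forget _).mapIso e⟩, congrArg Over.Hom.left he⟩

end Diagram

end

end OrthogonalGrassmannian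

namespace OrthogonalGrassmannian

noncomputable section

variable {R : Type u} [CommRing R] {M N : Type u} [AddCommGroup M] [Module R M]
  [AddCommGroup N] [Module R N]

section LocalTests

theorem mem_of_local_smul {S : Submodule R M} {x : M}
    (h : ∀ p : PrimeSpectrum R, ∃ s ∉ p.asIdeal, s • x ∈ S) : x ∈ S := by
  let I : Ideal R := S.comap (LinearMap.toSpanSingleton R M x)
  suffices hI : I = ⊤ by
    have : (1 : R) • x ∈ S := show (1 : R) ∈ I from hI ▸ trivial
    rwa [one_smul] at this
  by_contra hI
  obtain ⟨m, hm, hIm⟩ := I.exists_le_maximal hI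
  obtain ⟨s, hs, hsx⟩ := h ⟨m, hm.isPrime⟩
  exact hs (hIm hsx)

theorem eq_zero_of_local_smul {x : M}
    (h : ∀ p : PrimeSpectrum R, ∃ s ∉ p.asIdeal, s • x = 0) : x = 0 :=
  (Submodule.mem_bot R).mp (mem_of_local_smul h)

theorem surjective_of_local {M : Type u} [AddCommMonoid M] [Module R M] (L : M →ₗ[R] R)
    (h : ∀ p : PrimeSpectrum R, ∃ s ∈ LinearMap.range L, s ∉ p.asIdeal) : Function.Surjective L := by
  have h1 : (1 : R) ∈ LinearMap.range L := mem_of_local_smul fun p => by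
    obtain ⟨s, hL, hs⟩ := h p
    exact ⟨s, hs, by rwa [smul_eq_mul, mul_one]⟩
  intro a
  obtain ⟨t, ht⟩ := h1
  exact ⟨a • t, by rw [map_smul, ht, smul_eq_mul, mul_one]⟩

theorem lift_injective_of_local {P : Type u} [AddCommGroup P] [Module R P]
    (β : M →ₗ[R] N →ₗ[R] P) (h : ∀ p : PrimeSpectrum R, ∃ m₀,
      (∀ m, ∃ s ∉ p.asIdeal, ∃ c : R, s • m = c • m₀) ∧ ∀ y, β m₀ y = 0 → y = 0) :
    Function.Injective (TensorProduct.lift β) := by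
  refine (injective_iff_map_eq_zero _).mpr fun t ht => eq_zero_of_local_smul (R := R) fun p => ?_
  obtain ⟨m₀, hm, hβ⟩ := h p
  obtain ⟨s, hs, y, hy⟩ : ∃ s ∉ p.asIdeal, ∃ y : N, s • t = m₀ ⊗ₜ[R] y := by
    clear ht
    induction t with
    | zero => exact ⟨1, p.isPrime.one_notMem, 0, by simp⟩
    | tmul m y =>
      obtain ⟨s, hs, c, e⟩ := hm m
      exact ⟨s, hs, c • y, by rw [TensorProduct.smul_tmul', e, TensorProduct.smul_tmul]⟩
    | add t t' h h' =>
      obtain ⟨s, hs, y, e⟩ := h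
      obtain ⟨s', hs', y', e'⟩ := h'
      refine ⟨s * s', fun h => (p.isPrime.mem_or_mem h).elim hs hs', s' • y + s • y', ?_⟩
      rw [TensorProduct.tmul_add, TensorProduct.tmul_smul, TensorProduct.tmul_smul, ← e, ← e',
        smul_smul, smul_smul, mul_comm s' s, smul_add]
  refine ⟨s, hs, ?_⟩
  have h1 := congrArg (TensorProduct.lift β) hy
  rw [map_smul, ht, smul_zero, TensorProduct.lift.tmul] at h1
  rw [hy, hβ y h1.symm, TensorProduct.tmul_zero]

end LocalTests

section Determinants

variable {k : ℕ}

theorem alternating_combination (f : M [⋀^Fin k]→ₗ[R] N) (A : Matrix (Fin k) (Fin k) R)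
    (m : Fin k → M) : f (fun i => ∑ j, A i j • m j) = A.det • f m := by
  let F : (Fin k → R) [⋀^Fin k]→ₗ[R] N := f.compLinearMap (Fintype.linearCombination R m)
  let G : (Fin k → R) [⋀^Fin k]→ₗ[R] N :=
    (LinearMap.toSpanSingleton R N (f m)).compAlternatingMap Matrix.detRowAlternating
  have hb (i) : Fintype.linearCombination R m (Pi.basisFun R (Fin k) i) = m i := by
    rw [Pi.basisFun_apply, Fintype.linearCombination_apply_single, one_smul]
  have h : F = G := by
    refine Module.Basis.ext_alternating (Pi.basisFun R (Fin k)) fun i hi => ?_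
    let σ : Equiv.Perm (Fin k) := Equiv.ofBijective i (Finite.injective_iff_bijective.mp hi)
    have h1 (H : (Fin k → R) [⋀^Fin k]→ₗ[R] N) :
        H (fun j => Pi.basisFun R (Fin k) (i j)) = Equiv.Perm.sign σ • H (Pi.basisFun R (Fin k)) :=
      H.map_perm _ σ
    rw [h1, h1]
    congr 1
    have h2 : Matrix.detRowAlternating (R := R) (n := Fin k) (fun i => Pi.basisFun R (Fin k) i) =
        1 := by
      rw [← Matrix.det_one (n := Fin k)]
      change Matrix.det _ = _
      congr 1
      ext i j
      simp [Matrix.one_apply, Pi.single_apply, eq_comm]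
    change f (fun j => Fintype.linearCombination R m (Pi.basisFun R (Fin k) j)) =
      Matrix.detRowAlternating (fun i => Pi.basisFun R (Fin k) i) • f m
    rw [h2, one_smul]
    congr 1
    funext j
    exact hb j
  exact congrArg (fun H => H A) h

theorem det_smul_one_update {d : R} (η : Fin k → R) (A : Matrix (Fin k) (Fin k) R) (l₀ : Fin k)
    (hA : ∀ i j, A i j = (if i = l₀ then 0 else if i = j then d else 0) +
      if j = l₀ then η i else 0) : A.det = d ^ (k - 1) * η l₀ := by
  have h : A = (d • (1 : Matrix (Fin k) (Fin k) R)).updateCol l₀ η := by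
    ext i j
    rw [hA, Matrix.updateCol_apply, Matrix.smul_apply, Matrix.one_apply]
    by_cases hj : j = l₀
    · by_cases hi : i = l₀ <;> by_cases hij : i = j <;> simp_all
    · by_cases hi : i = l₀ <;> by_cases hij : i = j <;> simp_all
  rw [h]
  have := Matrix.cramer_apply (d • (1 : Matrix (Fin k) (Fin k) R)) η l₀
  rw [← this, Matrix.cramer_smul, Matrix.cramer_one]
  simp

variable {d : R} {g : Fin k → M} {ψ : M →ₗ[R] (Fin k → R)}

/-- Generators and dual functionals up to a factor induce the same for the top exterior power. -/
theorem exists_exterior_functional (hψ : ∀ l, ψ (g l) = Pi.single l d)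
    (hg : ∀ x, d • x = ∑ l, ψ x l • g l) : ∃ δ : ⋀[R]^k M →ₗ[R] R,
      δ (exteriorPower.ιMulti R k g) = d ^ k ∧
      ∀ y, d ^ k • y = δ y • exteriorPower.ιMulti R k g := by
  have hδ (m : Fin k → M) : exteriorPower.alternatingMapLinearEquiv
      (Matrix.detRowAlternating.compLinearMap ψ) (exteriorPower.ιMulti R k m) =
      Matrix.det (fun i => ψ (m i)) :=
    exteriorPower.alternatingMapLinearEquiv_apply_ιMulti _ _
  refine ⟨exteriorPower.alternatingMapLinearEquiv (Matrix.detRowAlternating.compLinearMap ψ),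
    ?_, fun y => ?_⟩
  · have : (fun i => ψ (g i)) = Matrix.diagonal fun _ => d := by
      ext i j
      rw [hψ, Matrix.diagonal_apply, Pi.single_apply]
      simp only [eq_comm]
    rw [hδ, this, Matrix.det_diagonal, Finset.prod_const, Finset.card_univ, Fintype.card_fin]
  · induction y using exterior_induction with
    | h m =>
      have h1 := (exteriorPower.ιMulti R k).toMultilinearMap.map_smul_univ (fun _ => d) m
      rw [Finset.prod_const, Finset.card_univ, Fintype.card_fin] at h1
      rw [hδ, ← alternating_combination (exteriorPower.ιMulti R k) (fun i => ψ (m i)) g]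
      refine h1.symm.trans ?_
      change exteriorPower.ιMulti R k _ = _
      congr 1
      funext i
      exact hg (m i)
    | h0 => simp
    | hadd x y hx hy => rw [smul_add, hx, hy, map_add, add_smul]
    | hsmul a x hx => rw [smul_comm, hx, map_smul, smul_smul, smul_eq_mul]

end Determinants

end

end OrthogonalGrassmannian

namespace OrthogonalGrassmannian

noncomputable section

section ExteriorFrames

variable {R : Type u} [CommRing R] {M M' : Type u} [AddCommGroup M] [Module R M]
  [AddCommGroup M'] [Module R M'] {k : ℕ}

/-- At every prime there are generators and dual functionals, up to a factor. -/
def HasLocalFrames (R M : Type u) [CommRing R] [AddCommGroup M] [Module R M] (k : ℕ) : Prop :=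
  ∀ p : PrimeSpectrum R, ∃ d ∉ p.asIdeal, ∃ (g : Fin k → M) (ψ : M →ₗ[R] (Fin k → R)),
    (∀ l, ψ (g l) = Pi.single l d) ∧ ∀ x, d • x = ∑ l, ψ x l • g l

/-- At every prime there are generators and dual functionals, up to a factor, for two modules,
such that a map between them has the form of a projection along the kernel of a cone. -/
def HasAdaptedFrames (π : M →ₗ[R] M') (I : Ideal R) (k : ℕ) [NeZero k] : Prop :=
  ∀ p : PrimeSpectrum R, ∃ d ∉ p.asIdeal, ∃ (g : Fin k → M) (ψ : M →ₗ[R] (Fin k → R))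
    (g' : Fin k → M') (ψ' : M' →ₗ[R] (Fin k → R)) (η : Fin k → R),
    (∀ l, ψ (g l) = Pi.single l d) ∧ (∀ x, d • x = ∑ l, ψ x l • g l) ∧
    (∀ l, ψ' (g' l) = Pi.single l d) ∧ (∀ x, d • x = ∑ l, ψ' x l • g' l) ∧
    (∀ l, d • π (g l) = (if l = 0 then 0 else d • g' l) + η l • g' 0) ∧
    η 0 ∈ I ∧ η 0 ≠ 0 ∧ ∀ a ∈ I, ∃ s ∉ p.asIdeal, ∃ c : R, s * a = c * η 0

variable [NeZero k] {π : M →ₗ[R] M'} {I : Ideal R}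

theorem HasAdaptedFrames.hasLocalFrames (h : HasAdaptedFrames π I k) : HasLocalFrames R M k :=
  fun p => by
    obtain ⟨d, hd, g, ψ, -, -, -, hψ, hg, -⟩ := h p
    exact ⟨d, hd, g, ψ, hψ, hg⟩

variable [NoZeroDivisors R]

/-- The determinants of two modules with adapted frames differ by the ideal. -/
theorem HasAdaptedFrames.exists_generators (h : HasAdaptedFrames π I k) (p : PrimeSpectrum R) :
    ∃ s ∉ p.asIdeal, ∃ (u : ⋀[R]^k M) (δ : ⋀[R]^k M →ₗ[R] R) (u' : ⋀[R]^k M')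
      (δ' : ⋀[R]^k M' →ₗ[R] R) (ε : I), (∀ y, s • y = δ y • u) ∧ δ' u' = s ∧
      (∀ y, s • y = δ' y • u') ∧ s • exteriorMap k π u = ε.1 • u' ∧ ε.1 ≠ 0 ∧
      ∀ a : I, ∃ s ∉ p.asIdeal, ∃ c : R, s • a = c • ε := by
  obtain ⟨d, hd, g, ψ, g', ψ', η, hψ, hg, hψ', hg', hπ, hη, hη0, hI⟩ := h p
  obtain ⟨δ, -, hy⟩ := exists_exterior_functional hψ hg
  obtain ⟨δ', hδ', hy'⟩ := exists_exterior_functional hψ' hg'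
  have hd0 : d ^ (k - 1) ∉ p.asIdeal := fun h => hd (p.isPrime.mem_of_pow_mem _ h)
  let A : Matrix (Fin k) (Fin k) R := fun i j =>
    (if i = 0 then 0 else if i = j then d else 0) + if j = 0 then η i else 0
  have hdet : A.det = d ^ (k - 1) * η 0 := det_smul_one_update η A 0 fun _ _ => rfl
  have hA (l) : d • π (g l) = ∑ j, A l j • g' j := by
    rw [hπ]
    simp only [A, add_smul, Finset.sum_add_distrib, ite_smul, zero_smul]
    congr 1
    · split_ifs with hl
      · simp
      · simp
    · simp
  have hu : d ^ k • exteriorMap k π (exteriorPower.ιMulti R k g) =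
      (d ^ (k - 1) * η 0) • exteriorPower.ιMulti R k g' := by
    rw [exteriorMap_ιMulti, ← hdet, ← alternating_combination (exteriorPower.ιMulti R k) A g']
    have h1 := (exteriorPower.ιMulti R k).toMultilinearMap.map_smul_univ (fun _ => d) (π ∘ g)
    rw [Finset.prod_const, Finset.card_univ, Fintype.card_fin] at h1
    refine h1.symm.trans ?_
    change exteriorPower.ιMulti R k _ = _
    congr 1
    funext i
    exact hA i
  refine ⟨d ^ k, fun h => hd (p.isPrime.mem_of_pow_mem _ h), exteriorPower.ιMulti R k g, δ,
    exteriorPower.ιMulti R k g', δ', ⟨d ^ (k - 1) * η 0, I.mul_mem_left _ hη⟩, hy, hδ', hy', hu,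
    fun h0 => hη0 ((mul_eq_zero.mp h0).resolve_left fun h => hd0 (h ▸ zero_mem _)), fun a => ?_⟩
  · obtain ⟨t, ht, c, e⟩ := hI a.1 a.2
    refine ⟨d ^ (k - 1) * t, fun h => (p.isPrime.mem_or_mem h).elim hd0 ht, c, Subtype.ext ?_⟩
    change d ^ (k - 1) * t * a.1 = c * (d ^ (k - 1) * η 0)
    rw [mul_assoc, e]
    ring

theorem HasAdaptedFrames.injective (h : HasAdaptedFrames π I k) :
    Function.Injective (exteriorMap k π) := by
  refine (injective_iff_map_eq_zero (exteriorMap k π)).mpr fun y hy =>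
    eq_zero_of_local_smul (R := R) fun p => ?_
  obtain ⟨s, hs, u, δ, u', δ', ε, hu, hδ', -, hπ, hε, -⟩ := h.exists_generators p
  have hs0 : s ≠ 0 := fun h0 => hs (h0 ▸ zero_mem _)
  refine ⟨s, hs, ?_⟩
  have h1 := congrArg (fun z => s • exteriorMap k π z) (hu y)
  simp only [LinearMap.map_smulₛₗ, hy, smul_zero, RingHom.id_apply] at h1
  rw [smul_comm, hπ] at h1
  have h2 := congrArg δ' h1
  rw [map_zero, map_smul, map_smul, hδ', smul_eq_mul, smul_eq_mul] at h2
  have h3 : δ y = 0 := by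
    rcases mul_eq_zero.mp h2.symm with h | h
    · exact h
    · exact absurd h (mul_ne_zero hε hs0)
  rw [hu, h3, zero_smul]

theorem HasAdaptedFrames.exists_mul (h : HasAdaptedFrames π I k) :
    ∃ β : I →ₗ[R] ⋀[R]^k M' →ₗ[R] ⋀[R]^k M, (∀ a y, exteriorMap k π (β a y) = a.1 • y) ∧
      Function.Bijective (TensorProduct.lift β) := by
  have hr (a : I) (y : ⋀[R]^k M') : a.1 • y ∈ LinearMap.range (exteriorMap k π) := by
    refine mem_of_local_smul fun p => ?_
    obtain ⟨s, hs, u, δ, u', δ', ε, hu, hδ', hu', hπ, hε, hI⟩ := h.exists_generators p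
    obtain ⟨t, ht, c, e⟩ := hI a
    refine ⟨t * s, fun hp => (p.isPrime.mem_or_mem hp).elim ht hs, (c * δ' y * s) • u, ?_⟩
    have e' : t * a.1 = c * ε.1 := congrArg Subtype.val e
    rw [LinearMap.map_smulₛₗ, RingHom.id_apply, mul_smul, hπ, smul_smul, smul_smul,
      mul_right_comm t, e', mul_right_comm c, mul_smul (c * ε.1), mul_smul (c * ε.1), hu']
  choose f hf using hr
  have hinj := h.injective
  let β : I →ₗ[R] ⋀[R]^k M' →ₗ[R] ⋀[R]^k M := LinearMap.mk₂ R f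
    (fun a a' y => hinj (by rw [map_add, hf, hf, hf, ← add_smul]; rfl))
    (fun c a y => hinj (by rw [LinearMap.map_smulₛₗ, hf, hf, smul_smul]; rfl))
    (fun a y y' => hinj (by rw [map_add, hf, hf, hf, smul_add]))
    (fun c a y => hinj (by rw [LinearMap.map_smulₛₗ, hf, hf, smul_comm]; rfl))
  have hβ (a) (y) : exteriorMap k π (β a y) = a.1 • y := hf a y
  refine ⟨β, hβ, lift_injective_of_local β fun p => ?_, fun y => ?_⟩
  · obtain ⟨s, hs, u, δ, u', δ', ε, hu, hδ', hu', hπ, hε, hI⟩ := h.exists_generators p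
    refine ⟨ε, hI, fun y hy => ?_⟩
    have h0 : ε.1 • y = 0 := by rw [← hβ, hy, map_zero]
    refine eq_zero_of_local_smul (R := R) fun p' => ?_
    obtain ⟨s, hs, -, -, u', δ', -, -, -, hu', -⟩ := h.exists_generators p'
    refine ⟨s, hs, ?_⟩
    have h1 := congrArg δ' h0
    rw [map_zero, map_smul, smul_eq_mul] at h1
    rw [hu', (mul_eq_zero.mp h1).resolve_left hε, zero_smul]
  · change y ∈ LinearMap.range (TensorProduct.lift β)
    refine mem_of_local_smul fun p => ?_
    obtain ⟨s, hs, u, δ, u', δ', ε, hu, hδ', hu', hπ, hε, hI⟩ := h.exists_generators p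
    refine ⟨s * s, fun hp => (p.isPrime.mem_or_mem hp).elim hs hs, δ y • ε ⊗ₜ[R] u', hinj ?_⟩
    rw [map_smul, TensorProduct.lift.tmul, LinearMap.map_smulₛₗ, hβ, mul_smul, hu,
      LinearMap.map_smulₛₗ, LinearMap.map_smulₛₗ, RingHom.id_apply, RingHom.id_apply, ← hπ,
      RingHom.id_apply, smul_eq_mul, mul_comm s, mul_smul]

end ExteriorFrames

end

end OrthogonalGrassmannian

namespace OrthogonalGrassmannian

noncomputable section

section PlueckerDual

variable {K : Type u} [Field K] {V : Type u} [AddCommGroup V] [Module K V]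
  [Module.Finite K V] {n k : ℕ}
  (b : Module.Basis (Fin n) K V) {A B C : CommAlgCat.{u} K} (N : Submodule A (A ⊗[K] V))
  {N' : Submodule B (B ⊗[K] V)} {N'' : Submodule C (C ⊗[K] V)}

variable (k) in
/-- The Plücker coordinates on the top exterior power of a submodule of rank `k`. -/
def plueckerMap : ⋀[A]^k N →ₗ[A] ((Fin k → Fin n) → A) :=
  LinearMap.pi fun J => exteriorPower.alternatingMapLinearEquiv
    (Matrix.detRowAlternating.compLinearMap
      (LinearMap.pi (fun j => LinearMap.proj (J j) ∘ₗ (crd b A).toLinearMap ∘ₗ N.subtype)))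

theorem plueckerMap_ιMulti (m : Fin k → N) (J : Fin k → Fin n) :
    plueckerMap k b N (exteriorPower.ιMulti A k m) J = minor b (fun i => (m i).1) J :=
  exteriorPower.alternatingMapLinearEquiv_apply_ιMulti _ _

variable (k) in
/-- The pairing of the top exterior power with the linear forms in the Plücker coordinates. -/
def plueckerPairing : ⋀[A]^k N →ₗ[A] ((Fin k → Fin n) → A) →ₗ[A] A :=
  dotProductBilin A A ∘ₗ plueckerMap k b N

theorem plueckerPairing_apply (y : ⋀[A]^k N) (c : (Fin k → Fin n) → A) :
    plueckerPairing k b N y c = ∑ J, plueckerMap k b N y J * c J := rfl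

variable (k) in
/-- The linear forms in the Plücker coordinates which vanish. -/
def plueckerKer : Submodule A ((Fin k → Fin n) → A) := LinearMap.ker (plueckerPairing k b N).flip

theorem mem_plueckerKer {c : (Fin k → Fin n) → A} :
    c ∈ plueckerKer k b N ↔ ∀ y, plueckerPairing k b N y c = 0 :=
  ⟨fun h y => LinearMap.congr_fun h y, fun h => LinearMap.ext h⟩

variable (k) in
/-- The linear forms in the Plücker coordinates modulo those which vanish. -/
abbrev PlueckerDual : Type u := ((Fin k → Fin n) → A) ⧸ plueckerKer k b N

variable (k) in
/-- The evaluation of linear forms in the Plücker coordinates. -/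
def plueckerEval : ⋀[A]^k N →ₗ[A] PlueckerDual k b N →ₗ[A] A :=
  ((plueckerKer k b N).liftQ (plueckerPairing k b N).flip le_rfl).flip

theorem plueckerEval_mk (y : ⋀[A]^k N) (c : (Fin k → Fin n) → A) :
    plueckerEval k b N y (Submodule.Quotient.mk c) = plueckerPairing k b N y c := rfl

theorem plueckerEval_eq_zero {y : ⋀[A]^k N} [NoZeroDivisors A] {s : A} (hs : s ≠ 0)
    {δ : ⋀[A]^k N →ₗ[A] A} (hy : ∀ x, s • x = δ x • y) {φ : PlueckerDual k b N}
    (hφ : plueckerEval k b N y φ = 0) : φ = 0 := by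
  obtain ⟨c, rfl⟩ := Submodule.Quotient.mk_surjective _ φ
  rw [plueckerEval_mk] at hφ
  refine (Submodule.Quotient.mk_eq_zero _).mpr ((mem_plueckerKer b N).mpr fun x => ?_)
  have h1 := congrArg (fun z => plueckerPairing k b N z c) (hy x)
  simp only [map_smul, LinearMap.smul_apply, hφ, smul_eq_mul, mul_zero] at h1
  exact (mul_eq_zero.mp h1).resolve_left hs

theorem plueckerEval_single (u : Fin k → N) (J : Fin k → Fin n) :
    plueckerEval k b N (exteriorPower.ιMulti A k u) (Submodule.Quotient.mk (Pi.single J 1)) =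
      minor b (fun i => (u i).1) J := by
  rw [plueckerEval_mk, plueckerPairing_apply, Finset.sum_eq_single J (fun J' _ h => by
    rw [Pi.single_eq_of_ne h, mul_zero]) (by simp), plueckerMap_ιMulti, Pi.single_eq_same, mul_one]

theorem plueckerEval_bijective [NoZeroDivisors A] (hN : HasLocalFrames A N k)
    (hm : ∀ p : PrimeSpectrum A, ∃ (u : Fin k → A ⊗[K] V) (J : Fin k → Fin n),
      (∀ i, u i ∈ N) ∧ minor b u J ∉ p.asIdeal) :
    Function.Bijective (TensorProduct.lift (plueckerEval k b N)) := by
  constructor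
  · refine lift_injective_of_local _ fun p => ?_
    obtain ⟨d, hd, g, ψ, hψ, hg⟩ := hN p
    obtain ⟨δ, -, hy⟩ := exists_exterior_functional hψ hg
    have hs : d ^ k ∉ p.asIdeal := fun h => hd (p.isPrime.mem_of_pow_mem _ h)
    have hs0 : d ^ k ≠ 0 := fun h => hs (h ▸ zero_mem _)
    exact ⟨exteriorPower.ιMulti A k g, fun y => ⟨d ^ k, hs, δ y, hy y⟩,
      fun φ hφ => plueckerEval_eq_zero b N hs0 hy hφ⟩
  · choose u J hu h using hm
    have e (p) := plueckerEval_single b N (fun i => ⟨u p i, hu p i⟩) (J p)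
    have h2 (p : PrimeSpectrum A) : minor b (u p) (J p) ∈
        LinearMap.range (TensorProduct.lift (plueckerEval k b N)) :=
      LinearMap.mem_range.mpr ⟨_, (TensorProduct.lift.tmul _ _).trans (e p)⟩
    exact surjective_of_local _ fun p => ⟨_, h2 p, h p⟩

variable {N} {f : A ⟶ B} (ρ : N →ₛₗ[(f.hom : A →+* B)] N') (hρ : ∀ x, (ρ x).1 = push f.hom x.1)

include hρ in
theorem plueckerMap_exteriorMap (y : ⋀[A]^k N) (J : Fin k → Fin n) :
    plueckerMap k b N' (exteriorMap k ρ y) J = f.hom (plueckerMap k b N y J) := by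
  induction y using exterior_induction with
  | h m =>
    rw [exteriorMap_ιMulti, plueckerMap_ιMulti, plueckerMap_ιMulti, ← minor_push]
    congr 1
    funext i
    exact hρ (m i)
  | h0 => simp
  | hadd x y hx hy => simp only [map_add, Pi.add_apply, hx, hy]
  | hsmul a x hx =>
    rw [LinearMap.map_smulₛₗ, map_smul, map_smul, Pi.smul_apply, Pi.smul_apply, hx, smul_eq_mul,
      smul_eq_mul, map_mul]
    rfl

include hρ in
theorem plueckerPairing_exteriorMap (y : ⋀[A]^k N) (c : (Fin k → Fin n) → A) :
    plueckerPairing k b N' (exteriorMap k ρ y) (fun J => f.hom (c J)) =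
      f.hom (plueckerPairing k b N y c) := by
  rw [plueckerPairing_apply, plueckerPairing_apply, map_sum]
  exact Finset.sum_congr rfl fun J _ => by rw [plueckerMap_exteriorMap b ρ hρ, map_mul]

variable (f) in
/-- A homomorphism of rings applied to the coefficients of a linear form. -/
def coefficientMap (ι : Type) : (ι → A) →ₛₗ[(f.hom : A →+* B)] (ι → B) where
  toFun c J := f.hom (c J)
  map_add' _ _ := funext fun _ => map_add _ _ _
  map_smul' _ _ := funext fun _ => map_mul _ _ _

variable (hs : Submodule.span B (Set.range ρ) = ⊤)

/-- The restriction of linear forms in the Plücker coordinates. -/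
def plueckerRes : PlueckerDual k b N →ₛₗ[(f.hom : A →+* B)] PlueckerDual k b N' :=
  Submodule.mapQ _ _ (coefficientMap f _) fun c hc => by
    refine (mem_plueckerKer b N').mpr fun y => ?_
    have hc' := (mem_plueckerKer b N).mp hc
    have hy : y ∈ Submodule.span B (exteriorPower.ιMulti B k '' {a | Set.range a ⊆ Set.range ρ}) :=
      (exteriorPower.ιMulti_span_of_span B k N' hs).ge trivial
    induction hy using Submodule.span_induction with
    | mem y hy =>
      obtain ⟨a, ha, rfl⟩ := hy
      choose m hm using fun i => ha ⟨i, rfl⟩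
      have e : exteriorPower.ιMulti B k a = exteriorMap k ρ (exteriorPower.ιMulti A k m) := by
        rw [exteriorMap_ιMulti]
        congr 1
        exact funext fun i => (hm i).symm
      rw [e]
      refine (plueckerPairing_exteriorMap b ρ hρ _ c).trans ?_
      exact (congrArg f.hom (hc' _)).trans (map_zero _)
    | zero => rw [map_zero, LinearMap.zero_apply]
    | add y y' _ _ h h' => rw [map_add, LinearMap.add_apply, h, h', add_zero]
    | smul a y _ h => rw [map_smul, LinearMap.smul_apply, h, smul_zero]

include hρ hs in
theorem plueckerEval_plueckerRes (y : ⋀[A]^k N) (φ : PlueckerDual k b N) :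
    plueckerEval k b N' (exteriorMap k ρ y) (plueckerRes b ρ hρ hs φ) =
      f.hom (plueckerEval k b N y φ) := by
  obtain ⟨c, rfl⟩ := Submodule.Quotient.mk_surjective _ φ
  exact plueckerPairing_exteriorMap b ρ hρ y c

end PlueckerDual

end

end OrthogonalGrassmannian

namespace OrthogonalGrassmannian

noncomputable section

variable {K : Type u} [Field K] {A : CommAlgCat.{u} K} [NoZeroDivisors A] {r : A} (hr : r ≠ 0)

section Denominators

include hr

theorem toLoc_injective : Function.Injective (toLoc A r).hom :=
  (injective_iff_map_eq_zero (toLoc A r).hom).mpr fun a ha => by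
    obtain ⟨n, hn⟩ := exists_pow_mul_eq_zero ha
    have : Nontrivial A := ⟨r, 0, hr⟩
    exact (mul_eq_zero.mp hn).resolve_left (pow_ne_zero n hr)

variable {W : Type u} [AddCommGroup W] [Module K W] [Module.Finite K W] {m k : ℕ}

theorem push_toLoc_injective : Function.Injective (push (V := W) (toLoc A r).hom) := by
  intro x y h
  refine (crd (Module.finBasis K W) A).injective (funext fun i => toLoc_injective hr ?_)
  rw [← crd_push, ← crd_push, h]

/-- Generators and dual functionals over a localization come from the ring, up to a factor. -/
theorem exists_lifted_frame {N : (Gr W m).obj A} {N₁ : Submodule A (A ⊗[K] W)}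
    (hN₁ : N₁ = N.toSubmodule) {n : Fin k → loc A r ⊗[K] W}
    (hn : ((Gr W m).map (toLoc A r) N).toSubmodule = Submodule.span _ (Set.range n))
    {ψ : A ⊗[K] W →ₗ[A] (Fin k → A)} {ψ' : loc A r ⊗[K] W →ₗ[loc A r] (Fin k → loc A r)}
    (hψ : ∀ x b, ψ' (push (toLoc A r).hom x) b = (toLoc A r).hom (ψ x b))
    (hψn : ∀ l, ψ' (n l) = Pi.single l 1) :
    ∃ a₀ : ℕ, ∀ a ≥ a₀, ∃ g : Fin k → N₁,
      (∀ l, push (toLoc A r).hom (g l).1 = (toLoc A r).hom (r ^ a) • n l) ∧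
      (∀ l, ψ (g l).1 = Pi.single l (r ^ a)) ∧ ∀ x : N₁, r ^ a • x = ∑ l, ψ x.1 l • g l := by
  subst hN₁
  have h (l) : ∃ (i : ℕ) (w : N.toSubmodule),
      push (toLoc A r).hom w.1 = (toLoc A r).hom (r ^ i) • n l := by
    obtain ⟨i, w, hw⟩ := exists_pow_smul_eq_push (n l)
    obtain ⟨j, hj⟩ := Gr_exists_pow (N := N) (x := w) (r := r) (by
      rw [← hw, hn]
      exact Submodule.smul_mem _ _ (Submodule.subset_span ⟨l, rfl⟩))
    refine ⟨j + i, ⟨_, hj⟩, ?_⟩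
    rw [push_smul, ← hw, smul_smul, ← map_pow, ← map_mul, pow_add]
  choose i w hw using h
  refine ⟨Finset.univ.sup i, fun a ha => ?_⟩
  have hi (l) : r ^ a = r ^ (a - i l) * r ^ i l := by
    rw [← pow_add, Nat.sub_add_cancel ((Finset.le_sup (Finset.mem_univ l)).trans ha)]
  have hg (l) : push (toLoc A r).hom (r ^ (a - i l) • w l).1 = (toLoc A r).hom (r ^ a) • n l := by
    refine (push_smul _ _ _).trans ?_
    rw [hw, smul_smul, ← map_mul, hi l]
  refine ⟨fun l => r ^ (a - i l) • w l, hg, fun l => funext fun b => toLoc_injective hr ?_,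
    fun x => Subtype.ext (push_toLoc_injective hr ?_)⟩
  · rw [← hψ, hg, map_smul, hψn, Pi.smul_apply, smul_eq_mul]
    by_cases hb : b = l
    · subst hb
      rw [Pi.single_eq_same, Pi.single_eq_same, mul_one]
    · rw [Pi.single_eq_of_ne hb, Pi.single_eq_of_ne hb, mul_zero, map_zero]
  · have hx := map_smul_mem_map (toLoc A r).hom N x.2
    have h1 := eq_sum_of_dual ψ' hψn (hn.le hx)
    rw [Submodule.coe_sum]
    refine (push_smul _ _ _).trans ?_
    refine Eq.trans ?_ (push_sum_smul (toLoc A r).hom _ (fun l => ψ x.1 l) _).symm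
    rw [h1, Finset.smul_sum]
    refine Finset.sum_congr rfl fun l _ => ?_
    rw [hg, hψ, smul_smul, smul_smul, mul_comm]

end Denominators

variable [CharZero K] {V : Type u} [AddCommGroup V] [Module K V] [Module.Finite K V]
  {q : QuadraticForm K V} {v : V} {k : ℕ} [NeZero k]
  {hv : LinearMap.ker (QuadraticMap.polarBilin q) = Submodule.span K {v}}

theorem Frame.hasAdaptedFrames (x : (TOGr q (Submodule.span K {v}) (reducedForm hv) k).obj A)
    (hx : ∀ p : PrimeSpectrum A, ∃ r ∉ p.asIdeal, ∃ (S : Frame q v k) (P : S.Param → loc A r),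
      S.point hv P = (TOGr q (Submodule.span K {v}) (reducedForm hv) k).map (toLoc A r) x)
    {I : Ideal A} (hI : ∀ (B : CommAlgCat.{u} K) (f : A ⟶ B),
      (1 : B) ⊗ₜ[K] v ∈ subspace ((OGr q k).map f x.1.1) ↔ ∀ a ∈ I, f.hom a = 0)
    (hI0 : Nontrivial A → I ≠ ⊥) {N : Submodule A (A ⊗[K] V)}
    {N' : Submodule A (A ⊗[K] (V ⧸ Submodule.span K {v}))} (hN : N = subspace x.1.1)
    (hN' : N' = subspace x.1.2) (π : N →ₗ[A] N') (hπ : ∀ y, (π y).1 = projection _ A y.1) :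
    HasAdaptedFrames (R := A) (M := N) (M' := N') π I k := by
  intro p
  obtain ⟨r, hrp, S, P, hP⟩ := hx p
  have hr : r ≠ 0 := fun h => hrp (h ▸ zero_mem _)
  have hinj := toLoc_injective hr
  have hP1 := congrArg (fun z => subspace z.1.1) hP
  have hP2 := congrArg (fun z => subspace z.1.2) hP
  obtain ⟨a₁, h₁⟩ := exists_lifted_frame hr (N := x.1.1.1) hN (n := S.gen P) hP1.symm
    (ψ := S.mixed A) (S.mixed_push _) (S.mixed_gen P)
  obtain ⟨a₂, h₂⟩ := exists_lifted_frame hr (N := x.1.2.1) hN'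
    (n := fun a => projection _ _ (S.lift P a)) hP2.symm
    (ψ := S.pairing A hv) (S.pairing_push hv _) (S.pairing_lift hv P)
  have hideal : Ideal.span {P (Sum.inr (Sum.inr 0))} = I.map (toLoc A r).hom.toRingHom := by
    refine ideal_eq_of_kills fun B f => ?_
    have e1 := hI B (toLoc A r ≫ f)
    have e2 := congrArg (fun z => z.1.1) (S.map_point hv f P)
    have e3 : (OGr q k).map (toLoc A r ≫ f) x.1.1 = (S.point hv fun i => f.hom (P i)).1.1 := by
      rw [OGr_map_comp, ← e2, hP]
      rfl
    rw [e3, S.mem_point_iff] at e1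
    constructor
    · intro h a ha
      have : I.map (toLoc A r).hom.toRingHom ≤ RingHom.ker f.hom.toRingHom :=
        Ideal.map_le_iff_le_comap.mpr fun a ha =>
          e1.mp (h _ (Ideal.subset_span rfl)) a ha
      exact this ha
    · intro h a ha
      obtain ⟨c, rfl⟩ := Ideal.mem_span_singleton'.mp ha
      rw [map_mul, e1.mpr fun a ha => h _ (Ideal.mem_map_of_mem _ ha), mul_zero]
  choose i c hc using fun l : Fin k => exists_pow_mul_eq (P (Sum.inr (Sum.inr l)))
  obtain ⟨⟨⟨ε, hε⟩, s⟩, hs⟩ := (IsLocalization.mem_map_algebraMap_iff (Submonoid.powers r)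
    (loc A r)).mp (hideal.le (Ideal.subset_span rfl))
  obtain ⟨_, a₃, rfl⟩ := s
  let a := a₁ + a₂ + a₃ + Finset.univ.sup i
  have hia (l) : i l ≤ a := (Finset.le_sup (Finset.mem_univ l)).trans (by omega)
  obtain ⟨g, hg1, hg2, hg3⟩ := h₁ a (by omega)
  obtain ⟨g', hg1', hg2', hg3'⟩ := h₂ a (by omega)
  let η (l : Fin k) : A := r ^ (a - i l) * c l
  have hη (l) : (toLoc A r).hom (η l) = (toLoc A r).hom (r ^ a) * P (Sum.inr (Sum.inr l)) := by
    rw [map_mul, ← hc, ← mul_assoc, ← map_pow, ← map_mul, ← pow_add, Nat.sub_add_cancel (hia l)]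
  have hη0 : η 0 = r ^ (a - a₃) * ε := hinj (by
    have h3 : P (Sum.inr (Sum.inr 0)) * (toLoc A r).hom (r ^ a₃) = (toLoc A r).hom ε := hs
    rw [hη, map_mul, ← h3, mul_comm (P _), ← mul_assoc, ← map_mul, ← pow_add,
      Nat.sub_add_cancel (by omega)])
  have hIη (b : A) (hb : b ∈ I) : ∃ s ∉ p.asIdeal, ∃ c : A, s * b = c * η 0 := by
    have h3 := hideal.ge (Ideal.mem_map_of_mem (toLoc A r).hom.toRingHom hb)
    obtain ⟨z, hz⟩ := Ideal.mem_span_singleton'.mp h3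
    obtain ⟨j, c, hc⟩ := exists_pow_mul_eq z
    refine ⟨r ^ (j + a), fun h => hrp (p.isPrime.mem_of_pow_mem _ h), c, hinj ?_⟩
    have hz' : z * P (Sum.inr (Sum.inr 0)) = (toLoc A r).hom b := hz
    rw [map_mul, map_mul, hη, ← hz', ← hc, pow_add, map_mul, map_pow]
    ring
  refine ⟨r ^ a, fun h => hrp (p.isPrime.mem_of_pow_mem _ h), g, S.mixed A ∘ₗ N.subtype, g',
    S.pairing A hv ∘ₗ N'.subtype, η, hg2, hg3, hg2', hg3', fun l => Subtype.ext
    (push_toLoc_injective hr ?_), hη0 ▸ I.mul_mem_left _ hε, fun h0 => ?_, hIη⟩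
  · have e0 : push (toLoc A r).hom (π (g l)).1 = (toLoc A r).hom (r ^ a) •
        ((if l = 0 then 0 else projection (Submodule.span K {v}) _ (S.lift P l)) +
          P (Sum.inr (Sum.inr l)) • projection (Submodule.span K {v}) _ (S.lift P 0)) := by
      rw [hπ, ← projection_push, hg1, map_smul, Frame.gen, map_add, map_smul]
      congr 2
      split_ifs with hl
      · exact S.projection_vec_zero
      · rfl
    refine (push_smul _ _ _).trans ?_
    rw [e0, Submodule.coe_add, map_add]
    refine Eq.trans ?_ (congrArg _ ((push_smul _ (η l) (g' 0).1).trans (by rw [hη, hg1'])).symm)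
    rw [smul_add, smul_add]
    congr 1
    · split_ifs with hl
      · rw [smul_zero, smul_zero]
        exact (map_zero _).symm
      · exact ((push_smul _ _ _).trans (by rw [hg1'])).symm
    · rw [smul_smul, smul_smul, smul_smul]
      congr 1
      ring
  · refine hI0 ⟨r, 0, hr⟩ ((Submodule.eq_bot_iff _).mpr fun b hb => ?_)
    obtain ⟨s, hs, c, e⟩ := hIη b hb
    rw [h0, mul_zero] at e
    exact (mul_eq_zero.mp e).resolve_left fun h => hs (h ▸ zero_mem _)

end

end OrthogonalGrassmannian

namespace OrthogonalGrassmannian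

noncomputable section

section Pairings

open MonoidalCategory

variable {𝒞 : Type*} [Category* 𝒞] {R : 𝒞ᵒᵖ ⥤ CommRingCat.{u}}
  {M N P : PresheafOfModules.{u} (R ⋙ forget₂ CommRingCat RingCat)}

theorem nonempty_iso_of_pairing
    (β : ∀ U : 𝒞ᵒᵖ, M.obj U →ₗ[R.obj U] N.obj U →ₗ[R.obj U] P.obj U)
    (h : ∀ U, Function.Bijective (TensorProduct.lift (β U)))
    (hβ : ∀ (U W : 𝒞ᵒᵖ) (i : U ⟶ W) (m : M.obj U) (n : N.obj U),
      β W (M.map i m) (N.map i n) = P.map i (β U m n)) : Nonempty (M ⊗ N ≅ P) :=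
  ⟨PresheafOfModules.isoMk
    (fun U => LinearEquiv.toModuleIso (R := R.obj U)
      (LinearEquiv.ofBijective (TensorProduct.lift (β U)) (h U)))
    fun U W i => ModuleCat.MonoidalCategory.tensor_ext (fun m n => hβ U W i m n)⟩

end Pairings

end

end OrthogonalGrassmannian

namespace OrthogonalGrassmannian

noncomputable section

open MonoidalCategory

variable {K : Type u} [Field K] [CharZero K] {V : Type u} [AddCommGroup V] [Module K V]
  [Module.Finite K V] {q : QuadraticForm K V} {k n : ℕ}

section PlueckerDualBundle

variable {T : Over (Spec (CommRingCat.of K))} {X : ModuliScheme (OGr q k)} (f : T ⟶ X.scheme)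
  (b : Module.Basis (Fin n) K V)

omit [Module.Finite K V] in
theorem span_range_tautRes {W W' : T.left.affineOpens} (h : W' ≤ W) :
    Submodule.span (coordAlg W') (Set.range (tautRes f h)) = ⊤ := by
  have e : taut f W' = Submodule.span (coordAlg W')
      (LinearMap.rTensor V (coordRes h).hom.toLinearMap '' (taut f W : Set (coordAlg W ⊗[K] V))) := by
    have := subspace_map (coordRes h) (X.pt (chart W ≫ f))
    rwa [← ModuliScheme.pt_comp, ← Category.assoc, chart_res] at this
  refine (Submodule.eq_top_iff').mpr fun y => ?_
  have hy : y.1 ∈ (Submodule.span (coordAlg W') (Set.range (tautRes f h))).map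
      (taut f W').subtype := by
    rw [Submodule.map_span, ← Set.range_comp]
    refine Submodule.span_mono ?_ (e.le y.2)
    rintro _ ⟨x, hx, rfl⟩
    exact ⟨⟨x, hx⟩, rfl⟩
  obtain ⟨z, hz, e⟩ := hy
  rwa [← Subtype.ext e]

/-- The restriction of linear forms in the Plücker coordinates of the tautological bundle. -/
def tautDualRes {W W' : T.left.affineOpens} (h : W' ≤ W) :
    PlueckerDual k b (taut f W) →ₛₗ[((coordRes h).hom : coordAlg W →+* coordAlg W')]
      PlueckerDual k b (taut f W') :=
  plueckerRes b (tautRes f h) (fun _ => rfl) (span_range_tautRes f h)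

/-- The presheaf of abelian groups underlying the dual of the determinant of the tautological
bundle. -/
def tautDualPresheaf : (T.left.affineOpens)ᵒᵖ ⥤ Ab.{u} where
  obj W := AddCommGrpCat.of (PlueckerDual k b (taut f W.unop))
  map g := AddCommGrpCat.ofHom (tautDualRes f b (leOfHom g.unop)).toAddMonoidHom
  map_id W := by
    apply ConcreteCategory.hom_ext
    intro x
    obtain ⟨c, rfl⟩ := Submodule.Quotient.mk_surjective _ x
    exact congrArg Submodule.Quotient.mk (funext fun J =>
      ConcreteCategory.congr_hom (T.left.presheaf.map_id (op W.unop.1)) (c J))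
  map_comp g g' := by
    apply ConcreteCategory.hom_ext
    intro x
    obtain ⟨c, rfl⟩ := Submodule.Quotient.mk_surjective _ x
    exact congrArg Submodule.Quotient.mk (funext fun J =>
      ConcreteCategory.congr_hom (T.left.presheaf.map_comp
        (homOfLE (X := T.left.Opens) (leOfHom g.unop)).op
        (homOfLE (X := T.left.Opens) (leOfHom g'.unop)).op) (c J))

/-- The dual of the determinant of the tautological bundle. -/
def tautDual : AffineModules T.left :=
  letI (W : (T.left.affineOpens)ᵒᵖ) :
      Module ((affineStructure T.left ⋙ forget₂ CommRingCat RingCat).obj W)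
        ((tautDualPresheaf f b).obj W) :=
    (inferInstance : Module (coordAlg W.unop) (PlueckerDual k b (taut f W.unop)))
  PresheafOfModules.ofPresheaf (tautDualPresheaf f b) fun _ _ g r m =>
    (tautDualRes f b (leOfHom g.unop)).map_smulₛₗ r m

theorem nonempty_detTaut_dual_iso (hk : k ≤ Module.finrank K V)
    (h0 : ∀ W : T.left.affineOpens, NoZeroDivisors (coordAlg W))
    (h : ∀ W : T.left.affineOpens, HasLocalFrames (coordAlg W) (taut f W) k) :
    Nonempty (detTaut f ⊗ tautDual f b ≅ 𝟙_ (AffineModules T.left)) :=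
  nonempty_iso_of_pairing (M := detTaut f) (N := tautDual f b)
    (P := PresheafOfModules.unit _)
    (fun W => plueckerEval k b (taut f W.unop))
    (fun W => by
      have := h0 W.unop
      exact plueckerEval_bijective b _ (h W.unop) fun p => exists_minor b hk _ p)
    fun U W i y φ => plueckerEval_plueckerRes b (tautRes f (leOfHom i.unop)) (fun _ => rfl)
      (span_range_tautRes f _) y φ

end PlueckerDualBundle

end

end OrthogonalGrassmannian

namespace OrthogonalGrassmannian

noncomputable section

open MonoidalCategory

theorem mul_exteriorMap {A B : Type u} [CommRing A] [CommRing B] {f : A →+* B}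
    {M N M' N' : Type u} [AddCommGroup M] [Module A M] [AddCommGroup N] [Module A N]
    [AddCommGroup M'] [Module B M'] [AddCommGroup N'] [Module B N'] {k : ℕ} {π : M →ₗ[A] N}
    {π' : M' →ₗ[B] N'} {ρ : M →ₛₗ[f] M'} {σ : N →ₛₗ[f] N'} (h : ∀ x, π' (ρ x) = σ (π x))
    (hinj : Function.Injective (exteriorMap k π')) {I : Ideal A} {I' : Ideal B}
    {β : I →ₗ[A] ⋀[A]^k N →ₗ[A] ⋀[A]^k M} {β' : I' →ₗ[B] ⋀[B]^k N' →ₗ[B] ⋀[B]^k M'}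
    (hβ : ∀ a y, exteriorMap k π (β a y) = a.1 • y)
    (hβ' : ∀ a y, exteriorMap k π' (β' a y) = a.1 • y) {a : I} {a' : I'} (ha : a'.1 = f a.1)
    (y : ⋀[A]^k N) : β' a' (exteriorMap k σ y) = exteriorMap k ρ (β a y) := by
  apply hinj
  rw [hβ', ← exteriorMap_comp k ρ π' (π'.comp ρ) (fun _ => rfl) (fun _ => rfl),
    exteriorMap_comp k π σ (π'.comp ρ) (fun _ => rfl) h, hβ, LinearMap.map_smulₛₗ, ha]

section PicardGroup

theorem exists_classes {X : Scheme.{u}} {I M M' N : AffineModules X}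
    (h : Nonempty (I ⊗ M' ≅ M)) (hN : Nonempty (M ⊗ N ≅ 𝟙_ _)) :
    ∃ E H H' : Pic X, IsClassOf E⁻¹ I ∧ IsClassOf H⁻¹ M ∧ IsClassOf H'⁻¹ M' ∧ E = H / H' := by
  have e1 : toSkeleton I * toSkeleton M' = toSkeleton M :=
    (Skeleton.toSkeleton_tensorObj I M').symm.trans (toSkeleton_eq_toSkeleton_iff.mpr h)
  have e2 : toSkeleton M * toSkeleton N = 1 :=
    (Skeleton.toSkeleton_tensorObj M N).symm.trans (toSkeleton_eq_toSkeleton_iff.mpr hN)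
  have e3 (a b : Skeleton (AffineModules X)) : a * b = b * a := mul_comm a b
  have e4 : toSkeleton I * (toSkeleton M' * toSkeleton N) = 1 := by rw [← mul_assoc, e1, e2]
  have e5 : toSkeleton M' * (toSkeleton I * toSkeleton N) = 1 := by
    rw [← mul_assoc, e3 (toSkeleton M'), e1, e2]
  let i : Pic X := ⟨_, _, e4, (e3 _ _).trans e4⟩
  let m : Pic X := ⟨_, _, e2, (e3 _ _).trans e2⟩
  let m' : Pic X := ⟨_, _, e5, (e3 _ _).trans e5⟩
  have e6 : m' * i = m := Units.ext ((e3 _ _).trans e1)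
  refine ⟨i⁻¹, m⁻¹, m'⁻¹, by rw [inv_inv]; rfl, by rw [inv_inv]; rfl, by rw [inv_inv]; rfl, ?_⟩
  rw [← e6, mul_inv_rev, mul_div_cancel_right]

end PicardGroup

variable {K : Type u} [Field K] [CharZero K] {V : Type u} [AddCommGroup V] [Module K V]
  {q : QuadraticForm K V} {v : V} {k : ℕ}
  {hv : LinearMap.ker (QuadraticMap.polarBilin q) = Submodule.span K {v}}

namespace Diagram

variable [Module.Finite K V] (D : Diagram k hv)

theorem taut_p₁ (W : D.T.scheme.left.affineOpens) :
    taut D.p₁ W = subspace (D.T.pt (chart W)).1.1 := congrArg subspace (D.pt_p₁ _ _)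

theorem taut_p₂ (W : D.T.scheme.left.affineOpens) :
    taut D.p₂ W = subspace (D.T.pt (chart W)).1.2 := congrArg subspace (D.pt_p₂ _ _)

/-- The projection from the first to the second tautological bundle. -/
def tautProjection (W : D.T.scheme.left.affineOpens) : taut D.p₁ W →ₗ[coordAlg W] taut D.p₂ W :=
  (projection (Submodule.span K {v}) (coordAlg W)).restrict fun x hx => by
    rw [taut_p₁] at hx
    rw [taut_p₂]
    exact (D.T.pt (chart W)).2 hx

theorem tautProjection_res {W W' : D.T.scheme.left.affineOpens} (h : W' ≤ W) (x : taut D.p₁ W) :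
    D.tautProjection W' (tautRes D.p₁ h x) = tautRes D.p₂ h (D.tautProjection W x) :=
  Subtype.ext (projection_push _ (coordRes h).hom x.1)

theorem noZeroDivisors_coordAlg [IsIntegral D.T.scheme.left] (W : D.T.scheme.left.affineOpens) :
    NoZeroDivisors (coordAlg W) := by
  by_cases hW : Nonempty W.1
  · exact (inferInstance : NoZeroDivisors Γ(D.T.scheme.left, W.1))
  · have hW' : W.1 = ⊥ := by
      ext x
      exact ⟨fun hx => hW ⟨x, hx⟩, fun hx => hx.elim⟩
    have : Subsingleton Γ(D.T.scheme.left, W.1) := by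
      rw [hW']
      infer_instance
    exact ⟨fun _ => Or.inl (Subsingleton.elim (α := Γ(D.T.scheme.left, W.1)) _ _)⟩

variable [IsAlgClosed K] (hv0 : v ≠ 0) (hk : 1 ≤ k) (hT : IsProjective D.T.scheme)
  (hn : 2 * k + 2 ≤ Module.finrank K V)

include hv0 hk hT hn

theorem coordIdeal_ne_bot (W : D.T.scheme.left.affineOpens) (hW : Nontrivial (coordAlg W)) :
    coordIdeal D.j.left.ker W ≠ ⊥ := by
  intro h0
  have h1 := (D.mem_coordIdeal_iff hv0 hk W _ (𝟙 _)).mpr fun a ha => by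
    rw [h0] at ha
    exact (congrArg _ ((Submodule.mem_bot _).mp ha)).trans (map_zero _)
  rw [D.exists_comp_j_iff hv0 hk, res_id] at h1
  obtain ⟨z, hz⟩ := h1
  obtain ⟨p⟩ := (inferInstance : Nonempty (PrimeSpectrum (coordAlg W)))
  obtain ⟨_, ht, ht'⟩ := (D.dense_openT hv0 hk hT hn).inter_open_nonempty _ W.1.isOpen
    ⟨_, (range_chart W).le ⟨p, rfl⟩⟩
  obtain ⟨p', rfl⟩ := (range_chart W).ge ht
  exact ht' ⟨_, congrArg (fun z => z.left p') hz⟩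

theorem hasAdaptedFrames [NeZero k] (W : D.T.scheme.left.affineOpens) :
    HasAdaptedFrames (R := coordAlg W) (M := taut D.p₁ W) (M' := taut D.p₂ W) (D.tautProjection W) (coordIdeal D.j.left.ker W) k := by
  have := (isSmoothProjectiveVariety_TOGr hv D.T hT hv0 hn).integral
  have := D.noZeroDivisors_coordAlg W
  refine Frame.hasAdaptedFrames (D.T.pt (chart W)) (fun p => ?_) (fun B f => ?_)
    (D.coordIdeal_ne_bot hv0 hk hT hn W) (D.taut_p₁ W) (D.taut_p₂ W) _ (fun _ => rfl)
  · obtain ⟨S, hS⟩ := exists_frame_mem hv D.T hT hv0 (by omega) ((chart W).left p)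
    obtain ⟨r, hr, f, hf⟩ := exists_local_factor (S.toScheme hv D.T) (chart W) p hS
    exact ⟨r, hr, S, S.paramsOf f, by rw [← S.pt_toScheme, ← hf, D.T.pt_res]⟩
  · rw [← D.mem_coordIdeal_iff hv0 hk, D.T.pt_res]
    exact Iff.rfl

theorem exists_exceptional_classes : ∃ E H H' : Pic D.T.scheme.left,
    IsClassOf E⁻¹ (idealModule (exceptionalIdeal D.p₁.left)) ∧ IsClassOf H⁻¹ (detTaut D.p₁) ∧
      IsClassOf H'⁻¹ (detTaut D.p₂) ∧ E = H / H' := by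
  have : NeZero k := ⟨by omega⟩
  have := (isSmoothProjectiveVariety_TOGr hv D.T hT hv0 hn).integral
  have h0 := D.noZeroDivisors_coordAlg
  have hf := D.hasAdaptedFrames hv0 hk hT hn
  choose β hβ hb using fun W => (hf W).exists_mul
  rw [D.exceptionalIdeal_eq hv0 hk hT hn]
  refine exists_classes (N := tautDual D.p₁ (Module.finBasis K V))
    (nonempty_iso_of_pairing (M := idealModule D.j.left.ker) (N := detTaut D.p₂)
      (P := detTaut D.p₁) (fun W => β W.unop) (fun W => hb W.unop) fun U W i a y =>
      mul_exteriorMap (D.tautProjection_res (leOfHom i.unop)) (hf W.unop).injective (hβ U.unop)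
        (hβ W.unop) rfl y)
    (nonempty_detTaut_dual_iso _ _ (by omega) h0 fun W => (hf W).hasLocalFrames)

end Diagram

end

end OrthogonalGrassmannian

theorem ne_zero_of_isBranchingPoint {K : Type u} [Field K] {n : ℕ} {a : Fin n → K} {s t : K}
    (hP : IsBranchingPoint a s t) {v : Fin n → K}
    (hv : LinearMap.ker (QuadraticMap.polarBilin (pencilForm a s t)) = Submodule.span K {v}) :
    v ≠ 0 := by
  obtain ⟨-, i, rfl⟩ := hP
  rintro rfl
  have h : (Pi.single i 1 : Fin n → K) ∈
      LinearMap.ker (QuadraticMap.polarBilin (pencilForm a s (s * a i))) := by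
    refine LinearMap.mem_ker.mpr (LinearMap.ext fun x => ?_)
    change QuadraticMap.polar _ _ _ = (0 : K)
    rw [QuadraticMap.polar, pencilForm_apply, pencilForm_apply, pencilForm_apply]
    simp only [mul_neg, Finset.mul_sum, ← sub_eq_add_neg, ← Finset.sum_sub_distrib]
    refine Finset.sum_eq_zero fun j _ => ?_
    by_cases hj : j = i
    · subst hj
      ring
    · rw [Pi.add_apply, Pi.single_eq_of_ne hj]
      ring
  rw [hv, Submodule.span_zero_singleton, Submodule.mem_bot] at h
  have h1 := congrFun h i
  rw [Pi.single_eq_same] at h1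
  exact one_ne_zero h1

theorem proposition2p1 {K : Type u} [Field K] [IsAlgClosed K] [CharZero K]
    (g : ℕ) (hg : 1 < g) (a : Fin (2 * g + 2) → K) (ha : Function.Injective a)
    (s t : K) (hP : IsBranchingPoint a s t)
    (v : Fin (2 * g + 2) → K)
    (hv : LinearMap.ker (QuadraticMap.polarBilin (pencilForm a s t)) = Submodule.span K {v})
    (k : ℕ) (hk₁ : 1 ≤ k) (hk₂ : k ≤ g) :
    -- the five moduli schemes exist, and so do the morphisms between them
    ∃ (X : ModuliScheme (OGr (pencilForm a s t) k)) (Y : ModuliScheme (OGr (reducedForm hv) k))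
      (T : ModuliScheme (TOGr (pencilForm a s t) (Submodule.span K {v}) (reducedForm hv) k))
      (Z : ModuliScheme (OGr (reducedForm hv) (k - 1)))
      (F : ModuliScheme (OFl (reducedForm hv) (k - 1) k))
      (p₁ : T.scheme ⟶ X.scheme) (p₂ : T.scheme ⟶ Y.scheme)
      (j : F.scheme ⟶ T.scheme) (r : F.scheme ⟶ Z.scheme) (i : Z.scheme ⟶ X.scheme),
      -- `p₁` and `p₂` are the two projections of `TOGr`
      (∀ (A : CommAlgCat.{u} K) (x : specOver A ⟶ T.scheme),
        X.pt (x ≫ p₁) = (T.pt x).1.1 ∧ Y.pt (x ≫ p₂) = (T.pt x).1.2) ∧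
      -- `j` sends a flag `(W, U')` to the pair consisting of the preimage of `W` and of `U'`
      (∀ (A : CommAlgCat.{u} K) (x : specOver A ⟶ F.scheme),
        subspace (T.pt (x ≫ j)).1.1 =
          (subspace (F.pt x).1.1).comap (projection (Submodule.span K {v}) A) ∧
        (T.pt (x ≫ j)).1.2 = (F.pt x).1.2) ∧
      -- `r` sends a flag `(W, U')` to `W`
      (∀ (A : CommAlgCat.{u} K) (x : specOver A ⟶ F.scheme), Z.pt (x ≫ r) = (F.pt x).1.1) ∧
      -- `i` sends `W` to its preimage
      (∀ (A : CommAlgCat.{u} K) (x : specOver A ⟶ Z.scheme),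
        subspace (X.pt (x ≫ i)) =
          (subspace (Z.pt x)).comap (projection (Submodule.span K {v}) A)) ∧
      -- `p₂` is a `P^k`-fibration, and `TOGr` is a smooth projective variety
      IsProjectiveFibration k p₂ ∧
      IsSmoothProjectiveVariety T.scheme ∧
      -- `p₁` is birational
      IsBirational p₁.left ∧
      -- `i` is a closed embedding onto the subscheme of all `U` that contain `v`
      IsClosedImmersion i.left ∧
      (∀ (A : CommAlgCat.{u} K) (x : specOver A ⟶ X.scheme),
        (∃ z : specOver A ⟶ Z.scheme, z ≫ i = x) ↔ (1 : A) ⊗ₜ[K] v ∈ subspace (X.pt x)) ∧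
      -- the exceptional divisor of `p₁` is the image of the flag variety under `j`, and its map
      -- to `OGr` is the composition of `r` and `i`
      (∃ e : F.scheme.left ≅ (exceptionalIdeal p₁.left).subscheme,
        e.hom ≫ (exceptionalIdeal p₁.left).subschemeι = j.left ∧
        (exceptionalIdeal p₁.left).subschemeι ≫ p₁.left = e.inv ≫ r.left ≫ i.left) ∧
      -- the exceptional divisor is an effective Cartier divisor, and `O(E) = O(H) ⊗ O(-H')`
      (∃ E H H' : Pic T.scheme.left,
        IsClassOf E⁻¹ (idealModule (exceptionalIdeal p₁.left)) ∧
        IsClassOf H⁻¹ (detTaut p₁) ∧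
        IsClassOf H'⁻¹ (detTaut p₂) ∧
        E = H / H') := by
  have hv0 : v ≠ 0 := ne_zero_of_isBranchingPoint hP hv
  have hn : 2 * k + 2 ≤ Module.finrank K (Fin (2 * g + 2) → K) := by
    rw [Module.finrank_fin_fun]
    omega
  have hk : NeZero k := ⟨by omega⟩
  obtain ⟨D, hT, hX⟩ := exists_diagram (k := k) (hv := hv) hv0 hk₁ (by omega)
  exact ⟨D.X, D.Y, D.T, D.Z, D.F, D.p₁, D.p₂, D.j, D.r, D.i,
    fun A x => ⟨D.pt_p₁ A x, D.pt_p₂ A x⟩, fun A x => ⟨D.pt_j_fst A x, D.pt_j_snd A x⟩, D.pt_r,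
    D.pt_i, isProjectiveFibration_of_points hv0 (by omega) D.p₂ D.pt_p₂,
    isSmoothProjectiveVariety_TOGr hv D.T hT hv0 hn, D.isBirational_p₁ hv0 hk₁ hT hX hn,
    D.isClosedImmersion_i hv0 hk₁, fun A x => (D.exists_comp_i_iff hv0 hk₁ x).symm,
    D.exists_exceptional_iso hv0 hk₁ hT hn, D.exists_exceptional_classes hv0 hk₁ hT hn⟩
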